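/- Let $k$ be a commutative artinian ring, $J$ an injective envelope of $k/\operatorname{rad}k$, $D=\operatorname{Hom}_k(-,J)$, and let $R$ be an artin $k$-algebra (a $k$-algebra that is finitely generated as a $k$-module). Modules are right modules; $\operatorname{mod}R$ is the category of finitely generated $R$-modules, and subcategories are full. Let $T\in\operatorname{mod}R$ be a Wakamatsu-tilting module with $S=\operatorname{End}(T_R)$: the canonical map from $R$ to the endomorphisms of ${}_ST$ is bijective, and $\operatorname{Ext}^i_R(T,T)=0=\operatorname{Ext}^i_S(T,T)$ for all $i>0$. **Definitions.** - $\mathcal X_T$ is the class of $M\in\operatorname{mod}R$ admitting an exact sequence $0\to M\xrightarrow{f_0}T_0\xrightarrow{f_1}T_1\to\cdots$ with all $T_i\in\operatorname{add}T$ and $\operatorname{Ext}_R^n(\operatorname{Im}f_i,T)=0$ for all $i\ge0$, $n\ge1$. Dually, ${}_T\mathcal X$ is the class of $M\in\operatorname{mod}R$ admitting an exact sequence $\cdots\to T_1\xrightarrow{f_1}T_0\xrightarrow{f_0}M\to0$ with all $T_i\in\operatorname{add}T$ and $\operatorname{Ext}_R^n(T,\operatorname{Im}f_i)=0$ for all $i\ge0$,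 $n\ge1$. - For a subcategory $\mathcal C$ of $\operatorname{mod}R$, $\operatorname{KerExt}^1_R(-,\mathcal C)$ (resp. $\operatorname{KerExt}^1_R(\mathcal C,-)$) consists of the $M\in\operatorname{mod}R$ with $\operatorname{Ext}^1_R(M,C)=0$ (resp. $\operatorname{Ext}^1_R(C,M)=0$) for all $C\in\mathcal C$. A subcategory is of finite representation type if it contains only finitely many indecomposable modules up to isomorphism. $T$ is of finite type if $\operatorname{KerExt}^1_R(-,{}_T\mathcal X)$ or $\operatorname{KerExt}^1_R(\mathcal X_T,-)$ is of finite representation type; $R$ is representation-finite if $\operatorname{mod}R$ is. - A pair $(\mathcal B,\mathcal A)$ of subcategories of $\operatorname{mod}R$ is a cotorsion pair if $\mathcal B=\operatorname{KerExt}_R^1(-,\mathcal A)$ and $\mathcal A=\operatorname{KerExt}_R^1(\mathcal B,-)$. It is hereditary if $\mathcal B$ is resolving (contains the projectives and is closed under extensions, kernels of epimorphisms and direct summands), and complete if for each $X\in\operatorname{mod}R$ there are exact sequences $0\to X\to A\to B\to0$ and $0\to A'\to B'\to X\to0$ with $A,A'\in\mathcal A$ and $B,B'\in\mathcal B$. -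 $T$ is good if there are complete hereditary cotorsion pairs $(\mathcal B,\mathcal A)$ in $\operatorname{mod}R$ and $(\mathcal G,\mathcal K)$ in $\operatorname{mod}S$ such that ${}_ST_R$ and ${}_RDT_S$ represent a cotorsion pair counter equivalence between them, i.e. $\operatorname{Hom}_R(T,-)$ and $-\otimes_ST$ restrict to mutually quasi-inverse equivalences between $\mathcal A$ and $\mathcal G$, and $\operatorname{Hom}_S(DT,-)$ and $-\otimes_RDT$ restrict to mutually quasi-inverse equivalences between $\mathcal K$ and $\mathcal B$. - A repe-complex over $R$ is a family $X_i\in\operatorname{mod}R$ ($i\in\mathbb Z$), almost all zero, with maps $\delta_i:X_i\to\operatorname{Hom}_R(DR,X_{i-1})$ such that $\operatorname{Hom}_R(DR,\delta_{i})$ after $\delta_{i+1}$ is zero for all $i$; morphisms are families of $R$-maps commuting with the $\delta_i$. These are the finitely generated modules over the repetitive algebra of $R$. The repetitive category $\underline{\mathcal{RC}}(R)$ is the quotient of the category of repe-complexes by the morphisms that factor through projective objects. An $R$-module is regarded as a repe-complex concentrated in degree $0$. **Proposition.** If the Wakamatsu-tilting module $T$ is of finite type, then $T$ is good. In particular, if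 $R$ is representation-finite, then every Wakamatsu-tilting $R$-module $T$ is good, and hence induces a repetitive equivalence: for any complete hereditary cotorsion pairs $(\mathcal B,\mathcal A)$, $(\mathcal G,\mathcal K)$ as in the definition of good, there is an equivalence of categories $\underline{\mathcal{RC}}(R)\simeq\underline{\mathcal{RC}}(S)$, with $S=\operatorname{End}(T_R)$, which restricts (up to natural isomorphism) to the equivalence $\operatorname{Hom}_R(T,-):\mathcal A\to\mathcal G$. -/

import Mathlib

open CategoryTheory
open scoped TensorProduct

universe u

noncomputable section

namespace WakamatsuTilting

/-! Conventions. A right module over a ring `R` is a `Module Rᵐᵒᵖ`, and `x · r` is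
`MulOpposite.op r • x`. An `S`-`R`-bimodule `V` is an abelian group with `Module S V`,
`Module Rᵐᵒᵖ V` and `SMulCommClass S Rᵐᵒᵖ V`. A subcategory of `mod R` (finitely generated right
modules) is an object property of `ModuleCat Rᵐᵒᵖ`. -/

/-! ### The duality `D` over a commutative artinian ring `k` -/

section Duality

variable (k : Type u) [CommRing k] (J : Type u) [AddCommGroup J] [Module k J]

/-- `J` is an injective envelope of `k / rad k`, i.e. a minimal injective cogenerator of
`mod k`. -/
structure IsInjectiveEnvelopeOfTop : Prop where
  injective : Module.Injective k J
  essential : ∃ ι : (k ⧸ Ring.jacobson k) →ₗ[k] J, Function.Injective ι ∧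
    ∀ N : Submodule k J, N ⊓ LinearMap.range ι = ⊥ → N = ⊥

/-- The dual `D M = Hom_k(M, J)`. -/
def Dual (M : Type u) [AddCommGroup M] [Module k M] : Type u := M →ₗ[k] J

variable (M : Type u) [AddCommGroup M] [Module k M]

instance : AddCommGroup (Dual k J M) := inferInstanceAs (AddCommGroup (M →ₗ[k] J))

variable {k J M} in
/-- The linear map underlying an element of the dual. -/
def Dual.toLin (f : Dual k J M) : M →ₗ[k] J := f

variable {k J M} in
@[ext] theorem Dual.ext {f g : Dual k J M} (h : ∀ m, f.toLin m = g.toLin m) : f = g :=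
  LinearMap.ext h

/-- If `M` is a right `R`-module then `D M` is a left `R`-module, by `(r f)(m) = f (m r)`. -/
instance dualLeftModule (R : Type u) [Ring R] [Module Rᵐᵒᵖ M] [SMulCommClass Rᵐᵒᵖ k M] :
    Module R (Dual k J M) where
  smul r f := f.toLin.comp (DistribSMul.toLinearMap k M (MulOpposite.op r))
  one_smul f := Dual.ext fun m => congrArg f.toLin (one_smul Rᵐᵒᵖ m)
  mul_smul r s f := Dual.ext fun m =>
    congrArg f.toLin (mul_smul (MulOpposite.op s) (MulOpposite.op r) m)
  smul_zero _ := rfl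
  smul_add _ _ _ := rfl
  add_smul r s f := Dual.ext fun m =>
    (congrArg f.toLin (add_smul (MulOpposite.op r) (MulOpposite.op s) m)).trans
      (f.toLin.map_add _ _)
  zero_smul f := Dual.ext fun m =>
    (congrArg f.toLin (zero_smul Rᵐᵒᵖ m)).trans f.toLin.map_zero

/-- If `M` is a left `S`-module then `D M` is a right `S`-module, by `(f s)(m) = f (s m)`. -/
instance dualRightModule (S : Type u) [Ring S] [Module S M] [SMulCommClass S k M] :
    Module Sᵐᵒᵖ (Dual k J M) where
  smul s f := f.toLin.comp (DistribSMul.toLinearMap k M s.unop)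
  one_smul f := Dual.ext fun m => congrArg f.toLin (one_smul S m)
  mul_smul s t f := Dual.ext fun m => congrArg f.toLin (mul_smul t.unop s.unop m)
  smul_zero _ := rfl
  smul_add _ _ _ := rfl
  add_smul s t f := Dual.ext fun m =>
    (congrArg f.toLin (add_smul s.unop t.unop m)).trans (f.toLin.map_add _ _)
  zero_smul f := Dual.ext fun m =>
    (congrArg f.toLin (zero_smul S m)).trans f.toLin.map_zero

/-- The dual of an `S`-`R`-bimodule is an `R`-`S`-bimodule. -/
instance dualBimodule (S R : Type u) [Ring S] [Ring R] [Module S M] [Module Rᵐᵒᵖ M]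
    [SMulCommClass S k M] [SMulCommClass Rᵐᵒᵖ k M] [SMulCommClass S Rᵐᵒᵖ M] :
    SMulCommClass R Sᵐᵒᵖ (Dual k J M) where
  smul_comm r s f := Dual.ext fun m =>
    congrArg f.toLin (smul_comm s.unop (MulOpposite.op r) m)

end Duality

/-! ### The functors `Hom_R(V, -)` and `- ⊗_S V` of an `S`-`R`-bimodule `V` -/

section Functors

variable (S R : Type u) [Ring S] [Ring R] (V : Type u) [AddCommGroup V]
  [Module S V] [Module Rᵐᵒᵖ V] [SMulCommClass S Rᵐᵒᵖ V]

/-- `Hom_R(V, X)` for right `R`-modules `V` and `X`. -/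
def RHom (X : Type u) [AddCommGroup X] [Module Rᵐᵒᵖ X] : Type u := V →ₗ[Rᵐᵒᵖ] X

section

variable (X : Type u) [AddCommGroup X] [Module Rᵐᵒᵖ X]

instance : AddCommGroup (RHom R V X) := inferInstanceAs (AddCommGroup (V →ₗ[Rᵐᵒᵖ] X))

variable {R V X} in
/-- The linear map underlying an element of `Hom_R(V, X)`. -/
def RHom.toLin (f : RHom R V X) : V →ₗ[Rᵐᵒᵖ] X := f

variable {R V X} in
@[ext] theorem RHom.ext {f g : RHom R V X} (h : ∀ v, f.toLin v = g.toLin v) : f = g :=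
  LinearMap.ext h

/-- `Hom_R(V, X)` is a right `S`-module, by `(f s)(v) = f (s v)`. -/
instance : Module Sᵐᵒᵖ (RHom R V X) where
  smul s f := f.toLin.comp (DistribSMul.toLinearMap Rᵐᵒᵖ V s.unop)
  one_smul f := RHom.ext fun v => congrArg f.toLin (one_smul S v)
  mul_smul s t f := RHom.ext fun v => congrArg f.toLin (mul_smul t.unop s.unop v)
  smul_zero _ := rfl
  smul_add _ _ _ := rfl
  add_smul s t f := RHom.ext fun v =>
    (congrArg f.toLin (add_smul s.unop t.unop v)).trans (f.toLin.map_add _ _)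
  zero_smul f := RHom.ext fun v =>
    (congrArg f.toLin (zero_smul S v)).trans f.toLin.map_zero

end

/-- The functor `Hom_R(V, -)` from right `R`-modules to right `S`-modules. -/
def homFunctor : ModuleCat.{u} Rᵐᵒᵖ ⥤ ModuleCat.{u} Sᵐᵒᵖ where
  obj X := ModuleCat.of Sᵐᵒᵖ (RHom R V X)
  map {X Y} g := ModuleCat.ofHom
    (X := RHom R V X) (Y := RHom R V Y)
    { toFun := fun f => g.hom.comp f.toLin
      map_add' := fun f f' => RHom.ext fun v => g.hom.map_add (f.toLin v) (f'.toLin v)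
      map_smul' := fun _ _ => rfl }
  map_id _ := rfl
  map_comp _ _ := rfl

/-- The relations `(s v) ⊗ y = v ⊗ (y s)` defining `Y ⊗_S V` as a quotient of `V ⊗_ℤ Y`. The
factors are swapped so that the right `R`-action on `V` acts on the first factor. -/
def balancedRel (Y : Type u) [AddCommGroup Y] [Module Sᵐᵒᵖ Y] : Submodule Rᵐᵒᵖ (V ⊗[ℤ] Y) :=
  Submodule.span Rᵐᵒᵖ
    {z | ∃ (s : S) (v : V) (y : Y), z = (s • v) ⊗ₜ[ℤ] y - v ⊗ₜ[ℤ] (MulOpposite.op s • y)}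

/-- The right `R`-module `Y ⊗_S V`, for a right `S`-module `Y`. -/
abbrev RTensor (Y : Type u) [AddCommGroup Y] [Module Sᵐᵒᵖ Y] : Type u :=
  (V ⊗[ℤ] Y) ⧸ balancedRel S R V Y

/-- The map `g ⊗_S V`. -/
def tensorMap {Y Z : Type u} [AddCommGroup Y] [Module Sᵐᵒᵖ Y] [AddCommGroup Z] [Module Sᵐᵒᵖ Z]
    (g : Y →ₗ[Sᵐᵒᵖ] Z) : RTensor S R V Y →ₗ[Rᵐᵒᵖ] RTensor S R V Z :=
  Submodule.mapQ _ _
    (TensorProduct.AlgebraTensorModule.lTensor Rᵐᵒᵖ V g.toAddMonoidHom.toIntLinearMap) (by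
      refine Submodule.span_le.2 ?_
      rintro _ ⟨s, v, y, rfl⟩
      refine Submodule.subset_span ⟨s, v, g y, ?_⟩
      simp)

/-- The functor `- ⊗_S V` from right `S`-modules to right `R`-modules. -/
def tensorFunctor : ModuleCat.{u} Sᵐᵒᵖ ⥤ ModuleCat.{u} Rᵐᵒᵖ where
  obj Y := ModuleCat.of Rᵐᵒᵖ (RTensor S R V Y)
  map g := ModuleCat.ofHom (tensorMap S R V g.hom)
  map_id Y := by
    refine ModuleCat.hom_ext (LinearMap.ext fun z => ?_)
    obtain ⟨z, rfl⟩ := Submodule.Quotient.mk_surjective _ z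
    induction z with
    | zero => simp
    | add a b ha hb => simp only [Submodule.Quotient.mk_add, map_add, ha, hb]
    | tmul v y => rfl
  map_comp {X Y Z} f g := by
    refine ModuleCat.hom_ext (LinearMap.ext fun z => ?_)
    obtain ⟨z, rfl⟩ := Submodule.Quotient.mk_surjective _ z
    induction z with
    | zero => simp
    | add a b ha hb => simp only [Submodule.Quotient.mk_add, map_add, ha, hb]
    | tmul v y => rfl

end Functors

/-! ### Subcategories of `mod R` and cotorsion pairs -/

section Subcategories

variable {A : Type u} [Ring A]

/-- `Ext^i_A(M, N) = 0`. -/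
def ExtVanishes (M N : ModuleCat.{u} A) (i : ℕ) : Prop := Subsingleton (Abelian.Ext M N i)

/-- The subcategory `KerExt^1(-, 𝓐)` of `mod`. -/
def leftPerp (𝓐 : ObjectProperty (ModuleCat.{u} A)) : ObjectProperty (ModuleCat.{u} A) :=
  fun M => Module.Finite A M ∧ ∀ N, 𝓐 N → ExtVanishes M N 1

/-- The subcategory `KerExt^1(𝓑, -)` of `mod`. -/
def rightPerp (𝓑 : ObjectProperty (ModuleCat.{u} A)) : ObjectProperty (ModuleCat.{u} A) :=
  fun M => Module.Finite A M ∧ ∀ N, 𝓑 N → ExtVanishes N M 1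

/-- A subcategory of `mod` is resolving if it contains the projectives and is closed under
extensions, kernels of epimorphisms and direct summands. -/
structure IsResolving (𝓑 : ObjectProperty (ModuleCat.{u} A)) : Prop where
  finite : ∀ M, 𝓑 M → Module.Finite A M
  projective : ∀ M : ModuleCat.{u} A, Module.Finite A M → Module.Projective A M → 𝓑 M
  extension : ∀ E : ShortComplex (ModuleCat.{u} A), E.ShortExact → 𝓑 E.X₁ → 𝓑 E.X₃ → 𝓑 E.X₂
  kernel : ∀ E : ShortComplex (ModuleCat.{u} A), E.ShortExact → 𝓑 E.X₂ → 𝓑 E.X₃ → 𝓑 E.X₁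
  summand : ∀ M N : ModuleCat.{u} A, Nonempty (Retract M N) → 𝓑 N → 𝓑 M

/-- `(𝓑, 𝓐)` is a complete hereditary cotorsion pair in `mod`. -/
structure IsCompleteHereditaryCotorsionPair (𝓑 𝓐 : ObjectProperty (ModuleCat.{u} A)) :
    Prop where
  left_eq : 𝓑 = leftPerp 𝓐
  right_eq : 𝓐 = rightPerp 𝓑
  hereditary : IsResolving 𝓑
  complete_right : ∀ X : ModuleCat.{u} A, Module.Finite A X →
    ∃ E : ShortComplex (ModuleCat.{u} A), E.ShortExact ∧ Nonempty (E.X₁ ≅ X) ∧ 𝓐 E.X₂ ∧ 𝓑 E.X₃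
  complete_left : ∀ X : ModuleCat.{u} A, Module.Finite A X →
    ∃ E : ShortComplex (ModuleCat.{u} A), E.ShortExact ∧ Nonempty (E.X₃ ≅ X) ∧ 𝓑 E.X₂ ∧ 𝓐 E.X₁

theorem IsCompleteHereditaryCotorsionPair.right_le {𝓑 𝓐 : ObjectProperty (ModuleCat.{u} A)}
    (h : IsCompleteHereditaryCotorsionPair 𝓑 𝓐) : 𝓐 ≤ ModuleCat.isFG A := by
  intro M hM
  rw [h.right_eq] at hM
  exact hM.1

theorem IsCompleteHereditaryCotorsionPair.left_le {𝓑 𝓐 : ObjectProperty (ModuleCat.{u} A)}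
    (h : IsCompleteHereditaryCotorsionPair 𝓑 𝓐) : 𝓑 ≤ ModuleCat.isFG A :=
  fun M hM => h.hereditary.finite M hM

/-- A subcategory is of finite representation type if it contains only finitely many
indecomposable modules up to isomorphism. -/
def IsOfFiniteRepresentationType (P : ObjectProperty (ModuleCat.{u} A)) : Prop :=
  ∃ (n : ℕ) (L : Fin n → ModuleCat.{u} A),
    ∀ M, P M → Indecomposable M → ∃ i, Nonempty (M ≅ L i)

/-- `M ∈ add T`: `M` is a direct summand of a finite direct sum of copies of `T`. -/
def InAdd (T : Type u) [AddCommGroup T] [Module A T] (M : ModuleCat.{u} A) : Prop :=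
  ∃ n : ℕ, Nonempty (Retract M (ModuleCat.of A (Fin n → T)))

/-- The Auslander class `𝒳_T`: there is an exact sequence `0 → M → T₀ → T₁ → ⋯` with all terms
in `add T` and all images in `KerExt^{≥1}(-, T)`. -/
def auslanderClass (T : Type u) [AddCommGroup T] [Module A T] :
    ObjectProperty (ModuleCat.{u} A) := fun M =>
  Module.Finite A M ∧
  ∃ (C : ℕ → ModuleCat.{u} A) (f : M →ₗ[A] C 0) (d : ∀ i, C i →ₗ[A] C (i + 1)),
    (∀ i, InAdd T (C i)) ∧
    Function.Injective f ∧ Function.Exact f (d 0) ∧ (∀ i, Function.Exact (d i) (d (i + 1))) ∧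
    (∀ n, 1 ≤ n →
      ExtVanishes (ModuleCat.of A (LinearMap.range f)) (ModuleCat.of A T) n) ∧
    (∀ i n, 1 ≤ n →
      ExtVanishes (ModuleCat.of A (LinearMap.range (d i))) (ModuleCat.of A T) n)

/-- The co-Auslander class `_T𝒳`: there is an exact sequence `⋯ → T₁ → T₀ → M → 0` with all terms
in `add T` and all images in `KerExt^{≥1}(T, -)`. -/
def coAuslanderClass (T : Type u) [AddCommGroup T] [Module A T] :
    ObjectProperty (ModuleCat.{u} A) := fun M =>
  Module.Finite A M ∧
  ∃ (C : ℕ → ModuleCat.{u} A) (f : C 0 →ₗ[A] M) (d : ∀ i, C (i + 1) →ₗ[A] C i),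
    (∀ i, InAdd T (C i)) ∧
    Function.Surjective f ∧ Function.Exact (d 0) f ∧ (∀ i, Function.Exact (d (i + 1)) (d i)) ∧
    (∀ n, 1 ≤ n →
      ExtVanishes (ModuleCat.of A T) (ModuleCat.of A (LinearMap.range f)) n) ∧
    (∀ i n, 1 ≤ n →
      ExtVanishes (ModuleCat.of A T) (ModuleCat.of A (LinearMap.range (d i))) n)

end Subcategories

/-- The bimodules `_S V_R` and `_R V'_S` represent a cotorsion pair counter equivalence between
`(𝓑, 𝓐)` in `mod R` and `(𝓖, 𝓚)` in `mod S`: there are equivalences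
`Hom_R(V, -) : 𝓐 ⇄ 𝓖 : - ⊗_S V` and `Hom_S(V', -) : 𝓚 ⇄ 𝓑 : - ⊗_R V'`. -/
structure CounterEquivalence (S R : Type u) [Ring S] [Ring R]
    (V : Type u) [AddCommGroup V] [Module S V] [Module Rᵐᵒᵖ V] [SMulCommClass S Rᵐᵒᵖ V]
    (V' : Type u) [AddCommGroup V'] [Module R V'] [Module Sᵐᵒᵖ V'] [SMulCommClass R Sᵐᵒᵖ V']
    (𝓑 𝓐 : ObjectProperty (ModuleCat.{u} Rᵐᵒᵖ)) (𝓖 𝓚 : ObjectProperty (ModuleCat.{u} Sᵐᵒᵖ)) where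
  e : 𝓐.FullSubcategory ≌ 𝓖.FullSubcategory
  e_functor : e.functor ⋙ 𝓖.ι ≅ 𝓐.ι ⋙ homFunctor S R V
  e_inverse : e.inverse ⋙ 𝓐.ι ≅ 𝓖.ι ⋙ tensorFunctor S R V
  e' : 𝓚.FullSubcategory ≌ 𝓑.FullSubcategory
  e'_functor : e'.functor ⋙ 𝓑.ι ≅ 𝓚.ι ⋙ homFunctor R S V'
  e'_inverse : e'.inverse ⋙ 𝓚.ι ≅ 𝓑.ι ⋙ tensorFunctor R S V'

/-! ### The repetitive category -/

section Repetitive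

variable (k : Type u) [CommRing k] (J : Type u) [AddCommGroup J] [Module k J]
  (R : Type u) [Ring R] [Algebra k R]

/-- A finitely generated module over the repetitive algebra of `R`, as a repe-complex: finitely
generated right `R`-modules `X i`, almost all zero, with maps
`δ : X (i + 1) → Hom_R(DR, X i)` such that
`X (i + 2) → Hom_R(DR, X (i + 1)) → Hom_R(DR, Hom_R(DR, X i))` is zero. -/
structure RepeComplex where
  X : ℤ → ModuleCat.{u} Rᵐᵒᵖ
  finite : ∀ i, Module.Finite Rᵐᵒᵖ (X i)
  bounded : {i | Nontrivial (X i)}.Finite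
  δ : ∀ i, X (i + 1) →ₗ[Rᵐᵒᵖ] RHom R (Dual k J R) (X i)
  δ_comp : ∀ i (x : X (i + 1 + 1)) (φ ψ : Dual k J R),
    (δ i ((δ (i + 1) x).toLin φ)).toLin ψ = 0

variable {k J R}

/-- Morphisms of repe-complexes. -/
@[ext] structure RepeComplex.Hom (X Y : RepeComplex k J R) where
  f : ∀ i, X.X i →ₗ[Rᵐᵒᵖ] Y.X i
  comm : ∀ i (x : X.X (i + 1)) (φ : Dual k J R),
    f i ((X.δ i x).toLin φ) = (Y.δ i (f (i + 1) x)).toLin φ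

instance : Category (RepeComplex k J R) where
  Hom := RepeComplex.Hom
  id X := ⟨fun _ => LinearMap.id, fun _ _ _ => rfl⟩
  comp a b := ⟨fun i => (b.f i).comp (a.f i), fun i x φ => by
    simp only [LinearMap.comp_apply, a.comm, b.comm]⟩

variable (k J R)

/-- `g - h` factors through a projective object. -/
def stableRel : HomRel (RepeComplex k J R) := fun X Y g h =>
  ∃ (P : RepeComplex k J R) (_ : Projective P) (a : X ⟶ P) (b : P ⟶ Y),
    ∀ i (x : X.X i), g.f i x - h.f i x = b.f i (a.f i x)

/-- The repetitive category of `R`: the stable category of finitely generated modules over the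
repetitive algebra of `R`. -/
abbrev RepetitiveCategory : Type _ := Quotient (stableRel k J R)

/-- The repe-complex with `M` in degree `0` and zero in all other degrees. -/
def stalk : FGModuleCat.{u} Rᵐᵒᵖ ⥤ RepeComplex k J R where
  obj M :=
    { X := fun i => ModuleCat.of Rᵐᵒᵖ (if i = 0 then ⊤ else ⊥ : Submodule Rᵐᵒᵖ M.obj)
      finite := fun i => by
        have : Module.Finite Rᵐᵒᵖ M.obj := M.property
        refine Module.Finite.iff_fg.2 ?_
        split_ifs
        · exact this.fg_top
        · exact Submodule.fg_bot
      bounded := (Set.finite_singleton (0 : ℤ)).subset fun i hi => by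
        by_contra h
        have h' : ¬ i = 0 := h
        have hi' : Nontrivial (if i = 0 then ⊤ else ⊥ : Submodule Rᵐᵒᵖ M.obj) := hi
        rw [if_neg h'] at hi'
        exact not_subsingleton (⊥ : Submodule Rᵐᵒᵖ M.obj) inferInstance
      δ := fun _ => 0
      δ_comp := fun _ _ _ _ => rfl }
  map g :=
    { f := fun i => g.hom.hom.restrict (by
        intro x hx
        by_cases h : i = 0
        · simp [h]
        · simp only [h, if_false, Submodule.mem_bot] at hx ⊢
          rw [hx, map_zero])
      comm := fun _ _ _ => map_zero _ }
  map_id _ := rfl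
  map_comp _ _ := rfl

/-- The canonical functor from `mod R` to the repetitive category of `R`. -/
def stalkStable : FGModuleCat.{u} Rᵐᵒᵖ ⥤ RepetitiveCategory k J R :=
  stalk k J R ⋙ Quotient.functor _

end Repetitive

/-! ### Wakamatsu-tilting modules -/

section Main

variable (R : Type u) [Ring R] (T : Type u) [AddCommGroup T] [Module Rᵐᵒᵖ T]

/-- The right `R`-module `T` is Wakamatsu-tilting, with `S = End(T_R)`: the canonical map from `R`
to the endomorphisms of `_S T` is bijective, and `Ext^i_R(T, T) = 0 = Ext^i_S(T, T)` for all
`i > 0`. -/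
structure IsWakamatsuTilting : Prop where
  finite : Module.Finite Rᵐᵒᵖ T
  balanced : Function.Bijective
    (Module.toModuleEnd (Module.End Rᵐᵒᵖ T) (S := Rᵐᵒᵖ) T)
  ext_right : ∀ i, 0 < i → ExtVanishes (ModuleCat.of Rᵐᵒᵖ T) (ModuleCat.of Rᵐᵒᵖ T) i
  ext_left : ∀ i, 0 < i →
    ExtVanishes (ModuleCat.of (Module.End Rᵐᵒᵖ T) T) (ModuleCat.of (Module.End Rᵐᵒᵖ T) T) i

/-- The finiteness condition on a Wakamatsu-tilting module: `KerExt^1(-, _T𝒳)` or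
`KerExt^1(𝒳_T, -)` is of finite representation type. -/
def IsOfFiniteType : Prop :=
  IsOfFiniteRepresentationType (leftPerp (coAuslanderClass (A := Rᵐᵒᵖ) T)) ∨
  IsOfFiniteRepresentationType (rightPerp (auslanderClass (A := Rᵐᵒᵖ) T))

/-- `R` is of finite representation type: `mod R` is. -/
def IsRepresentationFinite : Prop :=
  IsOfFiniteRepresentationType (ModuleCat.isFG.{u} Rᵐᵒᵖ)

variable (k : Type u) [CommRing k] (J : Type u) [AddCommGroup J] [Module k J]
  [Algebra k R] [Module k T] [IsScalarTower k Rᵐᵒᵖ T]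

/-- `T` is a good Wakamatsu-tilting module: `_S T_R` and `_R DT_S`, with `S = End(T_R)`, represent a
cotorsion pair counter equivalence between complete hereditary cotorsion pairs. -/
def IsGood : Prop :=
  IsWakamatsuTilting R T ∧
  ∃ (𝓑 𝓐 : ObjectProperty (ModuleCat.{u} Rᵐᵒᵖ))
    (𝓖 𝓚 : ObjectProperty (ModuleCat.{u} (Module.End Rᵐᵒᵖ T)ᵐᵒᵖ)),
    IsCompleteHereditaryCotorsionPair 𝓑 𝓐 ∧ IsCompleteHereditaryCotorsionPair 𝓖 𝓚 ∧
    Nonempty (CounterEquivalence (Module.End Rᵐᵒᵖ T) R T (Dual k J T) 𝓑 𝓐 𝓖 𝓚)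

/-- `T` induces a repetitive equivalence between `R` and `S = End(T_R)`: for all complete
hereditary cotorsion pairs `(𝓑, 𝓐)` and `(𝓖, 𝓚)` between which `_S T_R` and `_R DT_S` represent a
cotorsion pair counter equivalence, there is an equivalence of the repetitive categories which
restricts to the equivalence `Hom_R(T, -)` from `𝓐` to `𝓖`. -/
def InducesRepetitiveEquivalence : Prop :=
  ∀ (𝓑 𝓐 : ObjectProperty (ModuleCat.{u} Rᵐᵒᵖ))
    (𝓖 𝓚 : ObjectProperty (ModuleCat.{u} (Module.End Rᵐᵒᵖ T)ᵐᵒᵖ))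
    (hBA : IsCompleteHereditaryCotorsionPair 𝓑 𝓐) (hGK : IsCompleteHereditaryCotorsionPair 𝓖 𝓚)
    (c : CounterEquivalence (Module.End Rᵐᵒᵖ T) R T (Dual k J T) 𝓑 𝓐 𝓖 𝓚),
    ∃ E : RepetitiveCategory k J R ≌ RepetitiveCategory k J (Module.End Rᵐᵒᵖ T),
      Nonempty (ObjectProperty.ιOfLE hBA.right_le ⋙ stalkStable k J R ⋙ E.functor ≅
        c.e.functor ⋙ ObjectProperty.ιOfLE hGK.left_le ⋙
          stalkStable k J (Module.End Rᵐᵒᵖ T))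

end Main

end WakamatsuTilting

end

/-! The functors H = Hom_R(T, -), L = - ⊗_S T, H' = Hom_S(DT, -) and L' = - ⊗_R DT form adjoint
pairs L ⊣ H and L' ⊣ H' running in opposite directions between mod R and mod S. Nearly everything is
proved for such pairs (`AdjointPairs`, `WakamatsuContext`), so that exchanging R and S is a formal
operation (`swap`).

Goodness. The co-Auslander class is the Bass class `bass`: modules A with Ext(T, A) = 0, L H A ≅ A
and Ext(H A, DT) = 0, the last condition being a Tor-vanishing in dual form. Then H and L are
inverse equivalences between `bass` and the corresponding class `cobass` over S. Less formally, L'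
and H' are inverse equivalences between the left perpendicular class `lperp` of `bass` and the right
perpendicular class `rperp` of `cobass`. Invertibility of the units and counits comes from coverings
and embeddings by powers of T and DT. That the classes are respected (`lperp.L'`, `rperp.H'`) rests
on the duality formulas D Hom(B, L G) = Hom(G, L' B) and D Hom(P, A) = Hom(H A, L' P), used one
functional at a time. Since `bass` and `cobass` are recovered from their perpendicular classes
(`bass_iff`, `cobass_iff`), only completeness of the two cotorsion pairs is missing, and only here
does finite type enter. If `lperp` has finitely many indecomposables it consists of the summands of
powers of one module, so every module has a right approximation, minimal by Fitting's lemma.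
Wakamatsu's lemma places its kernel in the perpendicular class, and Salce's trick yields the second
kind of sequence. The functor L' carries the generator of `lperp` to one of `rperp`. The other
alternative of finite type is the same argument for the swapped context.

Repetitive equivalence. As L L' R ≅ DR, the functor H' H is Hom_R(DR, -), so a repe-complex over R
is a family with maps L' X_{i+1} → H X_i (`Rep`, `NakayamaData.toRep`). Choose sequences 0 → X_i →
A_i → B_i → 0 with A_i in 𝓐 and B_i in 𝓑, and let Y_i be the pushout of L' A_{i+1} ← L' X_{i+1} → H
A_i, an extension of L' B_{i+1} by H A_i. These Y_i form a repe-complex over S. The choices are not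
functorial, so no functor is built from them. Instead, all linked pairs (X, Y) form a category
`Link` with two projections. Stably, both projections are full and dense (`exists_hom_of_X`,
`exists_link_X`, `exists_hom_of_Y`, `exists_link_Y`), and a morphism of links is stably zero on one
side exactly when it is on the other (`Hom.null_y_of_null_f`, `Hom.null_f_of_null_y`). Hence both
stable categories are the same quotient of `Link` (`exists_equivalence_of_full_of_essSurj`). A
module A in 𝓐, placed in degree zero, may be linked with B = 0, which gives Y = H A and the
statement on the restriction to 𝓐. -/

noncomputable section

namespace WakamatsuTilting

open Limits

/-! ### Short exact sequences and `Ext` -/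

section ShortExactSequences

universe v w x

variable {C : Type w} [Category.{v} C] [Abelian C] {X Y Z M N W : C}

/-- The sequence `0 → X → Y → Z → 0` is exact. -/
def Ses (f : X ⟶ Y) (g : Y ⟶ Z) : Prop :=
  ∃ h : f ≫ g = 0, (ShortComplex.mk f g h).ShortExact

namespace Ses

variable {f : X ⟶ Y} {g : Y ⟶ Z}

theorem zero (h : Ses f g) : f ≫ g = 0 := h.1

theorem mono (h : Ses f g) : Mono f := h.2.mono_f

theorem epi (h : Ses f g) : Epi g := h.2.epi_g

theorem lift (h : Ses f g) (t : W ⟶ Y) (ht : t ≫ g = 0) : ∃ s : W ⟶ X, s ≫ f = t := by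
  have := h.mono
  exact ⟨h.2.exact.lift t ht, h.2.exact.lift_f t ht⟩

theorem desc (h : Ses f g) (t : Y ⟶ W) (ht : f ≫ t = 0) : ∃ s : Z ⟶ W, g ≫ s = t := by
  have := h.epi
  exact ⟨h.2.exact.desc t ht, h.2.exact.g_desc t ht⟩

theorem of_epi (g : Y ⟶ Z) [Epi g] : Ses (kernel.ι g) g :=
  ⟨kernel.condition g, { exact := ShortComplex.exact_of_f_is_kernel _ (kernelIsKernel g) }⟩

theorem of_mono (f : X ⟶ Y) [Mono f] : Ses f (cokernel.π f) :=
  ⟨cokernel.condition f, { exact := ShortComplex.exact_of_g_is_cokernel _ (cokernelIsCokernel f) }⟩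

theorem of_lift [Mono f] [Epi g] (h0 : f ≫ g = 0)
    (h : ∀ (W : C) (t : W ⟶ Y), t ≫ g = 0 → ∃ s : W ⟶ X, s ≫ f = t) : Ses f g := by
  refine ⟨h0, { exact := ShortComplex.exact_of_f_is_kernel _ ?_ }⟩
  exact KernelFork.IsLimit.ofι' _ _ fun {W} t ht => ⟨(h W t ht).choose, (h W t ht).choose_spec⟩

theorem of_desc [Mono f] [Epi g] (h0 : f ≫ g = 0)
    (h : ∀ (W : C) (t : Y ⟶ W), f ≫ t = 0 → ∃ s : Z ⟶ W, g ≫ s = t) : Ses f g := by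
  refine ⟨h0, { exact := ShortComplex.exact_of_g_is_cokernel _ ?_ }⟩
  exact CokernelCofork.IsColimit.ofπ' _ _
    fun {W} t ht => ⟨(h W t ht).choose, (h W t ht).choose_spec⟩

theorem biprod (X Y : C) : Ses (biprod.inl : X ⟶ X ⊞ Y) (biprod.snd : X ⊞ Y ⟶ Y) :=
  of_lift biprod.inl_snd fun W t ht => ⟨t ≫ biprod.fst, by
    ext <;> simp [ht]⟩

theorem isIso_of_isIso {X' Y' Z' : C} {f' : X' ⟶ Y'} {g' : Y' ⟶ Z'} (h : Ses f g)
    (h' : Ses f' g') (a : X ⟶ X') (b : Y ⟶ Y') (c : Z ⟶ Z') (hab : f ≫ b = a ≫ f')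
    (hbc : g ≫ c = b ≫ g') [IsIso a] [IsIso c] : IsIso b :=
  ShortComplex.isIso₂_of_shortExact_of_isIso₁₃'
    (ShortComplex.homMk (S₁ := .mk f g h.1) (S₂ := .mk f' g' h'.1) a b c hab.symm hbc.symm)
    h.2 h'.2 ‹_› ‹_›

theorem of_iso {X' Y' Z' : C} {f' : X' ⟶ Y'} {g' : Y' ⟶ Z'} (h : Ses f g)
    (a : X ≅ X') (b : Y ≅ Y') (c : Z ≅ Z') (hab : f ≫ b.hom = a.hom ≫ f')
    (hbc : g ≫ c.hom = b.hom ≫ g') : Ses f' g' := by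
  have h0 : f' ≫ g' = 0 := by
    rw [← cancel_epi a.hom, ← Category.assoc, ← hab, Category.assoc, ← hbc, ← Category.assoc,
      h.1, zero_comp, comp_zero]
  exact ⟨h0, ShortComplex.shortExact_of_iso
    (ShortComplex.isoMk (S₁ := .mk f g h.1) (S₂ := .mk f' g' h0) a b c hab.symm hbc.symm) h.2⟩

end Ses

variable [HasExt.{x} C]

open Abelian

section

variable {f : X ⟶ Y} {g : Y ⟶ Z}

theorem Ses.exists_extension (h : Ses f g) (hN : Subsingleton (Ext.{x} Z N 1)) (t : X ⟶ N) :
    ∃ s : Y ⟶ N, f ≫ s = t := by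
  obtain ⟨x, hx⟩ := Ext.contravariant_sequence_exact₁ h.2 N (Ext.mk₀ t) (n₁ := 1) rfl
    (Subsingleton.elim _ _)
  refine ⟨Ext.addEquiv₀ x, (Ext.mk₀_bijective _ _).1 ?_⟩
  rw [← Ext.mk₀_comp_mk₀, Ext.mk₀_addEquiv₀_apply]
  exact hx

theorem Ses.exists_lift (h : Ses f g) (hM : Subsingleton (Ext.{x} M X 1)) (t : M ⟶ Z) :
    ∃ s : M ⟶ Y, s ≫ g = t := by
  obtain ⟨x, hx⟩ := Ext.covariant_sequence_exact₃ M h.2 (Ext.mk₀ t) (n₁ := 1) rfl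
    (Subsingleton.elim _ _)
  refine ⟨Ext.addEquiv₀ x, (Ext.mk₀_bijective _ _).1 ?_⟩
  rw [← Ext.mk₀_comp_mk₀, Ext.mk₀_addEquiv₀_apply]
  exact hx

/-- Once `Ext¹(Y, N)` vanishes, `Ext¹(Z, N)` is the image of the connecting map from `Hom(X, N)`,
and that map kills every morphism that extends to `Y`. -/
theorem Ses.ext_one_of_extension (h : Ses f g) (hY : Subsingleton (Ext.{x} Y N 1))
    (hN : ∀ t : X ⟶ N, ∃ s : Y ⟶ N, f ≫ s = t) : Subsingleton (Ext.{x} Z N 1) := by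
  refine subsingleton_of_forall_eq 0 fun x => ?_
  obtain ⟨y, rfl⟩ := Ext.contravariant_sequence_exact₃ h.2 N x (n₀ := 0)
    (Subsingleton.elim _ _) rfl
  obtain ⟨t, rfl⟩ := (Ext.mk₀_bijective _ _).2 y
  obtain ⟨s, rfl⟩ := hN t
  have := h.2.comp_extClass
  have e : (Ext.mk₀ (f ≫ s) : Ext X N 0) = (Ext.mk₀ f).comp (Ext.mk₀ s) (zero_add 0) := by
    rw [Ext.mk₀_comp_mk₀]
  rw [e]
  exact h.2.extClass_comp_assoc (Ext.mk₀ s) (h := rfl)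

theorem Ses.ext_one_of_lift (h : Ses f g) (hY : Subsingleton (Ext.{x} M Y 1))
    (hM : ∀ t : M ⟶ Z, ∃ s : M ⟶ Y, s ≫ g = t) : Subsingleton (Ext.{x} M X 1) := by
  refine subsingleton_of_forall_eq 0 fun x => ?_
  obtain ⟨y, rfl⟩ := Ext.covariant_sequence_exact₁ M h.2 x (n₀ := 0)
    (Subsingleton.elim _ _) rfl
  obtain ⟨t, rfl⟩ := (Ext.mk₀_bijective _ _).2 y
  obtain ⟨s, rfl⟩ := hM t
  have e : (Ext.mk₀ (s ≫ g) : Ext M Z 0) = (Ext.mk₀ s).comp (Ext.mk₀ g) (zero_add 0) := by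
    rw [Ext.mk₀_comp_mk₀]
  rw [e, Ext.comp_assoc (h₁₂ := zero_add 0) (h₂₃ := zero_add 1) (h := by rfl),
    h.2.comp_extClass, Ext.comp_zero]

theorem Ses.ext_shift_right (h : Ses f g) {n : ℕ} (hX : Subsingleton (Ext.{x} X N n))
    (hY : Subsingleton (Ext.{x} Y N (n + 1))) : Subsingleton (Ext.{x} Z N (n + 1)) := by
  refine subsingleton_of_forall_eq 0 fun x => ?_
  obtain ⟨y, rfl⟩ := Ext.contravariant_sequence_exact₃ h.2 N x (n₀ := n)
    (Subsingleton.elim _ _) (add_comm 1 n)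
  rw [Subsingleton.elim y 0, Ext.comp_zero]

theorem Ses.ext_shift_left (h : Ses f g) {n : ℕ} (hZ : Subsingleton (Ext.{x} Z N (n + 1)))
    (hY : Subsingleton (Ext.{x} Y N n)) : Subsingleton (Ext.{x} X N n) := by
  refine subsingleton_of_forall_eq 0 fun x => ?_
  obtain ⟨y, rfl⟩ := Ext.contravariant_sequence_exact₁ h.2 N x (n₁ := n + 1) (add_comm 1 n)
    (Subsingleton.elim _ _)
  rw [Subsingleton.elim y 0, Ext.comp_zero]

theorem Ses.ext_middle_left (h : Ses f g) {n : ℕ} (hX : Subsingleton (Ext.{x} X N n))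
    (hZ : Subsingleton (Ext.{x} Z N n)) : Subsingleton (Ext.{x} Y N n) := by
  refine subsingleton_of_forall_eq 0 fun x => ?_
  obtain ⟨y, rfl⟩ := Ext.contravariant_sequence_exact₂ h.2 N x (Subsingleton.elim _ _)
  rw [Subsingleton.elim y 0, Ext.comp_zero]

theorem Ses.ext_coshift_left (h : Ses f g) {n : ℕ} (hZ : Subsingleton (Ext.{x} M Z n))
    (hY : Subsingleton (Ext.{x} M Y (n + 1))) : Subsingleton (Ext.{x} M X (n + 1)) := by
  refine subsingleton_of_forall_eq 0 fun x => ?_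
  obtain ⟨y, rfl⟩ := Ext.covariant_sequence_exact₁ M h.2 x (n₀ := n)
    (Subsingleton.elim _ _) rfl
  rw [Subsingleton.elim y 0, Ext.zero_comp]

theorem Ses.ext_coshift_right (h : Ses f g) {n : ℕ} (hX : Subsingleton (Ext.{x} M X (n + 1)))
    (hY : Subsingleton (Ext.{x} M Y n)) : Subsingleton (Ext.{x} M Z n) := by
  refine subsingleton_of_forall_eq 0 fun x => ?_
  obtain ⟨y, rfl⟩ := Ext.covariant_sequence_exact₃ M h.2 x (n₁ := n + 1) rfl
    (Subsingleton.elim _ _)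
  rw [Subsingleton.elim y 0, Ext.zero_comp]

theorem Ses.ext_middle_right (h : Ses f g) {n : ℕ} (hX : Subsingleton (Ext.{x} M X n))
    (hZ : Subsingleton (Ext.{x} M Z n)) : Subsingleton (Ext.{x} M Y n) := by
  refine subsingleton_of_forall_eq 0 fun x => ?_
  obtain ⟨y, rfl⟩ := Ext.covariant_sequence_exact₂ M h.2 x (Subsingleton.elim _ _)
  rw [Subsingleton.elim y 0, Ext.zero_comp]

end

theorem ext_of_retract_left (r : Retract X Y) {n : ℕ} (h : Subsingleton (Ext.{x} Y N n)) :
    Subsingleton (Ext.{x} X N n) := by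
  refine subsingleton_of_forall_eq 0 fun x => ?_
  have : x = (Ext.mk₀ r.i).comp ((Ext.mk₀ r.r).comp x (zero_add n)) (zero_add n) := by
    rw [Ext.mk₀_comp_mk₀_assoc, r.retract, Ext.mk₀_id_comp]
  rw [this, Subsingleton.elim ((Ext.mk₀ r.r).comp x (zero_add n)) 0, Ext.comp_zero]

theorem ext_of_retract_right (r : Retract X Y) {n : ℕ} (h : Subsingleton (Ext.{x} M Y n)) :
    Subsingleton (Ext.{x} M X n) := by
  refine subsingleton_of_forall_eq 0 fun x => ?_
  have : x = (x.comp (Ext.mk₀ r.i) (add_zero n)).comp (Ext.mk₀ r.r) (add_zero n) := by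
    rw [Ext.comp_assoc_of_third_deg_zero, Ext.mk₀_comp_mk₀, r.retract, Ext.comp_mk₀_id]
  rw [this, Subsingleton.elim (x.comp (Ext.mk₀ r.i) (add_zero n)) 0, Ext.zero_comp]

theorem ext_of_iso_left (r : X ≅ Y) {n : ℕ} (h : Subsingleton (Ext.{x} Y N n)) :
    Subsingleton (Ext.{x} X N n) :=
  ext_of_retract_left r.retract h

theorem ext_of_iso_right (r : X ≅ Y) {n : ℕ} (h : Subsingleton (Ext.{x} M Y n)) :
    Subsingleton (Ext.{x} M X n) :=
  ext_of_retract_right r.retract h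

end ShortExactSequences

/-! ### Equivalences from full and dense functors with the same kernel -/

section Equivalences

universe v₁ v₂ v₃ w₁ w₂ w₃

variable {Z : Type w₁} [Category.{v₁} Z] {X : Type w₂} [Category.{v₂} X] {Y : Type w₃}
  [Category.{v₃} Y]

/-- Both functors factor through the quotient of `Z` by one and the same relation, their common
kernel. The induced functors are full, faithful and dense, so the inverse of one can be followed by
the other; no functor from `X` to `Y` has to be chosen by hand. -/
theorem exists_equivalence_of_full_of_essSurj (p : Z ⥤ X) (q : Z ⥤ Y) [p.Full] [p.EssSurj]
    [q.Full] [q.EssSurj]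
    (h : ∀ (a b : Z) (f g : a ⟶ b), p.map f = p.map g ↔ q.map f = q.map g) :
    ∃ E : X ≌ Y, Nonempty (p ⋙ E.functor ≅ q) := by
  let r : HomRel Z := p.homRel
  let p' : CategoryTheory.Quotient r ⥤ X := CategoryTheory.Quotient.lift r p fun _ _ _ _ h => h
  let q' : CategoryTheory.Quotient r ⥤ Y := CategoryTheory.Quotient.lift r q fun a b f g hfg => (h a b f g).1 hfg
  have hp : CategoryTheory.Quotient.functor r ⋙ p' ≅ p := CategoryTheory.Quotient.lift.isLift r p _
  have hq : CategoryTheory.Quotient.functor r ⋙ q' ≅ q := CategoryTheory.Quotient.lift.isLift r q _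
  have : p'.Full := ⟨fun {a b} f => ⟨(CategoryTheory.Quotient.functor r).map (p.preimage f), 
    p.map_preimage f⟩⟩
  have : q'.Full := ⟨fun {a b} f => ⟨(CategoryTheory.Quotient.functor r).map (q.preimage f), 
    q.map_preimage f⟩⟩
  have : p'.Faithful := ⟨fun {a b} f g hfg => by
    obtain ⟨f, rfl⟩ := (CategoryTheory.Quotient.functor r).map_surjective f
    obtain ⟨g, rfl⟩ := (CategoryTheory.Quotient.functor r).map_surjective g
    exact CategoryTheory.Quotient.sound r hfg⟩
  have : q'.Faithful := ⟨fun {a b} f g hfg => by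
    obtain ⟨f, rfl⟩ := (CategoryTheory.Quotient.functor r).map_surjective f
    obtain ⟨g, rfl⟩ := (CategoryTheory.Quotient.functor r).map_surjective g
    exact CategoryTheory.Quotient.sound r ((h _ _ f g).2 hfg)⟩
  have : p'.EssSurj := ⟨fun x => ⟨⟨p.objPreimage x⟩, ⟨p.objObjPreimageIso x⟩⟩⟩
  have : q'.EssSurj := ⟨fun x => ⟨⟨q.objPreimage x⟩, ⟨q.objObjPreimageIso x⟩⟩⟩
  have : p'.IsEquivalence := {}
  have : q'.IsEquivalence := {}
  refine ⟨p'.asEquivalence.symm.trans q'.asEquivalence, ⟨?_⟩⟩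
  refine Functor.isoWhiskerRight hp.symm _ ≪≫ ?_ ≪≫ hq
  refine Functor.associator _ _ _ ≪≫ Functor.isoWhiskerLeft _ ?_
  refine (Functor.associator p' p'.inv q').symm ≪≫
    Functor.isoWhiskerRight p'.asEquivalence.unitIso.symm q' ≪≫ Functor.leftUnitor _

end Equivalences

/-- A family indexed by `ℤ` may be chosen on the successors. -/
theorem exists_family_of_succ {F : ℤ → Type*} (P : ∀ j, F (j + 1) → Prop)
    (h : ∀ j, ∃ x, P j x) : ∃ g : ∀ i, F i, ∀ j, P j (g (j + 1)) := by
  choose f hf using h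
  -- An integer `i` equals `i - 1 + 1` only propositionally, so the chosen element is transported;
  -- the claim below undoes the transport after substituting the index.
  refine ⟨fun i => cast (congrArg F (sub_add_cancel i 1)) (f (i - 1)), fun j => ?_⟩
  have : ∀ (m : ℤ) (e : m = j) (e' : F (m + 1) = F (j + 1)), cast e' (f m) = f j := by
    rintro m rfl e'
    rfl
  beta_reduce
  rw [this (j + 1 - 1) (by ring)]
  exact hf j

theorem exists_eq_succ (i : ℤ) : ∃ j, i = j + 1 := ⟨i - 1, by ring⟩

end WakamatsuTilting

end

set_option linter.unusedSectionVars false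

noncomputable section

namespace WakamatsuTilting

open Limits ZeroObject

/-! ### Repe-complexes over a pair of adjunctions -/

section Abstract

universe v w

/-- Two adjoint pairs `L ⊣ H` and `L' ⊣ H'` of additive functors going in opposite directions
between two categories, each with a class of finitely generated objects. -/
structure AdjointPairs (C D : Type w) [Category.{v} C] [Category.{v} D] [Abelian C]
    [Abelian D] where
  H : C ⥤ D
  L : D ⥤ C
  adj : L ⊣ H
  H' : D ⥤ C
  L' : C ⥤ D
  adj' : L' ⊣ H'
  H_additive : H.Additive
  H'_additive : H'.Additive
  fgC : ObjectProperty C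
  fgD : ObjectProperty D

variable {C D : Type w} [Category.{v} C] [Category.{v} D] [Abelian C] [Abelian D]

namespace AdjointPairs

/-- Exchange of the two categories. -/
@[reducible] def swap (Φ : AdjointPairs C D) : AdjointPairs D C where
  H := Φ.H'
  L := Φ.L'
  adj := Φ.adj'
  H' := Φ.H
  L' := Φ.L
  adj' := Φ.adj
  H_additive := Φ.H'_additive
  H'_additive := Φ.H_additive
  fgC := Φ.fgD
  fgD := Φ.fgC

variable (Φ : AdjointPairs C D)

instance : Φ.H.Additive := Φ.H_additive
instance : Φ.H'.Additive := Φ.H'_additive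
instance : Φ.L.Additive := Φ.adj.left_adjoint_additive
instance : Φ.L'.Additive := Φ.adj'.left_adjoint_additive
instance : Φ.H.IsRightAdjoint := ⟨_, ⟨Φ.adj⟩⟩
instance : Φ.H'.IsRightAdjoint := ⟨_, ⟨Φ.adj'⟩⟩
instance : Φ.L.IsLeftAdjoint := ⟨_, ⟨Φ.adj⟩⟩
instance : Φ.L'.IsLeftAdjoint := ⟨_, ⟨Φ.adj'⟩⟩

section

variable {M M' : D} {N N' : C}

/-- The morphism `M ⟶ H N` adjoint to `L M ⟶ N`. -/
def fl (t : Φ.L.obj M ⟶ N) : M ⟶ Φ.H.obj N := Φ.adj.homEquiv M N t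

/-- The morphism `L M ⟶ N` adjoint to `M ⟶ H N`. -/
def sh (t : M ⟶ Φ.H.obj N) : Φ.L.obj M ⟶ N := (Φ.adj.homEquiv M N).symm t

@[simp] theorem fl_sh (t : M ⟶ Φ.H.obj N) : Φ.fl (Φ.sh t) = t := by simp [fl, sh]

@[simp] theorem sh_fl (t : Φ.L.obj M ⟶ N) : Φ.sh (Φ.fl t) = t := by simp [fl, sh]

theorem fl_injective : Function.Injective (Φ.fl (M := M) (N := N)) :=
  (Φ.adj.homEquiv M N).injective

theorem sh_injective : Function.Injective (Φ.sh (M := M) (N := N)) :=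
  (Φ.adj.homEquiv M N).symm.injective

theorem fl_comp (t : Φ.L.obj M ⟶ N) (s : N ⟶ N') : Φ.fl (t ≫ s) = Φ.fl t ≫ Φ.H.map s :=
  Φ.adj.homEquiv_naturality_right t s

theorem fl_map (s : M' ⟶ M) (t : Φ.L.obj M ⟶ N) : Φ.fl (Φ.L.map s ≫ t) = s ≫ Φ.fl t :=
  Φ.adj.homEquiv_naturality_left s t

theorem sh_comp (t : M ⟶ Φ.H.obj N) (s : N ⟶ N') : Φ.sh (t ≫ Φ.H.map s) = Φ.sh t ≫ s :=
  Φ.adj.homEquiv_naturality_right_symm t s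

theorem sh_map (s : M' ⟶ M) (t : M ⟶ Φ.H.obj N) : Φ.sh (s ≫ t) = Φ.L.map s ≫ Φ.sh t :=
  Φ.adj.homEquiv_naturality_left_symm s t

@[simp] theorem fl_zero : Φ.fl (0 : Φ.L.obj M ⟶ N) = 0 := by
  simp [fl, Adjunction.homEquiv_unit]

@[simp] theorem sh_zero : Φ.sh (0 : M ⟶ Φ.H.obj N) = 0 := by
  simp [sh, Adjunction.homEquiv_counit]

theorem fl_add (s t : Φ.L.obj M ⟶ N) : Φ.fl (s + t) = Φ.fl s + Φ.fl t := by
  simp [fl, Adjunction.homEquiv_unit]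

theorem sh_add (s t : M ⟶ Φ.H.obj N) : Φ.sh (s + t) = Φ.sh s + Φ.sh t := by
  simp [sh, Adjunction.homEquiv_counit]

variable (M N)

/-- The unit of `L ⊣ H`. -/
def un : M ⟶ Φ.H.obj (Φ.L.obj M) := Φ.fl (𝟙 _)

/-- The counit of `L ⊣ H`. -/
def co : Φ.L.obj (Φ.H.obj N) ⟶ N := Φ.sh (𝟙 _)

variable {M N}

theorem un_map (t : Φ.L.obj M ⟶ N) : Φ.un M ≫ Φ.H.map t = Φ.fl t := by
  rw [un, ← fl_comp, Category.id_comp]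

theorem map_co (t : M ⟶ Φ.H.obj N) : Φ.L.map t ≫ Φ.co N = Φ.sh t := by
  rw [co, ← sh_map, Category.comp_id]

theorem sh_hmap (t : N ⟶ N') : Φ.sh (Φ.H.map t) = Φ.co N ≫ t := by
  rw [co, ← sh_comp, Category.id_comp]

theorem fl_lmap (t : M' ⟶ M) : Φ.fl (Φ.L.map t) = t ≫ Φ.un M := by
  rw [un, ← fl_map, Category.comp_id]

@[simp] theorem sh_un : Φ.sh (Φ.un M) = 𝟙 _ := sh_fl _ _

@[simp] theorem fl_co : Φ.fl (Φ.co N) = 𝟙 _ := fl_sh _ _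

end

/-- The morphism `M ⟶ H' N` adjoint to `L' M ⟶ N`. -/
abbrev fl' {M : C} {N : D} (t : Φ.L'.obj M ⟶ N) : M ⟶ Φ.H'.obj N := Φ.swap.fl t

/-- The morphism `L' M ⟶ N` adjoint to `M ⟶ H' N`. -/
abbrev sh' {M : C} {N : D} (t : M ⟶ Φ.H'.obj N) : Φ.L'.obj M ⟶ N := Φ.swap.sh t

/-- The unit of `L' ⊣ H'`. -/
abbrev un' (M : C) : M ⟶ Φ.H'.obj (Φ.L'.obj M) := Φ.swap.un M

/-- The counit of `L' ⊣ H'`. -/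
abbrev co' (N : D) : Φ.L'.obj (Φ.H'.obj N) ⟶ N := Φ.swap.co N

section

variable {M M' : C} {N N' : D}

theorem fl'_comp (t : Φ.L'.obj M ⟶ N) (s : N ⟶ N') : Φ.fl' (t ≫ s) = Φ.fl' t ≫ Φ.H'.map s :=
  Φ.swap.fl_comp t s

theorem fl'_map (s : M' ⟶ M) (t : Φ.L'.obj M ⟶ N) : Φ.fl' (Φ.L'.map s ≫ t) = s ≫ Φ.fl' t :=
  Φ.swap.fl_map s t

theorem sh'_comp (t : M ⟶ Φ.H'.obj N) (s : N ⟶ N') : Φ.sh' (t ≫ Φ.H'.map s) = Φ.sh' t ≫ s :=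
  Φ.swap.sh_comp t s

theorem sh'_map (s : M' ⟶ M) (t : M ⟶ Φ.H'.obj N) : Φ.sh' (s ≫ t) = Φ.L'.map s ≫ Φ.sh' t :=
  Φ.swap.sh_map s t

@[simp] theorem fl'_sh' (t : M ⟶ Φ.H'.obj N) : Φ.fl' (Φ.sh' t) = t := Φ.swap.fl_sh t

@[simp] theorem sh'_fl' (t : Φ.L'.obj M ⟶ N) : Φ.sh' (Φ.fl' t) = t := Φ.swap.sh_fl t

@[simp] theorem fl'_zero : Φ.fl' (0 : Φ.L'.obj M ⟶ N) = 0 := Φ.swap.fl_zero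

@[simp] theorem sh'_zero : Φ.sh' (0 : M ⟶ Φ.H'.obj N) = 0 := Φ.swap.sh_zero

theorem fl'_add (s t : Φ.L'.obj M ⟶ N) : Φ.fl' (s + t) = Φ.fl' s + Φ.fl' t := Φ.swap.fl_add s t

theorem map_co' (t : M ⟶ Φ.H'.obj N) : Φ.L'.map t ≫ Φ.co' N = Φ.sh' t := Φ.swap.map_co t

theorem sh'_injective : Function.Injective (Φ.sh' (M := M) (N := N)) := Φ.swap.sh_injective

theorem fl'_injective : Function.Injective (Φ.fl' (M := M) (N := N)) := Φ.swap.fl_injective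

theorem un'_map (t : Φ.L'.obj M ⟶ N) : Φ.un' M ≫ Φ.H'.map t = Φ.fl' t := Φ.swap.un_map t

theorem fl'_lmap (t : M' ⟶ M) : Φ.fl' (Φ.L'.map t) = t ≫ Φ.un' M := Φ.swap.fl_lmap t

end

end AdjointPairs

/-- Almost all members of the family are zero. -/
def Bdd {C : Type w} [Category.{v} C] (X : ℤ → C) : Prop := {i | ¬ IsZero (X i)}.Finite

theorem Bdd.shift {C : Type w} [Category.{v} C] {X : ℤ → C} (h : Bdd X) :
    Bdd fun i => X (i + 1) :=
  h.preimage (f := fun i : ℤ => i + 1) (fun _ _ _ _ h => by simpa using h)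

theorem Bdd.of_imp {C₁ C₂ C₃ : Type w} [Category.{v} C₁] [Category.{v} C₂] [Category.{v} C₃]
    {X : ℤ → C₁} {Y : ℤ → C₂} {Z : ℤ → C₃} (hX : Bdd X) (hY : Bdd Y)
    (h : ∀ i, IsZero (X i) → IsZero (Y i) → IsZero (Z i)) : Bdd Z :=
  Set.Finite.subset (Set.Finite.union hX hY) fun i hi => by
    by_contra hn
    simp only [Set.mem_union, Set.mem_ofPred_eq, not_or, not_not] at hn
    exact hi (h i hn.1 hn.2)

theorem Bdd.of_imp_one {C₁ C₂ : Type w} [Category.{v} C₁] [Category.{v} C₂] {X : ℤ → C₁}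
    {Z : ℤ → C₂} (hX : Bdd X) (h : ∀ i, IsZero (X i) → IsZero (Z i)) : Bdd Z :=
  hX.of_imp hX fun i hi _ => h i hi

variable (Φ : AdjointPairs C D)

/-- A repe-complex for the endofunctor `L L'`, with right adjoint `H' H`. -/
structure Rep where
  X : ℤ → C
  fg : ∀ i, Φ.fgC (X i)
  bdd : Bdd X
  d : ∀ i, Φ.L'.obj (X (i + 1)) ⟶ Φ.H.obj (X i)
  d_comp : ∀ i, Φ.sh (d (i + 1)) ≫ Φ.fl' (d i) = 0

variable {Φ}

namespace Rep

/-- The identity `d_comp` transposed along `L' ⊣ H'`; the next lemma transposes it along `L ⊣ H`. -/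
theorem map_sh_comp (X : Rep Φ) (i : ℤ) : Φ.L'.map (Φ.sh (X.d (i + 1))) ≫ X.d i = 0 :=
  Φ.fl'_injective (by rw [Φ.fl'_map, X.d_comp]; exact Φ.fl'_zero.symm)

theorem comp_map_fl (X : Rep Φ) (i : ℤ) : X.d (i + 1) ≫ Φ.H.map (Φ.fl' (X.d i)) = 0 :=
  Φ.sh_injective (by rw [Φ.sh_comp, X.d_comp, Φ.sh_zero])

/-- Morphisms of repe-complexes. -/
@[ext] structure Hom (X Y : Rep Φ) where
  f : ∀ i, X.X i ⟶ Y.X i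
  comm : ∀ i, X.d i ≫ Φ.H.map (f i) = Φ.L'.map (f (i + 1)) ≫ Y.d i

instance : Category (Rep Φ) where
  Hom := Hom
  id X := ⟨fun _ => 𝟙 _, fun i => by simp⟩
  comp a b := ⟨fun i => a.f i ≫ b.f i, fun i => by
    rw [Functor.map_comp, Functor.map_comp, Category.assoc, ← b.comm, ← Category.assoc, a.comm,
      Category.assoc]⟩

@[ext] theorem hom_ext {X Y : Rep Φ} {f g : X ⟶ Y} (h : ∀ i, f.f i = g.f i) : f = g :=
  Hom.ext (funext h)

@[simp] theorem id_f (X : Rep Φ) (i : ℤ) : Hom.f (𝟙 X) i = 𝟙 _ := rfl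

@[simp] theorem comp_f {X Y Z : Rep Φ} (f : X ⟶ Y) (g : Y ⟶ Z) (i : ℤ) :
    (f ≫ g).f i = f.f i ≫ g.f i := rfl

theorem comm_sh {X Y : Rep Φ} (f : X ⟶ Y) (i : ℤ) :
    Φ.sh (X.d i) ≫ f.f i = Φ.L.map (Φ.L'.map (f.f (i + 1))) ≫ Φ.sh (Y.d i) := by
  rw [← Φ.sh_comp, f.comm, Φ.sh_map]

theorem comm_fl {X Y : Rep Φ} (f : X ⟶ Y) (i : ℤ) :
    Φ.fl' (X.d i) ≫ Φ.H'.map (Φ.H.map (f.f i)) = f.f (i + 1) ≫ Φ.fl' (Y.d i) := by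
  rw [← Φ.fl'_comp, f.comm, Φ.fl'_map]

/-- An isomorphism of repe-complexes from isomorphisms in each degree. -/
@[simps] def isoMk {X Y : Rep Φ} (e : ∀ i, X.X i ≅ Y.X i)
    (h : ∀ i, X.d i ≫ Φ.H.map (e i).hom = Φ.L'.map (e (i + 1)).hom ≫ Y.d i) : X ≅ Y where
  hom := ⟨fun i => (e i).hom, h⟩
  inv := ⟨fun i => (e i).inv, fun i => by
    rw [← cancel_mono (Φ.H.map (e i).hom), Category.assoc, ← Functor.map_comp, Iso.inv_hom_id,
      Category.assoc, h, ← Category.assoc, ← Functor.map_comp, Iso.inv_hom_id]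
    simp⟩
  hom_inv_id := by ext i; simp
  inv_hom_id := by ext i; simp

/-- A family of morphisms which factors through an induced repe-complex on projectives. -/
def Null (X Y : Rep Φ) (f : ∀ i, X.X i ⟶ Y.X i) : Prop :=
  ∃ (Q : ℤ → C) (γ : ∀ i, X.X i ⟶ Q i) (α : ∀ i, X.X i ⟶ Φ.L.obj (Φ.L'.obj (Q (i + 1))))
    (β : ∀ i, Q i ⟶ Y.X i),
    (∀ i, Φ.fgC (Q i) ∧ Projective (Q i)) ∧ Bdd Q ∧
    (∀ i, X.d i ≫ Φ.H.map (γ i) = 0) ∧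
    (∀ i, X.d i ≫ Φ.H.map (α i) = Φ.L'.map (γ (i + 1)) ≫ Φ.un (Φ.L'.obj (Q (i + 1)))) ∧
    ∀ i, f i = γ i ≫ β i + α i ≫ Φ.L.map (Φ.L'.map (β (i + 1))) ≫ Φ.sh (Y.d i)

end Rep

variable (Φ) in
/-- Finitely generated projective objects behave as for a pair of dual bimodules. -/
structure HasNakayama : Prop where
  fg_quot : ∀ {X Y : C} (f : X ⟶ Y), Epi f → Φ.fgC X → Φ.fgC Y
  fg_biprod : ∀ X Y : C, Φ.fgC X → Φ.fgC Y → Φ.fgC (X ⊞ Y)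
  fg_ind : ∀ P : C, Φ.fgC P → Projective P → Φ.fgC (Φ.L.obj (Φ.L'.obj P))
  fg_zero : ∀ P : C, IsZero P → Φ.fgC P
  cover : ∀ X : C, Φ.fgC X → ∃ (P : C) (p : P ⟶ X), Epi p ∧ Φ.fgC P ∧ Projective P
  isIso_un' : ∀ P : C, Φ.fgC P → Projective P → IsIso (Φ.un' P)
  isIso_un : ∀ P : C, Φ.fgC P → Projective P → IsIso (Φ.un (Φ.L'.obj P))

theorem HasNakayama.exists_cover (h : HasNakayama Φ) (X : C) (hX : Φ.fgC X) :
    ∃ (P : C) (p : P ⟶ X), Epi p ∧ (Φ.fgC P ∧ Projective P) ∧ (IsZero X → IsZero P) := by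
  by_cases h0 : IsZero X
  · exact ⟨X, 𝟙 _, inferInstance, ⟨hX, ⟨fun f e _ => ⟨0, h0.eq_of_src _ _⟩⟩⟩, fun h => h⟩
  · obtain ⟨P, p, h1, h2, h3⟩ := h.cover X hX
    exact ⟨P, p, h1, ⟨h2, h3⟩, fun h => (h0 h).elim⟩

namespace Rep

/-! ### Induced repe-complexes, the free objects -/

section Induced

variable (hΦ : HasNakayama Φ) (Q : ℤ → C) (hQ : ∀ i, Φ.fgC (Q i) ∧ Projective (Q i))
  (bQ : Bdd Q)

/-- The induced repe-complex, with terms `Q i ⊞ L L' (Q (i + 1))`. -/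
@[reducible] def ind : Rep Φ where
  X i := Q i ⊞ Φ.L.obj (Φ.L'.obj (Q (i + 1)))
  fg i := hΦ.fg_biprod _ _ (hQ i).1 (hΦ.fg_ind _ (hQ _).1 (hQ _).2)
  bdd := bQ.of_imp bQ.shift fun i h h' => by
    rw [biprod_isZero_iff]
    exact ⟨h, Functor.map_isZero _ (Functor.map_isZero _ h')⟩
  d i := Φ.L'.map biprod.fst ≫ Φ.un _ ≫ Φ.H.map biprod.inr
  d_comp i := by
    rw [Φ.sh_map, Φ.sh_comp, Φ.sh_un, Category.id_comp, Φ.fl'_map, Category.assoc,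
      biprod.inr_fst_assoc, zero_comp, comp_zero]

variable {Q hQ bQ}

/-- The morphism out of an induced repe-complex determined by its values on the generators. -/
def indDesc {Y : Rep Φ} (β : ∀ i, Q i ⟶ Y.X i) : ind hΦ Q hQ bQ ⟶ Y where
  f i := biprod.desc (β i) (Φ.L.map (Φ.L'.map (β (i + 1))) ≫ Φ.sh (Y.d i))
  comm i := by
    apply Φ.sh_injective
    rw [Φ.sh_comp, Φ.sh_map, Φ.sh_comp, Φ.sh_un, Category.id_comp, Category.assoc,
      biprod.inr_desc, Φ.sh_map]
    rw [← Category.assoc, ← Functor.map_comp, ← Functor.map_comp]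
    apply Φ.fl_injective
    rw [Φ.fl_map, Φ.fl_map, Φ.fl_sh]
    apply Φ.fl'_injective
    rw [Φ.fl'_map, Φ.fl'_map]
    ext
    · simp
    · simp only [biprod.inr_fst_assoc, zero_comp, biprod.inr_desc_assoc, Category.assoc, Y.d_comp,
        comp_zero]

variable {hΦ}

/-- The induced object is free on the family `Q`: its differential maps the copy of `L L' Q (i + 1)`
coming from the next degree identically onto the second summand, so commutation forces the values
there. -/
theorem ind_hom_eq {Y : Rep Φ} (f : ind hΦ Q hQ bQ ⟶ Y) :
    f = indDesc hΦ (fun i => biprod.inl ≫ f.f i) := by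
  ext i : 1
  refine biprod.hom_ext' _ _ ?_ ?_
  · simp [indDesc]
  · have := comm_sh f i
    dsimp only at this
    rw [Φ.sh_map, Φ.sh_comp, Φ.sh_un, Category.id_comp] at this
    have h2 := congrArg (fun t => Φ.L.map (Φ.L'.map biprod.inl) ≫ t) this
    simp only [← Category.assoc, ← Functor.map_comp] at h2
    simpa [indDesc, ← Functor.map_comp] using h2

/-- A morphism into the induced object is a pair `(γ, α)`, and its commutation with the
differentials splits into the two equations of `Null`, one per summand. A morphism out of it is
given by `β` alone, by freeness. -/
theorem null_iff_factors {X Y : Rep Φ} (f : ∀ i, X.X i ⟶ Y.X i) :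
    Null X Y f ↔ ∃ (Q : ℤ → C) (hQ : ∀ i, Φ.fgC (Q i) ∧ Projective (Q i)) (bQ : Bdd Q)
      (a : X ⟶ ind hΦ Q hQ bQ) (b : ind hΦ Q hQ bQ ⟶ Y), ∀ i, f i = a.f i ≫ b.f i := by
  constructor
  · rintro ⟨Q, γ, α, β, hQ, bQ, h1, h2, h3⟩
    refine ⟨Q, hQ, bQ, ⟨fun i => biprod.lift (γ i) (α i), fun i => ?_⟩, indDesc hΦ β, fun i => ?_⟩
    · have e : (biprod.lift (γ i) (α i) : _ ⟶ (ind hΦ Q hQ bQ).X i) =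
        γ i ≫ biprod.inl + α i ≫ biprod.inr := by
        ext <;> simp
      rw [e, Functor.map_add, Preadditive.comp_add, Functor.map_comp, Functor.map_comp,
        ← Category.assoc, h1, zero_comp, zero_add, ← Category.assoc, h2]
      rw [← Category.assoc (Φ.L'.map _) (Φ.L'.map _), ← Functor.map_comp, biprod.lift_fst,
        Category.assoc]
    · rw [h3]
      exact biprod.lift_desc.symm
  · rintro ⟨Q, hQ, bQ, a, b, h⟩
    refine ⟨Q, fun i => a.f i ≫ biprod.fst, fun i => a.f i ≫ biprod.snd,
      fun i => biprod.inl ≫ b.f i, hQ, bQ, fun i => ?_, fun i => ?_, fun i => ?_⟩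
    · beta_reduce
      rw [Functor.map_comp, ← Category.assoc, a.comm]
      simp only [Category.assoc, ← Functor.map_comp, biprod.inr_fst, Functor.map_zero, comp_zero]
    · beta_reduce
      rw [Functor.map_comp, ← Category.assoc, a.comm]
      simp only [Category.assoc, ← Functor.map_comp, biprod.inr_snd]
      simp only [Functor.map_comp, Category.assoc, CategoryTheory.Functor.map_id,
        Category.comp_id]
    · rw [h]
      conv_lhs => rw [ind_hom_eq b]
      have e : a.f i = biprod.lift (a.f i ≫ biprod.fst) (a.f i ≫ biprod.snd) := by
        ext <;> simp
      conv_lhs => rw [e]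
      exact biprod.lift_desc

/-- Freeness reduces lifting along `e` to lifting each `Q i` along `e.f i`. -/
theorem ind_projective_of_epi (h : ∀ {X Y : Rep Φ} (e : X ⟶ Y), Epi e → ∀ i, Epi (e.f i)) :
    Projective (ind hΦ Q hQ bQ) where
  factors {X Y} f e he := by
    have := h e he
    have := fun i => (hQ i).2
    let g : ind hΦ Q hQ bQ ⟶ X :=
      indDesc hΦ fun i => Projective.factorThru (biprod.inl ≫ f.f i) (e.f i)
    refine ⟨g, (ind_hom_eq _).trans (Eq.trans ?_ (ind_hom_eq f).symm)⟩
    congr 1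
    funext i
    have e1 : biprod.inl ≫ g.f i = Projective.factorThru (biprod.inl ≫ f.f i) (e.f i) :=
      biprod.inl_desc _ _
    rw [comp_f, ← Category.assoc, e1, Projective.factorThru_comp]

end Induced

/-! ### Epimorphisms of repe-complexes are termwise -/

section Cokernel

variable {X Y : Rep Φ} (e : X ⟶ Y) (h : ∀ {X Y : C} (f : X ⟶ Y), Epi f → Φ.fgC X → Φ.fgC Y)

/-- The termwise cokernel. -/
@[reducible] def coker : Rep Φ where
  X i := cokernel (e.f i)
  fg i := h (cokernel.π (e.f i)) inferInstance (Y.fg i)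
  bdd := Bdd.of_imp_one Y.bdd fun i hi => IsZero.of_epi (cokernel.π (e.f i)) hi
  d i := Φ.sh' (cokernel.desc (e.f (i + 1))
    (Φ.fl' (Y.d i) ≫ Φ.H'.map (Φ.H.map (cokernel.π (e.f i)))) (by
      rw [← Category.assoc, ← comm_fl, Category.assoc, ← Functor.map_comp, ← Functor.map_comp,
        cokernel.condition, Functor.map_zero, Functor.map_zero, comp_zero]))
  d_comp i := by
    have key : ∀ i, Φ.L'.map (cokernel.π (e.f (i + 1))) ≫ Φ.sh' (cokernel.desc (e.f (i + 1))
        (Φ.fl' (Y.d i) ≫ Φ.H'.map (Φ.H.map (cokernel.π (e.f i)))) (by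
      rw [← Category.assoc, ← comm_fl, Category.assoc, ← Functor.map_comp, ← Functor.map_comp,
        cokernel.condition, Functor.map_zero, Functor.map_zero, comp_zero])) =
        Y.d i ≫ Φ.H.map (cokernel.π (e.f i)) := fun i => by
      apply Φ.fl'_injective
      rw [Φ.fl'_map, Φ.fl'_sh', cokernel.π_desc, Φ.fl'_comp]
    rw [← cancel_epi (Φ.L.map (Φ.L'.map (cokernel.π (e.f (i + 1 + 1))))), ← Category.assoc,
      ← Φ.sh_map, key, Φ.sh_comp, Category.assoc, ← Φ.fl'_map, key, Φ.fl'_comp, ← Category.assoc,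
      Y.d_comp, zero_comp, comp_zero]

/-- The projection onto the termwise cokernel. -/
def cokerπ : Y ⟶ coker e h where
  f i := cokernel.π (e.f i)
  comm i := by
    apply Φ.fl'_injective
    rw [Φ.fl'_map, Φ.fl'_sh', cokernel.π_desc, Φ.fl'_comp]

-- The termwise cokernel is again a repe-complex; its projection and the zero morphism agree after
-- the epimorphism `e`, hence are equal.
include h in
theorem epi_f [Epi e] (i : ℤ) : Epi (e.f i) := by
  let z : Y ⟶ coker e h := ⟨fun i => 0, fun i => by simp⟩
  have : cokerπ e h = z := by
    rw [← cancel_epi e]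
    ext i : 1
    exact (cokernel.condition _).trans (comp_zero).symm
  have h0 : cokernel.π (e.f i) = 0 := congrFun (congrArg Hom.f this) i
  exact Preadditive.epi_of_cokernel_zero h0

theorem epi_of_epi_f (he : ∀ i, Epi (e.f i)) : Epi e where
  left_cancellation a b hab := by
    ext i : 1
    rw [← cancel_epi (e.f i)]
    exact congrFun (congrArg Hom.f hab) i

end Cokernel

/-! ### Morphisms factoring through projective repe-complexes -/

section Stable

variable (hΦ : HasNakayama Φ)

theorem ind_projective {Q : ℤ → C} {hQ : ∀ i, Φ.fgC (Q i) ∧ Projective (Q i)} {bQ : Bdd Q} :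
    Projective (ind hΦ Q hQ bQ) :=
  ind_projective_of_epi fun e _ i => epi_f e hΦ.fg_quot i

theorem exists_family_cover {X : ℤ → C} (hX : ∀ i, Φ.fgC (X i)) (bX : Bdd X) (hΦ : HasNakayama Φ) :
    ∃ (Q : ℤ → C) (β : ∀ i, Q i ⟶ X i),
      (∀ i, Epi (β i)) ∧ (∀ i, Φ.fgC (Q i) ∧ Projective (Q i)) ∧ Bdd Q := by
  choose Q β h1 h2 h3 using fun i => hΦ.exists_cover (X i) (hX i)
  exact ⟨Q, β, h1, h2, Bdd.of_imp_one bX h3⟩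

-- Projectives mapping onto the terms give an epimorphism from an induced object onto any
-- repe-complex, and onto a projective one it splits.
include hΦ in
theorem null_iff_projective {X Y : Rep Φ} (f : ∀ i, X.X i ⟶ Y.X i) :
    Null X Y f ↔ ∃ (P : Rep Φ) (_ : Projective P) (a : X ⟶ P) (b : P ⟶ Y),
      ∀ i, f i = a.f i ≫ b.f i := by
  rw [null_iff_factors (hΦ := hΦ)]
  constructor
  · rintro ⟨Q, hQ, bQ, a, b, h⟩
    exact ⟨_, ind_projective hΦ, a, b, h⟩
  · rintro ⟨P, hP, a, b, h⟩
    obtain ⟨Q, β, h1, h2, h3⟩ := exists_family_cover P.fg P.bdd hΦ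
    let e : ind hΦ Q h2 h3 ⟶ P := indDesc hΦ β
    have : Epi e := epi_of_epi_f _ fun i => by
      have : biprod.inl ≫ e.f i = β i := biprod.inl_desc _ _
      have : Epi (biprod.inl ≫ e.f i) := this ▸ h1 i
      exact epi_of_epi biprod.inl (e.f i)
    refine ⟨Q, h2, h3, a ≫ Projective.factorThru (𝟙 P) e, e ≫ b, fun i => ?_⟩
    have e1 : (Projective.factorThru (𝟙 P) e).f i ≫ e.f i = 𝟙 _ :=
      congrFun (congrArg Hom.f (Projective.factorThru_comp (𝟙 P) e)) i
    rw [h, comp_f, comp_f, Category.assoc, reassoc_of% e1]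

variable {X Y Z : Rep Φ}

theorem Null.zero (hΦ : HasNakayama Φ) : Null X Y fun _ => 0 :=
  ⟨fun _ => (0 : C), fun _ => 0, fun _ => 0, fun _ => 0,
    fun _ => ⟨hΦ.fg_zero _ (isZero_zero _), inferInstance⟩,
    by simp [Bdd, isZero_zero], by simp, by simp, by simp⟩

theorem Null.neg {f : ∀ i, X.X i ⟶ Y.X i} (h : Null X Y f) : Null X Y fun i => -f i := by
  obtain ⟨Q, γ, α, β, h1, h2, h3, h4, h5⟩ := h
  exact ⟨Q, γ, α, fun i => -β i, h1, h2, h3, h4, fun i => by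
    simp only [h5, Functor.map_neg, Preadditive.comp_neg, Preadditive.neg_comp, neg_add]⟩

theorem Null.add (hΦ : HasNakayama Φ) {f g : ∀ i, X.X i ⟶ Y.X i} (h : Null X Y f)
    (h' : Null X Y g) : Null X Y fun i => f i + g i := by
  obtain ⟨Q, γ, α, β, h1, h2, h3, h4, h5⟩ := h
  obtain ⟨Q', γ', α', β', h1', h2', h3', h4', h5'⟩ := h'
  have := fun i => (h1 i).2
  have := fun i => (h1' i).2
  refine ⟨fun i => Q i ⊞ Q' i, fun i => γ i ≫ biprod.inl + γ' i ≫ biprod.inr,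
    fun i => α i ≫ Φ.L.map (Φ.L'.map biprod.inl) + α' i ≫ Φ.L.map (Φ.L'.map biprod.inr),
    fun i => biprod.desc (β i) (β' i),
    fun i => ⟨hΦ.fg_biprod _ _ (h1 i).1 (h1' i).1, inferInstance⟩,
    h2.of_imp h2' fun i h h' => (biprod_isZero_iff _ _).2 ⟨h, h'⟩, fun i => ?_, fun i => ?_,
    fun i => ?_⟩
  · simp only [Functor.map_add, Functor.map_comp, Preadditive.comp_add, ← Category.assoc, h3, h3',
      zero_comp, add_zero]
  · simp only [Functor.map_add, Functor.map_comp, Preadditive.comp_add, Preadditive.add_comp]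
    rw [← Category.assoc, h4, ← Category.assoc, h4']
    simp only [Category.assoc, Φ.un_map, Φ.fl_lmap]
  · simp only [h5, h5', Preadditive.add_comp, Category.assoc, biprod.inl_desc, biprod.inr_desc]
    rw [← Category.assoc (Φ.L.map _) (Φ.L.map _), ← Functor.map_comp, ← Functor.map_comp,
      ← Category.assoc (Φ.L.map _) (Φ.L.map _), ← Functor.map_comp, ← Functor.map_comp,
      biprod.inl_desc, biprod.inr_desc]
    abel

theorem Null.comp {f : ∀ i, X.X i ⟶ Y.X i} (h : Null X Y f) (g : Y ⟶ Z) :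
    Null X Z fun i => f i ≫ g.f i := by
  obtain ⟨Q, γ, α, β, h1, h2, h3, h4, h5⟩ := h
  refine ⟨Q, γ, α, fun i => β i ≫ g.f i, h1, h2, h3, h4, fun i => ?_⟩
  simp only [h5, Functor.map_comp, Preadditive.add_comp, Category.assoc, comm_sh]

theorem Null.precomp {f : ∀ i, Y.X i ⟶ Z.X i} (h : Null Y Z f) (g : X ⟶ Y) :
    Null X Z fun i => g.f i ≫ f i := by
  obtain ⟨Q, γ, α, β, h1, h2, h3, h4, h5⟩ := h
  refine ⟨Q, fun i => g.f i ≫ γ i, fun i => g.f i ≫ α i, β, h1, h2, fun i => ?_, fun i => ?_,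
    fun i => ?_⟩
  · simp only [Functor.map_comp]
    rw [← Category.assoc, g.comm, Category.assoc, h3, comp_zero]
  · simp only [Functor.map_comp]
    rw [← Category.assoc, g.comm, Category.assoc, h4, Category.assoc]
  · simp only [h5, Preadditive.comp_add, Category.assoc]

/-- The first condition on a null datum follows from the second one. -/
theorem comp_map_eq_zero (hΦ : HasNakayama Φ) {Q : ℤ → C}
    (hQ : ∀ i, Φ.fgC (Q i) ∧ Projective (Q i)) (γ : ∀ i, X.X i ⟶ Q i)
    (α : ∀ i, X.X i ⟶ Φ.L.obj (Φ.L'.obj (Q (i + 1))))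
    (h : ∀ i, X.d i ≫ Φ.H.map (α i) = Φ.L'.map (γ (i + 1)) ≫ Φ.un (Φ.L'.obj (Q (i + 1))))
    (i : ℤ) : X.d i ≫ Φ.H.map (γ i) = 0 := by
  obtain ⟨j, rfl⟩ := exists_eq_succ i
  have := hΦ.isIso_un' _ (hQ (j + 1)).1 (hQ (j + 1)).2
  have := hΦ.isIso_un _ (hQ (j + 1)).1 (hQ (j + 1)).2
  -- Both units are invertible, so the equation may be tested in `H H' H L L' Q`; there the second
  -- condition turns the composite into two consecutive differentials.
  rw [← cancel_mono (Φ.H.map (Φ.un' (Q (j + 1)) ≫ Φ.H'.map (Φ.un (Φ.L'.obj (Q (j + 1)))))),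
    Category.assoc, ← Functor.map_comp, zero_comp, Φ.un'_map, ← Φ.fl'_map, ← h, Φ.fl'_comp,
    Functor.map_comp, ← Category.assoc, X.comp_map_fl, zero_comp]

end Stable

end Rep

end Abstract

end WakamatsuTilting

end

set_option linter.unusedSectionVars false

noncomputable section

namespace WakamatsuTilting

open Limits ZeroObject

/-! ### Linked repe-complexes -/

section Links

universe v w

variable {C D : Type w} [Category.{v} C] [Category.{v} D] [Abelian C] [Abelian D]
  (Φ : AdjointPairs C D)

/-- The functors `H`, `L`, `H'`, `L'` represent a counter equivalence between the complete
hereditary cotorsion pairs `(𝓑, 𝓐)` and `(𝓖, 𝓚)`. -/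
structure CounterSetup (𝓑 𝓐 : ObjectProperty C) (𝓖 𝓚 : ObjectProperty D) : Prop where
  nakC : HasNakayama Φ
  nakD : HasNakayama Φ.swap
  fgC_sub : ∀ {X Y : C} (f : X ⟶ Y), Mono f → Φ.fgC Y → Φ.fgC X
  fg_L' : ∀ X, Φ.fgC X → Φ.fgD (Φ.L'.obj X)
  fg_A : ∀ X, 𝓐 X → Φ.fgC X
  fg_B : ∀ X, 𝓑 X → Φ.fgC X
  fg_G : ∀ X, 𝓖 X → Φ.fgD X
  fg_K : ∀ X, 𝓚 X → Φ.fgD X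
  zero_A : ∀ X, IsZero X → 𝓐 X
  zero_B : ∀ X, IsZero X → 𝓑 X
  zero_G : ∀ X, IsZero X → 𝓖 X
  zero_K : ∀ X, IsZero X → 𝓚 X
  isIso_co : ∀ X, 𝓐 X → IsIso (Φ.co X)
  isIso_un : ∀ X, 𝓖 X → IsIso (Φ.un X)
  isIso_co' : ∀ X, 𝓚 X → IsIso (Φ.co' X)
  isIso_un' : ∀ X, 𝓑 X → IsIso (Φ.un' X)
  H_mem : ∀ X, 𝓐 X → 𝓖 (Φ.H.obj X)
  L_mem : ∀ X, 𝓖 X → 𝓐 (Φ.L.obj X)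
  H'_mem : ∀ X, 𝓚 X → 𝓑 (Φ.H'.obj X)
  L'_mem : ∀ X, 𝓑 X → 𝓚 (Φ.L'.obj X)
  extC : ∀ {X Y Z M : C} {f : X ⟶ Y} {g : Y ⟶ Z}, Ses f g → 𝓑 Z → 𝓐 M →
    ∀ t : X ⟶ M, ∃ s, f ≫ s = t
  liftC : ∀ {X Y Z M : C} {f : X ⟶ Y} {g : Y ⟶ Z}, Ses f g → 𝓐 X → 𝓑 M →
    ∀ t : M ⟶ Z, ∃ s, s ≫ g = t
  liftD : ∀ {X Y Z M : D} {f : X ⟶ Y} {g : Y ⟶ Z}, Ses f g → 𝓚 X → 𝓖 M →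
    ∀ t : M ⟶ Z, ∃ s, s ≫ g = t
  complete_A : ∀ X, Φ.fgC X → ∃ (A B : C) (f : X ⟶ A) (g : A ⟶ B), Ses f g ∧ 𝓐 A ∧ 𝓑 B
  complete_G : ∀ X, Φ.fgD X → ∃ (K G : D) (f : K ⟶ G) (g : G ⟶ X), Ses f g ∧ 𝓖 G ∧ 𝓚 K
  B_ker : ∀ {X Y Z : C} {f : X ⟶ Y} {g : Y ⟶ Z}, Ses f g → 𝓑 Y → 𝓑 Z → 𝓑 X
  G_ker : ∀ {X Y Z : D} {f : X ⟶ Y} {g : Y ⟶ Z}, Ses f g → 𝓖 Y → 𝓖 Z → 𝓖 X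
  K_coker : ∀ {X Y Z : D} {f : X ⟶ Y} {g : Y ⟶ Z}, Ses f g → 𝓚 X → 𝓚 Y → 𝓚 Z
  B_biprod : ∀ X Y, 𝓑 X → 𝓑 Y → 𝓑 (X ⊞ Y)
  G_biprod : ∀ X Y, 𝓖 X → 𝓖 Y → 𝓖 (X ⊞ Y)
  L'_ses : ∀ {X Y Z : C} {f : X ⟶ Y} {g : Y ⟶ Z}, Ses f g → Φ.fgC Y → 𝓑 Z →
    Ses (Φ.L'.map f) (Φ.L'.map g)
  L_ses : ∀ {X Y Z : D} {f : X ⟶ Y} {g : Y ⟶ Z}, Ses f g → Φ.fgD Y → 𝓖 Z →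
    Ses (Φ.L.map f) (Φ.L.map g)
  H'_ses : ∀ {X Y Z : D} {f : X ⟶ Y} {g : Y ⟶ Z}, Ses f g → 𝓚 X →
    Ses (Φ.H'.map f) (Φ.H'.map g)
  proj_B : ∀ P, Φ.fgC P → Projective P → 𝓑 P
  proj_L'_G : ∀ P, Φ.fgC P → Projective P → 𝓖 (Φ.L'.obj P)
  proj_G : ∀ P, Φ.fgD P → Projective P → 𝓖 P
  proj_L_B : ∀ P, Φ.fgD P → Projective P → 𝓑 (Φ.L.obj P)
  proj_injective : ∀ P, Φ.fgD P → Projective P → Injective (Φ.L'.obj (Φ.L.obj P))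
  embed : ∀ X, Φ.fgD X → ∃ (P : D) (f : X ⟶ Φ.L'.obj (Φ.L.obj P)), Mono f ∧ Φ.fgD P ∧
    Projective P

variable {Φ}

theorem ses_pushout {X Y Z B : C} (f : X ⟶ Y) (g : X ⟶ Z) (p : Y ⟶ B) (h : Ses f p) :
    Ses (pushout.inr f g) (pushout.desc p 0 (by rw [h.zero, comp_zero]) : pushout f g ⟶ B) := by
  have := h.mono
  have := h.epi
  have w : f ≫ p = g ≫ 0 := by rw [h.zero, comp_zero]
  have hp : Epi (pushout.inl f g ≫ pushout.desc p 0 w) := by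
    rw [pushout.inl_desc]
    exact h.epi
  have : Epi (pushout.desc p 0 w) := epi_of_epi (pushout.inl f g) _
  refine Ses.of_desc (pushout.inr_desc _ _ _) fun W t ht => ?_
  obtain ⟨s, hs⟩ := h.desc (pushout.inl f g ≫ t) (by
    rw [← Category.assoc, pushout.condition, Category.assoc, ht, comp_zero])
  refine ⟨s, pushout.hom_ext ?_ ?_⟩
  · rw [← Category.assoc, pushout.inl_desc, hs]
  · rw [← Category.assoc, pushout.inr_desc, zero_comp, ht]

theorem Ses.lift_map {X Y Z : C} {f : X ⟶ Y} {g : Y ⟶ Z} (h : Ses f g) {W : D}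
    (t : W ⟶ Φ.H.obj Y) (ht : t ≫ Φ.H.map g = 0) : ∃ s, s ≫ Φ.H.map f = t := by
  obtain ⟨s, hs⟩ := h.lift (Φ.sh t) (by rw [← Φ.sh_comp, ht, Φ.sh_zero])
  exact ⟨Φ.fl s, by rw [← Φ.fl_comp, hs, Φ.fl_sh]⟩

variable (Φ) in
/-- A repe-complex `X` over `C` linked to a repe-complex `Y` over `D`. -/
structure Link (𝓑 𝓐 : ObjectProperty C) where
  X : Rep Φ
  Y : Rep Φ.swap
  A : ℤ → C
  B : ℤ → C
  hA : ∀ i, 𝓐 (A i)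
  hB : ∀ i, 𝓑 (B i)
  bdd : Bdd A
  ι : ∀ i, X.X i ⟶ A i
  π : ∀ i, A i ⟶ B i
  ses : ∀ i, Ses (ι i) (π i)
  j : ∀ i, Φ.H.obj (A i) ⟶ Y.X i
  μ : ∀ i, Φ.L'.obj (A (i + 1)) ⟶ Y.X i
  κ : ∀ i, Y.X i ⟶ Φ.L'.obj (B (i + 1))
  sesY : ∀ i, Ses (j i) (κ i)
  μ_κ : ∀ i, μ i ≫ κ i = Φ.L'.map (π (i + 1))
  sq : ∀ i, Φ.L'.map (ι (i + 1)) ≫ μ i = X.d i ≫ Φ.H.map (ι i) ≫ j i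
  j_d : ∀ i, Φ.L.map (j (i + 1)) ≫ Y.d i = Φ.co (A (i + 1)) ≫ Φ.fl' (μ i)

namespace Link

variable {𝓑 𝓐 : ObjectProperty C} {𝓖 𝓚 : ObjectProperty D} (hS : CounterSetup Φ 𝓑 𝓐 𝓖 𝓚)
  (Z Z' : Link Φ 𝓑 𝓐)

/-- The structure maps of the second repe-complex. -/
abbrev e (i : ℤ) : Φ.L.obj (Z.Y.X (i + 1)) ⟶ Φ.H'.obj (Z.Y.X i) := Z.Y.d i

theorem e_comp (i : ℤ) : Φ.sh' (Z.e (i + 1)) ≫ Φ.fl (Z.e i) = 0 := Z.Y.d_comp i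

theorem j_e (i : ℤ) : Φ.L.map (Z.j (i + 1)) ≫ Z.e i = Φ.co (Z.A (i + 1)) ≫ Φ.fl' (Z.μ i) :=
  Z.j_d i

theorem j_fl_e (i : ℤ) : Z.j (i + 1) ≫ Φ.fl (Z.e i) = Φ.H.map (Φ.fl' (Z.μ i)) := by
  rw [← Φ.fl_map, Z.j_e, Φ.fl_comp, Φ.fl_co, Category.id_comp]

theorem j_sh_e (i : ℤ) : Φ.L'.map (Φ.L.map (Z.j (i + 1))) ≫ Φ.sh' (Z.e i) =
    Φ.L'.map (Φ.co (Z.A (i + 1))) ≫ Z.μ i := by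
  rw [← Φ.sh'_map, Z.j_e, Φ.sh'_map, Φ.sh'_fl']

include hS

/-- The counit on `A` is invertible, so `L' A` is reached from `L' L H A`, where the composite
contains two consecutive differentials of `Y`. The differential of `Y` therefore lives only on the
part `H A`. -/
theorem μ_fl_e (i : ℤ) : Z.μ (i + 1) ≫ Φ.fl (Z.e i) = 0 := by
  have := hS.isIso_co _ (Z.hA (i + 1 + 1))
  rw [← cancel_epi (Φ.L'.map (Φ.co (Z.A (i + 1 + 1)))), ← Category.assoc, ← Z.j_sh_e,
    Category.assoc, Z.e_comp, comp_zero, comp_zero]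

theorem map_μ_e (i : ℤ) : Φ.L.map (Z.μ (i + 1)) ≫ Z.e i = 0 :=
  Φ.fl_injective (by rw [Φ.fl_map, Z.μ_fl_e hS, Φ.fl_zero])

/-- Since `L'` keeps `0 → X → A → B → 0` exact, the pushout is an extension of `L' B` by `H A`, just
as `Y` is by `sesY`, and the comparison map is the identity on both ends. Morphisms out of `Y` can
thus be built and tested on `μ` and `j`. -/
theorem exists_pushout_iso (i : ℤ) :
    ∃ p : pushout (Φ.L'.map (Z.ι (i + 1))) (Z.X.d i ≫ Φ.H.map (Z.ι i)) ≅ Z.Y.X i,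
      pushout.inl _ _ ≫ p.hom = Z.μ i ∧ pushout.inr _ _ ≫ p.hom = Z.j i := by
  have h := hS.L'_ses (Z.ses (i + 1)) (hS.fg_A _ (Z.hA _)) (Z.hB _)
  let p : pushout (Φ.L'.map (Z.ι (i + 1))) (Z.X.d i ≫ Φ.H.map (Z.ι i)) ⟶ Z.Y.X i :=
    pushout.desc (Z.μ i) (Z.j i) (by rw [Z.sq, Category.assoc])
  have : IsIso p := Ses.isIso_of_isIso (ses_pushout _ (Z.X.d i ≫ Φ.H.map (Z.ι i)) _ h) (Z.sesY i)
    (𝟙 _) p (𝟙 _) (by rw [Category.id_comp]; exact pushout.inr_desc _ _ _) (by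
      rw [Category.comp_id]
      apply pushout.hom_ext
      · rw [pushout.inl_desc, ← Category.assoc, pushout.inl_desc, Z.μ_κ]
      · rw [pushout.inr_desc, ← Category.assoc, pushout.inr_desc, (Z.sesY i).zero])
  exact ⟨asIso p, pushout.inl_desc _ _ _, pushout.inr_desc _ _ _⟩

theorem exists_desc (i : ℤ) {W : D} (u : Φ.L'.obj (Z.A (i + 1)) ⟶ W) (v : Φ.H.obj (Z.A i) ⟶ W)
    (h : Φ.L'.map (Z.ι (i + 1)) ≫ u = Z.X.d i ≫ Φ.H.map (Z.ι i) ≫ v) :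
    ∃ t : Z.Y.X i ⟶ W, Z.μ i ≫ t = u ∧ Z.j i ≫ t = v := by
  obtain ⟨p, h1, h2⟩ := Z.exists_pushout_iso hS i
  refine ⟨p.inv ≫ pushout.desc u v (by rw [h, Category.assoc]), ?_, ?_⟩
  · rw [← h1, Category.assoc, p.hom_inv_id_assoc, pushout.inl_desc]
  · rw [← h2, Category.assoc, p.hom_inv_id_assoc, pushout.inr_desc]

variable {Z} in
theorem hom_ext_Y {i : ℤ} {W : D} {s t : Z.Y.X i ⟶ W} (h : Z.μ i ≫ s = Z.μ i ≫ t)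
    (h' : Z.j i ≫ s = Z.j i ≫ t) : s = t := by
  obtain ⟨p, h1, h2⟩ := Z.exists_pushout_iso hS i
  rw [← cancel_epi p.hom]
  apply pushout.hom_ext
  · rw [← Category.assoc, ← Category.assoc, h1, h]
  · rw [← Category.assoc, ← Category.assoc, h2, h']

omit hS

/-- Morphisms of linked repe-complexes. -/
@[ext] structure Hom where
  f : Z.X ⟶ Z'.X
  a : ∀ i, Z.A i ⟶ Z'.A i
  y : Z.Y ⟶ Z'.Y
  ι_a : ∀ i, Z.ι i ≫ a i = f.f i ≫ Z'.ι i
  j_y : ∀ i, Z.j i ≫ y.f i = Φ.H.map (a i) ≫ Z'.j i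

instance : Category (Link Φ 𝓑 𝓐) where
  Hom := Hom
  id Z := ⟨𝟙 _, fun _ => 𝟙 _, 𝟙 _, fun _ => by simp, fun _ => by simp⟩
  comp h h' := ⟨h.f ≫ h'.f, fun i => h.a i ≫ h'.a i, h.y ≫ h'.y,
    fun i => by rw [← Category.assoc, h.ι_a, Category.assoc, h'.ι_a, Rep.comp_f, Category.assoc],
    fun i => by
      rw [Rep.comp_f, ← Category.assoc, h.j_y, Category.assoc, h'.j_y, Functor.map_comp,
        Category.assoc]⟩

variable {Z Z'}

-- Compatibility with `μ` need not be demanded of a morphism of links: up to the invertible counit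
-- on `A`, the transpose of `μ` is the differential of `Y` restricted along `j`.
include hS in
theorem Hom.μ_y (h : Hom Z Z') (i : ℤ) :
    Z.μ i ≫ h.y.f i = Φ.L'.map (h.a (i + 1)) ≫ Z'.μ i := by
  have := hS.isIso_co _ (Z.hA (i + 1))
  apply Φ.fl'_injective
  have hc : Z.e i ≫ Φ.H'.map (h.y.f i) = Φ.L.map (h.y.f (i + 1)) ≫ Z'.e i := h.y.comm i
  rw [← cancel_epi (Φ.co (Z.A (i + 1))), Φ.fl'_comp, Φ.fl'_map, ← Category.assoc, ← Z.j_e,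
    Category.assoc, hc, ← Category.assoc, ← Functor.map_comp, h.j_y, Functor.map_comp,
    Category.assoc, Z'.j_e, ← Category.assoc, Φ.map_co, Φ.sh_hmap, Category.assoc]

include hS in
/-- Every morphism between the first components extends to linked repe-complexes. -/
theorem exists_hom_of_X (f : Z.X ⟶ Z'.X) : ∃ h : Hom Z Z', h.f = f := by
  -- The field `extC` expresses `Ext¹(𝓑, 𝓐) = 0`; it extends `f` to the terms `A`, and the pushouts
  -- then supply the second component.
  choose a ha using fun i => hS.extC (Z.ses i) (Z.hB i) (Z'.hA i) (f.f i ≫ Z'.ι i)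
  choose y hy hy' using fun i => Z.exists_desc hS i (Φ.L'.map (a (i + 1)) ≫ Z'.μ i)
    (Φ.H.map (a i) ≫ Z'.j i) (by
      rw [← Category.assoc, ← Functor.map_comp, ha, Functor.map_comp, Category.assoc, Z'.sq,
        ← Category.assoc, ← f.comm, ← Category.assoc (Φ.H.map _), ← Functor.map_comp, ha,
        Functor.map_comp, Category.assoc, Category.assoc])
  refine ⟨⟨f, a, ⟨y, fun i => ?_⟩, ha, hy'⟩, rfl⟩
  change Z.e i ≫ Φ.H'.map (y i) = Φ.L.map (y (i + 1)) ≫ Z'.e i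
  apply Φ.fl_injective
  rw [Φ.fl_comp, Φ.fl_map]
  apply hom_ext_Y hS
  · rw [← Category.assoc, Z.μ_fl_e hS, zero_comp, ← Category.assoc, hy, Category.assoc,
      Z'.μ_fl_e hS, comp_zero]
  · rw [← Category.assoc, j_fl_e, ← Functor.map_comp, ← Φ.fl'_comp, hy, Φ.fl'_map,
      ← Category.assoc, hy', Category.assoc, j_fl_e, Functor.map_comp]

/-- A repe-complex with a monomorphism to members of `𝓐` with cokernels in `𝓑` is the first
component of linked repe-complexes. -/
theorem exists_of_X (hS : CounterSetup Φ 𝓑 𝓐 𝓖 𝓚) (X : Rep Φ) (A B : ℤ → C)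
    (hA : ∀ i, 𝓐 (A i)) (hB : ∀ i, 𝓑 (B i)) (bA : Bdd A) (ι : ∀ i, X.X i ⟶ A i)
    (π : ∀ i, A i ⟶ B i) (hι : ∀ i, Ses (ι i) (π i)) :
    ∃ Z : Link Φ 𝓑 𝓐, Z.X = X := by
  have hL := fun i => hS.L'_ses (hι i) (hS.fg_A _ (hA i)) (hB i)
  have hp := fun i => ses_pushout _ (X.d i ≫ Φ.H.map (ι i)) _ (hL (i + 1))
  let Y : ℤ → D := fun i => pushout (Φ.L'.map (ι (i + 1))) (X.d i ≫ Φ.H.map (ι i))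
  let μ : ∀ i, Φ.L'.obj (A (i + 1)) ⟶ Y i := fun i => pushout.inl _ _
  let j : ∀ i, Φ.H.obj (A i) ⟶ Y i := fun i => pushout.inr _ _
  have sq : ∀ i, Φ.L'.map (ι (i + 1)) ≫ μ i = X.d i ≫ Φ.H.map (ι i) ≫ j i := fun i => by
    rw [← Category.assoc]
    exact pushout.condition
  have key : ∀ i, ι (i + 1) ≫ Φ.fl' (μ i) = Φ.fl' (X.d i) ≫ Φ.H'.map (Φ.H.map (ι i) ≫ j i) :=
    fun i => by rw [← Φ.fl'_map, sq, Φ.fl'_comp]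
  -- The differential of `Y` is forced: zero on `L' A`, and the transpose of `μ` on `H A`. The two
  -- prescriptions agree on `L' X` because consecutive differentials of `X` compose to zero.
  let q : ∀ i, Y (i + 1) ⟶ Φ.H.obj (Φ.H'.obj (Y i)) := fun i =>
    pushout.desc 0 (Φ.H.map (Φ.fl' (μ i))) (by
      rw [comp_zero, Category.assoc, ← Functor.map_comp, key, Functor.map_comp, ← Category.assoc,
        X.comp_map_fl, zero_comp])
  have μq : ∀ i, μ (i + 1) ≫ q i = 0 := fun i => pushout.inl_desc _ _ _
  have jq : ∀ i, j (i + 1) ≫ q i = Φ.H.map (Φ.fl' (μ i)) := fun i => pushout.inr_desc _ _ _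
  have hepi : ∀ i, Epi (biprod.desc (μ i) (j i)) := fun i => by
    refine ⟨fun s t hst => pushout.hom_ext ?_ ?_⟩
    · have := congrArg (fun r => biprod.inl ≫ r) hst
      simpa using this
    · have := congrArg (fun r => biprod.inr ≫ r) hst
      simpa using this
  let Y' : Rep Φ.swap :=
    { X := Y
      fg := fun i => hS.nakD.fg_quot _ (hepi i) (hS.nakD.fg_biprod _ _
        (hS.fg_L' _ (hS.fg_A _ (hA _))) (hS.fg_G _ (hS.H_mem _ (hA i))))
      bdd := bA.of_imp bA.shift fun i h h' => IsZero.of_epi (biprod.desc (μ i) (j i))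
        ((biprod_isZero_iff _ _).2 ⟨Functor.map_isZero _ h', Functor.map_isZero _ h⟩)
      d := fun i => Φ.sh (q i)
      d_comp := fun i => by
        change Φ.sh' (Φ.sh (q (i + 1))) ≫ Φ.fl (Φ.sh (q i)) = 0
        rw [Φ.fl_sh]
        apply Φ.fl'_injective
        rw [Φ.fl'_comp, Φ.fl'_sh']
        apply Φ.fl_injective
        rw [Φ.fl_comp, Φ.fl_sh, Φ.fl'_zero, Φ.fl_zero]
        apply pushout.hom_ext
        · rw [← Category.assoc, comp_zero]
          exact (congrArg (· ≫ _) (μq (i + 1))).trans zero_comp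
        · rw [← Category.assoc, comp_zero]
          refine (congrArg (· ≫ _) (jq (i + 1))).trans ?_
          rw [← Functor.map_comp, ← Φ.fl'_comp, μq, Φ.fl'_zero, Functor.map_zero] }
  refine ⟨{ X := X, Y := Y', A := A, B := B, hA := hA, hB := hB, bdd := bA, ι := ι, π := π,
            ses := hι, j := j, μ := μ, κ := fun i => pushout.desc (Φ.L'.map (π (i + 1))) 0 (by
              rw [(hL (i + 1)).zero, comp_zero]), sesY := hp,
            μ_κ := fun i => pushout.inl_desc _ _ _, sq := sq, j_d := fun i => ?_ }, rfl⟩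
  change Φ.L.map (j (i + 1)) ≫ Φ.sh (q i) = _
  rw [← Φ.sh_map, jq, Φ.sh_hmap]

end Link

end Links

end WakamatsuTilting

end

set_option linter.unusedSectionVars false

noncomputable section

namespace WakamatsuTilting

open Limits ZeroObject

/-! ### Fullness of the second projection up to stably zero maps -/

section Links

universe v w

variable {C D : Type w} [Category.{v} C] [Category.{v} D] [Abelian C] [Abelian D]
  {Φ : AdjointPairs C D} {𝓑 𝓐 : ObjectProperty C} {𝓖 𝓚 : ObjectProperty D}

namespace Rep

/-- The difference of two morphisms. -/
@[simps] def homSub {X Y : Rep Φ} (f g : X ⟶ Y) : X ⟶ Y where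
  f i := f.f i - g.f i
  comm i := by
    rw [Functor.map_sub, Functor.map_sub, Preadditive.comp_sub, Preadditive.sub_comp, f.comm,
      g.comm]

theorem Null.exists_hom {X Y : Rep Φ} (hΦ : HasNakayama Φ) {f : ∀ i, X.X i ⟶ Y.X i}
    (h : Null X Y f) : ∃ g : X ⟶ Y, ∀ i, g.f i = f i := by
  obtain ⟨Q, hQ, bQ, a, b, h⟩ := (null_iff_factors (hΦ := hΦ) f).1 h
  exact ⟨a ≫ b, fun i => (h i).symm⟩

end Rep

namespace Link

variable (hS : CounterSetup Φ 𝓑 𝓐 𝓖 𝓚) {Z Z' : Link Φ 𝓑 𝓐}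

-- Completeness supplies the embeddings into `𝓐`. A zero term is embedded into itself, which keeps
-- the family `A` bounded.
include hS in
theorem exists_link_X (X : Rep Φ) : ∃ Z : Link Φ 𝓑 𝓐, Z.X = X := by
  have : ∀ M, Φ.fgC M → ∃ (A B : C) (f : M ⟶ A) (g : A ⟶ B), Ses f g ∧ 𝓐 A ∧ 𝓑 B ∧
      (IsZero M → IsZero A) := fun M hM => by
    by_cases h0 : IsZero M
    · refine ⟨M, 0, 𝟙 _, 0, ?_, hS.zero_A _ h0, hS.zero_B _ (isZero_zero _), fun h => h⟩
      have : Epi (0 : M ⟶ 0) := (isZero_zero C).epi _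
      exact Ses.of_lift comp_zero fun W t _ => ⟨t, Category.comp_id _⟩
    · obtain ⟨A, B, f, g, h1, h2, h3⟩ := hS.complete_A M hM
      exact ⟨A, B, f, g, h1, h2, h3, fun h => (h0 h).elim⟩
  choose A B ι π h1 h2 h3 h4 using fun i => this (X.X i) (X.fg i)
  exact exists_of_X hS X A B h2 h3 (Bdd.of_imp_one X.bdd h4) ι π h1

include hS in
/-- Each member of `𝓐` is covered by the image under `L` of a projective, with kernel in `𝓐`. -/
theorem exists_cover_A (A : ℤ → C) (hA : ∀ i, 𝓐 (A i)) (bA : Bdd A) :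
    ∃ (Q : ℤ → D) (β : ∀ i, Q i ⟶ Φ.H.obj (A i)), (∀ i, Φ.fgD (Q i) ∧ Projective (Q i)) ∧
      Bdd Q ∧ (∀ i, Epi (Φ.sh (β i))) ∧
      ∀ i (M : C), 𝓑 M → ∀ t : M ⟶ A i, ∃ s, s ≫ Φ.sh (β i) = t := by
  obtain ⟨Q, β, h1, h2, h3⟩ := Rep.exists_family_cover (Φ := Φ.swap)
    (fun i => hS.fg_G _ (hS.H_mem _ (hA i)))
    (Bdd.of_imp_one bA fun i h => Functor.map_isZero Φ.H h) hS.nakD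
  -- The kernel of `β` stays in `𝓖`, so `L` keeps the sequence exact and sends the kernel into `𝓐`;
  -- maps from `𝓑` then lift because `Ext¹(𝓑, 𝓐) = 0`.
  have key : ∀ i, Ses (Φ.L.map (kernel.ι (β i))) (Φ.sh (β i)) ∧
      𝓐 (Φ.L.obj (kernel (β i))) := fun i => by
    have s := Ses.of_epi (β i)
    have hk := hS.G_ker s (hS.proj_G _ (h2 i).1 (h2 i).2) (hS.H_mem _ (hA i))
    refine ⟨?_, hS.L_mem _ hk⟩
    have := hS.isIso_co _ (hA i)
    exact (hS.L_ses s (h2 i).1 (hS.H_mem _ (hA i))).of_iso (Iso.refl _) (Iso.refl _)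
      (asIso (Φ.co (A i))) (by simp) (by simp [Φ.map_co])
  exact ⟨Q, β, h2, h3, fun i => (key i).1.epi,
    fun i M hM t => hS.liftC (key i).1 (key i).2 hM t⟩

include hS in
/-- Every morphism between the second components is stably equal to one which extends to linked
repe-complexes. -/
theorem exists_hom_of_Y (y : Z.Y ⟶ Z'.Y) :
    ∃ h : Hom Z Z', Rep.Null Z.Y Z'.Y fun i => y.f i - h.y.f i := by
  obtain ⟨Q, β, hQ, bQ, hθ, -⟩ := exists_cover_A hS Z'.A Z'.hA Z'.bdd
  let θ : ∀ i, Φ.L.obj (Q i) ⟶ Z'.A i := fun i => Φ.sh (β i)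
  let τ : ∀ i, Φ.L.obj (Q i) ⟶ Z'.B i := fun i => θ i ≫ Z'.π i
  have hτ : ∀ i, Epi (τ i) := fun i => by
    have := hθ i
    have := (Z'.ses i).epi
    exact epi_comp _ _
  -- The composite `H A → Y → Y' → L' B'` is the obstruction to restricting `y` to `H A → H A'`. It
  -- lifts along `L' τ`, whose kernel `L' (ker τ)` lies in `𝓚`, and the lift extends to `Y` because
  -- `L' L Q` is injective.
  have hα : ∀ i, ∃ α : Z.Y.X i ⟶ Φ.L'.obj (Φ.L.obj (Q (i + 1))),
      Z.j i ≫ α ≫ Φ.L'.map (τ (i + 1)) = Z.j i ≫ y.f i ≫ Z'.κ i := fun i => by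
    have s := Ses.of_epi (τ (i + 1))
    have hB := hS.proj_L_B _ (hQ (i + 1)).1 (hQ (i + 1)).2
    have hk := hS.B_ker s hB (Z'.hB _)
    obtain ⟨ν, hν⟩ := hS.liftD (hS.L'_ses s (hS.fg_B _ hB) (Z'.hB _)) (hS.L'_mem _ hk)
      (hS.H_mem _ (Z.hA i)) (Z.j i ≫ y.f i ≫ Z'.κ i)
    have := hS.proj_injective _ (hQ (i + 1)).1 (hQ (i + 1)).2
    have := (Z.sesY i).mono
    exact ⟨Injective.factorThru ν (Z.j i), by
      rw [← Category.assoc, Injective.comp_factorThru, hν]⟩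
  choose α hα using hα
  -- Invertible units let `α` determine the other component `γ` of a morphism into the induced
  -- object.
  obtain ⟨γ, hγ⟩ := exists_family_of_succ (F := fun i => Z.Y.X i ⟶ Q i)
    (fun i γ => Z.e i ≫ Φ.H'.map (α i) = Φ.L.map γ ≫ Φ.un' (Φ.L.obj (Q (i + 1)))) (fun i => by
      have := hS.nakD.isIso_un' _ (hQ (i + 1)).1 (hQ (i + 1)).2
      have := hS.nakD.isIso_un _ (hQ (i + 1)).1 (hQ (i + 1)).2
      change IsIso (Φ.un (Q (i + 1))) at *
      change IsIso (Φ.un' (Φ.L.obj (Q (i + 1)))) at *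
      refine ⟨Φ.fl (Z.e i ≫ Φ.H'.map (α i) ≫ inv (Φ.un' (Φ.L.obj (Q (i + 1))))) ≫
        inv (Φ.un (Q (i + 1))), ?_⟩
      rw [← cancel_mono (inv (Φ.un' (Φ.L.obj (Q (i + 1)))))]
      apply Φ.fl_injective
      simp only [Category.assoc, IsIso.hom_inv_id, Category.comp_id]
      rw [Φ.fl_lmap, Category.assoc, IsIso.inv_hom_id, Category.comp_id])
  have hn : Rep.Null Z.Y Z'.Y fun i => γ i ≫ β i ≫ Z'.j i +
      α i ≫ Φ.L'.map (Φ.L.map (β (i + 1) ≫ Z'.j (i + 1))) ≫ Φ.sh' (Z'.e i) :=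
    ⟨Q, γ, α, fun i => β i ≫ Z'.j i, hQ, bQ, Rep.comp_map_eq_zero hS.nakD hQ γ α hγ, hγ,
      fun i => rfl⟩
  obtain ⟨n, hn'⟩ := hn.exists_hom hS.nakD
  have n_eq : ∀ i, n.f i = γ i ≫ β i ≫ Z'.j i + α i ≫ Φ.L'.map (θ (i + 1)) ≫ Z'.μ i :=
    fun i => by
      rw [hn', Functor.map_comp, Functor.map_comp, Category.assoc, Z'.j_sh_e, ← Category.assoc
        (Φ.L'.map _), ← Functor.map_comp, Φ.map_co]
  -- Subtracting the stably zero map kills the obstruction, so `z` restricts to `H A → H A'`; the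
  -- restriction comes from some `A → A'` since the counits are invertible.
  let z := Rep.homSub y n
  have hz : ∀ i, Z.j i ≫ z.f i ≫ Z'.κ i = 0 := fun i => by
    change Z.j i ≫ (y.f i - n.f i) ≫ Z'.κ i = 0
    rw [n_eq, Preadditive.sub_comp, Preadditive.add_comp, Preadditive.comp_sub, ← hα]
    simp only [Category.assoc, (Z'.sesY i).zero, comp_zero, zero_add, Z'.μ_κ, ← Functor.map_comp]
    exact sub_self _
  have ha : ∀ i, ∃ a : Z.A i ⟶ Z'.A i, Z.j i ≫ z.f i = Φ.H.map a ≫ Z'.j i := fun i => by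
    obtain ⟨g, hg⟩ := (Z'.sesY i).lift (Z.j i ≫ z.f i) (by rw [Category.assoc, hz])
    have := hS.isIso_co _ (Z.hA i)
    have := hS.isIso_co _ (Z'.hA i)
    refine ⟨inv (Φ.co (Z.A i)) ≫ Φ.sh g, ?_⟩
    rw [← hg]
    congr 1
    apply Φ.sh_injective
    rw [Φ.sh_hmap, IsIso.hom_inv_id_assoc]
  choose a ha using ha
  have hμ : ∀ i, Z.μ i ≫ z.f i = Φ.L'.map (a (i + 1)) ≫ Z'.μ i := fun i => by
    have := hS.isIso_co _ (Z.hA (i + 1))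
    apply Φ.fl'_injective
    have hc : Z.e i ≫ Φ.H'.map (z.f i) = Φ.L.map (z.f (i + 1)) ≫ Z'.e i := z.comm i
    rw [← cancel_epi (Φ.co (Z.A (i + 1))), Φ.fl'_comp, Φ.fl'_map, ← Category.assoc, ← Z.j_e,
      Category.assoc, hc, ← Category.assoc, ← Functor.map_comp, ha, Functor.map_comp,
      Category.assoc, Z'.j_e, ← Category.assoc, Φ.map_co, Φ.sh_hmap, Category.assoc]
  -- Whether `a` maps `X` into `X'` is tested after the invertible unit of `B'`, where, through
  -- `sq`, it becomes the vanishing `hz`.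
  have hf : ∀ i, ∃ f : Z.X.X i ⟶ Z'.X.X i, f ≫ Z'.ι i = Z.ι i ≫ a i := fun i => by
    refine (Z'.ses i).lift _ ?_
    obtain ⟨m, rfl⟩ := exists_eq_succ i
    have := hS.isIso_un' _ (Z'.hB (m + 1))
    rw [← cancel_mono (Φ.un' (Z'.B (m + 1))), zero_comp, Category.assoc, ← Φ.fl'_lmap, ← Φ.fl'_map,
      Functor.map_comp, ← Z'.μ_κ, Category.assoc, ← Category.assoc (Φ.L'.map (a _)), ← hμ,
      Category.assoc, reassoc_of% (Z.sq m), hz, comp_zero, comp_zero, Φ.fl'_zero]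
  choose f hf using hf
  refine ⟨⟨⟨f, fun i => ?_⟩, a, z, fun i => (hf i).symm, ha⟩, ?_⟩
  · have := (Z'.sesY i).mono
    have := (Z'.ses i).mono
    rw [← cancel_mono (Φ.H.map (Z'.ι i)), ← cancel_mono (Z'.j i), Category.assoc, Category.assoc,
      Category.assoc, Category.assoc, ← Z'.sq, ← Category.assoc (Φ.H.map (f i)), ← Functor.map_comp,
      hf, Functor.map_comp, Category.assoc, ← ha, ← Category.assoc (Φ.L'.map (f _)),
      ← Functor.map_comp, hf, Functor.map_comp, Category.assoc, ← hμ, ← Category.assoc (Φ.L'.map _),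
      Z.sq, Category.assoc, Category.assoc]
  · have e : (fun i => y.f i - z.f i) = fun i => n.f i := by
      funext i
      change y.f i - (y.f i - n.f i) = n.f i
      abel
    change Rep.Null Z.Y Z'.Y fun i => y.f i - z.f i
    rw [e]
    convert hn using 2 with i
    exact hn' i

end Link

end Links

end WakamatsuTilting

end

set_option linter.unusedSectionVars false

noncomputable section

namespace WakamatsuTilting

open Limits ZeroObject

/-! ### Stable vanishing of the two components of a morphism of links -/

section Links

universe v w

variable {C D : Type w} [Category.{v} C] [Category.{v} D] [Abelian C] [Abelian D]
  {Φ : AdjointPairs C D} {𝓑 𝓐 : ObjectProperty C} {𝓖 𝓚 : ObjectProperty D}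

namespace Link

variable (hS : CounterSetup Φ 𝓑 𝓐 𝓖 𝓚) {Z Z' : Link Φ 𝓑 𝓐}

include hS in
/-- If the first component is stably zero then so is the second one. -/
theorem Hom.null_y_of_null_f (h : Hom Z Z') (hf : Rep.Null Z.X Z'.X h.f.f) :
    Rep.Null Z.Y Z'.Y h.y.f := by
  obtain ⟨P, γ, α, β, hP, bP, hγ, hα, hn⟩ := hf
  obtain ⟨Q, bq, hQ, bQ, -, hlift⟩ := exists_cover_A hS Z'.A Z'.hA Z'.bdd
  let θ : ∀ i, Φ.L.obj (Q i) ⟶ Z'.A i := fun i => Φ.sh (bq i)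
  have LQ : ∀ i, 𝓐 (Φ.L.obj (Q i)) := fun i => hS.L_mem _ (hS.proj_G _ (hQ i).1 (hQ i).2)
  have isoQ : ∀ i, IsIso (Φ.un (Q i)) := fun i => hS.isIso_un _ (hS.proj_G _ (hQ i).1 (hQ i).2)
  have isoP : ∀ i, IsIso (Φ.un (Φ.L'.obj (P i))) := fun i =>
    hS.isIso_un _ (hS.proj_L'_G _ (hP i).1 (hP i).2)
  have LLP : ∀ i, 𝓐 (Φ.L.obj (Φ.L'.obj (P i))) := fun i =>
    hS.L_mem _ (hS.proj_L'_G _ (hP i).1 (hP i).2)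
  -- The factorisation is moved from `X` to `A`: `α` extends because `L L' P` lies in `𝓐`, and `β`
  -- is rerouted through `L Q → A'`, a cover adapted to the second component.
  choose α' hα' using fun i => hS.extC (Z.ses i) (Z.hB i) (LLP (i + 1)) (α i)
  choose c hc using fun i => hlift i (P i) (hS.proj_B _ (hP i).1 (hP i).2) (β i ≫ Z'.ι i)
  choose γ' hγ' using fun i => hS.extC (Z.ses i) (Z.hB i) (LQ i) (γ i ≫ c i)
  let ψ : ∀ i, Φ.L.obj (Φ.L'.obj (P (i + 1))) ⟶ Z'.A i := fun i =>
    Φ.L.map (Φ.L'.map (β (i + 1))) ≫ Φ.sh (Z'.X.d i) ≫ Z'.ι i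
  -- The error of the extended factorisation vanishes on `X`, so it factors through `B` and lifts
  -- from there to `L Q`. Adding this lift makes the factorisation of `h.a` exact without changing
  -- it on `X`.
  have hd : ∀ i, ∃ b : Z.A i ⟶ Φ.L.obj (Q i),
      Z.ι i ≫ b = γ i ≫ c i ∧ h.a i = α' i ≫ ψ i + b ≫ θ i := fun i => by
    obtain ⟨h', hh'⟩ := (Z.ses i).desc (h.a i - α' i ≫ ψ i - γ' i ≫ θ i) (by
      rw [Preadditive.comp_sub, Preadditive.comp_sub, h.ι_a, reassoc_of% (hα' i),
        reassoc_of% (hγ' i), hc, hn, Preadditive.add_comp]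
      simp only [Category.assoc, ψ]
      abel)
    obtain ⟨h2, hh2⟩ := hlift i _ (Z.hB i) h'
    refine ⟨γ' i + Z.π i ≫ h2, ?_, ?_⟩
    · rw [Preadditive.comp_add, hγ', ← Category.assoc, (Z.ses i).zero, zero_comp, add_zero]
    · rw [Preadditive.add_comp, Category.assoc, hh2, hh']
      abel
  choose b hb hab using hd
  let w : ∀ i, Φ.H.obj (Z.A i) ⟶ Φ.L'.obj (Φ.L.obj (Q (i + 1))) := fun i =>
    Φ.H.map (α' i) ≫ inv (Φ.un (Φ.L'.obj (P (i + 1)))) ≫ Φ.L'.map (c (i + 1))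
  -- The maps `gy` and `ay` are the two components of the morphism from `Y` to the object induced by
  -- `Q`, prescribed on the pushout by their restrictions to `L' A` and `H A`.
  choose gy gyμ gyj using fun i => Z.exists_desc hS i 0 (Φ.H.map (b i) ≫ inv (Φ.un (Q i))) (by
    rw [← Category.assoc (Φ.H.map _), ← Functor.map_comp, hb, Functor.map_comp, Category.assoc,
      ← Category.assoc, hγ, zero_comp, comp_zero])
  choose ay ayμ ayj using fun i => Z.exists_desc hS i (Φ.L'.map (b (i + 1))) (w i) (by
    rw [← Functor.map_comp, hb]
    simp only [w]
    rw [← Category.assoc (Φ.H.map _), ← Functor.map_comp, hα', reassoc_of% (hα i),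
      IsIso.hom_inv_id_assoc, Functor.map_comp])
  have hcond : ∀ i, Z.e i ≫ Φ.H'.map (ay i) = Φ.L.map (gy (i + 1)) ≫ Φ.un' _ := fun i => by
    apply Φ.fl_injective
    rw [Φ.fl_comp, Φ.fl_map]
    apply hom_ext_Y hS
    · rw [← Category.assoc, Z.μ_fl_e hS, ← Category.assoc, gyμ, zero_comp, zero_comp]
    · rw [← Category.assoc, j_fl_e, ← Functor.map_comp, ← Φ.fl'_comp, ayμ, Φ.fl'_lmap,
        ← Category.assoc, gyj, Category.assoc, ← Φ.un_map, IsIso.inv_hom_id_assoc,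
        Functor.map_comp]
  refine ⟨Q, gy, ay, fun i => bq i ≫ Z'.j i, hQ, bQ, Rep.comp_map_eq_zero hS.nakD hQ gy ay hcond,
    hcond, fun i => ?_⟩
  have e1 : Φ.L'.map (Φ.L.map (bq (i + 1) ≫ Z'.j (i + 1))) ≫ Φ.sh' (Z'.e i) =
      Φ.L'.map (θ (i + 1)) ≫ Z'.μ i := by
    rw [Functor.map_comp, Functor.map_comp, Category.assoc, Z'.j_sh_e, ← Category.assoc
        (Φ.L'.map _), ← Functor.map_comp, Φ.map_co]
  change h.y.f i = gy i ≫ bq i ≫ Z'.j i +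
    ay i ≫ Φ.L'.map (Φ.L.map (bq (i + 1) ≫ Z'.j (i + 1))) ≫ Φ.sh' (Z'.e i)
  rw [e1]
  apply hom_ext_Y hS
  · have e2 : Φ.L'.map (ψ (i + 1)) ≫ Z'.μ i = 0 := by
      simp only [ψ, Functor.map_comp, Category.assoc]
      rw [Z'.sq, reassoc_of% (Z'.X.map_sh_comp i), zero_comp, comp_zero]
    rw [h.μ_y hS, Preadditive.comp_add, reassoc_of% (gyμ i), zero_comp, zero_add,
      reassoc_of% (ayμ i), hab, Functor.map_add, Φ.L'.map_comp (α' _), Φ.L'.map_comp (b _),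
      Preadditive.add_comp, Category.assoc, e2, comp_zero, zero_add, Category.assoc]
  · have e3 : inv (Φ.un (Q i)) ≫ bq i = Φ.H.map (θ i) := by
      rw [IsIso.inv_comp_eq, Φ.un_map, Φ.fl_sh]
    have e4 : inv (Φ.un (Φ.L'.obj (P (i + 1)))) ≫ Φ.L'.map (β (i + 1)) ≫ Z'.X.d i =
        Φ.H.map (Φ.L.map (Φ.L'.map (β (i + 1))) ≫ Φ.sh (Z'.X.d i)) := by
      rw [IsIso.inv_comp_eq, Φ.un_map, Φ.fl_map, Φ.fl_sh]
    rw [h.j_y, Preadditive.comp_add, reassoc_of% (gyj i), reassoc_of% (ayj i), hab,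
      Functor.map_add, Φ.H.map_comp (α' _), Φ.H.map_comp (b _), Preadditive.add_comp, add_comm]
    congr 1
    · rw [Category.assoc, reassoc_of% e3]
    · simp only [w, ψ, Category.assoc]
      rw [← Category.assoc (Φ.L'.map (c _)), ← Functor.map_comp, hc,
        Φ.L'.map_comp (β _), Category.assoc, Z'.sq, reassoc_of% e4]
      simp only [Functor.map_comp, Category.assoc]

include hS in
/-- If the second component is stably zero then so is the first one. -/
theorem Hom.null_f_of_null_y (h : Hom Z Z') (hy : Rep.Null Z.Y Z'.Y h.y.f) :
    Rep.Null Z.X Z'.X h.f.f := by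
  obtain ⟨Q, γ, α, β, hQ, bQ, hγ, hα, hn⟩ := hy
  replace hγ : ∀ i, Z.e i ≫ Φ.H'.map (γ i) = 0 := hγ
  replace hα : ∀ i, Z.e i ≫ Φ.H'.map (α i) = Φ.L.map (γ (i + 1)) ≫ Φ.un' _ := hα
  replace hn : ∀ i, h.y.f i = γ i ≫ β i + α i ≫ Φ.L'.map (Φ.L.map (β (i + 1))) ≫
    Φ.sh' (Z'.e i) := hn
  obtain ⟨P, p, hp, hP, bP⟩ := Rep.exists_family_cover (Φ := Φ)
    (fun i => hS.fg_A _ (Z'.hA i)) Z'.bdd hS.nakC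
  have PB : ∀ i, 𝓑 (P i) := fun i => hS.proj_B _ (hP i).1 (hP i).2
  have LQB : ∀ i, 𝓑 (Φ.L.obj (Q i)) := fun i => hS.proj_L_B _ (hQ i).1 (hQ i).2
  have hepi : ∀ i, Epi (p i ≫ Z'.π i) := fun i => by
    have := (Z'.ses i).epi
    have := hp i
    exact epi_comp _ _
  -- Modulo `H A'` the map `β` becomes a map `Q → L' B'`, which lifts to `L' P` because the kernel
  -- of `L' P → L' B'` lies in `𝓚`. What remains of `β` takes values in `H A'` and is called `β1`.
  have h2 : ∀ i, ∃ b : Q i ⟶ Φ.L'.obj (P (i + 1)),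
      b ≫ Φ.L'.map (p (i + 1) ≫ Z'.π (i + 1)) = β i ≫ Z'.κ i := fun i => by
    have s := Ses.of_epi (p (i + 1) ≫ Z'.π (i + 1))
    exact hS.liftD (hS.L'_ses s (hP (i + 1)).1 (Z'.hB _))
      (hS.L'_mem _ (hS.B_ker s (PB _) (Z'.hB _))) (hS.proj_G _ (hQ i).1 (hQ i).2) _
  choose β2 hβ2 using h2
  have h1 : ∀ i, ∃ b : Q i ⟶ Φ.H.obj (Z'.A i),
      β i = b ≫ Z'.j i + β2 i ≫ Φ.L'.map (p (i + 1)) ≫ Z'.μ i := fun i => by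
    obtain ⟨b, hb⟩ := (Z'.sesY i).lift (β i - β2 i ≫ Φ.L'.map (p (i + 1)) ≫ Z'.μ i) (by
      rw [Preadditive.sub_comp, Category.assoc, Category.assoc, Z'.μ_κ, ← Functor.map_comp, hβ2,
        sub_self])
    exact ⟨b, by rw [hb]; abel⟩
  choose β1 hβ1 using h1
  let θ : ∀ i, Φ.L.obj (Q i) ⟶ Z'.A i := fun i => Φ.sh (β1 i)
  have he : ∀ i, Φ.L'.map (Φ.L.map (β (i + 1))) ≫ Φ.sh' (Z'.e i) =
      Φ.L'.map (θ (i + 1)) ≫ Z'.μ i := fun i => by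
    rw [← Φ.sh'_map, hβ1, Functor.map_add, Preadditive.add_comp]
    simp only [Functor.map_comp, Category.assoc]
    rw [Z'.map_μ_e hS, comp_zero, comp_zero, add_zero, Z'.j_e, ← Category.assoc, Φ.map_co,
      Φ.sh'_map, Φ.sh'_fl']
  -- Together `P` and `L Q` cover `B'`. The kernel of this cover lies in `𝓑` and is carried by `pθ`
  -- into `X'`; a projective `P'` mapping onto it will be the family through which `h.f` factors.
  let pθ : ∀ i, P i ⊞ Φ.L.obj (Q i) ⟶ Z'.A i := fun i => biprod.desc (p i) (θ i)
  have hepi' : ∀ i, Epi (pθ i ≫ Z'.π i) := fun i => by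
    have := hepi i
    have : biprod.inl ≫ pθ i ≫ Z'.π i = p i ≫ Z'.π i := biprod.inl_desc_assoc _ _ _
    have : Epi (biprod.inl ≫ pθ i ≫ Z'.π i) := this ▸ hepi i
    exact epi_of_epi biprod.inl _
  have sK : ∀ i, Ses (kernel.ι (pθ i ≫ Z'.π i)) (pθ i ≫ Z'.π i) := fun i => Ses.of_epi _
  have PQB : ∀ i, 𝓑 (P i ⊞ Φ.L.obj (Q i)) := fun i => hS.B_biprod _ _ (PB i) (LQB i)
  have KB : ∀ i, 𝓑 (kernel (pθ i ≫ Z'.π i)) := fun i => hS.B_ker (sK i) (PQB i) (Z'.hB i)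
  have hz : ∀ i, ∃ z : kernel (pθ i ≫ Z'.π i) ⟶ Z'.X.X i,
      z ≫ Z'.ι i = kernel.ι (pθ i ≫ Z'.π i) ≫ pθ i := fun i =>
    (Z'.ses i).lift _ (by rw [Category.assoc, kernel.condition])
  choose z hz using hz
  obtain ⟨P', q, hq, hP', bP'⟩ := Rep.exists_family_cover (Φ := Φ)
    (X := fun i => kernel (pθ i ≫ Z'.π i)) (fun i => hS.fg_B _ (KB i))
    (Bdd.of_imp bP bQ fun i h h' => IsZero.of_mono (kernel.ι _)
      ((biprod_isZero_iff _ _).2 ⟨h, Functor.map_isZero _ h'⟩)) hS.nakC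
  let τ : ∀ i, Z.Y.X i ⟶ Φ.L'.obj (P (i + 1) ⊞ Φ.L.obj (Q (i + 1))) := fun i =>
    γ i ≫ β2 i ≫ Φ.L'.map biprod.inl + α i ≫ Φ.L'.map biprod.inr
  have hτ : ∀ i, τ i ≫ Φ.L'.map (pθ (i + 1)) =
      γ i ≫ β2 i ≫ Φ.L'.map (p (i + 1)) + α i ≫ Φ.L'.map (θ (i + 1)) := fun i => by
    simp only [τ, Preadditive.add_comp, Category.assoc, ← Functor.map_comp, pθ, biprod.inl_desc,
      biprod.inr_desc]
  -- The component `h.y` maps `H A` into `H A'`, so `j ≫ τ` dies in `L' B'`. It therefore lands in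
  -- `L'` of the kernel, and lifts further to `L' P'`.
  have hσ : ∀ i, ∃ s : Φ.H.obj (Z.A i) ⟶ Φ.L'.obj (P' (i + 1)),
      s ≫ Φ.L'.map (q (i + 1) ≫ kernel.ι (pθ (i + 1) ≫ Z'.π (i + 1))) = Z.j i ≫ τ i := fun i => by
    obtain ⟨s, hs⟩ := (hS.L'_ses (sK (i + 1)) (hS.fg_B _ (PQB _)) (Z'.hB _)).lift (Z.j i ≫ τ i) (by
      have e1 : Z.j i ≫ h.y.f i ≫ Z'.κ i = 0 := by
        rw [reassoc_of% (h.j_y i), (Z'.sesY i).zero, comp_zero]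
      rw [hn, Preadditive.add_comp, Category.assoc, ← hβ2, Category.assoc, he, Category.assoc,
        Z'.μ_κ] at e1
      rw [Category.assoc, Functor.map_comp, reassoc_of% (hτ i), ← e1]
      simp only [Preadditive.add_comp, Category.assoc, Functor.map_comp])
    have := hq (i + 1)
    have s2 := Ses.of_epi (q (i + 1))
    obtain ⟨t, ht⟩ := hS.liftD (hS.L'_ses s2 (hP' _).1 (KB _))
      (hS.L'_mem _ (hS.B_ker s2 (hS.proj_B _ (hP' _).1 (hP' _).2) (KB _)))
      (hS.H_mem _ (Z.hA i)) s
    exact ⟨t, by rw [Functor.map_comp, reassoc_of% ht, hs]⟩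
  choose σ hσ using hσ
  have isoA := fun i => hS.isIso_co _ (Z.hA i)
  have isoP : ∀ i, IsIso (Φ.un' (P' i)) := fun i =>
    hS.isIso_un' _ (hS.proj_B _ (hP' i).1 (hP' i).2)
  let ᾱ : ∀ i, Z.A i ⟶ Φ.L.obj (Φ.L'.obj (P' (i + 1))) := fun i =>
    inv (Φ.co (Z.A i)) ≫ Φ.L.map (σ i)
  have Hᾱ : ∀ i, Φ.H.map (ᾱ i) = σ i ≫ Φ.un _ := fun i => by
    apply Φ.sh_injective
    rw [Φ.sh_hmap, ← Φ.fl_lmap, Φ.sh_fl, IsIso.hom_inv_id_assoc]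
  obtain ⟨g, hg⟩ := exists_family_of_succ (F := fun i => Z.X.X i ⟶ P' i)
    (fun i g => g ≫ Φ.un' _ = Φ.fl' (Z.X.d i ≫ Φ.H.map (Z.ι i) ≫ σ i)) (fun i =>
      ⟨Φ.fl' (Z.X.d i ≫ Φ.H.map (Z.ι i) ≫ σ i) ≫ inv (Φ.un' _), by
        rw [Category.assoc, IsIso.inv_hom_id, Category.comp_id]⟩)
  have hcond : ∀ i, Z.X.d i ≫ Φ.H.map (Z.ι i ≫ ᾱ i) = Φ.L'.map (g (i + 1)) ≫ Φ.un _ :=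
    fun i => by
      have : Φ.L'.map (g (i + 1)) = Z.X.d i ≫ Φ.H.map (Z.ι i) ≫ σ i := by
        apply Φ.fl'_injective
        rw [Φ.fl'_lmap, hg]
      rw [this, Functor.map_comp, Hᾱ, Category.assoc, Category.assoc]
  refine ⟨P', g, fun i => Z.ι i ≫ ᾱ i, fun i => q i ≫ z i, hP', bP',
    Rep.comp_map_eq_zero hS.nakC hP' _ _ hcond, hcond, fun i => ?_⟩
  have := (Z'.ses i).mono
  have := (Z'.sesY i).mono
  -- On `H A` the map splits into a part through `Q` and a part through `L' P'`; transposing along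
  -- `L ⊣ H` gives the same splitting for `h.a`.
  have key : Φ.H.map (h.a i) = Z.j i ≫ γ i ≫ β1 i +
      σ i ≫ Φ.L'.map (q (i + 1) ≫ z (i + 1)) ≫ Z'.X.d i ≫ Φ.H.map (Z'.ι i) := by
    rw [← cancel_mono (Z'.j i), ← h.j_y, hn, Preadditive.add_comp]
    simp only [Category.assoc]
    rw [← Z'.sq, ← Category.assoc (Φ.L'.map _) (Φ.L'.map _), ← Functor.map_comp, Category.assoc,
      hz, ← Category.assoc (q _), Functor.map_comp, Category.assoc, reassoc_of% (hσ i),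
      reassoc_of% (hτ i), he]
    conv_lhs => rw [hβ1]
    simp only [Preadditive.comp_add, Preadditive.add_comp, Category.assoc]
    abel
  have key' : h.a i = inv (Φ.co (Z.A i)) ≫ Φ.L.map (Z.j i ≫ γ i) ≫ θ i +
      ᾱ i ≫ Φ.L.map (Φ.L'.map (q (i + 1) ≫ z (i + 1))) ≫ Φ.sh (Z'.X.d i) ≫ Z'.ι i := by
    have := congrArg Φ.sh key
    rw [Φ.sh_hmap, Φ.sh_add, ← Category.assoc (Z.j i), Φ.sh_map, Φ.sh_map, Φ.sh_map,
      Φ.sh_comp] at this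
    rw [← cancel_epi (Φ.co (Z.A i)), this, Preadditive.comp_add]
    simp only [ᾱ, θ, Category.assoc, IsIso.hom_inv_id_assoc]
  -- The part through `Q`, restricted to `X`, is the contribution of `g`. The equality is tested
  -- after the invertible unit of `P ⊞ L Q`.
  have hgq : g i ≫ q i ≫ kernel.ι (pθ i ≫ Z'.π i) =
      Z.ι i ≫ inv (Φ.co (Z.A i)) ≫ Φ.L.map (Z.j i ≫ γ i) ≫ biprod.inr := by
    obtain ⟨m, rfl⟩ := exists_eq_succ i
    have := hS.isIso_un' _ (PQB (m + 1))
    have e0 : ∀ {M N : C} (t : M ⟶ N), t ≫ Φ.un' N = Φ.un' M ≫ Φ.H'.map (Φ.L'.map t) :=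
      fun t => by rw [Φ.un'_map, Φ.fl'_lmap]
    have e1 : Φ.co (Z.A (m + 1)) ≫ Φ.fl' (Z.μ m ≫ α m) =
        Φ.L.map (Z.j (m + 1) ≫ γ (m + 1)) ≫ Φ.un' _ := by
      rw [Φ.fl'_comp, ← Category.assoc, ← Z.j_e, Category.assoc, hα, Functor.map_comp,
        Category.assoc]
    have e2 : Z.μ m ≫ γ m = 0 := by
      apply Φ.fl'_injective
      rw [← cancel_epi (Φ.co (Z.A (m + 1))), Φ.fl'_comp, ← Category.assoc, ← Z.j_e,
        Category.assoc, hγ, comp_zero, Φ.fl'_zero, comp_zero]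
    have e3 : Z.μ m ≫ τ m = (Z.μ m ≫ α m) ≫ Φ.L'.map biprod.inr := by
      simp only [τ, Preadditive.comp_add, reassoc_of% e2, zero_comp, zero_add, Category.assoc]
    rw [← cancel_mono (Φ.un' (P (m + 1) ⊞ Φ.L.obj (Q (m + 1))))]
    simp only [Category.assoc]
    rw [e0 biprod.inr, ← reassoc_of% e1, IsIso.inv_hom_id_assoc, ← Φ.fl'_comp, ← e3,
      ← Category.assoc (q _), e0, reassoc_of% (hg m), ← Φ.fl'_comp, ← Φ.fl'_map, Category.assoc,
      Category.assoc, hσ, reassoc_of% (Z.sq m)]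
  rw [← cancel_mono (Z'.ι i), ← h.ι_a, key', Preadditive.comp_add, Preadditive.add_comp]
  simp only [Category.assoc]
  congr 1
  rw [hz, reassoc_of% hgq]
  simp only [pθ, biprod.inr_desc]

end Link

end Links

end WakamatsuTilting

end

set_option linter.unusedSectionVars false

noncomputable section

namespace WakamatsuTilting

open Limits ZeroObject

/-! ### Density of the second projection and the stable equivalence -/

section Links

universe v w

variable {C D : Type w} [Category.{v} C] [Category.{v} D] [Abelian C] [Abelian D]
  {Φ : AdjointPairs C D} {𝓑 𝓐 : ObjectProperty C} {𝓖 𝓚 : ObjectProperty D}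

namespace Link

variable (hS : CounterSetup Φ 𝓑 𝓐 𝓖 𝓚) {Z Z' : Link Φ 𝓑 𝓐}

include hS in
/-- A repe-complex filtered by members of `𝓖` and of `𝓚`, subject to a surjectivity condition, is
the second component of linked repe-complexes. -/
theorem exists_of_Y (Y : Rep Φ.swap) (G K : ℤ → D) (hG : ∀ i, 𝓖 (G i)) (hK : ∀ i, 𝓚 (K i))
    (bG : Bdd G) (m : ∀ i, G i ⟶ Y.X i) (k : ∀ i, Y.X i ⟶ K i) (hm : ∀ i, Ses (m i) (k i))
    (hepi : ∀ i, Epi (Φ.L.map (m (i + 1)) ≫ Y.d i ≫ Φ.H'.map (k i))) :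
    ∃ Z : Link Φ 𝓑 𝓐, Z.Y = Y := by
  have d_comp : ∀ i, Φ.sh' (Y.d (i + 1)) ≫ Φ.fl (Y.d i) = 0 := Y.d_comp
  have isoG := fun i => hS.isIso_un _ (hG i)
  have isoK := fun i => hS.isIso_co' _ (hK i)
  have hA : ∀ i, 𝓐 (Φ.L.obj (G i)) := fun i => hS.L_mem _ (hG i)
  have hBK : ∀ i, 𝓑 (Φ.H'.obj (K i)) := fun i => hS.H'_mem _ (hK i)
  -- The object `B (i + 1)` has to be `H' (K i)`. Because of the index shift, the object and the
  -- morphism to it are chosen together, up to the isomorphism `E`.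
  obtain ⟨Bπ, hBπ⟩ := exists_family_of_succ (F := fun i => Σ B : C, (Φ.L.obj (G i) ⟶ B))
    (fun i x => 𝓑 x.1 ∧ ∃ (E : x.1 ≅ Φ.H'.obj (K i)),
      x.2 ≫ E.hom = Φ.L.map (m (i + 1)) ≫ Y.d i ≫ Φ.H'.map (k i))
    (fun i => ⟨⟨_, Φ.L.map (m (i + 1)) ≫ Y.d i ≫ Φ.H'.map (k i)⟩, hBK i, Iso.refl _,
      Category.comp_id _⟩)
  let B : ℤ → C := fun i => (Bπ i).1
  let π : ∀ i, Φ.L.obj (G i) ⟶ B i := fun i => (Bπ i).2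
  choose hBπ' E hE using hBπ
  replace hE : ∀ i, π (i + 1) ≫ (E i).hom = Φ.L.map (m (i + 1)) ≫ Y.d i ≫ Φ.H'.map (k i) := hE
  have hπ : ∀ i, Epi (π i) := fun i => by
    obtain ⟨n, rfl⟩ := exists_eq_succ i
    have : Epi (π (n + 1) ≫ (E n).hom) := hE n ▸ hepi n
    have := epi_comp (π (n + 1) ≫ (E n).hom) (E n).inv
    rwa [Category.assoc, Iso.hom_inv_id, Category.comp_id] at this
  have hB : ∀ i, 𝓑 (B i) := fun i => by
    obtain ⟨n, rfl⟩ := exists_eq_succ i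
    exact hBπ' n
  have hι : ∀ i, Ses (kernel.ι (π i)) (π i) := fun i => Ses.of_epi _
  let ι : ∀ i, kernel (π i) ⟶ Φ.L.obj (G i) := fun i => kernel.ι (π i)
  replace hι : ∀ i, Ses (ι i) (π i) := hι
  let j : ∀ i, Φ.H.obj (Φ.L.obj (G i)) ⟶ Y.X i := fun i => inv (Φ.un (G i)) ≫ m i
  let μ : ∀ i, Φ.L'.obj (Φ.L.obj (G (i + 1))) ⟶ Y.X i := fun i =>
    Φ.sh' (Φ.L.map (m (i + 1)) ≫ Y.d i)
  let κ : ∀ i, Y.X i ⟶ Φ.L'.obj (B (i + 1)) := fun i =>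
    k i ≫ inv (Φ.co' (K i)) ≫ Φ.L'.map (E i).inv
  have sesY : ∀ i, Ses (j i) (κ i) := fun i =>
    (hm i).of_iso (asIso (Φ.un (G i))) (Iso.refl _)
      ((asIso (Φ.co' (K i))).symm ≪≫ Φ.L'.mapIso (E i).symm) (by simp [j]) (by simp [κ])
  have jmono := fun i => (sesY i).mono
  have ιmono := fun i => (hι i).mono
  have μ_κ : ∀ i, μ i ≫ κ i = Φ.L'.map (π (i + 1)) := fun i => by
    have : Φ.sh' (Φ.L.map (m (i + 1)) ≫ Y.d i) ≫ k i =
        Φ.L'.map (π (i + 1)) ≫ Φ.L'.map (E i).hom ≫ Φ.co' (K i) := by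
      rw [← Φ.sh'_comp, Category.assoc, ← hE, Φ.sh'_map, ← Φ.map_co']
    simp only [μ, κ]
    rw [reassoc_of% this, IsIso.hom_inv_id_assoc, ← Functor.map_comp, Iso.hom_inv_id]
    simp
  have μ_fl : ∀ i, μ (i + 1) ≫ Φ.fl (Y.d i) = 0 := fun i => by
    simp only [μ]
    rw [Φ.sh'_map, Category.assoc, d_comp, comp_zero]
  have ht : ∀ i, ∃ t : Φ.L'.obj (kernel (π (i + 1))) ⟶ Φ.H.obj (Φ.L.obj (G i)),
      t ≫ j i = Φ.L'.map (ι (i + 1)) ≫ μ i := fun i =>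
    (sesY i).lift _ (by
      rw [Category.assoc, μ_κ, ← Functor.map_comp, (hι (i + 1)).zero, Functor.map_zero])
  choose t ht using ht
  have j_un : ∀ i, Φ.H.map (Φ.L.map (m i)) = j i ≫ Φ.un (Y.X i) := fun i => by
    simp only [j]
    rw [Category.assoc, IsIso.eq_inv_comp, Φ.un_map, Φ.fl_lmap]
  have t_H : ∀ i, t (i + 1) ≫ Φ.H.map (Φ.L.map (m (i + 1)) ≫ Y.d i) = 0 := fun i => by
    rw [Functor.map_comp, j_un, Category.assoc, Φ.un_map, reassoc_of% (ht (i + 1)), μ_fl,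
      comp_zero]
  -- Followed by `π`, the map `t` contains two consecutive differentials of `Y`, so it factors
  -- through `H` of the kernel of `π`.
  have hd : ∀ i, ∃ d : Φ.L'.obj (kernel (π (i + 1))) ⟶ Φ.H.obj (kernel (π i)),
      d ≫ Φ.H.map (ι i) = t i := fun i => by
    refine (hι i).lift_map _ ?_
    obtain ⟨n, rfl⟩ := exists_eq_succ i
    rw [← cancel_mono (Φ.H.map (E n).hom), Category.assoc, ← Functor.map_comp, hE, zero_comp,
      ← Category.assoc (Φ.L.map _), Functor.map_comp, ← Category.assoc, t_H, zero_comp]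
  choose d hd using hd
  have hdj : ∀ i, d i ≫ Φ.H.map (ι i) ≫ j i = Φ.L'.map (ι (i + 1)) ≫ μ i := fun i => by
    rw [reassoc_of% (hd i), ht]
  let X : Rep Φ :=
    { X := fun i => kernel (π i)
      fg := fun i => hS.fgC_sub (ι i) inferInstance (hS.fg_A _ (hA i))
      bdd := Bdd.of_imp_one bG fun i h => IsZero.of_mono (ι i) (Functor.map_isZero Φ.L h)
      d := d
      d_comp := fun i => by
        rw [← cancel_mono (Φ.H'.map (Φ.H.map (ι i) ≫ j i)), Category.assoc, ← Φ.fl'_comp, hdj,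
          Φ.fl'_map, zero_comp, ← Category.assoc, ← Φ.sh_comp, hd, Φ.fl'_sh', ← Φ.sh_comp, t_H,
          Φ.sh_zero] }
  refine ⟨{ X := X, Y := Y, A := fun i => Φ.L.obj (G i), B := B, hA := hA, hB := hB,
            bdd := Bdd.of_imp_one bG fun i h => Functor.map_isZero Φ.L h, ι := ι, π := π,
            ses := hι, j := j, μ := μ, κ := κ, sesY := sesY, μ_κ := μ_κ,
            sq := fun i => (hdj i).symm, j_d := fun i => ?_ }, rfl⟩
  have e : Φ.L.map (inv (Φ.un (G (i + 1)))) = Φ.co (Φ.L.obj (G (i + 1))) := by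
    rw [Functor.map_inv, IsIso.inv_eq_of_hom_inv_id]
    rw [Φ.map_co, Φ.sh_un]
  change Φ.L.map (inv (Φ.un (G (i + 1))) ≫ m (i + 1)) ≫ Y.d i = _
  rw [Φ.fl'_sh', Functor.map_comp, e, Category.assoc]

end Link

namespace Rep

/-- The direct sum of two repe-complexes. -/
@[reducible] def biprod (hΦ : HasNakayama Φ) (X Y : Rep Φ) : Rep Φ where
  X i := X.X i ⊞ Y.X i
  fg i := hΦ.fg_biprod _ _ (X.fg i) (Y.fg i)
  bdd := X.bdd.of_imp Y.bdd fun i h h' => (biprod_isZero_iff _ _).2 ⟨h, h'⟩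
  d i := Φ.L'.map biprod.fst ≫ X.d i ≫ Φ.H.map biprod.inl +
    Φ.L'.map biprod.snd ≫ Y.d i ≫ Φ.H.map biprod.inr
  d_comp i := by
    have e1 : ∀ {U V : C} (a : U ⟶ X.X (i + 1 + 1)) (b : X.X (i + 1) ⟶ V),
        Φ.sh (Φ.L'.map a ≫ X.d (i + 1) ≫ Φ.H.map b) =
          Φ.L.map (Φ.L'.map a) ≫ Φ.sh (X.d (i + 1)) ≫ b :=
      fun a b => by rw [Φ.sh_map, Φ.sh_comp]
    have e2 : ∀ {U V : C} (a : U ⟶ Y.X (i + 1 + 1)) (b : Y.X (i + 1) ⟶ V),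
        Φ.sh (Φ.L'.map a ≫ Y.d (i + 1) ≫ Φ.H.map b) =
          Φ.L.map (Φ.L'.map a) ≫ Φ.sh (Y.d (i + 1)) ≫ b :=
      fun a b => by rw [Φ.sh_map, Φ.sh_comp]
    rw [Φ.sh_add, e1, e2, Φ.fl'_add, Φ.fl'_map, Φ.fl'_comp, Φ.fl'_map, Φ.fl'_comp]
    simp only [Preadditive.add_comp, Preadditive.comp_add, Category.assoc, biprod.inl_fst_assoc,
      biprod.inl_snd_assoc, biprod.inr_fst_assoc, biprod.inr_snd_assoc, zero_comp, comp_zero,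
      add_zero, zero_add]
    rw [reassoc_of% (X.d_comp i), reassoc_of% (Y.d_comp i)]
    simp

variable (hΦ : HasNakayama Φ) (X Y : Rep Φ)

/-- The inclusion of the first summand. -/
@[simps] def biprodInl : X ⟶ biprod hΦ X Y where
  f i := Limits.biprod.inl
  comm i := by
    have h1 : Φ.L'.map (Limits.biprod.inl : _ ⟶ X.X (i + 1) ⊞ Y.X (i + 1)) ≫
        Φ.L'.map Limits.biprod.fst = 𝟙 _ := by simp [← Functor.map_comp]
    have h2 : Φ.L'.map (Limits.biprod.inl : _ ⟶ X.X (i + 1) ⊞ Y.X (i + 1)) ≫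
        Φ.L'.map Limits.biprod.snd = 0 := by simp [← Functor.map_comp]
    rw [Preadditive.comp_add, reassoc_of% h1, reassoc_of% h2]
    simp

/-- The inclusion of the second summand. -/
@[simps] def biprodInr : Y ⟶ biprod hΦ X Y where
  f i := Limits.biprod.inr
  comm i := by
    have h1 : Φ.L'.map (Limits.biprod.inr : _ ⟶ X.X (i + 1) ⊞ Y.X (i + 1)) ≫
        Φ.L'.map Limits.biprod.snd = 𝟙 _ := by simp [← Functor.map_comp]
    have h2 : Φ.L'.map (Limits.biprod.inr : _ ⟶ X.X (i + 1) ⊞ Y.X (i + 1)) ≫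
        Φ.L'.map Limits.biprod.fst = 0 := by simp [← Functor.map_comp]
    rw [Preadditive.comp_add, reassoc_of% h1, reassoc_of% h2]
    simp

/-- The projection onto the first summand. -/
@[simps] def biprodFst : biprod hΦ X Y ⟶ X where
  f i := Limits.biprod.fst
  comm i := by simp [Preadditive.add_comp, ← Functor.map_comp]

/-- The projection onto the second summand. -/
@[simps] def biprodSnd : biprod hΦ X Y ⟶ Y where
  f i := Limits.biprod.snd
  comm i := by simp [Preadditive.add_comp, ← Functor.map_comp]

end Rep

theorem Bdd.of_shift {X : ℤ → C} (h : Bdd fun i => X (i + 1)) : Bdd X :=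
  (h.image fun i => i + 1).subset fun i hi => ⟨i - 1, by
    simpa only [Set.mem_ofPred_eq, sub_add_cancel] using hi, sub_add_cancel i 1⟩

namespace Link

variable (hS : CounterSetup Φ 𝓑 𝓐 𝓖 𝓚)

include hS in
/-- Every repe-complex over the second category is stably a retract, with stably zero complement,
of the second component of linked repe-complexes. -/
theorem exists_link_Y (Y : Rep Φ.swap) : ∃ (Z : Link Φ 𝓑 𝓐) (s : Y ⟶ Z.Y) (r : Z.Y ⟶ Y),
    s ≫ r = 𝟙 Y ∧ Rep.Null Z.Y Z.Y fun i => (𝟙 Z.Y : Z.Y ⟶ Z.Y).f i - (r ≫ s).f i := by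
  have h1 : ∀ M, Φ.fgD M → ∃ (K G : D) (f : K ⟶ G) (g : G ⟶ M), Ses f g ∧ 𝓖 G ∧ 𝓚 K ∧
      (IsZero M → IsZero G) := fun M hM => by
    by_cases h0 : IsZero M
    · refine ⟨0, M, 0, 𝟙 _, ?_, hS.zero_G _ h0, hS.zero_K _ (isZero_zero _), fun h => h⟩
      have : Mono (0 : 0 ⟶ M) := (isZero_zero D).mono _
      exact Ses.of_desc zero_comp fun W t _ => ⟨t, Category.id_comp _⟩
    · obtain ⟨K, G, f, g, h1, h2, h3⟩ := hS.complete_G M hM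
      exact ⟨K, G, f, g, h1, h2, h3, fun h => (h0 h).elim⟩
  choose K' G k g hkg hG hK' hG0 using fun i => h1 (Y.X i) (Y.fg i)
  have h2 : ∀ M, 𝓚 M → ∃ (P : D) (f : M ⟶ Φ.L'.obj (Φ.L.obj P)), Mono f ∧
      (Φ.fgD P ∧ Projective P) ∧ (IsZero M → IsZero P) := fun M hM => by
    by_cases h0 : IsZero M
    · exact ⟨M, 0, h0.mono _, ⟨hS.fg_K _ hM, ⟨fun f e _ => ⟨0, h0.eq_of_src _ _⟩⟩⟩, fun h => h⟩
    · obtain ⟨P, f, h1, h2, h3⟩ := hS.embed M (hS.fg_K _ hM)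
      exact ⟨P, f, h1, ⟨h2, h3⟩, fun h => (h0 h).elim⟩
  have bK' : Bdd K' := Bdd.of_imp_one Y.bdd fun i h => by
    have := (hkg i).mono
    exact IsZero.of_mono (k i) (hG0 i h)
  obtain ⟨Q, hQ'⟩ := exists_family_of_succ (F := fun _ => D)
    (fun i P => (∃ (f : K' i ⟶ Φ.L'.obj (Φ.L.obj P)), Mono f) ∧
      (Φ.fgD P ∧ Projective P) ∧ (IsZero (K' i) → IsZero P))
    (fun i => by
      obtain ⟨P, f, hf⟩ := h2 (K' i) (hK' i)
      exact ⟨P, ⟨f, hf.1⟩, hf.2⟩)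
  have hQ : ∀ i, Φ.fgD (Q i) ∧ Projective (Q i) := fun i => by
    obtain ⟨n, rfl⟩ := exists_eq_succ i
    exact (hQ' n).2.1
  have bQ : Bdd Q := Bdd.of_shift (Bdd.of_imp_one bK' fun i => (hQ' i).2.2)
  choose ψ hψ using fun i => (hQ' i).1
  have hI := fun i => hS.proj_injective _ (hQ i).1 (hQ i).2
  -- The kernel `K'` sits in the injective object `L' L Q`. Extending this embedding to `G` makes `G
  -- ⊞ Q` a subobject of `Y` plus the object induced by `Q`, with cokernel `L' L Q / K'`, which is
  -- again in `𝓚`.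
  have hφ : ∀ i, ∃ φ : G i ⟶ Φ.L'.obj (Φ.L.obj (Q (i + 1))), k i ≫ φ = ψ i := fun i => by
    have := (hkg i).mono
    exact ⟨Injective.factorThru (ψ i) (k i), Injective.comp_factorThru _ _⟩
  choose φ hφ using hφ
  let K : ℤ → D := fun i => cokernel (ψ i)
  let r : ∀ i, Φ.L'.obj (Φ.L.obj (Q (i + 1))) ⟶ K i := fun i => cokernel.π (ψ i)
  have hr : ∀ i, Ses (ψ i) (r i) := fun i => Ses.of_mono _
  have LQB : ∀ i, 𝓑 (Φ.L.obj (Q i)) := fun i => hS.proj_L_B _ (hQ i).1 (hQ i).2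
  have hK : ∀ i, 𝓚 (K i) := fun i => hS.K_coker (hr i) (hK' i) (hS.L'_mem _ (LQB _))
  have hs : ∀ i, ∃ s : Y.X i ⟶ K i, g i ≫ s = φ i ≫ r i := fun i =>
    (hkg i).desc _ (by rw [reassoc_of% (hφ i), (hr i).zero])
  choose s hs using hs
  let I : Rep Φ.swap := Rep.ind hS.nakD Q hQ bQ
  let W : Rep Φ.swap := Rep.biprod hS.nakD Y I
  let m : ∀ i, G i ⊞ Q i ⟶ Y.X i ⊞ (Q i ⊞ Φ.L'.obj (Φ.L.obj (Q (i + 1)))) := fun i =>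
    biprod.desc (g i ≫ biprod.inl + φ i ≫ biprod.inr ≫ biprod.inr) (biprod.inl ≫ biprod.inr)
  let c : ∀ i, Y.X i ⊞ (Q i ⊞ Φ.L'.obj (Φ.L.obj (Q (i + 1)))) ⟶ K i := fun i =>
    biprod.desc (-s i) (biprod.desc 0 (r i))
  have hm : ∀ i, Ses (m i) (c i) := fun i => by
    have := (hr i).epi
    have e1 : (biprod.inr ≫ biprod.inr) ≫ c i = r i := by simp [c]
    have : Epi (c i) := by
      have : Epi ((biprod.inr ≫ biprod.inr) ≫ c i) := e1 ▸ (hr i).epi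
      exact epi_of_epi (biprod.inr ≫ biprod.inr) (c i)
    have : Mono (m i) := by
      refine Preadditive.mono_of_cancel_zero _ fun {U} t ht => ?_
      have t1 : (t ≫ biprod.fst) ≫ g i = 0 := by
        have := congrArg (· ≫ biprod.fst) ht
        have e : m i ≫ biprod.fst = biprod.fst ≫ g i := by ext <;> simp [m]
        simpa [e] using this
      have t2 : (t ≫ biprod.fst) ≫ φ i = 0 := by
        have := congrArg (· ≫ biprod.snd ≫ biprod.snd) ht
        have e : m i ≫ biprod.snd ≫ biprod.snd = biprod.fst ≫ φ i := by ext <;> simp [m]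
        simpa [e] using this
      have t3 : t ≫ biprod.snd = 0 := by
        have := congrArg (· ≫ biprod.snd ≫ biprod.fst) ht
        have e : m i ≫ biprod.snd ≫ biprod.fst = biprod.snd := by ext <;> simp [m]
        simpa [e] using this
      obtain ⟨v, hv⟩ := (hkg i).lift _ t1
      have hv0 : v = 0 := by
        have := hψ i
        rw [← cancel_mono (ψ i), ← hφ, ← Category.assoc, hv, t2, zero_comp]
      ext
      · rw [← hv, hv0, zero_comp, zero_comp]
      · rw [t3, zero_comp]
    refine Ses.of_desc ?_ fun U t ht => ?_
    · ext
      · simp [m, c, hs]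
      · simp [m, c]
    · have t1 : g i ≫ biprod.inl ≫ t + φ i ≫ biprod.inr ≫ biprod.inr ≫ t = 0 := by
        have := congrArg (biprod.inl ≫ ·) ht
        simpa [m] using this
      have t2 : biprod.inl ≫ biprod.inr ≫ t = 0 := by
        have := congrArg (biprod.inr ≫ ·) ht
        simpa [m] using this
      obtain ⟨v, hv⟩ := (hr i).desc (biprod.inr ≫ biprod.inr ≫ t) (by
        have := congrArg (k i ≫ ·) t1
        simpa only [Preadditive.comp_add, reassoc_of% (hkg i).zero, zero_comp, zero_add,
          reassoc_of% (hφ i), comp_zero] using this)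
      refine ⟨v, ?_⟩
      have := (hkg i).epi
      ext
      · rw [← cancel_epi (g i), ← Category.assoc biprod.inl]
        simp only [c, biprod.inl_desc, Preadditive.neg_comp, Preadditive.comp_neg]
        rw [reassoc_of% (hs i), hv]
        exact (eq_neg_of_add_eq_zero_left t1).symm
      · rw [t2]
        simp [c]
      · rw [← hv]
        simp [c]
  obtain ⟨Z, hZ⟩ := exists_of_Y hS W (fun i => G i ⊞ Q i) K
    (fun i => hS.G_biprod _ _ (hG i) (hS.proj_G _ (hQ i).1 (hQ i).2)) hK
    (bQ.of_imp (Bdd.of_imp_one Y.bdd hG0) fun i h h' => (biprod_isZero_iff _ _).2 ⟨h', h⟩)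
    m c hm (fun i => by
      -- Already on the summand `Q` the map is the invertible unit followed by `H' r`, which is epi
      -- since `H'` is exact on sequences starting in `𝓚`. The projective summand was added for this
      -- surjectivity.
      have e : Φ.L.map biprod.inr ≫ Φ.L.map (m (i + 1)) ≫ W.d i ≫ Φ.H'.map (c i) =
          Φ.un' _ ≫ Φ.H'.map (r i) := by
        have e1 : W.d i = Φ.L.map biprod.fst ≫ Y.d i ≫ Φ.H'.map biprod.inl +
          Φ.L.map biprod.snd ≫ (Φ.L.map biprod.fst ≫ Φ.un' _ ≫ Φ.H'.map biprod.inr) ≫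
            Φ.H'.map biprod.inr := rfl
        have e2 : Φ.L.map (biprod.inr : Q (i + 1) ⟶ G (i + 1) ⊞ Q (i + 1)) ≫
            Φ.L.map (m (i + 1)) ≫ Φ.L.map biprod.fst = 0 := by
          simp [m, ← Functor.map_comp]
        have e3 : Φ.L.map (biprod.inr : Q (i + 1) ⟶ G (i + 1) ⊞ Q (i + 1)) ≫
            Φ.L.map (m (i + 1)) ≫ Φ.L.map biprod.snd ≫ Φ.L.map biprod.fst = 𝟙 _ := by
          simp [m, ← Functor.map_comp]
        rw [e1, Preadditive.add_comp, Preadditive.comp_add, Preadditive.comp_add]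
        simp only [Category.assoc]
        rw [reassoc_of% e2, reassoc_of% e3, zero_comp, zero_add, ← Functor.map_comp,
          ← Functor.map_comp]
        congr 2
        simp [c]
      have := hS.isIso_un' _ (LQB (i + 1))
      have := (hS.H'_ses (hr i) (hK' i)).epi
      have : Epi (Φ.L.map (biprod.inr : Q (i + 1) ⟶ G (i + 1) ⊞ Q (i + 1)) ≫
          Φ.L.map (m (i + 1)) ≫ W.d i ≫ Φ.H'.map (c i)) := e ▸ epi_comp _ _
      exact epi_of_epi (Φ.L.map (biprod.inr : Q (i + 1) ⟶ G (i + 1) ⊞ Q (i + 1))) _)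
  have key : ∃ (s : Y ⟶ W) (r : W ⟶ Y),
      s ≫ r = 𝟙 Y ∧ Rep.Null W W fun i => (𝟙 W : W ⟶ W).f i - (r ≫ s).f i := by
    refine ⟨Rep.biprodInl hS.nakD Y I, Rep.biprodFst hS.nakD Y I, ?_, ?_⟩
    · ext i : 1
      exact biprod.inl_fst
    · rw [Rep.null_iff_factors (hΦ := hS.nakD)]
      refine ⟨Q, hQ, bQ, Rep.biprodSnd hS.nakD Y I, Rep.biprodInr hS.nakD Y I, fun i => ?_⟩
      change 𝟙 (Y.X i ⊞ I.X i) - biprod.fst ≫ biprod.inl = biprod.snd ≫ biprod.inr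
      rw [← biprod.total]
      abel
  exact ⟨Z, hZ ▸ key⟩

variable (Φ 𝓑 𝓐) in
/-- The first component. -/
@[simps] def fst : Link Φ 𝓑 𝓐 ⥤ Rep Φ where
  obj Z := Z.X
  map h := h.f
  map_id _ := rfl
  map_comp _ _ := rfl

variable (Φ 𝓑 𝓐) in
/-- The second component. -/
@[simps] def snd : Link Φ 𝓑 𝓐 ⥤ Rep Φ.swap where
  obj Z := Z.Y
  map h := h.y
  map_id _ := rfl
  map_comp _ _ := rfl

/-- The difference of two morphisms. -/
@[simps] def homSub {Z Z' : Link Φ 𝓑 𝓐} (h h' : Z ⟶ Z') : Z ⟶ Z' where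
  f := Rep.homSub h.f h'.f
  a i := h.a i - h'.a i
  y := Rep.homSub h.y h'.y
  ι_a i := by
    rw [Preadditive.comp_sub, h.ι_a, h'.ι_a, ← Preadditive.sub_comp]
    rfl
  j_y i := by
    rw [Functor.map_sub, Preadditive.sub_comp, ← h.j_y, ← h'.j_y, ← Preadditive.comp_sub]
    rfl

/-- The equivalence of stable categories given by linked repe-complexes. -/
theorem exists_stable_equivalence (hS : CounterSetup Φ 𝓑 𝓐 𝓖 𝓚) {E E' : Type*} [Category E]
    [Category E'] (p : Rep Φ ⥤ E) (p' : Rep Φ.swap ⥤ E') [p.Full] [p.EssSurj] [p'.Full]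
    [p'.EssSurj]
    (hp : ∀ (X Y : Rep Φ) (f g : X ⟶ Y),
      p.map f = p.map g ↔ Rep.Null X Y fun i => f.f i - g.f i)
    (hp' : ∀ (X Y : Rep Φ.swap) (f g : X ⟶ Y),
      p'.map f = p'.map g ↔ Rep.Null X Y fun i => f.f i - g.f i) :
    ∃ e : E ≌ E', Nonempty ((fst Φ 𝓑 𝓐 ⋙ p) ⋙ e.functor ≅ snd Φ 𝓑 𝓐 ⋙ p') := by
  have hpn : ∀ {X Y : Rep Φ.swap} {f g : X ⟶ Y}, p'.map f = p'.map g ↔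
    Rep.Null X Y fun i => f.f i - g.f i := hp' _ _ _ _
  have : (fst Φ 𝓑 𝓐 ⋙ p).Full := ⟨fun {Z Z'} t => by
    obtain ⟨f, rfl⟩ := p.map_surjective t
    obtain ⟨h, rfl⟩ := exists_hom_of_X hS (f : Z.X ⟶ Z'.X)
    exact ⟨h, rfl⟩⟩
  have : (snd Φ 𝓑 𝓐 ⋙ p').Full := ⟨fun {Z Z'} t => by
    obtain ⟨y, rfl⟩ := p'.map_surjective t
    obtain ⟨h, hh⟩ := exists_hom_of_Y hS (y : Z.Y ⟶ Z'.Y)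
    exact ⟨h, (hpn.2 hh).symm⟩⟩
  have : (fst Φ 𝓑 𝓐 ⋙ p).EssSurj := ⟨fun t => by
    obtain ⟨Z, hZ⟩ := exists_link_X hS (p.objPreimage t)
    exact ⟨Z, ⟨p.mapIso (eqToIso hZ) ≪≫ p.objObjPreimageIso t⟩⟩⟩
  have : (snd Φ 𝓑 𝓐 ⋙ p').EssSurj := ⟨fun t => by
    obtain ⟨Z, s, r, h1, h2⟩ := exists_link_Y hS (p'.objPreimage t)
    have e1 : p'.map s ≫ p'.map r = 𝟙 _ := by rw [← p'.map_comp, h1, p'.map_id]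
    have e2 : p'.map r ≫ p'.map s = 𝟙 _ := by
      rw [← p'.map_comp, ← p'.map_id]
      exact (hpn.2 h2).symm
    exact ⟨Z, ⟨Iso.symm ⟨p'.map s, p'.map r, e1, e2⟩ ≪≫ p'.objObjPreimageIso t⟩⟩⟩
  refine exists_equivalence_of_full_of_essSurj (fst Φ 𝓑 𝓐 ⋙ p) (snd Φ 𝓑 𝓐 ⋙ p')
    fun Z Z' f g => ⟨fun h => hpn.2 ?_, fun h => (hp _ _ _ _).2 ?_⟩
  · exact Hom.null_y_of_null_f hS (homSub f g) ((hp _ _ _ _).1 h)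
  · exact Hom.null_f_of_null_y hS (homSub f g) (hpn.1 h)

/-- The linked repe-complexes of a family of members of `𝓐` with zero differentials. -/
@[reducible] def ofZero (hS : CounterSetup Φ 𝓑 𝓐 𝓖 𝓚) (X : Rep Φ) (hX : ∀ i, 𝓐 (X.X i))
    (h0 : ∀ i, X.d i = 0) : Link Φ 𝓑 𝓐 where
  X := X
  Y :=
    { X := fun i => Φ.H.obj (X.X i)
      fg := fun i => hS.fg_G _ (hS.H_mem _ (hX i))
      bdd := Bdd.of_imp_one X.bdd fun i h => Functor.map_isZero Φ.H h
      d := fun _ => 0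
      d_comp := fun _ => by rw [Φ.swap.sh_zero, zero_comp] }
  A := X.X
  B _ := 0
  hA := hX
  hB _ := hS.zero_B _ (isZero_zero _)
  bdd := X.bdd
  ι _ := 𝟙 _
  π _ := 0
  ses i := by
    have : Epi (0 : X.X i ⟶ 0) := (isZero_zero C).epi _
    exact Ses.of_lift comp_zero fun W t _ => ⟨t, Category.comp_id _⟩
  j _ := 𝟙 _
  μ _ := 0
  κ _ := 0
  sesY i := by
    have : Epi (0 : Φ.H.obj (X.X i) ⟶ Φ.L'.obj 0) :=
      (Functor.map_isZero Φ.L' (isZero_zero C)).epi _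
    exact Ses.of_lift comp_zero fun W t _ => ⟨t, Category.comp_id _⟩
  μ_κ _ := by simp
  sq i := by simp [h0]
  j_d i := by simp

/-- `ofZero` on morphisms. -/
@[reducible] def ofZeroMap (hS : CounterSetup Φ 𝓑 𝓐 𝓖 𝓚) {X X' : Rep Φ} (f : X ⟶ X')
    (hX : ∀ i, 𝓐 (X.X i)) (h0 : ∀ i, X.d i = 0) (hX' : ∀ i, 𝓐 (X'.X i))
    (h0' : ∀ i, X'.d i = 0) : ofZero hS X hX h0 ⟶ ofZero hS X' hX' h0' where
  f := f
  a := f.f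
  y := ⟨fun i => Φ.H.map (f.f i), fun i => by rw [zero_comp, comp_zero]⟩
  ι_a i := by simp
  j_y i := by simp

/-- A functor with values in the repe-complexes with zero differentials and terms in `𝓐` lifts to
linked repe-complexes. -/
@[simps] def ofZeroFunctor (hS : CounterSetup Φ 𝓑 𝓐 𝓖 𝓚) {J : Type*} [Category J] (F : J ⥤ Rep Φ)
    (hF : ∀ a i, 𝓐 ((F.obj a).X i)) (h0 : ∀ a i, (F.obj a).d i = 0) : J ⥤ Link Φ 𝓑 𝓐 where
  obj a := ofZero hS (F.obj a) (hF a) (h0 a)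
  map f := ofZeroMap hS (F.map f) _ _ _ _
  map_id a := by
    refine Hom.ext (F.map_id a) (funext fun i => ?_) (Rep.hom_ext fun i => ?_)
    · change (F.map (𝟙 a)).f i = _
      rw [F.map_id]
      rfl
    · change Φ.H.map ((F.map (𝟙 a)).f i) = _
      rw [F.map_id]
      exact Φ.H.map_id _
  map_comp f g := by
    refine Hom.ext (F.map_comp f g) (funext fun i => ?_) (Rep.hom_ext fun i => ?_)
    · change (F.map (f ≫ g)).f i = _
      rw [F.map_comp]
      rfl
    · change Φ.H.map ((F.map (f ≫ g)).f i) = _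
      rw [F.map_comp]
      exact Φ.H.map_comp _ _

end Link

end Links

end WakamatsuTilting

end

set_option linter.unusedSectionVars false

noncomputable section

namespace WakamatsuTilting

open Limits ZeroObject

/-! ### Categories resembling the modules over an artin algebra -/

section ModLike

universe v w

variable {C D : Type w} [Category.{v} C] [Category.{v} D] [Abelian C] [Abelian D]

/-- The direct sum of `n` copies of `X`. -/
def power (X : C) : ℕ → C
  | 0 => 0
  | n + 1 => X ⊞ power X n

theorem power_mem {P : ObjectProperty C} (h0 : ∀ X, IsZero X → P X)
    (h : ∀ X Y, P X → P Y → P (X ⊞ Y)) {X : C} (hX : P X) : ∀ n, P (power X n)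
  | 0 => h0 _ (isZero_zero C)
  | n + 1 => h _ _ hX (power_mem h0 h hX n)

instance power_projective (X : C) [Projective X] : ∀ n, Projective (power X n)
  | 0 => inferInstanceAs (Projective (0 : C))
  | n + 1 =>
    have := power_projective X n
    inferInstanceAs (Projective (X ⊞ power X n))

instance power_injective (X : C) [Injective X] : ∀ n, Injective (power X n)
  | 0 => inferInstanceAs (Injective (0 : C))
  | n + 1 =>
    have := power_injective X n
    inferInstanceAs (Injective (X ⊞ power X n))

/-- An isomorphism induces an isomorphism of direct sums of copies. -/
def powerIso {X Y : C} (e : X ≅ Y) : ∀ n, power X n ≅ power Y n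
  | 0 => Iso.refl _
  | n + 1 => biprod.mapIso e (powerIso e n)

/-- Additive functors preserve direct sums of copies. -/
def mapPowerIso (F : C ⥤ D) [F.Additive] (X : C) : ∀ n, F.obj (power X n) ≅ power (F.obj X) n
  | 0 => F.mapZeroObject
  | n + 1 =>
    have : PreservesBinaryBiproducts F := preservesBinaryBiproducts_of_preservesBiproducts F
    F.mapBiprod X (power X n) ≪≫ biprod.mapIso (Iso.refl _) (mapPowerIso F X n)

variable (k : Type v) [CommRing k] (J : Type v) [AddCommGroup J] [Module k J]

/-- `J` is an injective cogenerator. -/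
structure IsInjectiveCogenerator : Prop where
  extend : ∀ {M N : Type v} [AddCommGroup M] [Module k M] [AddCommGroup N] [Module k N]
    (i : M →ₗ[k] N), Function.Injective i → ∀ l : M →ₗ[k] J, ∃ l' : N →ₗ[k] J, ∀ m, l' (i m) = l m
  separate : ∀ {M : Type v} [AddCommGroup M] [Module k M] (m : M), m ≠ 0 →
    ∃ l : M →ₗ[k] J, l m ≠ 0

/-- The category `C` with its generator `R` and its cogenerator `E` resembles the category of
modules over an artin algebra with its regular module and the dual of the opposite regular
module. -/
structure ModLike [Linear k C] (fg : ObjectProperty C) (R E : C) (tr : (R ⟶ E) →ₗ[k] J) :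
    Prop where
  fg_R : fg R
  fg_E : fg E
  fg_quot : ∀ {X Y : C} (f : X ⟶ Y), Epi f → fg X → fg Y
  fg_sub : ∀ {X Y : C} (f : X ⟶ Y), Mono f → fg Y → fg X
  fg_ext : ∀ {X Y Z : C} {f : X ⟶ Y} {g : Y ⟶ Z}, Ses f g → fg X → fg Z → fg Y
  projective : Projective R
  cover : ∀ X, fg X → ∃ (n : ℕ) (p : power R n ⟶ X), Epi p
  embed : ∀ X, fg X → ∃ (n : ℕ) (i : X ⟶ power E n), Mono i
  right_approx : ∀ X Y, fg X → fg Y →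
    ∃ (n : ℕ) (p : power X n ⟶ Y), ∀ h : X ⟶ Y, ∃ s, s ≫ p = h
  left_approx : ∀ X Y, fg X → fg Y →
    ∃ (n : ℕ) (i : X ⟶ power Y n), ∀ h : X ⟶ Y, ∃ s, i ≫ s = h
  rep : ∀ (A : C) (l : (R ⟶ A) →ₗ[k] J), ∃ a : A ⟶ E, ∀ u, tr (u ≫ a) = l u
  rep' : ∀ Y, fg Y → ∀ l : (Y ⟶ E) →ₗ[k] J, ∃ y : R ⟶ Y, ∀ f, tr (y ≫ f) = l f
  eq_zero : ∀ {A : C} (a : A ⟶ E), (∀ u : R ⟶ A, tr (u ≫ a) = 0) → a = 0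
  eq_zero' : ∀ {Y : C} (y : R ⟶ Y), (∀ f : Y ⟶ E, tr (y ≫ f) = 0) → y = 0
  gen : ∀ {X A : C} (a : X ⟶ A), (∀ u : R ⟶ X, u ≫ a = 0) → a = 0
  fitting : ∃ len : C → ℕ, ∀ X, fg X → ∀ φ : X ⟶ X, IsIso φ ∨
    ∃ (Y : C) (e : X ⟶ Y) (m : Y ⟶ X), len Y < len X ∧ IsIso (m ≫ e) ∧
      (∀ (Z : C) (f : X ⟶ Z), φ ≫ f = f → e ≫ m ≫ f = f) ∧
      ∀ (Z : C) (f : Z ⟶ X), f ≫ φ = f → f ≫ e ≫ m = f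

namespace ModLike

variable {k J} [Linear k C] {fg : ObjectProperty C} {R E : C} {tr : (R ⟶ E) →ₗ[k] J}
  (h : ModLike k J fg R E tr)

include h

theorem fg_zero (X : C) (hX : IsZero X) : fg X :=
  h.fg_sub (0 : X ⟶ R) (hX.mono _) h.fg_R

theorem fg_biprod (X Y : C) (hX : fg X) (hY : fg Y) : fg (X ⊞ Y) :=
  h.fg_ext (Ses.biprod X Y) hX hY

theorem fg_iso {X Y : C} (e : X ≅ Y) (hX : fg X) : fg Y := h.fg_quot e.hom inferInstance hX

theorem fg_power {X : C} (hX : fg X) (n : ℕ) : fg (power X n) :=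
  power_mem h.fg_zero h.fg_biprod hX n

theorem cogen {X A : C} (a : X ⟶ A) (ha : ∀ e : A ⟶ E, a ≫ e = 0) : a = 0 :=
  h.gen a fun u => h.eq_zero' _ fun f => by rw [Category.assoc, ha, comp_zero, map_zero]

theorem hom_ext {X A : C} {a b : X ⟶ A}
    (hab : ∀ (u : R ⟶ X) (e : A ⟶ E), tr (u ≫ a ≫ e) = tr (u ≫ b ≫ e)) : a = b := by
  refine sub_eq_zero.1 (h.gen _ fun u => h.eq_zero' _ fun e => ?_)
  rw [Preadditive.comp_sub, Preadditive.sub_comp, map_sub, Category.assoc, Category.assoc, hab,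
    sub_self]

theorem epi_of_cancel {X Y : C} (f : X ⟶ Y) (hf : ∀ e : Y ⟶ E, f ≫ e = 0 → e = 0) : Epi f := by
  refine Preadditive.epi_of_cokernel_zero (h.cogen _ fun e => hf _ ?_)
  rw [← Category.assoc, cokernel.condition, zero_comp]

/-- The object `E` represents the functionals on `Hom(R, -)`, so the extension property of `J`
carries over to it. -/
theorem injective (hJ : IsInjectiveCogenerator k J) : Injective E where
  factors {X Y} a i hi := by
    obtain ⟨l, hl⟩ := hJ.extend (Linear.rightComp k R i)
      (fun u v huv => (cancel_mono i).1 huv) (tr.comp (Linear.rightComp k R a))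
    obtain ⟨b, hb⟩ := h.rep Y l
    refine ⟨b, sub_eq_zero.1 (h.eq_zero _ fun u => ?_)⟩
    have := hl u
    rw [Linear.rightComp_apply, ← hb, LinearMap.comp_apply, Linear.rightComp_apply] at this
    rw [Preadditive.comp_sub, map_sub, ← Category.assoc, this, sub_self]

theorem epi_of_lift {X Y : C} (f : X ⟶ Y) (hf : ∀ u : R ⟶ Y, ∃ s, s ≫ f = u) : Epi f := by
  have := h.projective
  refine Preadditive.epi_of_cokernel_zero (h.gen _ fun u => ?_)
  obtain ⟨s, rfl⟩ := hf u
  rw [Category.assoc, cokernel.condition, comp_zero]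

theorem mono_of_extend {X Y : C} (f : X ⟶ Y) (hf : ∀ u : X ⟶ E, ∃ s, f ≫ s = u) : Mono f := by
  refine Preadditive.mono_of_kernel_zero (h.cogen _ fun u => ?_)
  obtain ⟨s, rfl⟩ := hf u
  rw [← Category.assoc, kernel.condition, zero_comp]

end ModLike

end ModLike

/-! ### The setting of a Wakamatsu-tilting bimodule and its dual -/

section Context

universe v w x

variable {C D : Type w} [Category.{v} C] [Category.{v} D] [Abelian C] [Abelian D]
  (k : Type v) [CommRing k] (J : Type v) [AddCommGroup J] [Module k J] [Linear k C] [Linear k D]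
  [HasExt.{x} C] [HasExt.{x} D]

open Abelian

/-- The adjoint pairs given by a Wakamatsu-tilting bimodule and its dual. -/
structure WakamatsuContext (Φ : AdjointPairs C D) where
  cog : IsInjectiveCogenerator k J
  R : C
  E : C
  S : D
  F : D
  trC : (R ⟶ E) →ₗ[k] J
  trD : (S ⟶ F) →ₗ[k] J
  modC : ModLike k J Φ.fgC R E trC
  modD : ModLike k J Φ.fgD S F trD
  H_linear : Φ.H.Linear k
  L_linear : Φ.L.Linear k
  H'_linear : Φ.H'.Linear k
  L'_linear : Φ.L'.Linear k
  fg_H : ∀ X, Φ.fgC X → Φ.fgD (Φ.H.obj X)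
  fg_L : ∀ X, Φ.fgD X → Φ.fgC (Φ.L.obj X)
  fg_H' : ∀ X, Φ.fgD X → Φ.fgC (Φ.H'.obj X)
  fg_L' : ∀ X, Φ.fgC X → Φ.fgD (Φ.L'.obj X)
  isoE : Φ.H.obj E ≅ Φ.L'.obj R
  isoF : Φ.H'.obj F ≅ Φ.L.obj S
  tr_eq : ∀ (g : Φ.L.obj S ⟶ E) (h : R ⟶ Φ.L.obj S),
    trD (Φ.fl g ≫ isoE.hom ≫ Φ.sh' (h ≫ isoF.inv)) = trC (h ≫ g)
  isIso_un : IsIso (Φ.un S)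
  isIso_un' : IsIso (Φ.un' R)
  ext : ∀ i, 0 < i → Subsingleton (Ext.{x} (Φ.L.obj S) (Φ.L.obj S) i)
  ext' : ∀ i, 0 < i → Subsingleton (Ext.{x} (Φ.L'.obj R) (Φ.L'.obj R) i)

namespace WakamatsuContext

variable {k J} {Φ : AdjointPairs C D}

/-- Exchange of the two categories. -/
@[reducible] def swap (W : WakamatsuContext k J Φ) : WakamatsuContext k J Φ.swap where
  cog := W.cog
  R := W.S
  E := W.F
  S := W.R
  F := W.E
  trC := W.trD
  trD := W.trC
  modC := W.modD
  modD := W.modC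
  H_linear := W.H'_linear
  L_linear := W.L'_linear
  H'_linear := W.H_linear
  L'_linear := W.L_linear
  fg_H := W.fg_H'
  fg_L := W.fg_L'
  fg_H' := W.fg_H
  fg_L' := W.fg_L
  isoE := W.isoF
  isoF := W.isoE
  tr_eq g h := by
    have := W.tr_eq (Φ.sh (h ≫ W.isoE.inv)) (Φ.fl' g ≫ W.isoF.hom)
    rw [Φ.fl_sh, Category.assoc, W.isoE.inv_hom_id_assoc, Category.assoc, W.isoF.hom_inv_id,
      Category.comp_id, Φ.sh'_fl'] at this
    rw [this, Category.assoc]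
  isIso_un := W.isIso_un'
  isIso_un' := W.isIso_un
  ext := W.ext'
  ext' := W.ext

variable (W : WakamatsuContext k J Φ)

/-- The module `T` over the first algebra. -/
abbrev T : C := Φ.L.obj W.S

/-- The dual of `T`, over the second algebra. -/
abbrev T' : D := Φ.L'.obj W.R

theorem projS : Projective W.S := W.modD.projective

theorem projR : Projective W.R := W.modC.projective

theorem injE : Injective W.E := W.modC.injective W.cog

theorem injF : Injective W.F := W.modD.injective W.cog

theorem fgT : Φ.fgC W.T := W.fg_L _ W.modD.fg_R

theorem fgT' : Φ.fgD W.T' := W.fg_L' _ W.modC.fg_R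

/-- The property that all positive `Ext` groups from `X` to `Y` vanish. -/
def _root_.WakamatsuTilting.ExtZero {C : Type w} [Category.{v} C] [Abelian C] [HasExt.{x} C]
    (X Y : C) : Prop := ∀ i, 0 < i → Subsingleton (Ext.{x} X Y i)

/-- By adjunction and `H E ≅ T'`, morphisms from `L X` to the cogenerator `E` are morphisms from `X`
to `T'`; extending the former along `L f` is extending the latter along `f`. -/
theorem mono_L {X Y : D} (f : X ⟶ Y) (hf : ∀ u : X ⟶ W.T', ∃ s, f ≫ s = u) :
    Mono (Φ.L.map f) := by
  refine W.modC.mono_of_extend _ fun u => ?_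
  obtain ⟨s, hs⟩ := hf (Φ.fl u ≫ W.isoE.hom)
  refine ⟨Φ.sh (s ≫ W.isoE.inv), Φ.fl_injective ?_⟩
  rw [Φ.fl_map, Φ.fl_sh, ← Category.assoc, hs, Category.assoc, W.isoE.hom_inv_id,
    Category.comp_id]

theorem extend_of_mono_L {X Y : D} (f : X ⟶ Y) (hf : Mono (Φ.L.map f)) (u : X ⟶ W.T') :
    ∃ s, f ≫ s = u := by
  have := W.injE
  refine ⟨Φ.fl (Injective.factorThru (Φ.sh (u ≫ W.isoE.inv)) (Φ.L.map f)) ≫ W.isoE.hom, ?_⟩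
  rw [← Category.assoc, ← Φ.fl_map, Injective.comp_factorThru, Φ.fl_sh, Category.assoc,
    W.isoE.inv_hom_id, Category.comp_id]

theorem _root_.WakamatsuTilting.AdjointPairs.L_desc {X Y Z : D} {f : X ⟶ Y} {g : Y ⟶ Z}
    (h : Ses f g) {M : C} (t : Φ.L.obj Y ⟶ M) (ht : Φ.L.map f ≫ t = 0) :
    ∃ s, Φ.L.map g ≫ s = t := by
  obtain ⟨s, hs⟩ := h.desc (Φ.fl t) (by rw [← Φ.fl_map, ht, Φ.fl_zero])
  exact ⟨Φ.sh s, by rw [← Φ.sh_map, hs, Φ.sh_fl]⟩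

/-- The surjectivity of restriction to `T'`, which follows from `Ext¹(Z, T') = 0`, plays the role of
a vanishing `Tor₁`. -/
theorem ses_L {X Y Z : D} {f : X ⟶ Y} {g : Y ⟶ Z} (h : Ses f g)
    (hf : ∀ u : X ⟶ W.T', ∃ s, f ≫ s = u) : Ses (Φ.L.map f) (Φ.L.map g) := by
  have := W.mono_L f hf
  have := h.epi
  refine Ses.of_desc (by rw [← Functor.map_comp, h.zero, Functor.map_zero])
    fun M t ht => Φ.L_desc h t ht

theorem ses_H {X Y Z : C} {f : X ⟶ Y} {g : Y ⟶ Z} (h : Ses f g)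
    (hf : ∀ u : W.T ⟶ Z, ∃ s, s ≫ g = u) : Ses (Φ.H.map f) (Φ.H.map g) := by
  have := h.mono
  have : Epi (Φ.H.map g) := W.modD.epi_of_lift _ fun u => by
    obtain ⟨s, hs⟩ := hf (Φ.sh u)
    exact ⟨Φ.fl s, by rw [← Φ.fl_comp, hs, Φ.fl_sh]⟩
  exact Ses.of_lift (by rw [← Functor.map_comp, h.zero, Functor.map_zero])
    fun M t ht => h.lift_map t ht

theorem lift_of_epi_H {Y Z : C} (g : Y ⟶ Z) (hg : Epi (Φ.H.map g)) (u : W.T ⟶ Z) :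
    ∃ s, s ≫ g = u := by
  have := W.projS
  refine ⟨Φ.sh (Projective.factorThru (Φ.fl u) (Φ.H.map g)), ?_⟩
  rw [← Φ.sh_comp, Projective.factorThru_comp, Φ.sh_fl]

end WakamatsuContext

end Context

end WakamatsuTilting

end

set_option linter.unusedSectionVars false

noncomputable section

namespace WakamatsuTilting

open Limits ZeroObject Abelian

/-! ### Vanishing of positive `Ext` groups and isomorphism lemmas -/

section ExtZero

universe v w x

variable {C D : Type w} [Category.{v} C] [Category.{v} D] [Abelian C] [Abelian D]

section

variable {X Y Z X' Y' Z' : C} {f : X ⟶ Y} {g : Y ⟶ Z} {f' : X' ⟶ Y'} {g' : Y' ⟶ Z'}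
  {a : X ⟶ X'} {b : Y ⟶ Y'} {c : Z ⟶ Z'}

theorem Ses.isIso_first (h : Ses f g) (hf' : Mono f') (h0 : f' ≫ g' = 0) (hab : f ≫ b = a ≫ f')
    (hbc : g ≫ c = b ≫ g') (hb : IsIso b) (hc : Mono c) : IsIso a := by
  have := h.mono
  obtain ⟨r, hr⟩ := h.lift (f' ≫ inv b) (by
    rw [← cancel_mono c, Category.assoc, Category.assoc, hbc, IsIso.inv_hom_id_assoc, h0,
      zero_comp])
  refine ⟨r, ?_, ?_⟩
  · rw [← cancel_mono f, Category.assoc, hr, ← Category.assoc, ← hab, Category.assoc,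
      IsIso.hom_inv_id, Category.comp_id, Category.id_comp]
  · rw [← cancel_mono f', Category.assoc, ← hab, ← Category.assoc, hr, Category.assoc,
      IsIso.inv_hom_id, Category.comp_id, Category.id_comp]

theorem Ses.isIso_third (h' : Ses f' g') (hg : Epi g) (h0 : f ≫ g = 0) (hab : f ≫ b = a ≫ f')
    (hbc : g ≫ c = b ≫ g') (ha : Epi a) (hb : IsIso b) : IsIso c := by
  have := h'.epi
  obtain ⟨r, hr⟩ := h'.desc (inv b ≫ g) (by
    rw [← cancel_epi a, ← Category.assoc, ← hab, Category.assoc, IsIso.hom_inv_id_assoc, h0,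
      comp_zero])
  refine ⟨r, ?_, ?_⟩
  · rw [← cancel_epi g, ← Category.assoc, hbc, Category.assoc, hr, IsIso.hom_inv_id_assoc,
      Category.comp_id]
  · rw [← cancel_epi g', ← Category.assoc, hr, Category.assoc, hbc, IsIso.inv_hom_id_assoc,
      Category.comp_id]

theorem Ses.map_biprod (F : C ⥤ D) [F.Additive] (X Y : C) :
    Ses (F.map (biprod.inl : X ⟶ X ⊞ Y)) (F.map (biprod.snd : X ⊞ Y ⟶ Y)) := by
  refine Ses.of_lift (by rw [← F.map_comp, biprod.inl_snd, F.map_zero]) fun W t ht =>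
    ⟨t ≫ F.map biprod.fst, ?_⟩
  have := congrArg (fun s => t ≫ F.map s) (biprod.total (X := X) (Y := Y))
  simp only [F.map_add, F.map_comp, Preadditive.comp_add, reassoc_of% ht, zero_comp, add_zero,
    F.map_id, Category.comp_id] at this
  rw [Category.assoc, this]

theorem isIso_app_biprod {F G : C ⥤ D} [F.Additive] [G.Additive] (τ : F ⟶ G) (X Y : C)
    (hX : IsIso (τ.app X)) (hY : IsIso (τ.app Y)) : IsIso (τ.app (X ⊞ Y)) :=
  (Ses.map_biprod F X Y).isIso_of_isIso (Ses.map_biprod G X Y) (τ.app X) _ (τ.app Y)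
    (τ.naturality _) (τ.naturality _)

theorem isIso_app_zero {F G : C ⥤ D} [F.Additive] [G.Additive] (τ : F ⟶ G) (X : C)
    (hX : IsZero X) : IsIso (τ.app X) :=
  ⟨0, (F.map_isZero hX).eq_of_src _ _, (G.map_isZero hX).eq_of_src _ _⟩

theorem isIso_app_of_iso {F G : C ⥤ D} (τ : F ⟶ G) {X Y : C} (e : X ≅ Y)
    (hX : IsIso (τ.app X)) : IsIso (τ.app Y) := by
  have : τ.app Y = F.map e.inv ≫ τ.app X ≫ G.map e.hom := by
    rw [← τ.naturality, ← Category.assoc, ← F.map_comp, e.inv_hom_id, F.map_id, Category.id_comp]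
  rw [this]
  infer_instance

theorem isIso_app_of_retract {F G : C ⥤ D} (τ : F ⟶ G) {X Y : C} (e : Retract Y X)
    (hX : IsIso (τ.app X)) : IsIso (τ.app Y) := by
  refine ⟨G.map e.i ≫ inv (τ.app X) ≫ F.map e.r, ?_, ?_⟩
  · rw [← Category.assoc, ← τ.naturality, Category.assoc, IsIso.hom_inv_id_assoc, ← F.map_comp,
      e.retract, F.map_id]
  · rw [Category.assoc, Category.assoc, τ.naturality, IsIso.inv_hom_id_assoc, ← G.map_comp,
      e.retract, G.map_id]

end

variable [HasExt.{x} C] {X Y Z M N : C} {f : X ⟶ Y} {g : Y ⟶ Z}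

theorem extZero_of_projective (X Y : C) [Projective X] : ExtZero X Y := fun i hi => by
  obtain ⟨n, rfl⟩ := Nat.exists_eq_succ_of_ne_zero hi.ne'
  exact subsingleton_of_forall_eq 0 fun e => Ext.eq_zero_of_projective e

theorem extZero_of_injective (X Y : C) [Injective Y] : ExtZero X Y := fun i hi => by
  obtain ⟨n, rfl⟩ := Nat.exists_eq_succ_of_ne_zero hi.ne'
  exact subsingleton_of_forall_eq 0 fun e => Ext.eq_zero_of_injective e

theorem ExtZero.one (h : ExtZero X Y) : Subsingleton (Ext.{x} X Y 1) := h 1 one_pos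

theorem Ses.extZero_left_third (h : Ses f g) (hX : ExtZero X N) (hY : ExtZero Y N)
    (hZ : Subsingleton (Ext.{x} Z N 1)) : ExtZero Z N := fun i hi => by
  obtain ⟨n, rfl⟩ := Nat.exists_eq_succ_of_ne_zero hi.ne'
  rcases n.eq_zero_or_pos with rfl | hn
  · exact hZ
  · exact h.ext_shift_right (hX n hn) (hY _ hi)

theorem Ses.extZero_left_first (h : Ses f g) (hY : ExtZero Y N) (hZ : ExtZero Z N) :
    ExtZero X N := fun i hi => h.ext_shift_left (hZ _ (Nat.succ_pos i)) (hY i hi)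

theorem Ses.extZero_right_third (h : Ses f g) (hX : ExtZero M X) (hY : ExtZero M Y) :
    ExtZero M Z := fun i hi => h.ext_coshift_right (hX _ (Nat.succ_pos i)) (hY i hi)

theorem Ses.extZero_right_first (h : Ses f g) (hY : ExtZero M Y) (hZ : ExtZero M Z)
    (hX : Subsingleton (Ext.{x} M X 1)) : ExtZero M X := fun i hi => by
  obtain ⟨n, rfl⟩ := Nat.exists_eq_succ_of_ne_zero hi.ne'
  rcases n.eq_zero_or_pos with rfl | hn
  · exact hX
  · exact h.ext_coshift_left (hZ n hn) (hY _ hi)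

theorem Ses.extZero_middle_left (h : Ses f g) (hX : ExtZero X N) (hZ : ExtZero Z N) :
    ExtZero Y N := fun i hi => h.ext_middle_left (hX i hi) (hZ i hi)

theorem Ses.extZero_middle_right (h : Ses f g) (hX : ExtZero M X) (hZ : ExtZero M Z) :
    ExtZero M Y := fun i hi => h.ext_middle_right (hX i hi) (hZ i hi)

theorem ExtZero.of_iso_left (e : X ≅ Y) (h : ExtZero X N) : ExtZero Y N := fun i hi =>
  ext_of_iso_left e.symm (h i hi)

theorem ExtZero.of_iso_right (e : X ≅ Y) (h : ExtZero M X) : ExtZero M Y := fun i hi =>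
  ext_of_iso_right e.symm (h i hi)

theorem ExtZero.zero_left (h : IsZero X) (N : C) : ExtZero X N :=
  have := h.projective
  extZero_of_projective X N

theorem ExtZero.zero_right (h : IsZero X) (M : C) : ExtZero M X :=
  have := h.injective
  extZero_of_injective M X

theorem ExtZero.biprod_left (hX : ExtZero X N) (hY : ExtZero Y N) : ExtZero (X ⊞ Y) N :=
  (Ses.biprod X Y).extZero_middle_left hX hY

theorem ExtZero.biprod_right (hX : ExtZero M X) (hY : ExtZero M Y) : ExtZero M (X ⊞ Y) :=
  (Ses.biprod X Y).extZero_middle_right hX hY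

theorem ExtZero.power_left (hX : ExtZero X N) (n : ℕ) : ExtZero (power X n) N :=
  power_mem (P := fun X => ExtZero X N) (fun _ h => ExtZero.zero_left h N)
    (fun _ _ h h' => h.biprod_left h') hX n

theorem ExtZero.power_right (hX : ExtZero M X) (n : ℕ) : ExtZero M (power X n) :=
  power_mem (P := fun X => ExtZero M X) (fun _ h => ExtZero.zero_right h M)
    (fun _ _ h h' => h.biprod_right h') hX n

end ExtZero

/-! ### The Bass class and the Auslander class -/

section Context

universe v w x

variable {C D : Type w} [Category.{v} C] [Category.{v} D] [Abelian C] [Abelian D]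
  {k : Type v} [CommRing k] {J : Type v} [AddCommGroup J] [Module k J] [Linear k C] [Linear k D]
  [HasExt.{x} C] [HasExt.{x} D]

namespace AdjointPairs

variable (Φ : AdjointPairs C D)

theorem co_eq (X : C) : Φ.co X = Φ.adj.counit.app X := by
  simp [co, sh, Adjunction.homEquiv_counit]

theorem un_eq (X : D) : Φ.un X = Φ.adj.unit.app X := by
  simp [un, fl, Adjunction.homEquiv_unit]

theorem co_naturality {X Y : C} (f : X ⟶ Y) :
    Φ.L.map (Φ.H.map f) ≫ Φ.co Y = Φ.co X ≫ f := by rw [Φ.map_co, Φ.sh_hmap]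

theorem un_naturality {X Y : D} (f : X ⟶ Y) :
    f ≫ Φ.un Y = Φ.un X ≫ Φ.H.map (Φ.L.map f) := by rw [Φ.un_map, Φ.fl_lmap]

theorem un_co (X : C) : Φ.un (Φ.H.obj X) ≫ Φ.H.map (Φ.co X) = 𝟙 _ := by
  rw [Φ.un_map, Φ.fl_co]

theorem co_un (X : D) : Φ.L.map (Φ.un X) ≫ Φ.co (Φ.L.obj X) = 𝟙 _ := by
  rw [Φ.map_co, Φ.sh_un]

theorem isIso_co_biprod (X Y : C) (hX : IsIso (Φ.co X)) (hY : IsIso (Φ.co Y)) :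
    IsIso (Φ.co (X ⊞ Y)) := by
  rw [co_eq] at *
  exact isIso_app_biprod Φ.adj.counit X Y hX hY

theorem isIso_co_of_retract {X Y : C} (e : Retract Y X) (hX : IsIso (Φ.co X)) :
    IsIso (Φ.co Y) := by
  rw [co_eq] at *
  exact isIso_app_of_retract Φ.adj.counit e hX

theorem isIso_co_zero (X : C) (hX : IsZero X) : IsIso (Φ.co X) := by
  rw [co_eq]
  exact isIso_app_zero Φ.adj.counit X hX

theorem isIso_un_biprod (X Y : D) (hX : IsIso (Φ.un X)) (hY : IsIso (Φ.un Y)) :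
    IsIso (Φ.un (X ⊞ Y)) := by
  rw [un_eq] at *
  exact isIso_app_biprod Φ.adj.unit X Y hX hY

theorem isIso_un_of_iso {X Y : D} (e : X ≅ Y) (hX : IsIso (Φ.un X)) : IsIso (Φ.un Y) := by
  rw [un_eq] at *
  exact isIso_app_of_iso Φ.adj.unit e hX

theorem isIso_un_of_retract {X Y : D} (e : Retract Y X) (hX : IsIso (Φ.un X)) :
    IsIso (Φ.un Y) := by
  rw [un_eq] at *
  exact isIso_app_of_retract Φ.adj.unit e hX

theorem isIso_un_zero (X : D) (hX : IsZero X) : IsIso (Φ.un X) := by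
  rw [un_eq]
  exact isIso_app_zero Φ.adj.unit X hX

theorem isIso_un_H {X : C} (hX : IsIso (Φ.co X)) : IsIso (Φ.un (Φ.H.obj X)) := by
  have : Φ.un (Φ.H.obj X) = inv (Φ.H.map (Φ.co X)) :=
    IsIso.eq_inv_of_inv_hom_id (Φ.un_co X)
  rw [this]
  infer_instance

theorem isIso_co_L {X : D} (hX : IsIso (Φ.un X)) : IsIso (Φ.co (Φ.L.obj X)) := by
  have : Φ.co (Φ.L.obj X) = inv (Φ.L.map (Φ.un X)) :=
    IsIso.eq_inv_of_hom_inv_id (Φ.co_un X)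
  rw [this]
  infer_instance

end AdjointPairs

namespace WakamatsuContext

variable {Φ : AdjointPairs C D} (W : WakamatsuContext k J Φ)

/-- The Bass class. -/
def bass : ObjectProperty C := fun A =>
  Φ.fgC A ∧ ExtZero W.T A ∧ IsIso (Φ.co A) ∧ ExtZero (Φ.H.obj A) W.T'

/-- The class corresponding to the Bass class. -/
def cobass : ObjectProperty D := fun G =>
  Φ.fgD G ∧ ExtZero G W.T' ∧ IsIso (Φ.un G) ∧ ExtZero W.T (Φ.L.obj G)

variable {W}

theorem bass.H {A : C} (h : W.bass A) : W.cobass (Φ.H.obj A) := by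
  obtain ⟨h1, h2, h3, h4⟩ := h
  exact ⟨W.fg_H _ h1, h4, Φ.isIso_un_H h3, h2.of_iso_right (asIso (Φ.co A)).symm⟩

theorem cobass.L {G : D} (h : W.cobass G) : W.bass (Φ.L.obj G) := by
  obtain ⟨h1, h2, h3, h4⟩ := h
  exact ⟨W.fg_L _ h1, h4, Φ.isIso_co_L h3, h2.of_iso_left (asIso (Φ.un G))⟩

theorem cobass.of_iso {A A' : D} (e : A ≅ A') (h : W.cobass A) : W.cobass A' := by
  obtain ⟨h1, h2, h3, h4⟩ := h
  exact ⟨W.modD.fg_iso e h1, h2.of_iso_left e, Φ.isIso_un_of_iso e h3,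
    h4.of_iso_right (Φ.L.mapIso e)⟩

variable (W)

theorem bass_zero (X : C) (h : IsZero X) : W.bass X :=
  ⟨W.modC.fg_zero X h, ExtZero.zero_right h _, Φ.isIso_co_zero X h,
    ExtZero.zero_left (Φ.H.map_isZero h) _⟩

theorem cobass_zero (X : D) (h : IsZero X) : W.cobass X :=
  ⟨W.modD.fg_zero X h, ExtZero.zero_left h _, Φ.isIso_un_zero X h,
    ExtZero.zero_right (Φ.L.map_isZero h) _⟩

theorem bass_biprod (X Y : C) (hX : W.bass X) (hY : W.bass Y) : W.bass (X ⊞ Y) := by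
  refine ⟨W.modC.fg_biprod X Y hX.1 hY.1, hX.2.1.biprod_right hY.2.1,
    Φ.isIso_co_biprod X Y hX.2.2.1 hY.2.2.1, ?_⟩
  exact (Ses.map_biprod Φ.H X Y).extZero_middle_left hX.2.2.2 hY.2.2.2

theorem cobass_biprod (X Y : D) (hX : W.cobass X) (hY : W.cobass Y) : W.cobass (X ⊞ Y) := by
  refine ⟨W.modD.fg_biprod X Y hX.1 hY.1, hX.2.1.biprod_left hY.2.1,
    Φ.isIso_un_biprod X Y hX.2.2.1 hY.2.2.1, ?_⟩
  exact (Ses.map_biprod Φ.L X Y).extZero_middle_right hX.2.2.2 hY.2.2.2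

theorem cobass_S : W.cobass W.S :=
  have := W.projS
  ⟨W.modD.fg_R, extZero_of_projective _ _, W.isIso_un, W.ext⟩

theorem bass_T : W.bass W.T := W.cobass_S.L

theorem cobass_power_S (n : ℕ) : W.cobass (power W.S n) :=
  power_mem W.cobass_zero W.cobass_biprod W.cobass_S n

/-- An endomorphism `f` of `E` and its transpose `r` on `R` correspond under the identification of
`H E` with `L' R`, because `tr_eq` makes that identification respect traces, and traces separate
morphisms. -/
theorem dual_end_comm {f : W.E ⟶ W.E} {r : W.R ⟶ W.R}
    (hr : ∀ u : W.R ⟶ W.E, W.trC (r ≫ u) = W.trC (u ≫ f)) :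
    Φ.H.map f ≫ W.isoE.hom = W.isoE.hom ≫ Φ.L'.map r := by
  refine W.modD.hom_ext fun s t => ?_
  have h1 := W.tr_eq (Φ.sh s ≫ f) (Φ.fl' t ≫ W.isoF.hom)
  have h2 := W.tr_eq (Φ.sh s) (r ≫ Φ.fl' t ≫ W.isoF.hom)
  simp only [Category.assoc, W.isoF.hom_inv_id, Category.comp_id, Φ.fl_comp, Φ.fl_sh, Φ.sh'_map,
    Φ.sh'_fl', hr] at h1 h2 ⊢
  rw [h1, h2]

/-- Transposition matches endomorphisms of `E` with those of `R`, and `L'` is fully faithful on `R`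
since the unit there is invertible. Hence no nonzero endomorphism of `E` is killed by the counit,
and every morphism `L H E ⟶ E` factors through it; as `E` cogenerates, the counit is epi and mono.
-/
theorem isIso_co_E : IsIso (Φ.co W.E) := by
  have h1 : Epi (Φ.co W.E) := W.modC.epi_of_cancel _ fun f hf => by
    obtain ⟨r, hr⟩ := W.modC.rep' W.R W.modC.fg_R (W.trC.comp (Linear.rightComp k W.R f))
    replace hr : ∀ u : W.R ⟶ W.E, W.trC (r ≫ u) = W.trC (u ≫ f) := hr
    have h2 := W.dual_end_comm hr
    have h3 : Φ.H.map f = 0 := Φ.sh_injective (by rw [Φ.sh_hmap, hf, Φ.sh_zero])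
    rw [h3, zero_comp] at h2
    have := W.isIso_un'
    have h4 : Φ.L'.map r = 0 := by
      rw [← cancel_epi W.isoE.hom, ← h2, comp_zero]
    have h5 : r = 0 := by
      rw [← cancel_mono (Φ.un' W.R), ← Φ.fl'_lmap, h4, Φ.fl'_zero, zero_comp]
    exact W.modC.eq_zero _ fun u => by rw [← hr, h5, zero_comp, map_zero]
  have h2 : Mono (Φ.co W.E) := W.modC.mono_of_extend _ fun u => by
    have := W.isIso_un'
    let t : Φ.L'.obj W.R ⟶ Φ.L'.obj W.R := W.isoE.inv ≫ Φ.fl u ≫ W.isoE.hom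
    let r : W.R ⟶ W.R := Φ.fl' t ≫ inv (Φ.un' W.R)
    have hr : Φ.L'.map r = t := Φ.fl'_injective (by
      rw [Φ.fl'_lmap, Category.assoc, IsIso.inv_hom_id, Category.comp_id])
    obtain ⟨f, hf⟩ := W.modC.rep W.E (W.trC.comp (Linear.leftComp k W.E r))
    replace hf : ∀ u : W.R ⟶ W.E, W.trC (u ≫ f) = W.trC (r ≫ u) := hf
    refine ⟨f, Φ.fl_injective ?_⟩
    have h2 := W.dual_end_comm fun u => (hf u).symm
    rw [← Φ.sh_hmap, Φ.fl_sh, ← cancel_mono W.isoE.hom, h2, hr, W.isoE.hom_inv_id_assoc]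
  exact isIso_of_mono_of_epi _

end WakamatsuContext

end Context

end WakamatsuTilting

end

set_option linter.unusedSectionVars false

noncomputable section

namespace WakamatsuTilting

open Limits ZeroObject Abelian

/-! ### Closure properties of the Bass classes and their perpendicular classes -/

section Context

universe v w x

variable {C D : Type w} [Category.{v} C] [Category.{v} D] [Abelian C] [Abelian D]
  {k : Type v} [CommRing k] {J : Type v} [AddCommGroup J] [Module k J] [Linear k C] [Linear k D]
  [HasExt.{x} C] [HasExt.{x} D] {Φ : AdjointPairs C D} (W : WakamatsuContext k J Φ)

namespace WakamatsuContext

theorem bass_E : W.bass W.E :=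
  have := W.injE
  ⟨W.modC.fg_E, extZero_of_injective _ _, W.isIso_co_E, ExtZero.of_iso_left W.isoE.symm W.ext'⟩

theorem bass_power_E (n : ℕ) : W.bass (power W.E n) :=
  power_mem W.bass_zero W.bass_biprod W.bass_E n

theorem bass_power_T (n : ℕ) : W.bass (power W.T n) :=
  power_mem W.bass_zero W.bass_biprod W.bass_T n

/-- `T'` corresponds to the injective cogenerator. -/
theorem cobass_T' : W.cobass W.T' := W.bass_E.H.of_iso W.isoE

theorem cobass_power_T' (n : ℕ) : W.cobass (power W.T' n) :=
  power_mem W.cobass_zero W.cobass_biprod W.cobass_T' n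

section

variable {W} {X Y Z : C} {f : X ⟶ Y} {g : Y ⟶ Z}

theorem bass.ses_H (hX : W.bass X) (h : Ses f g) : Ses (Φ.H.map f) (Φ.H.map g) :=
  W.ses_H h fun u => h.exists_lift hX.2.1.one u

/-- `H` keeps the sequence exact because `Ext¹(T, X) = 0`, and `L` returns the original one up to
counits. In particular `L H f` is mono, and this is what gives `Ext¹(H Z, T') = 0`. -/
theorem bass.coker (hX : W.bass X) (hY : W.bass Y) (h : Ses f g) : W.bass Z := by
  have hH := hX.ses_H h
  have := h.epi
  have := h.mono
  have := hH.epi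
  have i1 := hX.2.2.1
  have i2 := hY.2.2.1
  refine ⟨W.modC.fg_quot g inferInstance hY.1, h.extZero_right_third hX.2.1 hY.2.1, ?_, ?_⟩
  · exact Ses.isIso_third h (f := Φ.L.map (Φ.H.map f)) (g := Φ.L.map (Φ.H.map g)) inferInstance
      (by rw [← Functor.map_comp, hH.zero, Functor.map_zero]) (Φ.co_naturality f)
      (Φ.co_naturality g) inferInstance i2
  · refine hH.extZero_left_third hX.2.2.2 hY.2.2.2 (hH.ext_one_of_extension hY.2.2.2.one fun t =>
      W.extend_of_mono_L _ ?_ t)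
    have e : Φ.L.map (Φ.H.map f) = Φ.co X ≫ f ≫ inv (Φ.co Y) := by
      rw [← Category.assoc, ← Φ.co_naturality, Category.assoc, IsIso.hom_inv_id, Category.comp_id]
    rw [e]
    infer_instance

end

section

variable {W} {X Y Z : D} {f : X ⟶ Y} {g : Y ⟶ Z}

theorem cobass.ses_L (hZ : W.cobass Z) (h : Ses f g) : Ses (Φ.L.map f) (Φ.L.map g) :=
  W.ses_L h fun u => h.exists_extension hZ.2.1.one u

/-- Mirror image of `bass.coker`: here `H L g` is epi, which supplies `Ext¹(T, L X) = 0`. -/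
theorem cobass.ker (hY : W.cobass Y) (hZ : W.cobass Z) (h : Ses f g) : W.cobass X := by
  have hL := hZ.ses_L h
  have := h.epi
  have := h.mono
  have := hL.mono
  have i1 := hY.2.2.1
  have i2 := hZ.2.2.1
  refine ⟨W.modD.fg_sub f inferInstance hY.1, h.extZero_left_first hY.2.1 hZ.2.1, ?_, ?_⟩
  · exact Ses.isIso_first h (f' := Φ.H.map (Φ.L.map f)) (g' := Φ.H.map (Φ.L.map g)) inferInstance
      (by rw [← Functor.map_comp, hL.zero, Functor.map_zero]) (Φ.un_naturality f)
      (Φ.un_naturality g) i1 inferInstance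
  · refine hL.extZero_right_first hY.2.2.2 hZ.2.2.2 (hL.ext_one_of_lift hY.2.2.2.one fun t =>
      W.lift_of_epi_H _ ?_ t)
    have e : Φ.H.map (Φ.L.map g) = inv (Φ.un Y) ≫ g ≫ Φ.un Z := by
      rw [Φ.un_naturality, IsIso.inv_hom_id_assoc]
    rw [e]
    infer_instance

theorem cobass.cover {G : D} (hG : W.cobass G) : ∃ (n : ℕ) (G₁ : D) (i : G₁ ⟶ power W.S n)
    (p : power W.S n ⟶ G), Ses i p ∧ W.cobass G₁ := by
  obtain ⟨n, p, hp⟩ := W.modD.cover G hG.1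
  exact ⟨n, _, _, p, Ses.of_epi p, (W.cobass_power_S n).ker hG (Ses.of_epi p)⟩

end

/-- Each member of the Bass class is a quotient of a sum of copies of `T` by a member of the
Bass class. -/
theorem bass.cover {W : WakamatsuContext k J Φ} {A : C} (hA : W.bass A) :
    ∃ (n : ℕ) (A₁ : C) (i : A₁ ⟶ power W.T n) (p : power W.T n ⟶ A), Ses i p ∧ W.bass A₁ := by
  obtain ⟨n, G₁, i, p, h, hG⟩ := hA.H.cover
  have := hA.2.2.1
  exact ⟨n, _, _, _, (hA.H.ses_L h).of_iso (Iso.refl _) (mapPowerIso Φ.L W.S n)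
    (asIso (Φ.co A)) (f' := Φ.L.map i ≫ (mapPowerIso Φ.L W.S n).hom)
    (g' := (mapPowerIso Φ.L W.S n).inv ≫ Φ.L.map p ≫ Φ.co A) (by simp) (by simp), hG.L⟩

/-- Each member of the class corresponding to the Bass class embeds into a sum of copies of `T'`
with cokernel in the class. -/
theorem cobass.embed {W : WakamatsuContext k J Φ} {G : D} (hG : W.cobass G) :
    ∃ (n : ℕ) (G₁ : D) (i : G ⟶ power W.T' n) (p : power W.T' n ⟶ G₁), Ses i p ∧
      W.cobass G₁ := by
  obtain ⟨n, i, hi⟩ := W.modC.embed _ hG.L.1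
  have h := Ses.of_mono i
  have := hG.2.2.1
  have h1 := hG.L.coker (W.bass_power_E n) h
  let e := mapPowerIso Φ.H W.E n ≪≫ powerIso W.isoE n
  exact ⟨n, _, _, _, (hG.L.ses_H h).of_iso (asIso (Φ.un G)).symm e (Iso.refl _)
    (f' := Φ.un G ≫ Φ.H.map i ≫ e.hom) (g' := e.inv ≫ Φ.H.map (cokernel.π i)) (by simp) (by simp),
    h1.H⟩

/-- The left perpendicular class of the Bass class. -/
def lperp : ObjectProperty C := fun B =>
  Φ.fgC B ∧ ∀ A, W.bass A → Subsingleton (Ext.{x} B A 1)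

/-- The right perpendicular class of the class corresponding to the Bass class. -/
def rperp : ObjectProperty D := fun K =>
  Φ.fgD K ∧ ∀ G, W.cobass G → Subsingleton (Ext.{x} G K 1)

variable {W}

/-- Dimension shifting stays inside the Bass class, which contains the injective cogenerator and is
closed under cokernels of monomorphisms. -/
theorem lperp.extZero {B : C} (hB : W.lperp B) {A : C} (hA : W.bass A) : ExtZero B A := by
  intro i hi
  obtain ⟨n, rfl⟩ := Nat.exists_eq_succ_of_ne_zero hi.ne'
  clear hi
  induction n generalizing A with
  | zero => exact hB.2 A hA
  | succ n ih =>
    obtain ⟨m, i, hi⟩ := W.modC.embed _ hA.1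
    have h := Ses.of_mono i
    have := W.injE
    exact h.ext_coshift_left (ih (hA.coker (W.bass_power_E m) h))
      (extZero_of_injective B (power W.E m) _ (Nat.succ_pos _))

theorem rperp.extZero {K : D} (hK : W.rperp K) {G : D} (hG : W.cobass G) : ExtZero G K := by
  intro i hi
  obtain ⟨n, rfl⟩ := Nat.exists_eq_succ_of_ne_zero hi.ne'
  clear hi
  induction n generalizing G with
  | zero => exact hK.2 G hG
  | succ n ih =>
    obtain ⟨m, G₁, i, p, h, hG₁⟩ := hG.cover
    have := W.projS
    exact h.ext_shift_right (ih hG₁) (extZero_of_projective (power W.S m) K _ (Nat.succ_pos _))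

theorem lperp_of_retract {X Y : C} (r : Retract X Y) (hY : W.lperp Y) : W.lperp X :=
  ⟨W.modC.fg_sub r.i inferInstance hY.1, fun A hA => ext_of_retract_left r (hY.2 A hA)⟩

theorem rperp_of_retract {X Y : D} (r : Retract X Y) (hY : W.rperp Y) : W.rperp X :=
  ⟨W.modD.fg_sub r.i inferInstance hY.1, fun A hA => ext_of_retract_right r (hY.2 A hA)⟩

theorem rperp_of_iso {X Y : D} (e : X ≅ Y) (hX : W.rperp X) : W.rperp Y :=
  rperp_of_retract e.symm.retract hX

theorem lperp_extension {X Y Z : C} {f : X ⟶ Y} {g : Y ⟶ Z} (h : Ses f g) (hX : W.lperp X)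
    (hZ : W.lperp Z) : W.lperp Y :=
  ⟨W.modC.fg_ext h hX.1 hZ.1, fun A hA => h.ext_middle_left (hX.2 A hA) (hZ.2 A hA)⟩

theorem rperp_extension {X Y Z : D} {f : X ⟶ Y} {g : Y ⟶ Z} (h : Ses f g) (hX : W.rperp X)
    (hZ : W.rperp Z) : W.rperp Y :=
  ⟨W.modD.fg_ext h hX.1 hZ.1, fun A hA => h.ext_middle_right (hX.2 A hA) (hZ.2 A hA)⟩

theorem lperp_ker {X Y Z : C} {f : X ⟶ Y} {g : Y ⟶ Z} (h : Ses f g) (hY : W.lperp Y)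
    (hZ : W.lperp Z) : W.lperp X :=
  ⟨W.modC.fg_sub f h.mono hY.1, fun A hA =>
    h.ext_shift_left (hZ.extZero hA 2 two_pos) (hY.2 A hA)⟩

theorem rperp_coker {X Y Z : D} {f : X ⟶ Y} {g : Y ⟶ Z} (h : Ses f g) (hX : W.rperp X)
    (hY : W.rperp Y) : W.rperp Z :=
  ⟨W.modD.fg_quot g h.epi hY.1, fun G hG =>
    h.ext_coshift_right (hX.extZero hG 2 two_pos) (hY.2 G hG)⟩

variable (W)

theorem lperp_of_projective (X : C) (hX : Φ.fgC X) [Projective X] : W.lperp X :=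
  ⟨hX, fun A _ => (extZero_of_projective X A).one⟩

theorem rperp_of_injective (X : D) (hX : Φ.fgD X) [Injective X] : W.rperp X :=
  ⟨hX, fun G _ => (extZero_of_injective G X).one⟩

theorem lperp_T : W.lperp W.T := ⟨W.fgT, fun A hA => hA.2.1.one⟩

theorem rperp_T' : W.rperp W.T' := ⟨W.fgT', fun G hG => hG.2.1.one⟩

end WakamatsuContext

theorem lift_power {X Y Z : C} {p : Y ⟶ Z} (h : ∀ t : X ⟶ Z, ∃ s, s ≫ p = t) (n : ℕ) :
    ∀ t : power X n ⟶ Z, ∃ s, s ≫ p = t :=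
  power_mem (P := fun X => ∀ t : X ⟶ Z, ∃ s, s ≫ p = t)
    (fun X hX t => ⟨0, hX.eq_of_src _ _⟩) (fun X₁ X₂ h₁ h₂ t => by
      obtain ⟨s₁, e₁⟩ := h₁ (biprod.inl ≫ t)
      obtain ⟨s₂, e₂⟩ := h₂ (biprod.inr ≫ t)
      refine ⟨biprod.desc s₁ s₂, ?_⟩
      ext <;> simp [e₁, e₂]) h n

theorem extend_power {X Y Z : C} {i : Y ⟶ Z} (h : ∀ t : Y ⟶ X, ∃ s, i ≫ s = t) (n : ℕ) :
    ∀ t : Y ⟶ power X n, ∃ s, i ≫ s = t :=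
  power_mem (P := fun X => ∀ t : Y ⟶ X, ∃ s, i ≫ s = t)
    (fun X hX t => ⟨0, hX.eq_of_tgt _ _⟩) (fun X₁ X₂ h₁ h₂ t => by
      obtain ⟨s₁, e₁⟩ := h₁ (t ≫ biprod.fst)
      obtain ⟨s₂, e₂⟩ := h₂ (t ≫ biprod.snd)
      refine ⟨biprod.lift s₁ s₂, ?_⟩
      ext <;> simp [e₁, e₂]) h n

namespace WakamatsuContext

variable {W}

/-- An object `M` with `Ext¹(G, M) = 0` for the members `G` of the class corresponding to the Bass
class receives a surjective approximation by sums of copies of `T'`. -/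
theorem rperp.exists_approx {K : D} (hK : W.rperp K) : ∃ (n : ℕ) (p : power W.T' n ⟶ K),
    Epi p ∧ ∀ G, (G = W.T' ∨ W.cobass G) → ∀ t : G ⟶ K, ∃ s, s ≫ p = t := by
  obtain ⟨n, p, hp⟩ := W.modD.right_approx W.T' K W.fgT' hK.1
  -- Since `G` embeds into a power of `T'` with cokernel in `cobass`, the map `t` extends to that
  -- power, and from there it factors through `p` by the choice of `p`.
  have key : ∀ G, W.cobass G → ∀ t : G ⟶ K, ∃ s, s ≫ p = t := fun G hG t => by
    obtain ⟨m, G₁, i, q, h, hG₁⟩ := hG.embed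
    obtain ⟨r, rfl⟩ := h.exists_extension (hK.2 _ hG₁) t
    obtain ⟨s, rfl⟩ := lift_power hp m r
    exact ⟨i ≫ s, Category.assoc _ _ _⟩
  refine ⟨n, p, ?_, fun G hG t => hG.elim (fun h => by subst h; exact hp t) fun h => key G h t⟩
  obtain ⟨m, c, hc⟩ := W.modD.cover K hK.1
  obtain ⟨s, rfl⟩ := key _ (W.cobass_power_S m) c
  exact epi_of_epi s p

/-- The approximation property makes the kernel perpendicular to `cobass`, because the powers of
`T'` are; so the covering can be iterated. -/
theorem rperp.cover {K : D} (hK : W.rperp K) : ∃ (n : ℕ) (K₁ : D) (i : K₁ ⟶ power W.T' n)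
    (p : power W.T' n ⟶ K), Ses i p ∧ W.rperp K₁ ∧ ∀ t : W.T' ⟶ K, ∃ s, s ≫ p = t := by
  obtain ⟨n, p, hp, h⟩ := hK.exists_approx
  refine ⟨n, _, _, p, Ses.of_epi p, ⟨W.modD.fg_sub (kernel.ι p) inferInstance
    (W.modD.fg_power W.fgT' n), fun G hG => ?_⟩, h _ (Or.inl rfl)⟩
  exact (Ses.of_epi p).ext_one_of_lift (hG.2.1.power_right n).one (h G (Or.inr hG))

theorem isIso_co'_T' : IsIso (Φ.co' W.T') := Φ.swap.isIso_co_L W.isIso_un'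

theorem isIso_co'_power_T' (n : ℕ) : IsIso (Φ.co' (power W.T' n)) :=
  power_mem (P := fun X => IsIso (Φ.co' X)) (fun X h => Φ.swap.isIso_co_zero X h)
    (fun X Y h h' => Φ.swap.isIso_co_biprod X Y h h') isIso_co'_T' n

/-- The counit is invertible on powers of `T'`. The cover shows it to be epi on every member of the
class; applied to the kernel, this makes it invertible. -/
theorem rperp.isIso_co' {K : D} (hK : W.rperp K) : IsIso (Φ.co' K) := by
  have hepi : ∀ {K : D}, W.rperp K → Epi (Φ.co' K) := fun {K} hK => by
    obtain ⟨n, K₁, i, p, h, -, -⟩ := hK.cover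
    have := W.isIso_co'_power_T' n
    have := h.epi
    have : Epi (Φ.L'.map (Φ.H'.map p) ≫ Φ.co' K) := by
      have e : Φ.L'.map (Φ.H'.map p) ≫ Φ.co' K = Φ.co' _ ≫ p := Φ.swap.co_naturality p
      rw [e]
      exact epi_comp _ _
    exact epi_of_epi (Φ.L'.map (Φ.H'.map p)) _
  obtain ⟨n, K₁, i, p, h, hK₁, hl⟩ := hK.cover
  have hH : Ses (Φ.H'.map i) (Φ.H'.map p) := W.swap.ses_H h hl
  have := hH.epi
  exact Ses.isIso_third h (f := Φ.L'.map (Φ.H'.map i)) (g := Φ.L'.map (Φ.H'.map p)) inferInstance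
    (by rw [← Functor.map_comp, hH.zero, Functor.map_zero]) (Φ.swap.co_naturality i)
    (Φ.swap.co_naturality p) (hepi hK₁) (W.isIso_co'_power_T' n)

/-- A member of the left perpendicular class has an injective approximation by sums of copies of
`T`. -/
theorem lperp.exists_approx {B : C} (hB : W.lperp B) : ∃ (n : ℕ) (i : B ⟶ power W.T n),
    Mono i ∧ ∀ A, (A = W.T ∨ W.bass A) → ∀ t : B ⟶ A, ∃ s, i ≫ s = t := by
  obtain ⟨n, i, hi⟩ := W.modC.left_approx B W.T hB.1 W.fgT
  have key : ∀ A, W.bass A → ∀ t : B ⟶ A, ∃ s, i ≫ s = t := fun A hA t => by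
    obtain ⟨m, A₁, j, q, h, hA₁⟩ := hA.cover
    obtain ⟨r, rfl⟩ := h.exists_lift (hB.2 _ hA₁) t
    obtain ⟨s, rfl⟩ := extend_power hi m r
    exact ⟨s ≫ q, (Category.assoc _ _ _).symm⟩
  refine ⟨n, i, ?_, fun A hA t => hA.elim (fun h => by subst h; exact hi t) fun h => key A h t⟩
  obtain ⟨m, c, hc⟩ := W.modC.embed B hB.1
  obtain ⟨s, rfl⟩ := key _ (W.bass_power_E m) c
  exact mono_of_mono i s

theorem lperp.embed {B : C} (hB : W.lperp B) : ∃ (n : ℕ) (B₁ : C) (i : B ⟶ power W.T n)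
    (p : power W.T n ⟶ B₁), Ses i p ∧ W.lperp B₁ ∧ ∀ t : B ⟶ W.T, ∃ s, i ≫ s = t := by
  obtain ⟨n, i, hi, h⟩ := hB.exists_approx
  refine ⟨n, _, i, _, Ses.of_mono i, ⟨W.modC.fg_quot (cokernel.π i) inferInstance
    (W.modC.fg_power W.fgT n), fun A hA => ?_⟩, h _ (Or.inl rfl)⟩
  exact (Ses.of_mono i).ext_one_of_extension (hA.2.1.power_left n).one (h A (Or.inr hA))

/-- Up to isomorphism `T` is `H'` of the injective cogenerator `F`, at which the counit is
invertible. -/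
theorem isIso_un'_T : IsIso (Φ.un' W.T) :=
  Φ.swap.isIso_un_of_iso W.isoF (Φ.swap.isIso_un_H W.swap.isIso_co_E)

theorem isIso_un'_power_T (n : ℕ) : IsIso (Φ.un' (power W.T n)) :=
  power_mem (P := fun X => IsIso (Φ.un' X)) (fun X h => Φ.swap.isIso_un_zero X h)
    (fun X Y h h' => Φ.swap.isIso_un_biprod X Y h h') isIso_un'_T n

theorem lperp.isIso_un' {B : C} (hB : W.lperp B) : IsIso (Φ.un' B) := by
  have hmono : ∀ {B : C}, W.lperp B → Mono (Φ.un' B) := fun {B} hB => by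
    obtain ⟨n, B₁, i, p, h, -, -⟩ := hB.embed
    have := W.isIso_un'_power_T n
    have := h.mono
    have : Mono (Φ.un' B ≫ Φ.H'.map (Φ.L'.map i)) := by
      have e : i ≫ Φ.un' _ = Φ.un' B ≫ Φ.H'.map (Φ.L'.map i) := Φ.swap.un_naturality i
      rw [← e]
      exact mono_comp _ _
    exact mono_of_mono _ (Φ.H'.map (Φ.L'.map i))
  obtain ⟨n, B₁, i, p, h, hB₁, hl⟩ := hB.embed
  have hL : Ses (Φ.L'.map i) (Φ.L'.map p) := W.swap.ses_L h hl
  have := hL.mono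
  exact Ses.isIso_first h (f' := Φ.H'.map (Φ.L'.map i)) (g' := Φ.H'.map (Φ.L'.map p)) inferInstance
    (by rw [← Functor.map_comp, hL.zero, Functor.map_zero]) (Φ.swap.un_naturality i)
    (Φ.swap.un_naturality p) (W.isIso_un'_power_T n) (hmono hB₁)

end WakamatsuContext

end Context

end WakamatsuTilting

end

set_option linter.unusedSectionVars false

noncomputable section

namespace WakamatsuTilting

open Limits ZeroObject Abelian

/-! ### Separating and descending functionals -/

section Cogenerator

universe v

variable {k : Type v} [CommRing k] {J : Type v} [AddCommGroup J] [Module k J]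

theorem IsInjectiveCogenerator.exists_ne_zero (hJ : IsInjectiveCogenerator k J) {M : Type v}
    [AddCommGroup M] [Module k M] (N : Submodule k M) {m : M} (hm : m ∉ N) :
    ∃ l : M →ₗ[k] J, l m ≠ 0 ∧ ∀ n ∈ N, l n = 0 := by
  obtain ⟨l, hl⟩ := hJ.separate (N.mkQ m) fun h => hm ((Submodule.Quotient.mk_eq_zero N).1 h)
  exact ⟨l.comp N.mkQ, hl, fun n hn => by
    rw [LinearMap.comp_apply, Submodule.mkQ_apply, (Submodule.Quotient.mk_eq_zero N).2 hn,
      map_zero]⟩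

theorem exists_comp_eq_of_surjective {M N P : Type v} [AddCommGroup M] [Module k M]
    [AddCommGroup N] [Module k N] [AddCommGroup P] [Module k P] (f : M →ₗ[k] N)
    (hf : Function.Surjective f) (l : M →ₗ[k] P) (hl : ∀ m, f m = 0 → l m = 0) :
    ∃ l' : N →ₗ[k] P, ∀ m, l' (f m) = l m := by
  refine ⟨((LinearMap.ker f).liftQ l fun m hm => hl m hm).comp
    (f.quotKerEquivOfSurjective hf).symm.toLinearMap, fun m => ?_⟩
  have : (f.quotKerEquivOfSurjective hf).symm (f m) = (LinearMap.ker f).mkQ m :=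
    (LinearEquiv.symm_apply_eq _).2 rfl
  rw [LinearMap.comp_apply, LinearEquiv.coe_coe, this]
  exact Submodule.liftQ_apply _ _ _

end Cogenerator

/-! ### The duality D Hom(B, L G) = Hom(G, L' B) and the image of `lperp` under `L'` -/

section Context

universe v w x

variable {C D : Type w} [Category.{v} C] [Category.{v} D] [Abelian C] [Abelian D]
  {k : Type v} [CommRing k] {J : Type v} [AddCommGroup J] [Module k J] [Linear k C] [Linear k D]
  [HasExt.{x} C] [HasExt.{x} D] {Φ : AdjointPairs C D} (W : WakamatsuContext k J Φ)

theorem comp_eq_biprod_add {X Y V Z : C} (w : V ⟶ X ⊞ Y) (p : X ⊞ Y ⟶ Z) :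
    w ≫ p = (w ≫ biprod.fst) ≫ (biprod.inl ≫ p) + (w ≫ biprod.snd) ≫ (biprod.inr ≫ p) := by
  simp only [Category.assoc, ← Preadditive.comp_add]
  rw [← Category.assoc biprod.fst, ← Category.assoc biprod.snd, ← Preadditive.add_comp,
    biprod.total, Category.id_comp]

namespace WakamatsuContext

/-- Endomorphisms of `S` can be moved around the trace, by the transposition of `dual_end_comm`;
this is the compatibility that `Corr` needs at `G = S`. -/
theorem trD_comp_sh' (s : W.S ⟶ W.S) {B : C} (ψ : W.S ⟶ Φ.L'.obj B) (h : B ⟶ W.T) :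
    W.trD (ψ ≫ Φ.sh' ((h ≫ Φ.L.map s) ≫ W.isoF.inv)) =
      W.trD (s ≫ ψ ≫ Φ.sh' (h ≫ W.isoF.inv)) := by
  obtain ⟨f, hf⟩ := W.modD.rep W.F (W.trD.comp (Linear.leftComp k W.F s))
  have e : Φ.H'.map f ≫ W.isoF.hom = W.isoF.hom ≫ Φ.L.map s :=
    W.swap.dual_end_comm fun u => (hf u).symm
  have e' : Φ.L.map s ≫ W.isoF.inv = W.isoF.inv ≫ Φ.H'.map f := by
    rw [Iso.comp_inv_eq, Category.assoc, e, Iso.inv_hom_id_assoc]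
  have e'' := hf (ψ ≫ Φ.sh' (h ≫ W.isoF.inv))
  rw [Category.assoc, e', ← Category.assoc, Φ.sh'_comp, ← Category.assoc, e'']
  rfl

/-- The functional `l` on `Hom(B, L G)` and the morphism `φ : G ⟶ L' B` correspond to each other. -/
def Corr {B : C} {G : D} (l : (B ⟶ Φ.L.obj G) →ₗ[k] J) (φ : G ⟶ Φ.L'.obj B) : Prop :=
  ∀ (h : B ⟶ W.T) (s : W.S ⟶ G),
    l (h ≫ Φ.L.map s) = W.trD (s ≫ φ ≫ Φ.sh' (h ≫ W.isoF.inv))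

/-- For `G = S` a morphism `S ⟶ L' B` is an element of `L' B`, and pairing it with the morphisms `B
⟶ T` gives `l`; powers are treated summand by summand. -/
theorem exists_corr_left (B : C) (n : ℕ) : ∀ φ : power W.S n ⟶ Φ.L'.obj B, ∃ l, W.Corr l φ := by
  refine power_mem (P := fun X => ∀ φ : X ⟶ Φ.L'.obj B, ∃ l, W.Corr l φ) ?_ ?_ ?_ n
  · intro X hX φ
    refine ⟨0, fun h s => ?_⟩
    rw [hX.eq_of_src φ 0, zero_comp, comp_zero, map_zero, LinearMap.zero_apply]
  · intro X₁ X₂ h₁ h₂ φ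
    obtain ⟨l₁, e₁⟩ := h₁ (biprod.inl ≫ φ)
    obtain ⟨l₂, e₂⟩ := h₂ (biprod.inr ≫ φ)
    refine ⟨l₁.comp (Linear.rightComp k B (Φ.L.map biprod.fst)) +
      l₂.comp (Linear.rightComp k B (Φ.L.map biprod.snd)), fun h s => ?_⟩
    rw [← Category.assoc s, comp_eq_biprod_add s φ, Preadditive.add_comp,
      Category.assoc (s ≫ biprod.fst), Category.assoc (s ≫ biprod.snd), map_add, ← e₁, ← e₂]
    simp
  · intro φ
    have := W.L'_linear
    refine ⟨W.trD.comp ((Linear.rightComp k W.S (Φ.co' W.F)).comp ((Linear.leftComp k _ φ).comp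
      ((Φ.L'.mapLinearMap k).comp (Linear.rightComp k B W.isoF.inv)))), fun h s => ?_⟩
    rw [← W.trD_comp_sh', ← Φ.map_co']
    simp

/-- The converse is double duality: `Hom(B, T)` is the dual of `L' B`, and by `rep'` a functional on
it is evaluation at an element of `L' B`. -/
theorem exists_corr_right (B : C) (hB : Φ.fgC B) (n : ℕ) :
    ∀ l : (B ⟶ Φ.L.obj (power W.S n)) →ₗ[k] J, ∃ φ, W.Corr l φ := by
  refine power_mem (P := fun X => ∀ l : (B ⟶ Φ.L.obj X) →ₗ[k] J, ∃ φ, W.Corr l φ) ?_ ?_ ?_ n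
  · intro X hX l
    refine ⟨0, fun h s => ?_⟩
    rw [hX.eq_of_tgt s 0, Functor.map_zero, comp_zero, zero_comp, map_zero, map_zero]
  · intro X₁ X₂ h₁ h₂ l
    obtain ⟨φ₁, e₁⟩ := h₁ (l.comp (Linear.rightComp k B (Φ.L.map biprod.inl)))
    obtain ⟨φ₂, e₂⟩ := h₂ (l.comp (Linear.rightComp k B (Φ.L.map biprod.inr)))
    refine ⟨biprod.desc φ₁ φ₂, fun h s => ?_⟩
    have e : h ≫ Φ.L.map s = (h ≫ Φ.L.map (s ≫ biprod.fst)) ≫ Φ.L.map biprod.inl +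
        (h ≫ Φ.L.map (s ≫ biprod.snd)) ≫ Φ.L.map biprod.inr := by
      simp only [Category.assoc, ← Functor.map_comp, ← Preadditive.comp_add, ← Functor.map_add,
        biprod.total, Category.comp_id]
    have e₁' := e₁ h (s ≫ biprod.fst)
    have e₂' := e₂ h (s ≫ biprod.snd)
    rw [LinearMap.comp_apply, Linear.rightComp_apply] at e₁' e₂'
    rw [e, map_add, e₁', e₂', ← map_add, biprod.desc_eq]
    simp
  · intro l
    have := W.H'_linear
    obtain ⟨φ, hφ⟩ := W.modD.rep' (Φ.L'.obj B) (W.fg_L' B hB)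
      (l.comp ((Linear.rightComp k B W.isoF.hom).comp ((Linear.leftComp k _ (Φ.un' B)).comp
        (Φ.H'.mapLinearMap k))))
    refine ⟨φ, fun h s => ?_⟩
    rw [← W.trD_comp_sh', hφ]
    have e : Φ.un' B ≫ Φ.H'.map (Φ.sh' ((h ≫ Φ.L.map s) ≫ W.isoF.inv)) =
        (h ≫ Φ.L.map s) ≫ W.isoF.inv := (Φ.un'_map _).trans (Φ.fl'_sh' _)
    change _ = l ((Φ.un' B ≫ Φ.H'.map (Φ.sh' ((h ≫ Φ.L.map s) ≫ W.isoF.inv))) ≫ W.isoF.hom)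
    rw [e, Category.assoc, W.isoF.inv_hom_id, Category.comp_id]

variable {W}

/-- Present `G` by a power of `S` with kernel `G₁` in `cobass`. The functional on `Hom(B, L Sⁿ)`
vanishes on `Hom(B, L G₁)`, since maps `B ⟶ L G₁` factor through powers of `T`; it descends to
`Hom(B, L G)` because `Ext¹(B, L G₁) = 0`. -/
theorem lperp.exists_corr {B : C} (hB : W.lperp B) {G : D} (hG : W.cobass G)
    (φ : G ⟶ Φ.L'.obj B) : ∃ l, W.Corr l φ := by
  obtain ⟨n, G₁, j, q, h, hG₁⟩ := hG.cover
  obtain ⟨l, hl⟩ := W.exists_corr_left B n (q ≫ φ)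
  have hL := hG.ses_L h
  have key : ∀ v : B ⟶ Φ.L.obj G₁, l (v ≫ Φ.L.map j) = 0 := fun v => by
    obtain ⟨m, A₁, i, p, h', hA₁⟩ := hG₁.L.cover
    obtain ⟨w, rfl⟩ := h'.exists_lift (hB.2 _ hA₁) v
    refine power_mem (P := fun U => ∀ (w : B ⟶ U) (p : U ⟶ Φ.L.obj G₁),
      l ((w ≫ p) ≫ Φ.L.map j) = 0) ?_ ?_ ?_ m w p
    · intro X hX w p
      rw [hX.eq_of_tgt w 0, zero_comp, zero_comp, map_zero]
    · intro X₁ X₂ h₁ h₂ w p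
      have e : w ≫ p = (w ≫ biprod.fst) ≫ (biprod.inl ≫ p) +
          (w ≫ biprod.snd) ≫ (biprod.inr ≫ p) := comp_eq_biprod_add w p
      rw [e, Preadditive.add_comp, map_add, h₁, h₂, add_zero]
    · intro w p
      have := hG₁.2.2.1
      have e : p = Φ.L.map (Φ.fl p ≫ inv (Φ.un G₁)) := Φ.fl_injective (by
        rw [Φ.fl_lmap, Category.assoc, IsIso.inv_hom_id, Category.comp_id])
      have e' : ((Φ.fl p ≫ inv (Φ.un G₁)) ≫ j) ≫ q = 0 := by
        rw [Category.assoc, h.zero, comp_zero]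
      rw [e, Category.assoc, ← Functor.map_comp, hl, Category.assoc q, ← Category.assoc, e',
        zero_comp, map_zero]
  obtain ⟨l', hl'⟩ := exists_comp_eq_of_surjective (Linear.rightComp k B (Φ.L.map q))
    (fun v => hL.exists_lift (hB.2 _ hG₁.L) v) l (fun v hv => by
      obtain ⟨w, rfl⟩ := hL.lift v hv
      exact key w)
  refine ⟨l', fun h s => ?_⟩
  have := W.projS
  have := Ses.epi ‹Ses j q›
  obtain ⟨s', rfl⟩ : ∃ s', s' ≫ q = s := ⟨_, Projective.factorThru_comp s q⟩
  have e := hl' (h ≫ Φ.L.map s')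
  rw [Linear.rightComp_apply, Category.assoc, ← Functor.map_comp, hl] at e
  rw [e]
  simp

/-- A morphism from the syzygy `G₁` to `L' B` becomes a functional on `Hom(B, L G₁)`, is extended to
`Hom(B, L Sⁿ)` by injectivity of `J`, and is turned back into a morphism. So it extends to `Sⁿ`,
which is the vanishing of `Ext¹(G, L' B)`. -/
theorem lperp.L' {B : C} (hB : W.lperp B) : W.rperp (Φ.L'.obj B) := by
  refine ⟨W.fg_L' B hB.1, fun G hG => ?_⟩
  obtain ⟨n, G₁, i, p, h, hG₁⟩ := hG.cover
  have := W.projS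
  refine h.ext_one_of_extension (extZero_of_projective (power W.S n) _).one fun t => ?_
  obtain ⟨l, hl⟩ := hB.exists_corr hG₁ t
  have hL := hG.ses_L h
  have := hL.mono
  obtain ⟨l', hl'⟩ := W.cog.extend (Linear.rightComp k B (Φ.L.map i))
    (fun u v huv => (cancel_mono (Φ.L.map i)).1 huv) l
  obtain ⟨φ, hφ⟩ := W.exists_corr_right B hB.1 n l'
  refine ⟨φ, W.modD.hom_ext fun u e => ?_⟩
  obtain ⟨g, rfl⟩ : ∃ g : B ⟶ W.T, Φ.sh' (g ≫ W.isoF.inv) = e :=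
    ⟨Φ.fl' e ≫ W.isoF.hom, by
      rw [Category.assoc, W.isoF.hom_inv_id, Category.comp_id, Φ.sh'_fl']⟩
  have e₁ := hφ g (u ≫ i)
  have e₂ := hl' (g ≫ Φ.L.map u)
  rw [Linear.rightComp_apply, Category.assoc, ← Functor.map_comp, e₁, hl] at e₂
  simpa using e₂

end WakamatsuContext

end Context

end WakamatsuTilting

end

set_option linter.unusedSectionVars false

noncomputable section

namespace WakamatsuTilting

open Limits ZeroObject Abelian


/-! ### The duality D Hom(P, A) = Hom(H A, L' P) and the image of `rperp` under `H'` -/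

section Context

universe v w x

variable {C D : Type w} [Category.{v} C] [Category.{v} D] [Abelian C] [Abelian D]
  {k : Type v} [CommRing k] {J : Type v} [AddCommGroup J] [Module k J] [Linear k C] [Linear k D]
  [HasExt.{x} C] [HasExt.{x} D] {Φ : AdjointPairs C D} (W : WakamatsuContext k J Φ)

namespace WakamatsuContext

/-- The functional `l` on `Hom(B, A)` and the morphism `φ : H A ⟶ L' B` correspond to each
other. -/
def Corr' {B A : C} (l : (B ⟶ A) →ₗ[k] J) (φ : Φ.H.obj A ⟶ Φ.L'.obj B) : Prop :=
  ∀ (h : B ⟶ W.T) (g : W.T ⟶ A), l (h ≫ g) = W.trD (Φ.fl g ≫ φ ≫ Φ.sh' (h ≫ W.isoF.inv))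

/-- One half of the Nakayama formula: for `P = R` the functional is represented by a morphism `A ⟶
E`, and `H E ≅ L' R`. -/
theorem exists_corr'_right (A : C) (n : ℕ) :
    ∀ l : (power W.R n ⟶ A) →ₗ[k] J, ∃ φ, W.Corr' l φ := by
  refine power_mem (P := fun X => ∀ l : (X ⟶ A) →ₗ[k] J, ∃ φ, W.Corr' l φ) ?_ ?_ ?_ n
  · intro X hX l
    refine ⟨0, fun h s => ?_⟩
    rw [hX.eq_of_src h 0, zero_comp, zero_comp, comp_zero, map_zero, map_zero]
  · intro X₁ X₂ h₁ h₂ l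
    obtain ⟨φ₁, e₁⟩ := h₁ (l.comp (Linear.leftComp k A biprod.fst))
    obtain ⟨φ₂, e₂⟩ := h₂ (l.comp (Linear.leftComp k A biprod.snd))
    refine ⟨φ₁ ≫ Φ.L'.map biprod.inl + φ₂ ≫ Φ.L'.map biprod.inr, fun h s => ?_⟩
    have e : h ≫ s = biprod.fst ≫ (biprod.inl ≫ h) ≫ s + biprod.snd ≫ (biprod.inr ≫ h) ≫ s := by
      have := comp_eq_biprod_add (𝟙 _) (h ≫ s)
      simpa using this
    have e₁' := e₁ (biprod.inl ≫ h) s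
    have e₂' := e₂ (biprod.inr ≫ h) s
    rw [LinearMap.comp_apply, Linear.leftComp_apply] at e₁' e₂'
    rw [e, map_add, e₁', e₂', ← map_add, Category.assoc biprod.inl, Category.assoc biprod.inr,
      Φ.sh'_map biprod.inl, Φ.sh'_map biprod.inr]
    simp
  · intro l
    obtain ⟨a, ha⟩ := W.modC.rep A l
    refine ⟨Φ.H.map a ≫ W.isoE.hom, fun h g => ?_⟩
    have e := W.tr_eq (g ≫ a) h
    rw [Φ.fl_comp] at e
    rw [← ha, Category.assoc, ← e]
    simp

/-- The Bass condition enters through the invertible counit at `A`, which makes every morphism `H A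
⟶ H E` come from a morphism `A ⟶ E`. -/
theorem bass.exists_corr' {W : WakamatsuContext k J Φ} {A : C} (hA : W.bass A) (n : ℕ) :
    ∀ φ : Φ.H.obj A ⟶ Φ.L'.obj (power W.R n), ∃ l, W.Corr' l φ := by
  refine power_mem (P := fun X => ∀ φ : Φ.H.obj A ⟶ Φ.L'.obj X, ∃ l, W.Corr' l φ) ?_ ?_ ?_ n
  · intro X hX φ
    refine ⟨0, fun h s => ?_⟩
    rw [hX.eq_of_src h 0, zero_comp, zero_comp, Φ.sh'_zero, comp_zero, comp_zero, map_zero, map_zero]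
  · intro X₁ X₂ h₁ h₂ φ
    obtain ⟨l₁, e₁⟩ := h₁ (φ ≫ Φ.L'.map biprod.fst)
    obtain ⟨l₂, e₂⟩ := h₂ (φ ≫ Φ.L'.map biprod.snd)
    refine ⟨l₁.comp (Linear.leftComp k A biprod.inl) +
      l₂.comp (Linear.leftComp k A biprod.inr), fun h s => ?_⟩
    have e : φ = φ ≫ Φ.L'.map biprod.fst ≫ Φ.L'.map biprod.inl +
        φ ≫ Φ.L'.map biprod.snd ≫ Φ.L'.map biprod.inr := by
      rw [← Preadditive.comp_add, ← Functor.map_comp, ← Functor.map_comp, ← Functor.map_add,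
        biprod.total, CategoryTheory.Functor.map_id, Category.comp_id]
    have e₁' := e₁ (biprod.inl ≫ h) s
    have e₂' := e₂ (biprod.inr ≫ h) s
    rw [Category.assoc biprod.inl h W.isoF.inv, Φ.sh'_map biprod.inl] at e₁'
    rw [Category.assoc biprod.inr h W.isoF.inv, Φ.sh'_map biprod.inr] at e₂'
    rw [LinearMap.add_apply, LinearMap.comp_apply, LinearMap.comp_apply, Linear.leftComp_apply,
      Linear.leftComp_apply, ← Category.assoc biprod.inl, ← Category.assoc biprod.inr, e₁', e₂',
      ← map_add]
    conv_rhs => rw [e]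
    simp
  · intro φ
    have := hA.2.2.1
    obtain ⟨a, ha⟩ : ∃ a : A ⟶ W.E, Φ.H.map a ≫ W.isoE.hom = φ := by
      refine ⟨inv (Φ.co A) ≫ Φ.sh (φ ≫ W.isoE.inv), ?_⟩
      have e : Φ.H.map (inv (Φ.co A) ≫ Φ.sh (φ ≫ W.isoE.inv)) = φ ≫ W.isoE.inv :=
        Φ.sh_injective (by rw [Φ.sh_hmap, IsIso.hom_inv_id_assoc])
      rw [e, Category.assoc, W.isoE.inv_hom_id, Category.comp_id]
    refine ⟨W.trC.comp (Linear.rightComp k W.R a), fun h g => ?_⟩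
    have e := W.tr_eq (g ≫ a) h
    rw [Φ.fl_comp] at e
    rw [LinearMap.comp_apply, Linear.rightComp_apply, Category.assoc, ← e, ← ha]
    simp

/-- Every morphism from a projective to `A` factors through a power of `T`. -/
theorem bass.functional_ext {W : WakamatsuContext k J Φ} {A : C} (hA : W.bass A) {P : C}
    [Projective P] {l l' : (P ⟶ A) →ₗ[k] J}
    (hl : ∀ (h : P ⟶ W.T) (g : W.T ⟶ A), l (h ≫ g) = l' (h ≫ g)) : l = l' := by
  refine LinearMap.ext fun v => ?_
  obtain ⟨n, A₁, i, p, hs, -⟩ := hA.cover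
  have := hs.epi
  obtain ⟨w, rfl⟩ : ∃ w, w ≫ p = v := ⟨_, Projective.factorThru_comp v p⟩
  refine power_mem (P := fun U => ∀ (w : P ⟶ U) (p : U ⟶ A), l (w ≫ p) = l' (w ≫ p)) ?_ ?_ hl n w p
  · intro X hX w p
    rw [hX.eq_of_tgt w 0, zero_comp, map_zero, map_zero]
  · intro X₁ X₂ h₁ h₂ w p
    have e : w ≫ p = (w ≫ biprod.fst) ≫ (biprod.inl ≫ p) +
        (w ≫ biprod.snd) ≫ (biprod.inr ≫ p) := comp_eq_biprod_add w p
    rw [e, map_add, map_add, h₁, h₂]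

/-- The objects `B` corresponding to a member `L' B` of the right perpendicular class. -/
def reflexive : ObjectProperty C := fun B => IsIso (Φ.un' B) ∧ W.rperp (Φ.L'.obj B)

variable {W}

theorem rperp.H'_reflexive {K : D} (hK : W.rperp K) : W.reflexive (Φ.H'.obj K) := by
  have := hK.isIso_co'
  exact ⟨Φ.swap.isIso_un_H hK.isIso_co', rperp_of_iso (asIso (Φ.co' K)).symm hK⟩

/-- Cover `L' B` by a power of `T'` and apply `H'`, which turns `T'` into `R`. Applying `L'` returns
the first cover, all counits involved being invertible, so both sequences are exact. -/
theorem reflexive.cover {B : C} (hB : W.reflexive B) : ∃ (n : ℕ) (B₁ : C) (i : B₁ ⟶ power W.R n)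
    (p : power W.R n ⟶ B), Ses i p ∧ Ses (Φ.L'.map i) (Φ.L'.map p) ∧ W.reflexive B₁ := by
  obtain ⟨n, K₁, i, p, h, hK₁, hl⟩ := hB.2.cover
  have := hB.1
  have := W.isIso_un'
  have hH : Ses (Φ.H'.map i) (Φ.H'.map p) := W.swap.ses_H h hl
  let e : Φ.H'.obj (power W.T' n) ≅ power W.R n :=
    mapPowerIso Φ.H' W.T' n ≪≫ powerIso (asIso (Φ.un' W.R)).symm n
  have h1 : Ses (Φ.H'.map i ≫ e.hom) (e.inv ≫ Φ.H'.map p ≫ inv (Φ.un' B)) :=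
    hH.of_iso (Iso.refl _) e (asIso (Φ.un' B)).symm (by simp) (by simp)
  refine ⟨n, _, _, _, h1, ?_, hK₁.H'_reflexive⟩
  have hu : IsIso (Φ.un' (power W.R n)) :=
    power_mem (P := fun X => IsIso (Φ.un' X)) (fun X h => Φ.swap.isIso_un_zero X h)
    (fun X Y h h' => Φ.swap.isIso_un_biprod X Y h h') W.isIso_un' n
  have := hK₁.isIso_co'
  have := W.isIso_co'_power_T' n
  have := Φ.swap.isIso_co_L hB.1
  have h2 : Ses (Φ.L'.map (Φ.H'.map i)) (Φ.L'.map (Φ.H'.map p)) := by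
    refine h.of_iso (asIso (Φ.co' _)).symm (asIso (Φ.co' _)).symm (asIso (Φ.co' _)).symm ?_ ?_
    · have e : Φ.L'.map (Φ.H'.map i) ≫ Φ.co' _ = Φ.co' _ ≫ i := Φ.swap.co_naturality i
      simp only [Iso.symm_hom, asIso_inv]
      rw [IsIso.comp_inv_eq, Category.assoc, e, IsIso.inv_hom_id_assoc]
    · have e : Φ.L'.map (Φ.H'.map p) ≫ Φ.co' _ = Φ.co' _ ≫ p := Φ.swap.co_naturality p
      simp only [Iso.symm_hom, asIso_inv]
      rw [IsIso.comp_inv_eq, Category.assoc, e, IsIso.inv_hom_id_assoc]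
  refine h2.of_iso (Iso.refl _) (Φ.L'.mapIso e) (Φ.L'.mapIso (asIso (Φ.un' B)).symm)
    (by simp) (by simp)

/-- If `v` did not extend, some functional on `Hom(B₁, A)` would be nonzero at `v` and vanish on
everything restricted from `P`. Read as a morphism `H A ⟶ L' P₁`, with `P₁` covering `B₁`, it passes
through `L' B₂` and lifts to `L' P₂` because `Ext¹(H A, L' B₃) = 0`. Read back, it factors through
restriction along `P₂ ⟶ P₁`, which kills whatever comes from `B₁`. -/
theorem reflexive.exists_extension {B P B₁ : C} {i : B₁ ⟶ P} {p : P ⟶ B}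
    (hL : Ses (Φ.L'.map i) (Φ.L'.map p)) (hB₁ : W.reflexive B₁) {A : C} (hA : W.bass A)
    (v : B₁ ⟶ A) : ∃ w, i ≫ w = v := by
  by_contra hv
  obtain ⟨l, hl, hl0⟩ := W.cog.exists_ne_zero (LinearMap.range (Linear.leftComp k A i)) (m := v) hv
  obtain ⟨n₁, B₂, i₁, p₁, h₁, hL₁, hB₂⟩ := hB₁.cover
  obtain ⟨n₂, B₃, i₂, p₂, h₂, hL₂, hB₃⟩ := hB₂.cover
  have := h₁.epi
  have := hL.mono
  have := W.projR
  obtain ⟨l₁, hl₁⟩ := W.cog.extend (Linear.leftComp k A p₁)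
    (fun u v huv => (cancel_epi p₁).1 huv) l
  obtain ⟨φ₁, hφ₁⟩ := W.exists_corr'_right A n₁ l₁
  have e0 : φ₁ ≫ Φ.L'.map p₁ = 0 := by
    rw [← cancel_mono (Φ.L'.map i), zero_comp]
    refine W.modD.hom_ext fun u e => ?_
    obtain ⟨h, rfl⟩ : ∃ h : P ⟶ W.T, Φ.sh' (h ≫ W.isoF.inv) = e :=
      ⟨Φ.fl' e ≫ W.isoF.hom, by
        rw [Category.assoc, W.isoF.hom_inv_id, Category.comp_id, Φ.sh'_fl']⟩
    have e₁ := hφ₁ (p₁ ≫ i ≫ h) (Φ.sh u)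
    have e₂ := hl₁ (i ≫ h ≫ Φ.sh u)
    rw [hl0 (i ≫ h ≫ Φ.sh u) ⟨h ≫ Φ.sh u, rfl⟩] at e₂
    rw [Linear.leftComp_apply] at e₂
    rw [Category.assoc, Category.assoc, e₂, Φ.fl_sh] at e₁
    rw [zero_comp, comp_zero, map_zero, e₁, Category.assoc p₁ (i ≫ h) W.isoF.inv,
      Category.assoc i h W.isoF.inv, Φ.sh'_map p₁, Φ.sh'_map i]
    simp
  obtain ⟨ψ, rfl⟩ := hL₁.lift φ₁ e0
  obtain ⟨ψ', rfl⟩ := hL₂.exists_lift (hB₃.2.2 _ hA.H) ψ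
  obtain ⟨l₂, hl₂⟩ := hA.exists_corr' n₂ ψ'
  have key : l₁ = l₂.comp (Linear.leftComp k A (p₂ ≫ i₁)) := hA.functional_ext fun h g => by
    rw [hφ₁, LinearMap.comp_apply, Linear.leftComp_apply, ← Category.assoc (p₂ ≫ i₁), hl₂,
      Category.assoc p₂, Category.assoc p₂, Category.assoc i₁, Φ.sh'_map p₂, Φ.sh'_map i₁]
    simp
  have e := hl₁ v
  rw [key, LinearMap.comp_apply, Linear.leftComp_apply, Linear.leftComp_apply, Category.assoc,
    reassoc_of% h₁.zero, zero_comp, comp_zero, map_zero] at e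
  exact hl e.symm

theorem rperp.H' {K : D} (hK : W.rperp K) : W.lperp (Φ.H'.obj K) := by
  obtain ⟨n, B₁, i, p, h, hL, hB₁⟩ := hK.H'_reflexive.cover
  have := W.projR
  exact ⟨W.fg_H' K hK.1, fun A hA => h.ext_one_of_extension
    (extZero_of_projective (power W.R n) _).one (hB₁.exists_extension hL hA)⟩

end WakamatsuContext

end Context

end WakamatsuTilting

end

set_option linter.unusedSectionVars false

noncomputable section

namespace WakamatsuTilting

open Limits ZeroObject Abelian


/-! ### Resolutions by powers of `T` and the double perpendicular classes -/

section Context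

universe v w x

variable {C D : Type w} [Category.{v} C] [Category.{v} D] [Abelian C] [Abelian D]
  {k : Type v} [CommRing k] {J : Type v} [AddCommGroup J] [Module k J] [Linear k C] [Linear k D]
  [HasExt.{x} C] [HasExt.{x} D] {Φ : AdjointPairs C D} (W : WakamatsuContext k J Φ)

namespace WakamatsuContext

variable {W}

/-- The counit is invertible on `U` and `H U` is projective. So the counit is epi on the whole class
and then, using this for the kernel, invertible. It follows that `L H i` is mono, which gives
`Ext¹(H X, T') = 0`; higher degrees are shifted along the projective `H U`. -/
theorem bass_of_resolution {P : ObjectProperty C} (hfg : ∀ X, P X → Φ.fgC X)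
    (hT : ∀ X, P X → ExtZero W.T X)
    (hP : ∀ X, P X → ∃ (n : ℕ) (X₁ U : C) (i : X₁ ⟶ U) (p : U ⟶ X), Ses i p ∧ P X₁ ∧
      Nonempty (Retract U (power W.T n))) : P ≤ W.bass := by
  have hU : ∀ (n : ℕ) (U : C), Retract U (power W.T n) →
      IsIso (Φ.co U) ∧ Projective (Φ.H.obj U) := fun n U r => by
    have := W.isIso_un
    have := W.projS
    let e : Φ.H.obj (power W.T n) ≅ power W.S n :=
      mapPowerIso Φ.H W.T n ≪≫ powerIso (asIso (Φ.un W.S)).symm n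
    exact ⟨Φ.isIso_co_of_retract r (W.bass_power_T n).2.2.1,
      ((r.map Φ.H).trans (Retract.ofIso e)).projective⟩
  have hH : ∀ {X₁ U X : C} {i : X₁ ⟶ U} {p : U ⟶ X}, Ses i p → P X₁ →
      Ses (Φ.H.map i) (Φ.H.map p) := fun h hX₁ =>
    W.ses_H h fun u => h.exists_lift (hT _ hX₁).one u
  have hepi : ∀ X, P X → Epi (Φ.co X) := fun X hX => by
    obtain ⟨n, X₁, U, i, p, h, hX₁, ⟨r⟩⟩ := hP X hX
    have := (hU n U r).1
    have := h.epi
    have : Epi (Φ.L.map (Φ.H.map p) ≫ Φ.co X) := by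
      rw [Φ.co_naturality]
      exact epi_comp _ _
    exact epi_of_epi (Φ.L.map (Φ.H.map p)) _
  have hco : ∀ X, P X → IsIso (Φ.co X) := fun X hX => by
    obtain ⟨n, X₁, U, i, p, h, hX₁, ⟨r⟩⟩ := hP X hX
    have hs := hH h hX₁
    have := hs.epi
    exact Ses.isIso_third h (f := Φ.L.map (Φ.H.map i)) (g := Φ.L.map (Φ.H.map p)) inferInstance
      (by rw [← Functor.map_comp, hs.zero, Functor.map_zero]) (Φ.co_naturality i)
      (Φ.co_naturality p) (hepi _ hX₁) (hU n U r).1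
  refine fun X hX => ⟨hfg X hX, hT X hX, hco X hX, fun j hj => ?_⟩
  obtain ⟨m, rfl⟩ := Nat.exists_eq_succ_of_ne_zero hj.ne'
  clear hj
  induction m generalizing X with
  | zero =>
    obtain ⟨n, X₁, U, i, p, h, hX₁, ⟨r⟩⟩ := hP X hX
    have hs := hH h hX₁
    have := (hU n U r).2
    have i1 := hco _ hX₁
    have i2 := (hU n U r).1
    have := h.mono
    refine hs.ext_one_of_extension (extZero_of_projective _ _).one fun t =>
      W.extend_of_mono_L _ ?_ t
    have e : Φ.L.map (Φ.H.map i) = Φ.co X₁ ≫ i ≫ inv (Φ.co U) := by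
      rw [← Category.assoc, ← Φ.co_naturality, Category.assoc, IsIso.hom_inv_id, Category.comp_id]
    rw [e]
    infer_instance
  | succ m ih =>
    obtain ⟨n, X₁, U, i, p, h, hX₁, ⟨r⟩⟩ := hP X hX
    have := (hU n U r).2
    exact (hH h hX₁).ext_shift_right (ih X₁ hX₁)
      (extZero_of_projective (Φ.H.obj U) _ _ (Nat.succ_pos _))

/-- The dual argument, in which `L U` is injective because `L T' ≅ E`. -/
theorem cobass_of_coresolution {P : ObjectProperty D} (hfg : ∀ X, P X → Φ.fgD X)
    (hT : ∀ X, P X → ExtZero X W.T')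
    (hP : ∀ X, P X → ∃ (n : ℕ) (U X₁ : D) (i : X ⟶ U) (p : U ⟶ X₁), Ses i p ∧ P X₁ ∧
      Nonempty (Retract U (power W.T' n))) : P ≤ W.cobass := by
  have hU : ∀ (n : ℕ) (U : D), Retract U (power W.T' n) →
      IsIso (Φ.un U) ∧ Injective (Φ.L.obj U) := fun n U r => by
    have := W.isIso_co_E
    have := W.injE
    let e : Φ.L.obj (power W.T' n) ≅ power W.E n :=
      mapPowerIso Φ.L W.T' n ≪≫ powerIso (Φ.L.mapIso W.isoE.symm ≪≫ asIso (Φ.co W.E)) n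
    exact ⟨Φ.isIso_un_of_retract r (W.cobass_power_T' n).2.2.1,
      ((r.map Φ.L).trans (Retract.ofIso e)).injective⟩
  have hL : ∀ {X₁ U X : D} {i : X₁ ⟶ U} {p : U ⟶ X}, Ses i p → P X →
      Ses (Φ.L.map i) (Φ.L.map p) := fun h hX =>
    W.ses_L h fun u => h.exists_extension (hT _ hX).one u
  have hmono : ∀ X, P X → Mono (Φ.un X) := fun X hX => by
    obtain ⟨n, U, X₁, i, p, h, hX₁, ⟨r⟩⟩ := hP X hX
    have := (hU n U r).1
    have := h.mono
    have : Mono (Φ.un X ≫ Φ.H.map (Φ.L.map i)) := by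
      rw [← Φ.un_naturality]
      exact mono_comp _ _
    exact mono_of_mono _ (Φ.H.map (Φ.L.map i))
  have hun : ∀ X, P X → IsIso (Φ.un X) := fun X hX => by
    obtain ⟨n, U, X₁, i, p, h, hX₁, ⟨r⟩⟩ := hP X hX
    have hs := hL h hX₁
    have := hs.mono
    exact Ses.isIso_first h (f' := Φ.H.map (Φ.L.map i)) (g' := Φ.H.map (Φ.L.map p)) inferInstance
      (by rw [← Functor.map_comp, hs.zero, Functor.map_zero]) (Φ.un_naturality i)
      (Φ.un_naturality p) (hU n U r).1 (hmono _ hX₁)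
  refine fun X hX => ⟨hfg X hX, hT X hX, hun X hX, fun j hj => ?_⟩
  obtain ⟨m, rfl⟩ := Nat.exists_eq_succ_of_ne_zero hj.ne'
  clear hj
  induction m generalizing X with
  | zero =>
    obtain ⟨n, U, X₁, i, p, h, hX₁, ⟨r⟩⟩ := hP X hX
    have hs := hL h hX₁
    have := (hU n U r).2
    have i1 := hun _ hX₁
    have i2 := (hU n U r).1
    have := h.epi
    refine hs.ext_one_of_lift (extZero_of_injective _ _).one fun t =>
      W.lift_of_epi_H _ ?_ t
    have e : Φ.H.map (Φ.L.map p) = inv (Φ.un U) ≫ p ≫ Φ.un X₁ := by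
      rw [Φ.un_naturality, IsIso.inv_hom_id_assoc]
    rw [e]
    infer_instance
  | succ m ih =>
    obtain ⟨n, U, X₁, i, p, h, hX₁, ⟨r⟩⟩ := hP X hX
    have := (hU n U r).2
    exact (hL h hX₁).ext_coshift_left (ih X₁ hX₁)
      (extZero_of_injective _ (Φ.L.obj U) _ (Nat.succ_pos _))

theorem extZero_of_lperp {M : C} (hM : ∀ B, W.lperp B → Subsingleton (Ext.{x} B M 1)) {B : C}
    (hB : W.lperp B) : ExtZero B M := by
  intro i hi
  obtain ⟨n, rfl⟩ := Nat.exists_eq_succ_of_ne_zero hi.ne'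
  clear hi
  induction n generalizing B with
  | zero => exact hM B hB
  | succ n ih =>
    obtain ⟨m, p, hp⟩ := W.modC.cover _ hB.1
    have h := Ses.of_epi p
    have := W.projR
    exact h.ext_shift_right (ih (lperp_ker h (W.lperp_of_projective (power W.R m)
      (W.modC.fg_power W.modC.fg_R m)) hB))
      (extZero_of_projective (power W.R m) M _ (Nat.succ_pos _))

theorem extZero_of_rperp {M : D} (hM : ∀ K, W.rperp K → Subsingleton (Ext.{x} M K 1)) {K : D}
    (hK : W.rperp K) : ExtZero M K := by
  intro i hi
  obtain ⟨n, rfl⟩ := Nat.exists_eq_succ_of_ne_zero hi.ne'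
  clear hi
  induction n generalizing K with
  | zero => exact hM K hK
  | succ n ih =>
    obtain ⟨m, p, hp⟩ := W.modD.embed _ hK.1
    have h := Ses.of_mono p
    have := W.injF
    exact h.ext_coshift_left (ih (rperp_coker h hK (W.rperp_of_injective (power W.F m)
      (W.modD.fg_power W.modD.fg_E m))))
      (extZero_of_injective M (power W.F m) _ (Nat.succ_pos _))

variable (W)

/-- The Bass class is the right perpendicular class of its left perpendicular class. -/
theorem bass_iff (M : C) :
    W.bass M ↔ Φ.fgC M ∧ ∀ B, W.lperp B → Subsingleton (Ext.{x} B M 1) := by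
  refine ⟨fun h => ⟨h.1, fun B hB => hB.2 M h⟩, fun h => ?_⟩
  refine bass_of_resolution (W := W)
    (P := fun M => Φ.fgC M ∧ ∀ B, W.lperp B → Subsingleton (Ext.{x} B M 1)) (fun X h => h.1)
    (fun X h => extZero_of_lperp h.2 W.lperp_T) (fun X h => ?_) M h
  obtain ⟨n, p, hp⟩ := W.modC.right_approx W.T X W.fgT h.1
  -- Since `B` embeds into a power of `T` with cokernel in `lperp`, every map from `B` factors
  -- through `p`. Applied to projectives this makes `p` epi, and in general it returns the kernel of
  -- `p` to the class.
  have key : ∀ B, W.lperp B → ∀ t : B ⟶ X, ∃ s, s ≫ p = t := fun B hB t => by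
    obtain ⟨m, B₁, i, q, hs, hB₁, -⟩ := hB.embed
    obtain ⟨r, rfl⟩ := hs.exists_extension (h.2 _ hB₁) t
    obtain ⟨s, rfl⟩ := lift_power hp m r
    exact ⟨i ≫ s, Category.assoc _ _ _⟩
  have : Epi p := by
    obtain ⟨m, c, hc⟩ := W.modC.cover X h.1
    have := W.projR
    obtain ⟨s, rfl⟩ := key _ (W.lperp_of_projective (power W.R m)
      (W.modC.fg_power W.modC.fg_R m)) c
    exact epi_of_epi s p
  exact ⟨n, _, _, _, p, Ses.of_epi p, ⟨W.modC.fg_sub (kernel.ι p) inferInstance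
    (W.modC.fg_power W.fgT n), fun B hB => (Ses.of_epi p).ext_one_of_lift
      (hB.2 _ (W.bass_power_T n)) (key B hB)⟩, ⟨Retract.refl _⟩⟩

theorem cobass_iff (M : D) :
    W.cobass M ↔ Φ.fgD M ∧ ∀ K, W.rperp K → Subsingleton (Ext.{x} M K 1) := by
  refine ⟨fun h => ⟨h.1, fun K hK => hK.2 M h⟩, fun h => ?_⟩
  refine cobass_of_coresolution (W := W)
    (P := fun M => Φ.fgD M ∧ ∀ K, W.rperp K → Subsingleton (Ext.{x} M K 1)) (fun X h => h.1)
    (fun X h => extZero_of_rperp h.2 W.rperp_T') (fun X h => ?_) M h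
  obtain ⟨n, i, hi⟩ := W.modD.left_approx X W.T' h.1 W.fgT'
  have key : ∀ K, W.rperp K → ∀ t : X ⟶ K, ∃ s, i ≫ s = t := fun K hK t => by
    obtain ⟨m, K₁, j, q, hs, hK₁, -⟩ := hK.cover
    obtain ⟨r, rfl⟩ := hs.exists_lift (h.2 _ hK₁) t
    obtain ⟨s, rfl⟩ := extend_power hi m r
    exact ⟨s ≫ q, (Category.assoc _ _ _).symm⟩
  have : Mono i := by
    obtain ⟨m, c, hc⟩ := W.modD.embed X h.1
    have := W.injF
    obtain ⟨s, rfl⟩ := key _ (W.rperp_of_injective (power W.F m)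
      (W.modD.fg_power W.modD.fg_E m)) c
    exact mono_of_mono i s
  exact ⟨n, _, _, i, _, Ses.of_mono i, ⟨W.modD.fg_quot (cokernel.π i) inferInstance
    (W.modD.fg_power W.fgT' n), fun K hK => (Ses.of_mono i).ext_one_of_extension
      (hK.2 _ (W.cobass_power_T' n)) (key K hK)⟩,
      ⟨Retract.refl _⟩⟩

end WakamatsuContext

end Context

end WakamatsuTilting

end

set_option linter.unusedSectionVars false

noncomputable section

namespace WakamatsuTilting

open Limits ZeroObject Abelian


/-! ### Minimal approximations and Wakamatsu's lemma -/

section Approximations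

universe v w x

variable {C : Type w} [Category.{v} C] [Abelian C]

theorem ses_pullback {X Y Z B : C} {f : X ⟶ Y} {p : Y ⟶ B} (h : Ses f p) (g : Z ⟶ B) :
    Ses (pullback.lift f 0 (by rw [h.zero, zero_comp]) : X ⟶ pullback p g)
      (pullback.snd p g) := by
  have := h.mono
  have := h.epi
  have w : f ≫ p = (0 : X ⟶ Z) ≫ g := by rw [h.zero, zero_comp]
  have hp : Mono (pullback.lift f 0 w ≫ pullback.fst p g) := by
    rw [pullback.lift_fst]
    exact h.mono
  have : Mono (pullback.lift f 0 w) := mono_of_mono _ (pullback.fst p g)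
  refine Ses.of_lift (pullback.lift_snd _ _ _) fun W t ht => ?_
  obtain ⟨s, hs⟩ := h.lift (t ≫ pullback.fst p g) (by
    rw [Category.assoc, pullback.condition, ← Category.assoc, ht, zero_comp])
  refine ⟨s, pullback.hom_ext ?_ ?_⟩
  · rw [Category.assoc, pullback.lift_fst, hs]
  · rw [Category.assoc, pullback.lift_snd, comp_zero, ht]

theorem Ses.congr_middle {X Y Z Y' : C} {f : X ⟶ Y} {g : Y ⟶ Z} (h : Ses f g) (e : Y ≅ Y') :
    Ses (f ≫ e.hom) (e.inv ≫ g) :=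
  h.of_iso (Iso.refl _) e (Iso.refl _) (by simp) (by simp)

theorem exists_pullback {X Y X' Y' B : C} {f : X ⟶ Y} {p : Y ⟶ B} (h : Ses f p) {f' : X' ⟶ Y'}
    {p' : Y' ⟶ B} (h' : Ses f' p') : ∃ (Z : C) (i : X ⟶ Z) (q : Z ⟶ Y') (i' : X' ⟶ Z)
      (q' : Z ⟶ Y), Ses i q ∧ Ses i' q' :=
  ⟨_, _, _, _, _, ses_pullback h p', (ses_pullback h' p).congr_middle (pullbackSymmetry p' p)⟩

theorem exists_pushout {X Y Z X' Y' : C} {f : X ⟶ Y} {p : Y ⟶ Z} (h : Ses f p) {f' : X ⟶ X'}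
    {p' : X' ⟶ Y'} (h' : Ses f' p') : ∃ (V : C) (i : X' ⟶ V) (q : V ⟶ Z) (i' : Y ⟶ V)
      (q' : V ⟶ Y'), Ses i q ∧ Ses i' q' :=
  ⟨_, _, _, _, _, ses_pushout f f' p h,
    (ses_pushout f' f p' h').congr_middle (pushoutSymmetry f' f)⟩

/-- Every member of the class is a direct summand of a sum of copies of one member. -/
def HasGenerator (P : ObjectProperty C) : Prop :=
  ∃ M, P M ∧ ∀ B, P B → ∃ n, Nonempty (Retract B (power M n))

variable [HasExt.{x} C] {k : Type v} [CommRing k] {J : Type v} [AddCommGroup J] [Module k J]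
  [Linear k C] {fg : ObjectProperty C} {R E : C} {tr : (R ⟶ E) →ₗ[k] J}
  (h : ModLike k J fg R E tr) {P : ObjectProperty C} (hfg : P ≤ fg)
  (hret : ∀ X Y, Nonempty (Retract X Y) → P Y → P X)
  (hext : ∀ {X Y Z : C} {f : X ⟶ Y} {g : Y ⟶ Z}, Ses f g → P X → P Z → P Y)
  (hgen : HasGenerator P)

include h hfg hret hext hgen

/-- Each finitely generated object has a surjective minimal right approximation, and its kernel is
perpendicular to the class. -/
theorem ModLike.exists_right_approximation (hproj : ∀ X, fg X → Projective X → P X) {X : C}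
    (hX : fg X) : ∃ (A B : C) (i : A ⟶ B) (f : B ⟶ X), Ses i f ∧ P B ∧
      ∀ B', P B' → Subsingleton (Ext.{x} B' A 1) := by
  classical
  have hR := h.projective
  have hPR : ∀ n, P (power R n) := fun n => hproj _ (h.fg_power h.fg_R n) inferInstance
  obtain ⟨len, hlen⟩ := h.fitting
  -- Powers of the generator provide a right approximation, and one of least `len` is selected; this
  -- plays the role of right minimality.
  have hex : ∃ (l : ℕ) (B : C) (f : B ⟶ X), P B ∧ (∀ B', P B' → ∀ t : B' ⟶ X, ∃ s, s ≫ f = t) ∧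
      len B = l := by
    obtain ⟨M, hM, hM'⟩ := hgen
    obtain ⟨n, p, hp⟩ := h.right_approx M X (hfg M hM) hX
    refine ⟨_, power M n, p, power_mem (fun X hX => hproj X (h.fg_zero X hX) hX.projective)
      (fun X Y hX hY => hext (Ses.biprod X Y) hX hY) hM n, fun B' hB' t => ?_, rfl⟩
    obtain ⟨m, ⟨r⟩⟩ := hM' B' hB'
    obtain ⟨s, hs⟩ := lift_power hp m (r.r ≫ t)
    exact ⟨r.i ≫ s, by rw [Category.assoc, hs, r.retract_assoc]⟩
  obtain ⟨B, f, hB, hf, hl⟩ := Nat.find_spec hex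
  have hmin := fun m hm => Nat.find_min hex (m := m) hm
  -- If `φ` were not invertible, the Fitting summand would be a shorter approximation.
  have hiso : ∀ φ : B ⟶ B, φ ≫ f = f → IsIso φ := fun φ hφ => by
    rcases hlen B (hfg B hB) φ with h' | ⟨Y, e, m, hY, hme, hZ, -⟩
    · exact h'
    · refine (hmin (len Y) (hl ▸ hY) ⟨Y, m ≫ f, ?_, fun B' hB' t => ?_, rfl⟩).elim
      · exact hret Y B ⟨⟨m, e ≫ inv (m ≫ e), by rw [← Category.assoc, IsIso.hom_inv_id]⟩⟩ hB
      · obtain ⟨s, rfl⟩ := hf B' hB' t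
        exact ⟨s ≫ e, by rw [Category.assoc, hZ X f hφ]⟩
  have hepi : Epi f := by
    obtain ⟨n, p, hp⟩ := h.cover X hX
    obtain ⟨s, rfl⟩ := hf _ (hPR n) p
    exact epi_of_epi s f
  refine ⟨_, B, kernel.ι f, f, Ses.of_epi f, hB, fun B' hB' => ?_⟩
  obtain ⟨n, p, hp⟩ := h.cover B' (hfg B' hB')
  have hs := Ses.of_epi p
  refine hs.ext_one_of_extension (extZero_of_projective (power R n) _).one fun t => ?_
  -- Wakamatsu's lemma: the pushout is an extension of `B'` by `B`, hence in the class, so its map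
  -- to `X` factors through `f`. The resulting endomorphism `φ` of `B` is invertible by minimality,
  -- and dividing by it extends `t`.
  have hsp := ses_pushout (kernel.ι p) (t ≫ kernel.ι f) p hs
  let g : pushout (kernel.ι p) (t ≫ kernel.ι f) ⟶ X := pushout.desc 0 f (by simp)
  obtain ⟨s, hs⟩ := hf _ (hext hsp hB hB') g
  let φ : B ⟶ B := pushout.inr _ _ ≫ s
  have hφ : φ ≫ f = f := by simp only [φ, Category.assoc, hs, g, pushout.inr_desc]
  have := hiso φ hφ
  have hφ' : inv φ ≫ f = f := by rw [IsIso.inv_comp_eq, hφ]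
  refine ⟨kernel.lift f (pushout.inl _ _ ≫ s ≫ inv φ) ?_, ?_⟩
  · simp only [Category.assoc, hφ', hs, g, pushout.inl_desc]
  · rw [← cancel_mono (kernel.ι f), Category.assoc, kernel.lift_ι, pushout.condition_assoc]
    rw [← Category.assoc (pushout.inr _ _) s]
    change (t ≫ kernel.ι f) ≫ φ ≫ inv φ = _
    rw [IsIso.hom_inv_id, Category.comp_id]

/-- Each finitely generated object has an injective minimal left approximation, and its cokernel is
perpendicular to the class. -/
theorem ModLike.exists_left_approximation (hE : Injective E)
    (hinj : ∀ X, fg X → Injective X → P X) {X : C}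
    (hX : fg X) : ∃ (K G : C) (f : X ⟶ K) (p : K ⟶ G), Ses f p ∧ P K ∧
      ∀ K', P K' → Subsingleton (Ext.{x} G K' 1) := by
  classical
  have hPE : ∀ n, P (power E n) := fun n => hinj _ (h.fg_power h.fg_E n) inferInstance
  obtain ⟨len, hlen⟩ := h.fitting
  have hex : ∃ (l : ℕ) (B : C) (f : X ⟶ B), P B ∧ (∀ B', P B' → ∀ t : X ⟶ B', ∃ s, f ≫ s = t) ∧
      len B = l := by
    obtain ⟨M, hM, hM'⟩ := hgen
    obtain ⟨n, p, hp⟩ := h.left_approx X M hX (hfg M hM)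
    refine ⟨_, power M n, p, power_mem (fun X hX => hinj X (h.fg_zero X hX) hX.injective)
      (fun X Y hX hY => hext (Ses.biprod X Y) hX hY) hM n, fun B' hB' t => ?_, rfl⟩
    obtain ⟨m, ⟨r⟩⟩ := hM' B' hB'
    obtain ⟨s, hs⟩ := extend_power hp m (t ≫ r.i)
    exact ⟨s ≫ r.r, by rw [← Category.assoc, hs, Category.assoc, r.retract, Category.comp_id]⟩
  obtain ⟨B, f, hB, hf, hl⟩ := Nat.find_spec hex
  have hmin := fun m hm => Nat.find_min hex (m := m) hm
  have hiso : ∀ φ : B ⟶ B, f ≫ φ = f → IsIso φ := fun φ hφ => by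
    rcases hlen B (hfg B hB) φ with h' | ⟨Y, e, m, hY, hme, -, hZ⟩
    · exact h'
    · refine (hmin (len Y) (hl ▸ hY) ⟨Y, f ≫ e, ?_, fun B' hB' t => ?_, rfl⟩).elim
      · exact hret Y B ⟨⟨m, e ≫ inv (m ≫ e), by rw [← Category.assoc, IsIso.hom_inv_id]⟩⟩ hB
      · obtain ⟨s, rfl⟩ := hf B' hB' t
        exact ⟨m ≫ s, by simpa using congrArg (· ≫ s) (hZ X f hφ)⟩
  have hmono : Mono f := by
    obtain ⟨n, p, hp⟩ := h.embed X hX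
    obtain ⟨s, rfl⟩ := hf _ (hPE n) p
    exact mono_of_mono f s
  refine ⟨B, _, f, cokernel.π f, Ses.of_mono f, hB, fun B' hB' => ?_⟩
  obtain ⟨n, p, hp⟩ := h.embed B' (hfg B' hB')
  have hs := Ses.of_mono p
  refine hs.ext_one_of_lift (extZero_of_injective _ (power E n)).one fun t => ?_
  have hsp := ses_pullback hs (cokernel.π f ≫ t)
  let g : X ⟶ pullback (cokernel.π p) (cokernel.π f ≫ t) := pullback.lift 0 f (by simp)
  obtain ⟨s, hs⟩ := hf _ (hext hsp hB' hB) g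
  let φ : B ⟶ B := s ≫ pullback.snd _ _
  have hφ : f ≫ φ = f := by
    simp only [φ, ← Category.assoc, hs, g, pullback.lift_snd]
  have := hiso φ hφ
  have hφ' : f ≫ inv φ = f := by rw [IsIso.comp_inv_eq, hφ]
  refine ⟨cokernel.desc f (inv φ ≫ s ≫ pullback.fst _ _) ?_, ?_⟩
  · rw [← Category.assoc, hφ', ← Category.assoc, hs, pullback.lift_fst]
  · rw [← cancel_epi (cokernel.π f), ← Category.assoc, cokernel.π_desc, Category.assoc,
      Category.assoc, pullback.condition]
    rw [← Category.assoc s]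
    change inv φ ≫ φ ≫ _ = _
    rw [IsIso.inv_hom_id_assoc]

end Approximations

/-! ### Completeness of the cotorsion pairs in finite type -/

section Context

universe v w x

variable {C D : Type w} [Category.{v} C] [Category.{v} D] [Abelian C] [Abelian D]
  {k : Type v} [CommRing k] {J : Type v} [AddCommGroup J] [Module k J] [Linear k C] [Linear k D]
  [HasExt.{x} C] [HasExt.{x} D] {Φ : AdjointPairs C D} (W : WakamatsuContext k J Φ)

namespace WakamatsuContext

/-- `L'` is additive and `L' H' K ≅ K` on `rperp`, so finiteness on one side serves both. -/
theorem rperp_hasGenerator (h : HasGenerator W.lperp) : HasGenerator W.rperp := by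
  obtain ⟨M, hM, h⟩ := h
  refine ⟨Φ.L'.obj M, hM.L', fun K hK => ?_⟩
  obtain ⟨n, ⟨r⟩⟩ := h _ hK.H'
  have := hK.isIso_co'
  exact ⟨n, ⟨(Retract.ofIso (asIso (Φ.co' K)).symm).trans ((r.map Φ.L').trans
    (Retract.ofIso (mapPowerIso Φ.L' M n)))⟩⟩

theorem lperp_hasGenerator (h : HasGenerator W.rperp) : HasGenerator W.lperp := by
  obtain ⟨M, hM, h⟩ := h
  refine ⟨Φ.H'.obj M, hM.H', fun B hB => ?_⟩
  obtain ⟨n, ⟨r⟩⟩ := h _ hB.L'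
  have := hB.isIso_un'
  exact ⟨n, ⟨(Retract.ofIso (asIso (Φ.un' B))).trans ((r.map Φ.H').trans
    (Retract.ofIso (mapPowerIso Φ.H' M n)))⟩⟩

variable {W}

section

variable (h : HasGenerator W.lperp) {X : C} (hX : Φ.fgC X)

include h hX

/-- The kernel of a minimal approximation is right perpendicular to `lperp`, hence in the Bass class
by `bass_iff`. -/
theorem exists_bass_lperp : ∃ (A B : C) (i : A ⟶ B) (p : B ⟶ X), Ses i p ∧ W.bass A ∧
    W.lperp B := by
  obtain ⟨A, B, i, p, hs, hB, hA⟩ := W.modC.exists_right_approximation (fun X hX => hX.1)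
    (fun X Y ⟨r⟩ => lperp_of_retract r) (fun h => lperp_extension h) h
    (fun X hX _ => W.lperp_of_projective X hX) hX
  exact ⟨A, B, i, p, hs, (W.bass_iff A).2 ⟨W.modC.fg_sub i hs.mono hB.1, hA⟩, hB⟩

/-- Salce's trick: embed `X` into a power of `E` and pull back along the special cover of the
cokernel. The pullback is an extension of two members of the Bass class. -/
theorem exists_embed_bass_lperp : ∃ (A B : C) (i : X ⟶ A) (p : A ⟶ B), Ses i p ∧ W.bass A ∧
    W.lperp B := by
  obtain ⟨n, i, hi⟩ := W.modC.embed X hX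
  have hs := Ses.of_mono i
  obtain ⟨A, B, j, p, hs', hA, hB⟩ := exists_bass_lperp h (W.modC.fg_quot (cokernel.π i)
    inferInstance (W.modC.fg_power W.modC.fg_E n))
  obtain ⟨Z, i₁, q₁, i₂, q₂, h₁, h₂⟩ := exists_pullback hs hs'
  refine ⟨Z, B, i₁, q₁, h₁, (W.bass_iff Z).2 ⟨W.modC.fg_ext h₁ hX hB.1, fun B' hB' => ?_⟩, hB⟩
  exact h₂.ext_middle_right (hB'.2 A hA) (hB'.2 _ (W.bass_power_E n))

end

section

variable (h : HasGenerator W.rperp) {X : D} (hX : Φ.fgD X)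

include h hX

theorem exists_embed_rperp_cobass : ∃ (K G : D) (i : X ⟶ K) (p : K ⟶ G), Ses i p ∧ W.rperp K ∧
    W.cobass G := by
  obtain ⟨K, G, i, p, hs, hK, hG⟩ := W.modD.exists_left_approximation (fun X hX => hX.1)
    (fun X Y ⟨r⟩ => rperp_of_retract r) (fun h => rperp_extension h) h W.injF
    (fun X hX _ => W.rperp_of_injective X hX) hX
  exact ⟨K, G, i, p, hs, hK, (W.cobass_iff G).2 ⟨W.modD.fg_quot p hs.epi hK.1, hG⟩⟩

theorem exists_rperp_cobass : ∃ (K G : D) (i : K ⟶ G) (p : G ⟶ X), Ses i p ∧ W.rperp K ∧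
    W.cobass G := by
  obtain ⟨n, p, hp⟩ := W.modD.cover X hX
  have hs := Ses.of_epi p
  obtain ⟨K, G, j, q, hs', hK, hG⟩ := exists_embed_rperp_cobass h (W.modD.fg_sub (kernel.ι p)
    inferInstance (W.modD.fg_power W.modD.fg_R n))
  obtain ⟨Z, i₁, q₁, i₂, q₂, h₁, h₂⟩ := exists_pushout hs hs'
  refine ⟨K, Z, i₁, q₁, h₁, hK, (W.cobass_iff Z).2 ⟨W.modD.fg_ext h₁ hK.1 hX, fun K' hK' => ?_⟩⟩
  exact h₂.ext_middle_left (hK'.2 _ (W.cobass_power_S n)) (hK'.2 G hG)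

end

theorem cobass_of_retract {X Y : D} (r : Retract X Y) (hY : W.cobass Y) : W.cobass X :=
  (W.cobass_iff X).2 ⟨W.modD.fg_sub r.i inferInstance hY.1, fun K hK =>
    ext_of_retract_left r (hK.2 Y hY)⟩

theorem cobass_extension {X Y Z : D} {f : X ⟶ Y} {g : Y ⟶ Z} (h : Ses f g) (hX : W.cobass X)
    (hZ : W.cobass Z) : W.cobass Y :=
  (W.cobass_iff Y).2 ⟨W.modD.fg_ext h hX.1 hZ.1, fun K hK => h.ext_middle_left (hK.2 X hX)
    (hK.2 Z hZ)⟩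

theorem cobass_of_projective (X : D) (hX : Φ.fgD X) [Projective X] : W.cobass X :=
  (W.cobass_iff X).2 ⟨hX, fun K _ => (extZero_of_projective X K).one⟩

end WakamatsuContext

end Context

end WakamatsuTilting

end

set_option linter.unusedSectionVars false

noncomputable section

namespace WakamatsuTilting

open Limits ZeroObject Abelian


/-! ### Adjunctions restricted to subcategories -/

section Restriction

universe v w

variable {C D : Type w} [Category.{v} C] [Category.{v} D] {H : C ⥤ D} {L : D ⥤ C} (adj : L ⊣ H)
  {P : ObjectProperty C} {Q : ObjectProperty D}

/-- The adjunction bijection is `H` on morphisms followed by precomposition with the unit. Full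
faithfulness of `H` on `P` thus makes precomposition with the unit bijective towards all of `Q`, so
the unit is invertible by a Yoneda argument; the triangle identity then handles the counit. -/
theorem isIso_of_bijective_of_restrict (hH : ∀ X, P X → Q (H.obj X))
    (hL : ∀ X, Q X → P (L.obj X))
    (hff : ∀ X Y, P X → P Y → Function.Bijective (fun f : X ⟶ Y => H.map f))
    (hes : ∀ Y, Q Y → ∃ X, P X ∧ Nonempty (H.obj X ≅ Y)) :
    (∀ X, P X → IsIso (adj.counit.app X)) ∧ ∀ Y, Q Y → IsIso (adj.unit.app Y) := by
  have hun : ∀ Y, Q Y → IsIso (adj.unit.app Y) := fun Y hY => by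
    have key : ∀ X, P X → Function.Bijective
        (fun f : H.obj (L.obj Y) ⟶ H.obj X => adj.unit.app Y ≫ f) := fun X hX => by
      have hb := (adj.homEquiv Y X).bijective
      have e : (adj.homEquiv Y X : (L.obj Y ⟶ X) → (Y ⟶ H.obj X)) =
          (fun f : H.obj (L.obj Y) ⟶ H.obj X => adj.unit.app Y ≫ f) ∘
          (fun f : L.obj Y ⟶ X => H.map f) := by
        funext f
        simp [Adjunction.homEquiv_unit]
      rw [e] at hb
      exact (Function.Bijective.of_comp_iff _ (hff _ X (hL Y hY) hX)).1 hb
    have key' : ∀ Z, Q Z → Function.Bijective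
        (fun f : H.obj (L.obj Y) ⟶ Z => adj.unit.app Y ≫ f) := fun Z hZ => by
      obtain ⟨X, hX, ⟨e⟩⟩ := hes Z hZ
      refine ⟨fun f g hfg => ?_, fun f => ?_⟩
      · rw [← cancel_mono e.inv]
        exact (key X hX).1 (by simpa using congrArg (· ≫ e.inv) hfg)
      · obtain ⟨g, hg⟩ := (key X hX).2 (f ≫ e.inv)
        exact ⟨g ≫ e.hom, by simpa using congrArg (· ≫ e.hom) hg⟩
    obtain ⟨g, hg⟩ := (key' Y hY).2 (𝟙 _)
    exact ⟨g, hg, (key' _ (hH _ (hL Y hY))).1 (by simpa using congrArg (· ≫ adj.unit.app Y) hg)⟩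
  refine ⟨fun X hX => ?_, hun⟩
  have := hun _ (hH X hX)
  obtain ⟨s, hs⟩ := (hff X _ hX (hL _ (hH X hX))).2 (adj.unit.app (H.obj X))
  have h1 : H.map (adj.counit.app X) = inv (adj.unit.app (H.obj X)) :=
    IsIso.eq_inv_of_hom_inv_id (adj.right_triangle_components X)
  refine ⟨s, (hff _ _ (hL _ (hH X hX)) (hL _ (hH X hX))).1 ?_, (hff _ _ hX hX).1 ?_⟩
  · change H.map _ = H.map _
    rw [Functor.map_comp, h1]
    refine Eq.trans ?_ (H.map_id _).symm
    exact (congrArg (_ ≫ ·) hs).trans (IsIso.inv_hom_id _)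
  · change H.map _ = H.map _
    rw [Functor.map_comp, h1]
    refine Eq.trans ?_ (H.map_id _).symm
    exact (congrArg (· ≫ _) hs).trans (IsIso.hom_inv_id _)

theorem exists_restricted_equivalence (hH : ∀ X, P X → Q (H.obj X))
    (hL : ∀ X, Q X → P (L.obj X)) (hco : ∀ X, P X → IsIso (adj.counit.app X))
    (hun : ∀ Y, Q Y → IsIso (adj.unit.app Y)) :
    ∃ e : P.FullSubcategory ≌ Q.FullSubcategory,
      Nonempty (e.functor ⋙ Q.ι ≅ P.ι ⋙ H) ∧ Nonempty (e.inverse ⋙ P.ι ≅ Q.ι ⋙ L) := by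
  let F : P.FullSubcategory ⥤ Q.FullSubcategory := Q.lift (P.ι ⋙ H) fun X => hH _ X.property
  let G : Q.FullSubcategory ⥤ P.FullSubcategory := P.lift (Q.ι ⋙ L) fun X => hL _ X.property
  let a : G ⊣ F := adj.restrictFullyFaithful Q.fullyFaithfulι P.fullyFaithfulι (Iso.refl _)
    (Iso.refl _)
  have h1 : ∀ X, IsIso (a.counit.app X) := fun X => by
    have : IsIso (P.ι.map (a.counit.app X)) := by
      have := hco _ X.property
      rw [Adjunction.map_restrictFullyFaithful_counit_app]
      simp [F, G]
      infer_instance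
    exact isIso_of_reflects_iso _ P.ι
  have h2 : ∀ X, IsIso (a.unit.app X) := fun X => by
    have : IsIso (Q.ι.map (a.unit.app X)) := by
      have := hun _ X.property
      rw [Adjunction.map_restrictFullyFaithful_unit_app]
      simp [F, G]
      infer_instance
    exact isIso_of_reflects_iso _ Q.ι
  have : IsIso a.counit := NatIso.isIso_of_isIso_app _
  have : IsIso a.unit := NatIso.isIso_of_isIso_app _
  exact ⟨a.toEquivalence.symm, ⟨Iso.refl _⟩, ⟨Iso.refl _⟩⟩

end Restriction

/-! ### From a counter equivalence to the axioms used for links -/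

section Context

universe v w x

variable {C D : Type w} [Category.{v} C] [Category.{v} D] [Abelian C] [Abelian D]
  {k : Type v} [CommRing k] {J : Type v} [AddCommGroup J] [Module k J] [Linear k C] [Linear k D]
  [HasExt.{x} C] [HasExt.{x} D] {Φ : AdjointPairs C D} (W : WakamatsuContext k J Φ)

/-- The adjoint pairs restrict to a counter equivalence between complete hereditary cotorsion
pairs. -/
structure IsCounterPair (Φ : AdjointPairs C D) (𝓑 𝓐 : ObjectProperty C) (𝓖 𝓚 : ObjectProperty D) : Prop where
  mem_B : ∀ X, 𝓑 X ↔ Φ.fgC X ∧ ∀ N, 𝓐 N → Subsingleton (Ext.{x} X N 1)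
  mem_A : ∀ X, 𝓐 X ↔ Φ.fgC X ∧ ∀ N, 𝓑 N → Subsingleton (Ext.{x} N X 1)
  mem_G : ∀ X, 𝓖 X ↔ Φ.fgD X ∧ ∀ N, 𝓚 N → Subsingleton (Ext.{x} X N 1)
  mem_K : ∀ X, 𝓚 X ↔ Φ.fgD X ∧ ∀ N, 𝓖 N → Subsingleton (Ext.{x} N X 1)
  B_ker : ∀ {X Y Z : C} {f : X ⟶ Y} {g : Y ⟶ Z}, Ses f g → 𝓑 Y → 𝓑 Z → 𝓑 X
  G_ker : ∀ {X Y Z : D} {f : X ⟶ Y} {g : Y ⟶ Z}, Ses f g → 𝓖 Y → 𝓖 Z → 𝓖 X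
  complete_A : ∀ X, Φ.fgC X → ∃ (A B : C) (f : X ⟶ A) (g : A ⟶ B), Ses f g ∧ 𝓐 A ∧ 𝓑 B
  complete_G : ∀ X, Φ.fgD X → ∃ (K G : D) (f : K ⟶ G) (g : G ⟶ X), Ses f g ∧ 𝓖 G ∧ 𝓚 K
  H_mem : ∀ X, 𝓐 X → 𝓖 (Φ.H.obj X)
  L_mem : ∀ X, 𝓖 X → 𝓐 (Φ.L.obj X)
  H'_mem : ∀ X, 𝓚 X → 𝓑 (Φ.H'.obj X)
  L'_mem : ∀ X, 𝓑 X → 𝓚 (Φ.L'.obj X)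
  isIso_co : ∀ X, 𝓐 X → IsIso (Φ.co X)
  isIso_un : ∀ X, 𝓖 X → IsIso (Φ.un X)
  isIso_co' : ∀ X, 𝓚 X → IsIso (Φ.co' X)
  isIso_un' : ∀ X, 𝓑 X → IsIso (Φ.un' X)

namespace WakamatsuContext

theorem exists_retract_power (X : C) (hX : Φ.fgC X) [Projective X] :
    ∃ n, Nonempty (Retract X (power W.R n)) := by
  obtain ⟨n, p, hp⟩ := W.modC.cover X hX
  exact ⟨n, ⟨⟨Projective.factorThru (𝟙 X) p, p, Projective.factorThru_comp _ _⟩⟩⟩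

include W in
theorem hasNakayama : HasNakayama Φ where
  fg_quot := W.modC.fg_quot
  fg_biprod := W.modC.fg_biprod
  fg_ind P hP _ := W.fg_L _ (W.fg_L' _ hP)
  fg_zero := W.modC.fg_zero
  cover X hX := by
    obtain ⟨n, p, hp⟩ := W.modC.cover X hX
    have := W.projR
    exact ⟨_, p, hp, W.modC.fg_power W.modC.fg_R n, inferInstance⟩
  isIso_un' P hP _ := (W.lperp_of_projective P hP).isIso_un'
  isIso_un P hP _ := by
    obtain ⟨n, ⟨r⟩⟩ := W.exists_retract_power P hP
    exact Φ.isIso_un_of_retract ((r.map Φ.L').trans (Retract.ofIso (mapPowerIso Φ.L' W.R n)))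
      (W.cobass_power_T' n).2.2.1

/-- The Nakayama functor sends the sums of copies of the generator to sums of copies of the
cogenerator. -/
def nakayamaPowerIso {n : ℕ} : Φ.L'.obj (Φ.L.obj (power W.S n)) ≅ power W.F n :=
  have : IsIso (Φ.co' W.F) := W.swap.isIso_co_E
  Φ.L'.mapIso (mapPowerIso Φ.L W.S n) ≪≫ mapPowerIso Φ.L' W.T n ≪≫
    powerIso (Φ.L'.mapIso W.isoF.symm ≪≫ asIso (Φ.co' W.F)) n

end WakamatsuContext

namespace IsCounterPair

variable {𝓑 𝓐 : ObjectProperty C} {𝓖 𝓚 : ObjectProperty D} (h : IsCounterPair.{v, w, x} Φ 𝓑 𝓐 𝓖 𝓚)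

include h W

theorem B_of_retract {X Y : C} (r : Retract X Y) (hY : 𝓑 Y) : 𝓑 X := by
  rw [h.mem_B] at hY ⊢
  exact ⟨W.modC.fg_sub r.i inferInstance hY.1, fun A hA => ext_of_retract_left r (hY.2 A hA)⟩

theorem G_of_retract {X Y : D} (r : Retract X Y) (hY : 𝓖 Y) : 𝓖 X := by
  rw [h.mem_G] at hY ⊢
  exact ⟨W.modD.fg_sub r.i inferInstance hY.1, fun A hA => ext_of_retract_left r (hY.2 A hA)⟩

theorem B_of_projective (X : C) (hX : Φ.fgC X) [Projective X] : 𝓑 X :=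
  (h.mem_B X).2 ⟨hX, fun A _ => (extZero_of_projective X A).one⟩

theorem G_of_projective (X : D) (hX : Φ.fgD X) [Projective X] : 𝓖 X :=
  (h.mem_G X).2 ⟨hX, fun A _ => (extZero_of_projective X A).one⟩

theorem A_of_injective (X : C) (hX : Φ.fgC X) [Injective X] : 𝓐 X :=
  (h.mem_A X).2 ⟨hX, fun A _ => (extZero_of_injective A X).one⟩

theorem K_of_injective (X : D) (hX : Φ.fgD X) [Injective X] : 𝓚 X :=
  (h.mem_K X).2 ⟨hX, fun A _ => (extZero_of_injective A X).one⟩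

theorem zero_B (X : C) (hX : IsZero X) : 𝓑 X :=
  have := hX.projective
  h.B_of_projective W X (W.modC.fg_zero X hX)

theorem zero_A (X : C) (hX : IsZero X) : 𝓐 X :=
  have := hX.injective
  h.A_of_injective W X (W.modC.fg_zero X hX)

theorem zero_G (X : D) (hX : IsZero X) : 𝓖 X :=
  have := hX.projective
  h.G_of_projective W X (W.modD.fg_zero X hX)

theorem zero_K (X : D) (hX : IsZero X) : 𝓚 X :=
  have := hX.injective
  h.K_of_injective W X (W.modD.fg_zero X hX)

theorem B_biprod (X Y : C) (hX : 𝓑 X) (hY : 𝓑 Y) : 𝓑 (X ⊞ Y) := by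
  rw [h.mem_B] at hX hY ⊢
  exact ⟨W.modC.fg_biprod X Y hX.1 hY.1, fun A hA =>
    (Ses.biprod X Y).ext_middle_left (hX.2 A hA) (hY.2 A hA)⟩

theorem G_biprod (X Y : D) (hX : 𝓖 X) (hY : 𝓖 Y) : 𝓖 (X ⊞ Y) := by
  rw [h.mem_G] at hX hY ⊢
  exact ⟨W.modD.fg_biprod X Y hX.1 hY.1, fun A hA =>
    (Ses.biprod X Y).ext_middle_left (hX.2 A hA) (hY.2 A hA)⟩

theorem A_T : 𝓐 W.T :=
  have := W.projS
  h.L_mem _ (h.G_of_projective W _ W.modD.fg_R)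

theorem K_T' : 𝓚 W.T' :=
  have := W.projR
  h.L'_mem _ (h.B_of_projective W _ W.modC.fg_R)

theorem G_T' : 𝓖 W.T' :=
  have := W.injE
  h.G_of_retract W (Retract.ofIso W.isoE.symm) (h.H_mem _ (h.A_of_injective W _ W.modC.fg_E))

theorem B_T : 𝓑 W.T :=
  have := W.injF
  h.B_of_retract W (Retract.ofIso W.isoF.symm) (h.H'_mem _ (h.K_of_injective W _ W.modD.fg_E))

/-- Heredity passes from `𝓖` to `𝓚`: `Ext²(G, X)` is an `Ext¹` of a syzygy of `G`, which stays in
`𝓖`. -/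
theorem K_coker {X Y Z : D} {f : X ⟶ Y} {g : Y ⟶ Z} (hs : Ses f g) (hX : 𝓚 X) (hY : 𝓚 Y) :
    𝓚 Z := by
  have hY' := (h.mem_K Y).1 hY
  refine (h.mem_K Z).2 ⟨W.modD.fg_quot g hs.epi hY'.1, fun G hG => ?_⟩
  obtain ⟨n, p, hp⟩ := W.modD.cover G ((h.mem_G G).1 hG).1
  have := W.projS
  have hG' := h.G_ker (Ses.of_epi p) (h.G_of_projective W _ (W.modD.fg_power W.modD.fg_R n)) hG
  exact hs.ext_coshift_right ((Ses.of_epi p).ext_shift_right (((h.mem_K X).1 hX).2 _ hG')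
    (extZero_of_projective (power W.S n) X 2 two_pos)) (hY'.2 G hG)

/-- Exactness of `L`, `L'` and `H'` on the relevant sequences holds because `T` lies in `𝓐` and `T'`
in both `𝓖` and `𝓚`. The axioms on injectives hold because `L' L` carries powers of `S` to powers of
`F`. -/
theorem counterSetup : CounterSetup Φ 𝓑 𝓐 𝓖 𝓚 where
  nakC := W.hasNakayama
  nakD := W.swap.hasNakayama
  fgC_sub := W.modC.fg_sub
  fg_L' := W.fg_L'
  fg_A X hX := ((h.mem_A X).1 hX).1
  fg_B X hX := ((h.mem_B X).1 hX).1
  fg_G X hX := ((h.mem_G X).1 hX).1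
  fg_K X hX := ((h.mem_K X).1 hX).1
  zero_A := h.zero_A W
  zero_B := h.zero_B W
  zero_G := h.zero_G W
  zero_K := h.zero_K W
  isIso_co := h.isIso_co
  isIso_un := h.isIso_un
  isIso_co' := h.isIso_co'
  isIso_un' := h.isIso_un'
  H_mem := h.H_mem
  L_mem := h.L_mem
  H'_mem := h.H'_mem
  L'_mem := h.L'_mem
  extC hs hZ hM := hs.exists_extension (((h.mem_B _).1 hZ).2 _ hM)
  liftC hs hX hM := hs.exists_lift (((h.mem_B _).1 hM).2 _ hX)
  liftD hs hX hM := hs.exists_lift (((h.mem_G _).1 hM).2 _ hX)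
  complete_A := h.complete_A
  complete_G := h.complete_G
  B_ker := h.B_ker
  G_ker := h.G_ker
  K_coker := h.K_coker W
  B_biprod := h.B_biprod W
  G_biprod := h.G_biprod W
  L'_ses hs _ hZ := W.swap.ses_L hs (hs.exists_extension (((h.mem_B _).1 hZ).2 _ (h.A_T W)))
  L_ses hs _ hZ := W.ses_L hs (hs.exists_extension (((h.mem_G _).1 hZ).2 _ (h.K_T' W)))
  H'_ses hs hX := W.swap.ses_H hs (hs.exists_lift (((h.mem_G _).1 (h.G_T' W)).2 _ hX))
  proj_B P hP _ := h.B_of_projective W P hP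
  proj_L'_G P hP _ := by
    obtain ⟨n, ⟨r⟩⟩ := W.exists_retract_power P hP
    exact h.G_of_retract W ((r.map Φ.L').trans (Retract.ofIso (mapPowerIso Φ.L' W.R n)))
      (power_mem (h.zero_G W) (h.G_biprod W) (h.G_T' W) n)
  proj_G P hP _ := h.G_of_projective W P hP
  proj_L_B P hP _ := by
    obtain ⟨n, ⟨r⟩⟩ := W.swap.exists_retract_power P hP
    exact h.B_of_retract W ((r.map Φ.L).trans (Retract.ofIso (mapPowerIso Φ.L W.S n)))
      (power_mem (h.zero_B W) (h.B_biprod W) (h.B_T W) n)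
  proj_injective P hP _ := by
    obtain ⟨n, ⟨r⟩⟩ := W.swap.exists_retract_power P hP
    have := W.injF
    exact ((r.map (Φ.L ⋙ Φ.L')).trans (Retract.ofIso W.nakayamaPowerIso)).injective
  embed X hX := by
    obtain ⟨n, i, hi⟩ := W.modD.embed X hX
    have := W.projS
    exact ⟨power W.S n, i ≫ W.nakayamaPowerIso.inv, mono_comp _ _,
      W.modD.fg_power W.modD.fg_R n, inferInstance⟩

end IsCounterPair

end Context

end WakamatsuTilting

end

set_option linter.unusedSectionVars false

noncomputable section

namespace WakamatsuTilting

/-! ### Duality over an artinian ring -/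

section Matlis

variable {k : Type u} [CommRing k] [IsArtinianRing k] {J : Type u} [AddCommGroup J] [Module k J]

namespace IsInjectiveEnvelopeOfTop

variable (hJ : IsInjectiveEnvelopeOfTop k J)

include hJ

/-- The simple module `k / m` is a summand of the semisimple module `k / rad k`, which embeds into
`J`. -/
theorem exists_embedding (m : Ideal k) [m.IsMaximal] :
    ∃ l : (k ⧸ m) →ₗ[k] J, l 1 ≠ 0 := by
  obtain ⟨ι, hι, -⟩ := hJ.essential
  have : IsSemisimpleModule k (k ⧸ Ring.jacobson k) := by
    have : IsSemisimpleRing (k ⧸ Ring.jacobson k) := inferInstance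
    let σ : (k ⧸ Ring.jacobson k) →ₛₗ[Ideal.Quotient.mk (Ring.jacobson k)] (k ⧸ Ring.jacobson k) :=
      { toFun := id
        map_add' := fun _ _ => rfl
        map_smul' := fun c x => by
          rw [id, id, Algebra.smul_def, smul_eq_mul]
          rfl }
    exact (σ.isSemisimpleModule_iff_of_bijective Function.bijective_id).2 this
  have hle : Ring.jacobson k ≤ m := by
    rw [← Ideal.jacobson_bot]
    exact sInf_le ⟨bot_le, ‹_›⟩
  obtain ⟨s, hs⟩ := IsSemisimpleModule.lifting_property (Submodule.factor hle)
    (Submodule.factor_surjective hle) (LinearMap.id (M := k ⧸ m))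
  refine ⟨ι.comp s, fun h => ?_⟩
  have h1 : s 1 = 0 := hι (by rw [map_zero]; exact h)
  have h2 := LinearMap.congr_fun hs 1
  rw [LinearMap.comp_apply, h1, map_zero] at h2
  exact zero_ne_one h2

/-- A nonzero `m` generates a cyclic module with a simple quotient `k / I`; this embeds into `J`,
and injectivity extends the functional to `M`. -/
theorem isInjectiveCogenerator : IsInjectiveCogenerator k J where
  extend i hi l := by
    have := hJ.injective
    exact Module.Injective.out i hi l
  separate {M} _ _ m hm := by
    have := hJ.injective
    obtain ⟨I, hI, hle⟩ := Ideal.exists_le_maximal (LinearMap.ker (LinearMap.toSpanSingleton k M m))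
      (fun h => hm (by
        have : (1 : k) ∈ LinearMap.ker (LinearMap.toSpanSingleton k M m) := h ▸ Submodule.mem_top
        simpa using this))
    obtain ⟨l, hl⟩ := hJ.exists_embedding I
    obtain ⟨f, hf⟩ := exists_comp_eq_of_surjective
      (LinearMap.toSpanSingleton k M m).rangeRestrict (LinearMap.surjective_rangeRestrict _)
      (l.comp I.mkQ) (fun c hc => by
        have hc' : c ∈ I := hle (by simpa using congrArg Subtype.val hc)
        rw [LinearMap.comp_apply, Submodule.mkQ_apply, (Submodule.Quotient.mk_eq_zero I).2 hc',
          map_zero])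
    obtain ⟨g, hg⟩ := Module.Injective.out (Submodule.subtype _) (Submodule.subtype_injective _) f
    refine ⟨g, fun h => hl ?_⟩
    have h1 := hf 1
    have h2 := hg ((LinearMap.toSpanSingleton k M m).rangeRestrict 1)
    rw [h1] at h2
    exact h2.symm.trans (by simpa using h)

/-- Elements of `J` killed by `m` lie in the image of `k / rad k`, by essentiality, and the part of
`k / rad k` killed by `m` is at most one-dimensional over `k / m`. -/
theorem exists_smul_eq (m : Ideal k) [m.IsMaximal] {x y : J} (hx : ∀ c ∈ m, c • x = 0)
    (hy : ∀ c ∈ m, c • y = 0) (hx0 : x ≠ 0) : ∃ c : k, c • x = y := by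
  obtain ⟨ι, hι, hess⟩ := hJ.essential
  have hrange : ∀ z : J, (∀ c ∈ m, c • z = 0) → ∃ p : k, ι (Submodule.Quotient.mk p) = z := by
    intro z hz
    by_cases hz0 : z = 0
    · exact ⟨0, by rw [hz0]; exact map_zero ι⟩
    · have h1 : Submodule.span k {z} ⊓ LinearMap.range ι ≠ ⊥ := fun h =>
        hz0 (Submodule.span_singleton_eq_bot.1 (hess _ h))
      obtain ⟨w, ⟨hw, v, hv⟩, hw0⟩ := Submodule.exists_mem_ne_zero_of_ne_bot h1
      obtain ⟨c, rfl⟩ := Submodule.mem_span_singleton.1 hw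
      have hc : c ∉ m := fun h => hw0 (hz c h)
      obtain ⟨d, e, he, hde⟩ := Ideal.IsMaximal.exists_inv ‹m.IsMaximal› hc
      obtain ⟨p, hp⟩ := Submodule.Quotient.mk_surjective _ (d • v)
      refine ⟨p, ?_⟩
      rw [hp, map_smul, hv, smul_smul]
      have := congrArg (· • z) hde
      simpa [add_smul, hz e he] using this
  obtain ⟨p, rfl⟩ := hrange x hx
  obtain ⟨q, rfl⟩ := hrange y hy
  have hmem : ∀ p : k, (∀ c ∈ m, c • ι (Submodule.Quotient.mk p) = 0) → ∀ c ∈ m,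
      c * p ∈ Ring.jacobson k := fun p hp c hc => by
    have h := hp c hc
    rw [← map_smul, ← Submodule.Quotient.mk_smul] at h
    exact (Submodule.Quotient.mk_eq_zero _).1 (hι (h.trans (map_zero ι).symm))
  have hp0 : p ∉ Ring.jacobson k := fun h => hx0 (by
    rw [(Submodule.Quotient.mk_eq_zero _).2 h, map_zero])
  -- If `p` were in `m`, then `p * p` would lie in every maximal ideal, and hence so would `p`.
  have hpm : p ∉ m := fun h => hp0 (by
    have h2 := hmem p hx p h
    rw [← Ideal.jacobson_bot, Ideal.jacobson, Submodule.mem_sInf] at h2 ⊢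
    intro I hI
    have hI' : Ideal.IsMaximal (α := k) I := hI.2
    exact (hI'.isPrime.mem_or_mem (h2 I hI)).elim id id)
  obtain ⟨d, e, he, hde⟩ := Ideal.IsMaximal.exists_inv ‹m.IsMaximal› hpm
  refine ⟨q * d, ?_⟩
  rw [← map_smul, ← Submodule.Quotient.mk_smul]
  congr 1
  rw [Submodule.Quotient.eq]
  have h := hmem q hy e he
  have e1 : (q * d) • p - q = -(e * q) := by
    rw [smul_eq_mul]
    linear_combination q * hde
  rw [e1]
  exact neg_mem h

/-- Evaluation at the elements of a finitely generated module gives all functionals on the dual, and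
the dual is finitely generated. -/
theorem dual_reflexive (M : Type u) [AddCommGroup M] [Module k M] (hM : Module.Finite k M) :
    IsNoetherian k (M →ₗ[k] J) ∧ ∀ l : (M →ₗ[k] J) →ₗ[k] J, ∃ m, ∀ f, l f = f m := by
  -- Prime ideals of `k` are maximal, so the middle case is a simple module `k / m`, whose dual is
  -- generated by the single functional `l₀`.
  refine IsNoetherianRing.induction_on_isQuotientEquivQuotientPrime k hM
    (motive := fun M _ _ _ => IsNoetherian k (M →ₗ[k] J) ∧
      ∀ l : (M →ₗ[k] J) →ₗ[k] J, ∃ m, ∀ f, l f = f m) ?_ ?_ ?_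
  · intro M _ _ _ _
    have : Subsingleton (M →ₗ[k] J) := ⟨fun f g => LinearMap.ext fun m => by
      rw [Subsingleton.elim m 0, map_zero, map_zero]⟩
    exact ⟨inferInstance, fun l => ⟨0, fun f => by
      rw [Subsingleton.elim f 0, map_zero, LinearMap.zero_apply]⟩⟩
  · intro M _ _ _ p e
    have hp : p.1.IsMaximal := have := p.2; inferInstance
    obtain ⟨l₀, hl₀⟩ := hJ.exists_embedding p.1
    have hann : ∀ c ∈ p.1, ∀ m : M, c • m = 0 := fun c hc m => e.injective (by
      rw [map_smul, map_zero]
      obtain ⟨x, hx⟩ := Submodule.Quotient.mk_surjective _ (e m)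
      rw [← hx, ← Submodule.Quotient.mk_smul, Submodule.Quotient.mk_eq_zero]
      exact p.1.mul_mem_right _ hc)
    have hgen : ∀ f : M →ₗ[k] J, ∃ c : k, c • l₀.comp e.toLinearMap = f := fun f => by
      obtain ⟨c, hc⟩ := hJ.exists_smul_eq p.1 (x := l₀ 1) (y := f (e.symm 1))
        (fun c hc => by
          have := hann c hc (e.symm 1)
          rw [← map_smul, ← e.apply_symm_apply 1, ← map_smul, this, map_zero, map_zero])
        (fun c hc => by rw [← map_smul, hann c hc, map_zero]) hl₀
      refine ⟨c, LinearMap.ext fun m => ?_⟩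
      obtain ⟨x, hx⟩ := Submodule.Quotient.mk_surjective _ (e m)
      have e1 : m = x • e.symm 1 := e.injective (by
        rw [map_smul, e.apply_symm_apply, ← hx]
        change _ = x • Submodule.Quotient.mk (p := p.1) 1
        rw [← Submodule.Quotient.mk_smul, smul_eq_mul, mul_one])
      rw [e1]
      simp only [LinearMap.smul_apply, LinearMap.comp_apply, map_smul, LinearEquiv.coe_coe,
        e.apply_symm_apply]
      exact congrArg (x • ·) hc
    refine ⟨?_, fun l => ?_⟩
    · have hs : Function.Surjective (LinearMap.toSpanSingleton k (M →ₗ[k] J)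
        (l₀.comp e.toLinearMap)) := hgen
      have : Module.Finite k (M →ₗ[k] J) := Module.Finite.of_surjective _ hs
      infer_instance
    · obtain ⟨c, hc⟩ := hJ.exists_smul_eq p.1 (x := l₀ 1) (y := l (l₀.comp e.toLinearMap))
        (fun c hc => by
          have := hann c hc (e.symm 1)
          rw [← map_smul, ← e.apply_symm_apply 1, ← map_smul, this, map_zero, map_zero])
        (fun c hc => by
          rw [← map_smul]
          have : c • l₀.comp e.toLinearMap = 0 := LinearMap.ext fun m => by
            rw [LinearMap.smul_apply, ← map_smul, hann c hc, map_zero, LinearMap.zero_apply]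
          rw [this, map_zero]) hl₀
      refine ⟨c • e.symm 1, fun f => ?_⟩
      obtain ⟨d, rfl⟩ := hgen f
      rw [map_smul, ← hc]
      simp only [LinearMap.smul_apply, LinearMap.comp_apply, map_smul, LinearEquiv.coe_coe,
        e.apply_symm_apply]
      exact smul_comm _ _ _
  · intro M₁ _ _ _ M₂ _ _ _ M₃ _ _ _ f g hf hg hfg h₁ h₃
    have i1 := h₁.1
    have i3 := h₃.1
    have hsurj : Function.Surjective (LinearMap.lcomp k J f) := fun l => by
      obtain ⟨l', hl'⟩ := hJ.isInjectiveCogenerator.extend f hf l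
      exact ⟨l', LinearMap.ext hl'⟩
    have hex : ∀ l : M₂ →ₗ[k] J, LinearMap.lcomp k J f l = 0 →
        ∃ l', LinearMap.lcomp k J g l' = l := fun l hl => by
      obtain ⟨l', hl'⟩ := exists_comp_eq_of_surjective g hg l (fun m hm => by
        obtain ⟨x, rfl⟩ := (hfg m).1 hm
        exact LinearMap.congr_fun hl x)
      exact ⟨l', LinearMap.ext hl'⟩
    refine ⟨isNoetherian_of_range_eq_ker (LinearMap.lcomp k J g) (LinearMap.lcomp k J f) ?_,
      fun l => ?_⟩
    · ext l
      refine ⟨?_, fun h => hex l h⟩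
      rintro ⟨l', rfl⟩
      refine LinearMap.ext fun m => ?_
      simp [hfg.apply_apply_eq_zero m]
    · obtain ⟨q, hq⟩ := h₃.2 (l.comp (LinearMap.lcomp k J g))
      obtain ⟨m, rfl⟩ := hg q
      obtain ⟨l', hl'⟩ := exists_comp_eq_of_surjective (LinearMap.lcomp k J f) hsurj
        (l - LinearMap.applyₗ m) (fun t ht => by
          obtain ⟨t', rfl⟩ := hex t ht
          have := hq t'
          rw [LinearMap.comp_apply] at this
          simp [this])
      obtain ⟨n, hn⟩ := h₁.2 l'
      refine ⟨f n + m, fun t => ?_⟩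
      have := hl' t
      rw [hn] at this
      simp only [LinearMap.lcomp_apply, LinearMap.sub_apply, LinearMap.applyₗ_apply_apply] at this
      rw [map_add, this, sub_add_cancel]

end IsInjectiveEnvelopeOfTop

end Matlis

end WakamatsuTilting

end

set_option linter.unusedSectionVars false

noncomputable section

namespace WakamatsuTilting

open Limits ZeroObject

/-! ### Modules over an artin algebra -/

section FiniteHom

universe v w

variable {C : Type w} [Category.{v} C] [Abelian C] {k : Type v} [CommRing k] [Linear k C]

theorem exists_power_desc {X Y : C} : ∀ (n : ℕ) (s : Fin n → (X ⟶ Y)),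
    ∃ p : power X n ⟶ Y, ∀ i, ∃ t, t ≫ p = s i
  | 0, _ => ⟨0, fun i => i.elim0⟩
  | n + 1, s => by
    obtain ⟨p, hp⟩ := exists_power_desc n (fun i => s i.succ)
    refine ⟨biprod.desc (s 0) p, fun i => Fin.cases ⟨biprod.inl, biprod.inl_desc _ _⟩
      (fun i => ?_) i⟩
    obtain ⟨t, ht⟩ := hp i
    exact ⟨t ≫ biprod.inr, (Category.assoc _ _ _).trans
      ((congrArg (t ≫ ·) (biprod.inr_desc _ _)).trans ht)⟩

theorem exists_power_lift {X Y : C} : ∀ (n : ℕ) (s : Fin n → (X ⟶ Y)),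
    ∃ p : X ⟶ power Y n, ∀ i, ∃ t, p ≫ t = s i
  | 0, _ => ⟨0, fun i => i.elim0⟩
  | n + 1, s => by
    obtain ⟨p, hp⟩ := exists_power_lift n (fun i => s i.succ)
    refine ⟨biprod.lift (s 0) p, fun i => Fin.cases ⟨biprod.fst, biprod.lift_fst _ _⟩
      (fun i => ?_) i⟩
    obtain ⟨t, ht⟩ := hp i
    exact ⟨biprod.snd ≫ t, (Category.assoc _ _ _).symm.trans
      ((congrArg (· ≫ t) (biprod.lift_snd _ _)).trans ht)⟩

variable (k) in
theorem exists_right_approx {X Y : C} (h : Module.Finite k (X ⟶ Y)) :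
    ∃ (n : ℕ) (p : power X n ⟶ Y), ∀ h : X ⟶ Y, ∃ s, s ≫ p = h := by
  obtain ⟨n, s, hs⟩ := Module.Finite.exists_fin (R := k) (M := X ⟶ Y)
  obtain ⟨p, hp⟩ := exists_power_desc n s
  refine ⟨n, p, fun h => ?_⟩
  have h1 : Submodule.span k (Set.range s) ≤ LinearMap.range (Linear.rightComp k X p) := by
    rw [Submodule.span_le]
    rintro _ ⟨i, rfl⟩
    exact hp i
  exact h1 (hs ▸ Submodule.mem_top)

variable (k) in
theorem exists_left_approx {X Y : C} (h : Module.Finite k (X ⟶ Y)) :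
    ∃ (n : ℕ) (p : X ⟶ power Y n), ∀ h : X ⟶ Y, ∃ s, p ≫ s = h := by
  obtain ⟨n, s, hs⟩ := Module.Finite.exists_fin (R := k) (M := X ⟶ Y)
  obtain ⟨p, hp⟩ := exists_power_lift n s
  refine ⟨n, p, fun h => ?_⟩
  have h1 : Submodule.span k (Set.range s) ≤ LinearMap.range (Linear.leftComp k Y p) := by
    rw [Submodule.span_le]
    rintro _ ⟨i, rfl⟩
    exact hp i
  exact h1 (hs ▸ Submodule.mem_top)

end FiniteHom

section DualModule

variable {k : Type u} [CommRing k] {J : Type u} [AddCommGroup J] [Module k J]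
  {M : Type u} [AddCommGroup M] [Module k M]

variable (k J M) in
/-- The dual as a module over the base ring. -/
@[reducible] def dualModule : Module k (Dual k J M) := inferInstanceAs (Module k (M →ₗ[k] J))

theorem dual_isScalarTower_op (S : Type u) [Ring S] [Algebra k S] [Module S M]
    [IsScalarTower k S M] : letI := dualModule k J M; IsScalarTower k Sᵐᵒᵖ (Dual k J M) :=
  letI := dualModule k J M
  { smul_assoc := fun c s f => Dual.ext fun m => by
      change f.toLin ((c • s).unop • m) = c • f.toLin (s.unop • m)
      rw [MulOpposite.unop_smul, smul_assoc, map_smul] }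

end DualModule

section ArtinAlgebra

open scoped ModuleCat.Algebra

variable (k : Type u) [CommRing k] [IsArtinianRing k] (J : Type u) [AddCommGroup J] [Module k J]
  (R : Type u) [Ring R] [Algebra k R] [Module.Finite k R]

include k in
theorem isNoetherianRing_op : IsNoetherianRing Rᵐᵒᵖ :=
  isNoetherian_of_tower k (inferInstance : IsNoetherian k Rᵐᵒᵖ)

include k in
theorem isArtinianRing_op : IsArtinianRing Rᵐᵒᵖ :=
  isArtinian_of_tower k (inferInstance : IsArtinian k Rᵐᵒᵖ)

variable {R} in
theorem finite_of_isFG {X : ModuleCat.{u} Rᵐᵒᵖ} (h : ModuleCat.isFG Rᵐᵒᵖ X) : Module.Finite k X :=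
  have : Module.Finite Rᵐᵒᵖ X := h
  Module.Finite.trans Rᵐᵒᵖ X

variable {R} in
theorem finite_hom {X Y : ModuleCat.{u} Rᵐᵒᵖ} (hX : ModuleCat.isFG Rᵐᵒᵖ X)
    (hY : ModuleCat.isFG Rᵐᵒᵖ Y) : Module.Finite k (X ⟶ Y) := by
  have := finite_of_isFG k hX
  have := finite_of_isFG k hY
  let f : (X ⟶ Y) →ₗ[k] (X →ₗ[k] Y) := (LinearMap.restrictScalarsₗ k Rᵐᵒᵖ X Y k).comp
    (ModuleCat.homLinearEquiv (S := k)).toLinearMap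
  have hf : Function.Injective f := (LinearMap.restrictScalars_injective k).comp
    (ModuleCat.homLinearEquiv (S := k)).injective
  exact Module.Finite.of_injective f hf

variable {k J R}

/-- The morphism from the regular module given by an element. -/
def ofElement {X : ModuleCat.{u} Rᵐᵒᵖ} (x : X) : ModuleCat.of Rᵐᵒᵖ R ⟶ X :=
  ModuleCat.ofHom
    { toFun := fun r => MulOpposite.op r • x
      map_add' := fun r s => by rw [MulOpposite.op_add, add_smul]
      map_smul' := fun s r => mul_smul s (MulOpposite.op r) x }

@[simp] theorem ofElement_apply {X : ModuleCat.{u} Rᵐᵒᵖ} (x : X) (r : R) :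
    (ofElement x).hom r = MulOpposite.op r • x := rfl

@[simp] theorem ofElement_one {X : ModuleCat.{u} Rᵐᵒᵖ} (x : X) : (ofElement x).hom (1 : R) = x := by
  rw [ofElement_apply, MulOpposite.op_one, one_smul]

theorem ofElement_hom_one {X : ModuleCat.{u} Rᵐᵒᵖ} (u : ModuleCat.of Rᵐᵒᵖ R ⟶ X) :
    ofElement (u.hom (1 : R)) = u := by
  refine ModuleCat.hom_ext (LinearMap.ext fun (r : R) => ?_)
  rw [ofElement_apply, ← map_smul]
  congr 1
  exact one_mul r

/-- The morphism to the dual of the regular module given by a functional. -/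
def ofFunctional {X : ModuleCat.{u} Rᵐᵒᵖ} (l : X →ₗ[k] J) : X ⟶ ModuleCat.of Rᵐᵒᵖ (Dual k J R) :=
  ModuleCat.ofHom
    { toFun := fun x => (l.comp
        { toFun := fun r => MulOpposite.op r • x
          map_add' := fun r s => by rw [MulOpposite.op_add, add_smul]
          map_smul' := fun c r => by
            rw [MulOpposite.op_smul, smul_assoc, RingHom.id_apply] } : R →ₗ[k] J)
      map_add' := fun x y => Dual.ext fun r => by
        change l (MulOpposite.op r • (x + y)) = l _ + l _
        rw [smul_add, map_add]
        rfl
      map_smul' := fun s x => Dual.ext fun r => by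
        change l (MulOpposite.op r • s • x) = l (MulOpposite.op (s.unop * r) • x)
        rw [MulOpposite.op_mul, MulOpposite.op_unop, mul_smul] }

@[simp] theorem ofFunctional_apply {X : ModuleCat.{u} Rᵐᵒᵖ} (l : X →ₗ[k] J) (x : X) (r : R) :
    ((ofFunctional l).hom x : Dual k J R).toLin r = l (MulOpposite.op r • x) := rfl

/-- The functional given by a morphism to the dual of the regular module. -/
def toFunctional {X : ModuleCat.{u} Rᵐᵒᵖ} (f : X ⟶ ModuleCat.of Rᵐᵒᵖ (Dual k J R)) : X →ₗ[k] J where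
  toFun x := (f.hom x : Dual k J R).toLin (1 : R)
  map_add' x y := by rw [map_add]; rfl
  map_smul' c x := by
    rw [← algebraMap_smul Rᵐᵒᵖ c x, map_smul, RingHom.id_apply]
    change (f.hom x : Dual k J R).toLin (algebraMap k R c * 1) = _
    rw [← Algebra.smul_def, map_smul]

theorem toFunctional_apply {X : ModuleCat.{u} Rᵐᵒᵖ} (f : X ⟶ ModuleCat.of Rᵐᵒᵖ (Dual k J R)) (x : X) :
    toFunctional f x = (f.hom x : Dual k J R).toLin (1 : R) := rfl

theorem ofFunctional_toFunctional {X : ModuleCat.{u} Rᵐᵒᵖ}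
    (f : X ⟶ ModuleCat.of Rᵐᵒᵖ (Dual k J R)) : ofFunctional (toFunctional f) = f := by
  refine ModuleCat.hom_ext (LinearMap.ext fun x => Dual.ext fun (r : R) => ?_)
  rw [ofFunctional_apply, toFunctional_apply, map_smul]
  change (f.hom x : Dual k J R).toLin (r * 1) = _
  rw [mul_one]

variable (k J R) in
/-- The canonical functional on the morphisms from the regular module to its dual. -/
def regularTrace : (ModuleCat.of Rᵐᵒᵖ R ⟶ ModuleCat.of Rᵐᵒᵖ (Dual k J R)) →ₗ[k] J where
  toFun e := (e.hom (1 : R) : Dual k J R).toLin (1 : R)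
  map_add' _ _ := rfl
  map_smul' c e := by
    change (e.hom (1 : R) : Dual k J R).toLin (algebraMap k R c * 1) = _
    rw [← Algebra.smul_def, map_smul]
    rfl

theorem regularTrace_apply (e : ModuleCat.of Rᵐᵒᵖ R ⟶ ModuleCat.of Rᵐᵒᵖ (Dual k J R)) :
    regularTrace k J R e = (e.hom (1 : R) : Dual k J R).toLin (1 : R) := rfl

-- Fitting's lemma, with the image of `φ ^ n` for large `n` as summand. The composite `e ≫ m` is `φ
-- ^ n` and not an idempotent, so `m ≫ e` is only invertible; it still fixes whatever `φ` fixes.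
variable (k) in
include k in
theorem exists_fitting : ∃ len : ModuleCat.{u} Rᵐᵒᵖ → ℕ, ∀ X, ModuleCat.isFG Rᵐᵒᵖ X →
    ∀ φ : X ⟶ X, IsIso φ ∨
    ∃ (Y : ModuleCat.{u} Rᵐᵒᵖ) (e : X ⟶ Y) (m : Y ⟶ X), len Y < len X ∧ IsIso (m ≫ e) ∧
      (∀ (Z : ModuleCat.{u} Rᵐᵒᵖ) (f : X ⟶ Z), φ ≫ f = f → e ≫ m ≫ f = f) ∧
      ∀ (Z : ModuleCat.{u} Rᵐᵒᵖ) (f : Z ⟶ X), f ≫ φ = f → f ≫ e ≫ m = f := by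
  refine ⟨fun X => (Module.length Rᵐᵒᵖ X).toNat, fun X hX φ => ?_⟩
  have := isNoetherianRing_op k R
  have := isArtinianRing_op k R
  have : Module.Finite Rᵐᵒᵖ X := hX
  obtain ⟨n, hn, hn0⟩ := ((LinearMap.eventually_isCompl_ker_pow_range_pow φ.hom).and
    (Filter.eventually_ge_atTop 1)).exists
  by_cases htop : LinearMap.range (φ.hom ^ n) = ⊤
  · left
    have hb : LinearMap.ker (φ.hom ^ n) = ⊥ := by
      have := hn.disjoint
      rwa [htop, disjoint_top] at this
    rw [ConcreteCategory.isIso_iff_bijective]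
    obtain ⟨m, rfl⟩ := Nat.exists_eq_add_of_le' hn0
    constructor
    · refine LinearMap.ker_eq_bot.1 (le_bot_iff.1 ?_ : LinearMap.ker φ.hom = ⊥)
      rw [← hb, pow_succ]
      exact LinearMap.ker_le_ker_comp _ _
    · refine LinearMap.range_eq_top.1 (top_le_iff.1 ?_ : LinearMap.range φ.hom = ⊤)
      rw [← htop, pow_succ']
      exact LinearMap.range_comp_le_range _ _
  · right
    let N := LinearMap.range (φ.hom ^ n)
    have hpow : ∀ {Z : ModuleCat.{u} Rᵐᵒᵖ} (f : X ⟶ Z), φ ≫ f = f → ∀ m x,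
        f.hom ((φ.hom ^ m) x) = f.hom x := fun f hf m x => by
      induction m with
      | zero => rfl
      | succ m ih =>
        rw [pow_succ', Module.End.mul_apply]
        exact (congrArg (fun t => t.hom ((φ.hom ^ m) x)) hf).trans ih
    have hpow' : ∀ {Z : ModuleCat.{u} Rᵐᵒᵖ} (f : Z ⟶ X), f ≫ φ = f → ∀ m x,
        (φ.hom ^ m) (f.hom x) = f.hom x := fun f hf m x => by
      induction m with
      | zero => rfl
      | succ m ih =>
        rw [pow_succ', Module.End.mul_apply, ih]
        exact congrArg (fun t => t.hom x) hf
    refine ⟨ModuleCat.of Rᵐᵒᵖ N, ModuleCat.ofHom (LinearMap.rangeRestrict (φ.hom ^ n)),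
      ModuleCat.ofHom N.subtype, ?_, ?_, fun Z f hf => ?_, fun Z f hf => ?_⟩
    · refine ENat.coe_lt_coe.1 ?_
      rw [ENat.coe_toNat (Submodule.length_lt htop).ne_top, ENat.coe_toNat Module.length_ne_top]
      exact Submodule.length_lt htop
    · rw [ConcreteCategory.isIso_iff_bijective]
      constructor
      · rw [injective_iff_map_eq_zero]
        intro x hx
        have h1 : (φ.hom ^ n) (x : X) = 0 := congrArg Subtype.val hx
        exact Subtype.ext (Submodule.disjoint_def.1 hn.disjoint _ h1 x.2)
      · rintro ⟨_, y, rfl⟩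
        obtain ⟨a, b, ha, hb, rfl⟩ := Submodule.codisjoint_iff_exists_add_eq.1 hn.codisjoint y
        refine ⟨⟨b, hb⟩, Subtype.ext ?_⟩
        change (φ.hom ^ n) b = (φ.hom ^ n) (a + b)
        rw [map_add, LinearMap.mem_ker.1 ha, zero_add]
    · exact ModuleCat.hom_ext (LinearMap.ext fun x => hpow f hf n x)
    · exact ModuleCat.hom_ext (LinearMap.ext fun x => hpow' f hf n x)

/-- Morphisms from the regular module are elements and morphisms to its dual are functionals. So
`rep'` is double duality over `k`, and approximations exist because the morphism groups are finitely
generated over `k`. -/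
theorem modLike (hJ : IsInjectiveEnvelopeOfTop k J) :
    ModLike k J (ModuleCat.isFG.{u} Rᵐᵒᵖ) (ModuleCat.of Rᵐᵒᵖ R) (ModuleCat.of Rᵐᵒᵖ (Dual k J R))
      (regularTrace k J R) := by
  have i1 := isNoetherianRing_op k R
  have fgR : ModuleCat.isFG.{u} Rᵐᵒᵖ (ModuleCat.of Rᵐᵒᵖ R) :=
    (Module.Finite.of_restrictScalars_finite k Rᵐᵒᵖ R : Module.Finite Rᵐᵒᵖ R)
  have fgE : ModuleCat.isFG.{u} Rᵐᵒᵖ (ModuleCat.of Rᵐᵒᵖ (Dual k J R)) := by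
    let := dualModule k J R
    have : IsScalarTower k Rᵐᵒᵖ (Dual k J R) := dual_isScalarTower_op R
    have : IsNoetherian k (Dual k J R) := (hJ.dual_reflexive R inferInstance).1
    exact (Module.Finite.of_restrictScalars_finite k Rᵐᵒᵖ (Dual k J R) :
      Module.Finite Rᵐᵒᵖ (Dual k J R))
  have hgen : ∀ {X A : ModuleCat.{u} Rᵐᵒᵖ} (a : X ⟶ A),
      (∀ u : ModuleCat.of Rᵐᵒᵖ R ⟶ X, u ≫ a = 0) → a = 0 := fun {X A} a ha => by
    refine ModuleCat.hom_ext (LinearMap.ext fun x => ?_)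
    have h : a.hom ((ofElement x).hom (1 : R)) = 0 :=
      congrArg (fun t => t.hom (1 : R)) (ha (ofElement x))
    rwa [ofElement_one] at h
  have right_approx : ∀ X Y : ModuleCat.{u} Rᵐᵒᵖ, ModuleCat.isFG Rᵐᵒᵖ X → ModuleCat.isFG Rᵐᵒᵖ Y →
      ∃ (n : ℕ) (p : power X n ⟶ Y), ∀ h : X ⟶ Y, ∃ s, s ≫ p = h :=
    fun X Y hX hY => exists_right_approx k (finite_hom k hX hY)
  have left_approx : ∀ X Y : ModuleCat.{u} Rᵐᵒᵖ, ModuleCat.isFG Rᵐᵒᵖ X → ModuleCat.isFG Rᵐᵒᵖ Y →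
      ∃ (n : ℕ) (p : X ⟶ power Y n), ∀ h : X ⟶ Y, ∃ s, p ≫ s = h :=
    fun X Y hX hY => exists_left_approx k (finite_hom k hX hY)
  refine
    { fg_R := fgR
      fg_E := fgE
      fg_quot := fun {X Y} f hf hX => ?_
      fg_sub := fun {X Y} f hf hY => ?_
      fg_ext := fun {X Y Z f g} h hX hZ => ?_
      projective := ?_
      cover := fun X hX => ?_
      embed := fun X hX => ?_
      right_approx := right_approx
      left_approx := left_approx
      rep := fun A l => ?_
      rep' := fun Y hY l => ?_
      eq_zero := fun {A} a ha => ?_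
      eq_zero' := fun {Y} y hy => ?_
      gen := hgen
      fitting := exists_fitting k }
  · have : Module.Finite Rᵐᵒᵖ X := hX
    exact Module.Finite.of_surjective f.hom ((ModuleCat.epi_iff_surjective f).1 hf)
  · have : Module.Finite Rᵐᵒᵖ Y := hY
    exact Module.Finite.of_injective f.hom ((ModuleCat.mono_iff_injective f).1 hf)
  · have : Module.Finite Rᵐᵒᵖ X := hX
    have : Module.Finite Rᵐᵒᵖ Z := hZ
    have : IsNoetherian Rᵐᵒᵖ Y := isNoetherian_of_range_eq_ker f.hom g.hom
      (LinearMap.exact_iff.1 ((ShortComplex.ShortExact.moduleCat_exact_iff_function_exact _).1 h.2.exact)).symm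
    exact (inferInstance : Module.Finite Rᵐᵒᵖ Y)
  · refine ⟨fun {E X} f e he => ?_⟩
    obtain ⟨x, hx⟩ := (ModuleCat.epi_iff_surjective e).1 he (f.hom (1 : R))
    refine ⟨ofElement x, ?_⟩
    rw [← ofElement_hom_one f, ← hx]
    refine ModuleCat.hom_ext (LinearMap.ext fun (r : R) => ?_)
    exact map_smul e.hom _ _
  · obtain ⟨n, p, hp⟩ := right_approx _ X fgR hX
    refine ⟨n, p, (ModuleCat.epi_iff_surjective p).2 fun x => ?_⟩
    obtain ⟨s, hs⟩ := hp (ofElement x)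
    refine ⟨s.hom (1 : R), ?_⟩
    exact (congrArg (fun t => t.hom (1 : R)) hs).trans (ofElement_one x)
  · obtain ⟨n, i, hi⟩ := left_approx X _ hX fgE
    refine ⟨n, i, (ModuleCat.mono_iff_injective i).2 ?_⟩
    rw [← LinearMap.ker_eq_bot, LinearMap.ker_eq_bot']
    intro x hx
    by_contra h0
    obtain ⟨l, hl⟩ := hJ.isInjectiveCogenerator.separate x h0
    obtain ⟨s, hs⟩ := hi (ofFunctional l)
    have h : (s.hom (i.hom x) : Dual k J R).toLin (1 : R) = l (MulOpposite.op (1 : R) • x) :=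
      congrArg (fun t => (t.hom x : Dual k J R).toLin (1 : R)) hs
    have hx' : i.hom x = 0 := hx
    rw [hx', map_zero, MulOpposite.op_one, one_smul] at h
    exact hl h.symm
  · let o : A →ₗ[k] (ModuleCat.of Rᵐᵒᵖ R ⟶ A) :=
      { toFun := fun x => ofElement x
        map_add' := fun x y => ModuleCat.hom_ext (LinearMap.ext fun (r : R) => smul_add _ _ _)
        map_smul' := fun c x =>
          ModuleCat.hom_ext (LinearMap.ext fun (r : R) => smul_comm _ _ _) }
    refine ⟨ofFunctional (l.comp o), fun u => ?_⟩
    · rw [regularTrace_apply]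
      conv_rhs => rw [← ofElement_hom_one u]
      rw [ModuleCat.comp_apply]
      change l (ofElement (MulOpposite.op (1 : R) • _)) = _
      rw [MulOpposite.op_one, one_smul]
  · have := finite_of_isFG k hY
    let o : (Y →ₗ[k] J) →ₗ[k] (Y ⟶ ModuleCat.of Rᵐᵒᵖ (Dual k J R)) :=
      { toFun := fun m => ofFunctional m
        map_add' := fun x y => rfl
        map_smul' := fun c x => by
          refine ModuleCat.hom_ext (LinearMap.ext fun z => Dual.ext fun r => ?_)
          change c • x (MulOpposite.op r • z) = x (MulOpposite.op (algebraMap k R c * r) • z)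
          rw [← Algebra.smul_def, MulOpposite.op_smul, smul_assoc]
          exact (LinearMap.map_smul x c _).symm }
    obtain ⟨y, hy⟩ := (hJ.dual_reflexive Y this).2 (l.comp o)
    · refine ⟨ofElement y, fun f => ?_⟩
      have := hy (toFunctional f)
      rw [LinearMap.comp_apply] at this
      change l (ofFunctional (toFunctional f)) = _ at this
      rw [ofFunctional_toFunctional] at this
      rw [this, regularTrace_apply, toFunctional_apply, ModuleCat.comp_apply, ofElement_apply,
        MulOpposite.op_one, one_smul]
  · rw [← ofFunctional_toFunctional a]
    have : toFunctional a = 0 := LinearMap.ext fun x => by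
      have h := ha (ofElement x)
      rw [regularTrace_apply, ModuleCat.comp_apply, ofElement_apply, MulOpposite.op_one,
        one_smul] at h
      exact h
    rw [this]
    rfl
  · rw [← ofElement_hom_one y]
    have : y.hom (1 : R) = 0 := by
      by_contra h0
      obtain ⟨l, hl⟩ := hJ.isInjectiveCogenerator.separate (y.hom (1 : R)) h0
      apply hl
      have h := hy (ofFunctional l)
      rw [regularTrace_apply, ModuleCat.comp_apply, ofFunctional_apply, MulOpposite.op_one,
        one_smul] at h
      exact h
    rw [this]
    refine ModuleCat.hom_ext (LinearMap.ext fun (r : R) => ?_)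
    exact smul_zero _

end ArtinAlgebra

end WakamatsuTilting

end

set_option linter.unusedSectionVars false

noncomputable section

namespace WakamatsuTilting

open Limits ZeroObject Abelian

/-! ### The tensor-hom adjunction -/

section TensorHom

variable (S R : Type u) [Ring S] [Ring R] (V : Type u) [AddCommGroup V]
  [Module S V] [Module Rᵐᵒᵖ V] [SMulCommClass S Rᵐᵒᵖ V]

section

variable {V} {Y : Type u} [AddCommGroup Y] [Module Sᵐᵒᵖ Y]

/-- The pure tensor `y ⊗ v` of `Y ⊗_S V`. -/
def RTensor.tmul (v : V) (y : Y) : RTensor S R V Y := Submodule.Quotient.mk (v ⊗ₜ[ℤ] y)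

theorem RTensor.tmul_add (v : V) (y y' : Y) :
    RTensor.tmul S R v (y + y') = RTensor.tmul S R v y + RTensor.tmul S R v y' :=
  congrArg Submodule.Quotient.mk (TensorProduct.tmul_add v y y')

theorem RTensor.add_tmul (v v' : V) (y : Y) :
    RTensor.tmul S R (v + v') y = RTensor.tmul S R v y + RTensor.tmul S R v' y :=
  congrArg Submodule.Quotient.mk (TensorProduct.add_tmul v v' y)

theorem RTensor.smul_tmul (r : Rᵐᵒᵖ) (v : V) (y : Y) :
    RTensor.tmul S R (r • v) y = r • RTensor.tmul S R v y := rfl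

theorem RTensor.tmul_smul (s : S) (v : V) (y : Y) :
    RTensor.tmul S R v (MulOpposite.op s • y) = RTensor.tmul S R (s • v) y :=
  Eq.symm ((Submodule.Quotient.eq (balancedRel S R V Y)).2 (Submodule.subset_span ⟨s, v, y, rfl⟩))

variable {S R} in
@[elab_as_elim]
theorem RTensor.induction {p : RTensor S R V Y → Prop} (z : RTensor S R V Y) (h0 : p 0)
    (h : ∀ v y, p (RTensor.tmul S R v y)) (hadd : ∀ a b, p a → p b → p (a + b)) : p z := by
  obtain ⟨z, rfl⟩ := Submodule.Quotient.mk_surjective _ z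
  induction z with
  | zero => exact h0
  | add a b ha hb => exact hadd _ _ ha hb
  | tmul v y => exact h v y

variable {S R} in
theorem RTensor.hom_ext {X : Type u} [AddCommGroup X] [Module Rᵐᵒᵖ X]
    {f g : RTensor S R V Y →ₗ[Rᵐᵒᵖ] X}
    (h : ∀ v y, f (RTensor.tmul S R v y) = g (RTensor.tmul S R v y)) : f = g := by
  refine LinearMap.ext fun z => ?_
  induction z using RTensor.induction with
  | h0 => rw [map_zero, map_zero]
  | h v y => exact h v y
  | hadd a b ha hb => rw [map_add, map_add, ha, hb]

variable {S R} in
/-- The linear map from `Y ⊗_S V` given by a linear map to `Hom_R(V, X)`. -/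
def RTensor.lift {X : Type u} [AddCommGroup X] [Module Rᵐᵒᵖ X] (g : Y →ₗ[Sᵐᵒᵖ] RHom R V X) :
    RTensor S R V Y →ₗ[Rᵐᵒᵖ] X :=
  Submodule.liftQ _ (TensorProduct.AlgebraTensorModule.lift (R := ℤ) (A := Rᵐᵒᵖ)
      { toFun := fun v =>
          ({ toFun := fun y => (g y).toLin v
             map_zero' := by rw [map_zero]; rfl
             map_add' := fun y y' => by rw [map_add]; rfl } : Y →+ X).toIntLinearMap
        map_add' := fun v v' => LinearMap.ext fun y => map_add (g y).toLin v v'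
        map_smul' := fun r v => LinearMap.ext fun y => map_smul (g y).toLin r v }) (by
    refine Submodule.span_le.2 ?_
    rintro _ ⟨s, v, y, rfl⟩
    refine (map_sub _ _ _).trans (sub_eq_zero.2 ?_)
    change (g y).toLin (s • v) = (g (MulOpposite.op s • y)).toLin v
    rw [map_smul g]
    rfl)

variable {S R} in
/-- The linear map to `Hom_R(V, X)` given by a linear map from `Y ⊗_S V`. -/
def RTensor.curry {X : Type u} [AddCommGroup X] [Module Rᵐᵒᵖ X] (g : RTensor S R V Y →ₗ[Rᵐᵒᵖ] X) :
    Y →ₗ[Sᵐᵒᵖ] RHom R V X where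
  toFun y := ({
    toFun := fun v => g (RTensor.tmul S R v y)
    map_add' := fun v v' => by rw [RTensor.add_tmul, map_add]
    map_smul' := fun r v => by rw [RTensor.smul_tmul, map_smul, RingHom.id_apply] } :
      V →ₗ[Rᵐᵒᵖ] X)
  map_add' y y' := RHom.ext fun v => by
    change g (RTensor.tmul S R v (y + y')) = g _ + g _
    rw [RTensor.tmul_add, map_add]
  map_smul' s y := RHom.ext fun v => congrArg g (RTensor.tmul_smul S R s.unop v y)

end

/-- The tensor-hom adjunction. -/
def tensorHomAdjunction : tensorFunctor S R V ⊣ homFunctor S R V :=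
  Adjunction.mkOfHomEquiv
    { homEquiv := fun _ _ =>
        { toFun := fun g => ModuleCat.ofHom (RTensor.curry g.hom)
          invFun := fun g => ModuleCat.ofHom (RTensor.lift g.hom)
          left_inv := fun _ => ModuleCat.hom_ext (RTensor.hom_ext fun _ _ => rfl)
          right_inv := fun _ => rfl }
      homEquiv_naturality_left_symm := fun _ _ =>
        ModuleCat.hom_ext (RTensor.hom_ext fun _ _ => rfl)
      homEquiv_naturality_right := fun _ _ => rfl }

instance homFunctor_additive : (homFunctor S R V).Additive where
  map_add := rfl

section Linear

open scoped ModuleCat.Algebra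

variable (k : Type u) [CommRing k] [Algebra k S] [Algebra k R]
  (hV : ∀ (c : k) (v : V), algebraMap k S c • v = algebraMap k Rᵐᵒᵖ c • v)

include hV

theorem homFunctor_linear : (homFunctor S R V).Linear k where
  map_smul {X Y} f c := by
    refine ModuleCat.hom_ext (LinearMap.ext fun (g : RHom R V X) => RHom.ext fun v => ?_)
    change algebraMap k Rᵐᵒᵖ c • f.hom (g.toLin v) = f.hom (g.toLin (algebraMap k S c • v))
    rw [hV, map_smul, map_smul]

theorem tensorFunctor_linear : (tensorFunctor S R V).Linear k where
  map_smul {X Y} f c := by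
    refine ModuleCat.hom_ext (RTensor.hom_ext fun v y => ?_)
    change RTensor.tmul S R v (MulOpposite.op (algebraMap k S c) • f.hom y) =
      algebraMap k Rᵐᵒᵖ c • RTensor.tmul S R v (f.hom y)
    rw [RTensor.tmul_smul, hV, RTensor.smul_tmul]

end Linear

/-- `S ⊗_S V ≅ V`. -/
def tensorRegularIso : (tensorFunctor S R V).obj (ModuleCat.of Sᵐᵒᵖ S) ≅ ModuleCat.of Rᵐᵒᵖ V where
  hom := ModuleCat.ofHom (RTensor.lift
    { toFun := fun s => (DistribSMul.toLinearMap Rᵐᵒᵖ V s : V →ₗ[Rᵐᵒᵖ] V)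
      map_add' := fun s t => RHom.ext fun v => add_smul s t v
      map_smul' := fun s t => RHom.ext fun v => mul_smul t s.unop v } :
      RTensor S R V S →ₗ[Rᵐᵒᵖ] V)
  inv := ModuleCat.ofHom
    { toFun := fun v => RTensor.tmul S R v (1 : S)
      map_add' := fun v v' => RTensor.add_tmul S R v v' 1
      map_smul' := fun r v => RTensor.smul_tmul S R r v 1 }
  hom_inv_id := ModuleCat.hom_ext (RTensor.hom_ext fun v (s : S) => by
    change RTensor.tmul S R (s • v) (1 : S) = RTensor.tmul S R v s
    rw [← RTensor.tmul_smul]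
    congr 1
    exact one_mul s)
  inv_hom_id := ModuleCat.hom_ext (LinearMap.ext fun (v : V) => one_smul S v)

end TensorHom

end WakamatsuTilting

end

set_option linter.unusedSectionVars false

noncomputable section

namespace WakamatsuTilting

open Limits ZeroObject Abelian

/-! ### Duals of bimodules -/

section DualBimodule

variable {k : Type u} [CommRing k] {J : Type u} [AddCommGroup J] [Module k J]
  {S R : Type u} [Ring S] [Ring R] [Algebra k S] [Algebra k R] {V : Type u} [AddCommGroup V]
  [Module k V] [Module S V] [Module Rᵐᵒᵖ V] [SMulCommClass S Rᵐᵒᵖ V] [IsScalarTower k S V]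
  [IsScalarTower k Rᵐᵒᵖ V]

variable (k J S R V) in
/-- `Hom_R(V, DR) ≅ DV`. -/
def homDualIso : (homFunctor S R V).obj (ModuleCat.of Rᵐᵒᵖ (Dual k J R)) ≅
    ModuleCat.of Sᵐᵒᵖ (Dual k J V) where
  hom := ModuleCat.ofHom
    { toFun := fun g : RHom R V (Dual k J R) => ({
        toFun := fun v => (g.toLin v).toLin (1 : R)
        map_add' := fun v w => by rw [map_add]; rfl
        map_smul' := fun c v => by
          have h : g.toLin (c • v) = MulOpposite.op (algebraMap k R c) • g.toLin v := by
            rw [← map_smul]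
            exact congrArg g.toLin (algebraMap_smul Rᵐᵒᵖ c v).symm
          rw [h]
          change (g.toLin v).toLin (algebraMap k R c * 1) = _
          rw [← Algebra.smul_def, map_smul, RingHom.id_apply] } : V →ₗ[k] J)
      map_add' := fun _ _ => rfl
      map_smul' := fun _ _ => rfl }
  inv := ModuleCat.ofHom (Y := RHom R V (Dual k J R))
    { toFun := fun f : Dual k J V => ({
        toFun := fun v => ({
          toFun := fun r => f.toLin (MulOpposite.op r • v)
          map_add' := fun r s => by rw [MulOpposite.op_add, add_smul, map_add]
          map_smul' := fun c r => by
            rw [MulOpposite.op_smul, smul_assoc, RingHom.id_apply, map_smul] } : R →ₗ[k] J)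
        map_add' := fun x y => Dual.ext fun r => by
          change f.toLin (MulOpposite.op r • (x + y)) = f.toLin _ + f.toLin _
          rw [smul_add, map_add]
        map_smul' := fun s x => Dual.ext fun r => by
          change f.toLin (MulOpposite.op r • s • x) =
            f.toLin (MulOpposite.op (s.unop * r) • x)
          rw [MulOpposite.op_mul, MulOpposite.op_unop, mul_smul] } : V →ₗ[Rᵐᵒᵖ] Dual k J R)
      map_add' := fun _ _ => rfl
      map_smul' := fun s f => RHom.ext fun v => Dual.ext fun (r : R) =>
        congrArg f.toLin (smul_comm s.unop (MulOpposite.op r) v) }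
  hom_inv_id := ModuleCat.hom_ext (LinearMap.ext fun (g : RHom R V (Dual k J R)) =>
    RHom.ext fun v => Dual.ext fun (r : R) => by
      change (g.toLin (MulOpposite.op r • v)).toLin (1 : R) = (g.toLin v).toLin r
      rw [map_smul]
      exact congrArg (g.toLin v).toLin (mul_one r))
  inv_hom_id := ModuleCat.hom_ext (LinearMap.ext fun (f : Dual k J V) => Dual.ext fun v => by
    change f.toLin (MulOpposite.op (1 : R) • v) = f.toLin v
    rw [MulOpposite.op_one, one_smul])

variable (k J S R V) in
/-- The evaluation map `V → Hom_S(DV, DS)`. -/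
def evalDual : ModuleCat.of Rᵐᵒᵖ V ⟶
    (homFunctor R S (Dual k J V)).obj (ModuleCat.of Sᵐᵒᵖ (Dual k J S)) :=
  ModuleCat.ofHom (Y := RHom S (Dual k J V) (Dual k J S))
    { toFun := fun v => ({
        toFun := fun f => (f.toLin.comp ({
          toFun := fun s => s • v
          map_add' := fun s t => add_smul s t v
          map_smul' := fun c s => smul_assoc c s v } : S →ₗ[k] V) : S →ₗ[k] J)
        map_add' := fun _ _ => rfl
        map_smul' := fun s f => Dual.ext fun (t : S) =>
          congrArg f.toLin (mul_smul s.unop t v).symm } : Dual k J V →ₗ[Sᵐᵒᵖ] Dual k J S)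
      map_add' := fun v w => RHom.ext fun f => Dual.ext fun (s : S) => by
        change f.toLin (s • (v + w)) = f.toLin (s • v) + f.toLin (s • w)
        rw [smul_add, map_add]
      map_smul' := fun r v => RHom.ext fun f => Dual.ext fun (s : S) =>
        congrArg f.toLin (smul_comm s r v) }

/-- A morphism `DV ⟶ DS` followed by evaluation at `1` is a functional on `DV`, hence evaluation at
an element of `V`. -/
theorem isIso_evalDual [IsArtinianRing k] (hJ : IsInjectiveEnvelopeOfTop k J) [Module.Finite k V] :
    IsIso (evalDual k J S R V) := by
  rw [ConcreteCategory.isIso_iff_bijective]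
  constructor
  · refine (injective_iff_map_eq_zero (evalDual k J S R V).hom).2 fun (v : V) hv => ?_
    by_contra h0
    obtain ⟨l, hl⟩ := hJ.isInjectiveCogenerator.separate v h0
    have h : l ((1 : S) • v) = 0 :=
      congrArg (fun g : RHom S (Dual k J V) (Dual k J S) =>
        (g.toLin (l : Dual k J V)).toLin (1 : S)) hv
    rw [one_smul] at h
    exact hl h
  · intro (g : RHom S (Dual k J V) (Dual k J S))
    have hsmul : ∀ (c : k) (f : V →ₗ[k] J), (show Dual k J V from c • f) =
        MulOpposite.op (algebraMap k S c) • (show Dual k J V from f) := fun c f =>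
      Dual.ext fun v => by
        change c • f v = f (algebraMap k S c • v)
        rw [algebraMap_smul, map_smul]
    let l : (V →ₗ[k] J) →ₗ[k] J :=
      { toFun := fun f => (g.toLin (show Dual k J V from f)).toLin (1 : S)
        map_add' := fun f f' => congrArg (fun t : Dual k J S => t.toLin (1 : S))
          (map_add g.toLin (show Dual k J V from f) (show Dual k J V from f'))
        map_smul' := fun c f => by
          rw [hsmul, map_smul]
          change (g.toLin (show Dual k J V from f)).toLin (algebraMap k S c * 1) = _
          rw [← Algebra.smul_def, map_smul, RingHom.id_apply] }
    obtain ⟨v, hv⟩ := (hJ.dual_reflexive V inferInstance).2 l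
    refine ⟨v, RHom.ext fun f => Dual.ext fun (s : S) => ?_⟩
    have h : (g.toLin (MulOpposite.op s • f)).toLin (1 : S) = f.toLin (s • v) :=
      hv (MulOpposite.op s • f : Dual k J V)
    refine Eq.trans h.symm ?_
    rw [map_smul]
    exact congrArg (g.toLin f).toLin (mul_one s)

end DualBimodule

/-! ### The functors of a bimodule and its dual -/

section Pairs

open scoped ModuleCat.Algebra

variable (k : Type u) [CommRing k] (J : Type u) [AddCommGroup J] [Module k J]
  (S R : Type u) [Ring S] [Ring R] [Algebra k S] [Algebra k R] (V : Type u) [AddCommGroup V]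
  [Module k V] [Module S V] [Module Rᵐᵒᵖ V] [SMulCommClass S Rᵐᵒᵖ V] [IsScalarTower k S V]
  [IsScalarTower k Rᵐᵒᵖ V]

/-- The adjoint pairs of functors represented by a bimodule and by its dual. -/
@[reducible] def bimodulePairs : AdjointPairs (ModuleCat.{u} Rᵐᵒᵖ) (ModuleCat.{u} Sᵐᵒᵖ) where
  H := homFunctor S R V
  L := tensorFunctor S R V
  adj := tensorHomAdjunction S R V
  H' := homFunctor R S (Dual k J V)
  L' := tensorFunctor R S (Dual k J V)
  adj' := tensorHomAdjunction R S (Dual k J V)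
  H_additive := inferInstance
  H'_additive := inferInstance
  fgC := ModuleCat.isFG Rᵐᵒᵖ
  fgD := ModuleCat.isFG Sᵐᵒᵖ

variable {k S R V} in
theorem algebraMap_smul_bimodule (c : k) (v : V) :
    algebraMap k S c • v = algebraMap k Rᵐᵒᵖ c • v := by
  rw [algebraMap_smul, algebraMap_smul]

variable {k J S R V} in
theorem algebraMap_smul_dual (c : k) (f : Dual k J V) :
    algebraMap k R c • f = algebraMap k Sᵐᵒᵖ c • f :=
  Dual.ext fun v => congrArg f.toLin (algebraMap_smul_bimodule c v).symm

theorem finite_tensor [Module.Finite Rᵐᵒᵖ V] (Y : ModuleCat.{u} Sᵐᵒᵖ)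
    (hY : ModuleCat.isFG Sᵐᵒᵖ Y) : ModuleCat.isFG Rᵐᵒᵖ ((tensorFunctor S R V).obj Y) := by
  have : Module.Finite Sᵐᵒᵖ Y := hY
  obtain ⟨n, y, hy⟩ := Module.Finite.exists_fin (R := Sᵐᵒᵖ) (M := Y)
  let t : Y → (V →ₗ[Rᵐᵒᵖ] RTensor S R V Y) := fun z =>
    { toFun := fun v => RTensor.tmul S R v z
      map_add' := fun v v' => RTensor.add_tmul S R v v' z
      map_smul' := fun r v => RTensor.smul_tmul S R r v z }
  let p : (Fin n → V) →ₗ[Rᵐᵒᵖ] RTensor S R V Y := ∑ i, (t (y i)).comp (LinearMap.proj i)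
  refine (Module.Finite.of_surjective p ?_ : Module.Finite Rᵐᵒᵖ (RTensor S R V Y))
  have hp : ∀ z (v : V), RTensor.tmul S R v z ∈ LinearMap.range p := fun z => by
    have hz : z ∈ Submodule.span Sᵐᵒᵖ (Set.range y) := hy ▸ Submodule.mem_top
    induction hz using Submodule.span_induction with
    | mem z hz =>
      obtain ⟨i, rfl⟩ := hz
      intro v
      refine ⟨Pi.single i v, ?_⟩
      change (∑ j, (t (y j)).comp (LinearMap.proj j)) (Pi.single i v) = t (y i) v
      rw [LinearMap.sum_apply, Finset.sum_eq_single i]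
      · rw [LinearMap.comp_apply, LinearMap.proj_apply, Pi.single_eq_same]
      · intro j _ hj
        rw [LinearMap.comp_apply, LinearMap.proj_apply, Pi.single_eq_of_ne hj, map_zero]
      · exact fun h => absurd (Finset.mem_univ i) h
    | zero =>
      intro v
      have h : RTensor.tmul S R v (0 : Y) = 0 :=
        congrArg Submodule.Quotient.mk (TensorProduct.tmul_zero _ _)
      rw [h]
      exact Submodule.zero_mem _
    | add a b _ _ ha hb =>
      intro v
      rw [RTensor.tmul_add]
      exact Submodule.add_mem _ (ha v) (hb v)
    | smul s a _ ha =>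
      intro v
      have := RTensor.tmul_smul S R s.unop v a
      rw [MulOpposite.op_unop] at this
      rw [this]
      exact ha _
  intro z
  change z ∈ LinearMap.range p
  induction z using RTensor.induction with
  | h0 => exact Submodule.zero_mem _
  | h v y => exact hp y v
  | hadd a b ha hb => exact Submodule.add_mem _ ha hb

end Pairs

section FiniteHom

open scoped ModuleCat.Algebra

variable (k : Type u) [CommRing k]
  (S R : Type u) [Ring S] [Ring R] [Algebra k S] [Algebra k R] (V : Type u) [AddCommGroup V]
  [Module S V] [Module Rᵐᵒᵖ V] [SMulCommClass S Rᵐᵒᵖ V]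

theorem finite_homFunctor [IsArtinianRing k] [Module.Finite k R] [Module.Finite Rᵐᵒᵖ V]
    (hV : ∀ (c : k) (v : V), algebraMap k S c • v = algebraMap k Rᵐᵒᵖ c • v)
    (X : ModuleCat.{u} Rᵐᵒᵖ) (hX : ModuleCat.isFG Rᵐᵒᵖ X) :
    ModuleCat.isFG Sᵐᵒᵖ ((homFunctor S R V).obj X) := by
  have := finite_of_isFG k hX
  let : Module k V := Module.compHom V (algebraMap k Rᵐᵒᵖ)
  have : IsScalarTower k Rᵐᵒᵖ V := IsScalarTower.of_algebraMap_smul fun _ _ => rfl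
  have : Module.Finite k V := Module.Finite.trans Rᵐᵒᵖ V
  let f : (homFunctor S R V).obj X →ₗ[k] (V →ₗ[k] X) :=
    { toFun := fun g : RHom R V X => g.toLin.restrictScalars k
      map_add' := fun _ _ => rfl
      map_smul' := fun c (g : RHom R V X) => LinearMap.ext fun (v : V) => by
        change g.toLin (algebraMap k S c • v) = algebraMap k Rᵐᵒᵖ c • g.toLin v
        rw [hV, map_smul] }
  have hf : Function.Injective f := fun (g : RHom R V X) g' h =>
    RHom.ext fun v => congrArg (fun t : V →ₗ[k] X => t v) h
  have : Module.Finite k ((homFunctor S R V).obj X) := Module.Finite.of_injective f hf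
  exact (Module.Finite.of_restrictScalars_finite k Sᵐᵒᵖ _)

end FiniteHom

end WakamatsuTilting

end

set_option linter.unusedSectionVars false

noncomputable section

namespace WakamatsuTilting

open Limits ZeroObject Abelian

/-! ### Self-extensions of the dual bimodule -/

section DualExt

theorem ses_of_function_exact {A : Type u} [Ring A] {X Y Z : Type u} [AddCommGroup X]
    [AddCommGroup Y] [AddCommGroup Z] [Module A X] [Module A Y] [Module A Z] {f : X →ₗ[A] Y}
    {g : Y →ₗ[A] Z} (hf : Function.Injective f) (hg : Function.Surjective g)
    (h : Function.Exact f g) : Ses (ModuleCat.ofHom f) (ModuleCat.ofHom g) :=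
  ⟨ModuleCat.hom_ext h.linearMap_comp_eq_zero,
    { exact := (ShortComplex.ShortExact.moduleCat_exact_iff_function_exact _).2 h
      mono_f := (ModuleCat.mono_iff_injective _).2 hf
      epi_g := (ModuleCat.epi_iff_surjective _).2 hg }⟩

theorem Ses.function_exact {A : Type u} [Ring A] {X Y Z : ModuleCat.{u} A} {f : X ⟶ Y} {g : Y ⟶ Z}
    (h : Ses f g) : Function.Exact f.hom g.hom :=
  (ShortComplex.ShortExact.moduleCat_exact_iff_function_exact _).1 h.2.exact

variable {k : Type u} [CommRing k] {J : Type u} [AddCommGroup J] [Module k J]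
  {S : Type u} [Ring S] [Algebra k S]

/-- The dual of a linear map of left modules. -/
def dualMap {M N : Type u} [AddCommGroup M] [Module k M] [Module S M] [IsScalarTower k S M]
    [AddCommGroup N] [Module k N] [Module S N] [IsScalarTower k S N] (f : M →ₗ[S] N) :
    Dual k J N →ₗ[Sᵐᵒᵖ] Dual k J M where
  toFun l := l.toLin.comp (f.restrictScalars k)
  map_add' _ _ := rfl
  map_smul' s l := Dual.ext fun m => congrArg l.toLin (map_smul f s.unop m).symm

section

variable {M N : Type u} [AddCommGroup M] [Module k M] [Module S M] [IsScalarTower k S M]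
    [AddCommGroup N] [Module k N] [Module S N] [IsScalarTower k S N]

@[simp] theorem dualMap_toLin (f : M →ₗ[S] N) (l : Dual k J N) (m : M) :
    (dualMap f l).toLin m = l.toLin (f m) := rfl

/-- For each `m`, evaluating `t` at `m` is a functional on the dual of `N`, hence evaluation at a
unique element of `N`; this element is the value of `f` at `m`. -/
theorem exists_eq_dualMap [IsArtinianRing k] (hJ : IsInjectiveEnvelopeOfTop k J) [Module.Finite k N]
    (t : Dual k J N →ₗ[Sᵐᵒᵖ] Dual k J M) : ∃ f : M →ₗ[S] N, dualMap f = t := by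
  have hsmul : ∀ (c : k) (f : N →ₗ[k] J), (show Dual k J N from c • f) =
      MulOpposite.op (algebraMap k S c) • (show Dual k J N from f) := fun c f =>
    Dual.ext fun v => by
      change c • f v = f (algebraMap k S c • v)
      rw [algebraMap_smul, map_smul]
  let l (m : M) : (N →ₗ[k] J) →ₗ[k] J :=
    { toFun := fun f => (t (show Dual k J N from f)).toLin m
      map_add' := fun f f' => congrArg (fun t : Dual k J M => t.toLin m)
        (map_add t (show Dual k J N from f) (show Dual k J N from f'))
      map_smul' := fun c f => by
        rw [hsmul, map_smul]
        change (t (show Dual k J N from f)).toLin (algebraMap k S c • m) = _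
        rw [algebraMap_smul, map_smul, RingHom.id_apply] }
  have hl : ∀ m, ∃ n : N, ∀ f : Dual k J N, (t f).toLin m = f.toLin n :=
    fun m => (hJ.dual_reflexive N inferInstance).2 (l m)
  have hsep : ∀ n n' : N, (∀ f : Dual k J N, f.toLin n = f.toLin n') → n = n' := by
    intro n n' h
    by_contra h0
    obtain ⟨f, hf⟩ := hJ.isInjectiveCogenerator.separate _ (sub_ne_zero.2 h0)
    exact hf ((map_sub f n n').trans (sub_eq_zero.2 (h f)))
  choose f hf using hl
  refine ⟨{ toFun := f, map_add' := fun m m' => ?_, map_smul' := fun s m => ?_ }, ?_⟩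
  · refine hsep _ _ fun g => ?_
    rw [← hf, map_add, map_add, hf, hf]
  · refine hsep _ _ fun g => ?_
    rw [← hf, RingHom.id_apply]
    change (MulOpposite.op s • t g).toLin m = (MulOpposite.op s • g).toLin (f m)
    rw [← map_smul, hf]
  · exact LinearMap.ext fun g => Dual.ext fun m => (hf m g).symm

theorem ses_dualMap (hJ : IsInjectiveCogenerator k J) {L : Type u} [AddCommGroup L] [Module k L]
    [Module S L] [IsScalarTower k S L] {f : L →ₗ[S] M} {g : M →ₗ[S] N}
    (hf : Function.Injective f) (hg : Function.Surjective g) (h : Function.Exact f g) :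
    Ses (ModuleCat.ofHom (dualMap (k := k) (J := J) g))
      (ModuleCat.ofHom (dualMap (k := k) (J := J) f)) := by
  refine ses_of_function_exact (fun l l' hl => Dual.ext fun n => ?_) (fun l => ?_) fun l => ⟨?_, ?_⟩
  · obtain ⟨m, rfl⟩ := hg n
    exact congrArg (fun t : Dual k J M => t.toLin m) hl
  · obtain ⟨l', hl'⟩ := hJ.extend (f.restrictScalars k) hf l.toLin
    exact ⟨l', Dual.ext hl'⟩
  · intro hl
    obtain ⟨l', hl'⟩ := exists_comp_eq_of_surjective (f := g.restrictScalars k) hg l.toLin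
      (fun m hm => by
        obtain ⟨x, rfl⟩ := (h m).1 hm
        exact congrArg (fun t : Dual k J L => t.toLin x) hl)
    exact ⟨l', Dual.ext hl'⟩
  · rintro ⟨l', rfl⟩
    refine Dual.ext fun x => ?_
    rw [dualMap_toLin, dualMap_toLin, h.apply_apply_eq_zero, map_zero]
    rfl

end

section

open scoped ModuleCat.Algebra

/-- A morphism into the dual of a free module amounts to one functional per basis vector, and
functionals extend. -/
theorem injective_dual_free (hJ : IsInjectiveCogenerator k J) (n : ℕ) :
    Injective (ModuleCat.of Sᵐᵒᵖ (Dual k J (Fin n → S))) where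
  factors {A B} φ f hf := by
    have h := fun i => hJ.extend (f.hom.restrictScalars k) ((ModuleCat.mono_iff_injective f).1 hf)
      ({ toFun := fun a => (φ.hom a : Dual k J (Fin n → S)).toLin (Pi.single i 1)
         map_add' := fun a b => by rw [map_add]; rfl
         map_smul' := fun c a => by
          rw [← algebraMap_smul Sᵐᵒᵖ c a, map_smul, RingHom.id_apply]
          change (φ.hom a : Dual k J (Fin n → S)).toLin (algebraMap k S c • Pi.single i 1) = _
          rw [algebraMap_smul, map_smul] } : A →ₗ[k] J)
    choose l hl using h
    let ψ : B →ₗ[Sᵐᵒᵖ] Dual k J (Fin n → S) :=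
      { toFun := fun b => ({
          toFun := fun x => ∑ i, l i (MulOpposite.op (x i) • b)
          map_add' := fun x y => by
            rw [← Finset.sum_add_distrib]
            refine Finset.sum_congr rfl fun i _ => ?_
            rw [Pi.add_apply, MulOpposite.op_add, add_smul, map_add]
          map_smul' := fun c x => by
            rw [RingHom.id_apply, Finset.smul_sum]
            refine Finset.sum_congr rfl fun i _ => ?_
            rw [Pi.smul_apply, MulOpposite.op_smul, smul_assoc, map_smul] } :
              (Fin n → S) →ₗ[k] J)
        map_add' := fun b b' => Dual.ext fun x => by
          change ∑ i, l i (MulOpposite.op (x i) • (b + b')) =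
            ∑ i, l i (MulOpposite.op (x i) • b) + ∑ i, l i (MulOpposite.op (x i) • b')
          rw [← Finset.sum_add_distrib]
          refine Finset.sum_congr rfl fun i _ => ?_
          rw [smul_add, map_add]
        map_smul' := fun s b => Dual.ext fun x => by
          change ∑ i, l i (MulOpposite.op (x i) • s • b) =
            ∑ i, l i (MulOpposite.op (s.unop * x i) • b)
          refine Finset.sum_congr rfl fun i _ => ?_
          rw [MulOpposite.op_mul, MulOpposite.op_unop, mul_smul] }
    refine ⟨ModuleCat.ofHom ψ, ModuleCat.hom_ext (LinearMap.ext fun a => Dual.ext fun x => ?_)⟩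
    change ∑ i, l i (MulOpposite.op (x i) • f.hom a) = (φ.hom a : Dual k J (Fin n → S)).toLin x
    have hx : x = ∑ i, x i • (Pi.single i 1 : Fin n → S) := by
      simp [← Pi.single_smul, Finset.univ_sum_single]
    conv_rhs => rw [hx, map_sum]
    refine Finset.sum_congr rfl fun i _ => ?_
    rw [← map_smul]
    refine (hl i _).trans ?_
    change (φ.hom (MulOpposite.op (x i) • a) : Dual k J (Fin n → S)).toLin (Pi.single i 1) = _
    rw [map_smul]
    rfl

end

/-- Duality turns a free presentation of `M` into an injective copresentation of its dual. In degree
one, morphisms from `DV` to the dual of the syzygy are duals of morphisms from the syzygy to `V`,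
which extend because `Ext¹(M, V) = 0`. Higher degrees are shifted to the syzygy. -/
theorem extVanishes_dual [IsArtinianRing k] [Module.Finite k S] (hJ : IsInjectiveEnvelopeOfTop k J)
    (V : Type u) [AddCommGroup V] [Module k V] [Module S V] [IsScalarTower k S V]
    [Module.Finite k V] (n : ℕ) : ∀ (M : Type u) [AddCommGroup M] [Module k M] [Module S M]
    [IsScalarTower k S M] [Module.Finite S M],
    (∀ j, 0 < j → ExtVanishes (ModuleCat.of S M) (ModuleCat.of S V) j) →
    ExtVanishes (ModuleCat.of Sᵐᵒᵖ (Dual k J V)) (ModuleCat.of Sᵐᵒᵖ (Dual k J M)) (n + 1) := by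
  have : IsNoetherianRing S := isNoetherian_of_tower k (inferInstance : IsNoetherian k S)
  induction n with
  | zero =>
    intro M _ _ _ _ _ hM
    obtain ⟨m, p, hp⟩ := Module.Finite.exists_fin' S M
    have h := ses_of_function_exact (LinearMap.ker p).injective_subtype hp
      (LinearMap.exact_subtype_ker_map p)
    have hD := ses_dualMap hJ.isInjectiveCogenerator (LinearMap.ker p).injective_subtype hp
      (LinearMap.exact_subtype_ker_map p)
    have := injective_dual_free (S := S) hJ.isInjectiveCogenerator m
    refine hD.ext_one_of_lift (Ext.subsingleton_of_injective _ _ 0) fun t => ?_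
    obtain ⟨f, hf⟩ := exists_eq_dualMap hJ t.hom
    obtain ⟨s, hs⟩ := h.exists_extension (hM 1 Nat.one_pos) (ModuleCat.ofHom f)
    refine ⟨ModuleCat.ofHom (dualMap s.hom), ?_⟩
    refine ModuleCat.hom_ext (LinearMap.ext fun l => Dual.ext fun x => ?_)
    rw [← hf]
    exact congrArg (fun t => l.toLin (t.hom x)) hs
  | succ n ih =>
    intro M _ _ _ _ _ hM
    obtain ⟨m, p, hp⟩ := Module.Finite.exists_fin' S M
    have h := ses_of_function_exact (LinearMap.ker p).injective_subtype hp
      (LinearMap.exact_subtype_ker_map p)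
    have hD := ses_dualMap hJ.isInjectiveCogenerator (LinearMap.ker p).injective_subtype hp
      (LinearMap.exact_subtype_ker_map p)
    have := injective_dual_free (S := S) hJ.isInjectiveCogenerator m
    have : Projective (ModuleCat.of S (Fin m → S)) := ModuleCat.projective_of_free (Pi.basisFun S _)
    refine hD.ext_coshift_left (ih _ fun j hj => ?_) (Ext.subsingleton_of_injective _ _ (n + 1))
    obtain ⟨j, rfl⟩ := Nat.exists_eq_add_of_le' hj
    exact h.ext_shift_left (hM _ (Nat.succ_pos _)) (Ext.subsingleton_of_projective _ _ j)

end DualExt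

end WakamatsuTilting

end

set_option linter.unusedSectionVars false

noncomputable section

namespace WakamatsuTilting

open Limits ZeroObject Abelian

section TensorHomUnit

variable {S R : Type u} [Ring S] [Ring R] {V : Type u} [AddCommGroup V]
  [Module S V] [Module Rᵐᵒᵖ V] [SMulCommClass S Rᵐᵒᵖ V]

/-- As `S ⊗ V ≅ V`, the unit at `S` is the canonical map from `S` to the endomorphisms of `V`. -/
theorem isIso_tensorHom_unit (hS : ∀ f : V →ₗ[Rᵐᵒᵖ] V, ∃! s : S, ∀ v, f v = s • v) :
    IsIso ((tensorHomAdjunction S R V).homEquiv (ModuleCat.of Sᵐᵒᵖ S) _ (𝟙 _)) := by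
  rw [ConcreteCategory.isIso_iff_bijective]
  constructor
  · intro (s : S) (t : S) hst
    refine (hS (DistribSMul.toLinearMap Rᵐᵒᵖ V s)).unique (fun v => rfl) fun v => ?_
    have h : RTensor.tmul S R v s = RTensor.tmul S R v t :=
      congrArg (fun g : RHom R V (RTensor S R V S) => g.toLin v) hst
    exact congrArg (fun z : RTensor S R V S => (tensorRegularIso S R V).hom.hom z) h
  · intro (g : RHom R V (RTensor S R V S))
    obtain ⟨s, hs, -⟩ := hS ((tensorRegularIso S R V).hom.hom.comp g.toLin)
    refine ⟨s, RHom.ext fun v => ?_⟩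
    refine (ModuleCat.mono_iff_injective (tensorRegularIso S R V).hom).1 inferInstance ?_
    exact (hs v).symm

end TensorHomUnit

/-! ### The context of a Wakamatsu-tilting bimodule -/

section BimoduleContext

open scoped ModuleCat.Algebra

variable {k : Type u} [CommRing k] [IsArtinianRing k] {J : Type u} [AddCommGroup J] [Module k J]
  {S R : Type u} [Ring S] [Ring R] [Algebra k S] [Algebra k R] {V : Type u} [AddCommGroup V]
  [Module k V] [Module S V] [Module Rᵐᵒᵖ V] [SMulCommClass S Rᵐᵒᵖ V] [IsScalarTower k S V]
  [IsScalarTower k Rᵐᵒᵖ V]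

variable (k J S R V) in
/-- `Hom_R(V, DR) ≅ R ⊗_R DV`. -/
def bimoduleIsoE : (homFunctor S R V).obj (ModuleCat.of Rᵐᵒᵖ (Dual k J R)) ≅
    (tensorFunctor R S (Dual k J V)).obj (ModuleCat.of Rᵐᵒᵖ R) :=
  homDualIso k J S R V ≪≫ (tensorRegularIso R S (Dual k J V)).symm

/-- `Hom_S(DV, DS) ≅ S ⊗_S V`. -/
def bimoduleIsoF (hJ : IsInjectiveEnvelopeOfTop k J) [Module.Finite k V] :
    (homFunctor R S (Dual k J V)).obj (ModuleCat.of Sᵐᵒᵖ (Dual k J S)) ≅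
    (tensorFunctor S R V).obj (ModuleCat.of Sᵐᵒᵖ S) :=
  have := isIso_evalDual (S := S) (R := R) (V := V) hJ
  (asIso (evalDual k J S R V)).symm ≪≫ (tensorRegularIso S R V).symm

theorem finite_dual (hJ : IsInjectiveEnvelopeOfTop k J) [Module.Finite k V] :
    Module.Finite Sᵐᵒᵖ (Dual k J V) := by
  let := dualModule k J V
  have : IsScalarTower k Sᵐᵒᵖ (Dual k J V) := dual_isScalarTower_op S
  have : IsNoetherian k (Dual k J V) := (hJ.dual_reflexive V inferInstance).1
  exact Module.Finite.of_restrictScalars_finite k Sᵐᵒᵖ (Dual k J V)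

/-- Both traces evaluate `g` at the element of `S ⊗ V` picked out by `h`; they agree by unfolding
once that element is written as a pure tensor with `1`. -/
theorem bimodule_trace_eq (hJ : IsInjectiveEnvelopeOfTop k J) [Module.Finite k V]
    (g : (tensorFunctor S R V).obj (ModuleCat.of Sᵐᵒᵖ S) ⟶ ModuleCat.of Rᵐᵒᵖ (Dual k J R))
    (h : ModuleCat.of Rᵐᵒᵖ R ⟶ (tensorFunctor S R V).obj (ModuleCat.of Sᵐᵒᵖ S)) :
    regularTrace k J S ((bimodulePairs k J S R V).fl g ≫ (bimoduleIsoE k J S R V).hom ≫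
      (bimodulePairs k J S R V).sh' (h ≫ (bimoduleIsoF hJ).inv)) = regularTrace k J R (h ≫ g) := by
  let z : RTensor S R V S := h.hom (1 : R)
  let v : V := (tensorRegularIso S R V).hom.hom z
  have hz : RTensor.tmul S R v (1 : S) = z :=
    congrArg (fun t => t.hom z) (tensorRegularIso S R V).hom_inv_id
  change (g.hom (RTensor.tmul S R ((1 : S) • v) (1 : S) : RTensor S R V S) : Dual k J R).toLin
    (1 : R) = (g.hom z : Dual k J R).toLin (1 : R)
  rw [← hz, one_smul]

/-- Endomorphisms of the dual are duals of endomorphisms of `V`, so the claim reduces to the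
balancedness of `V`. -/
theorem isIso_bimodule_unit' (hJ : IsInjectiveEnvelopeOfTop k J) [Module.Finite k V]
    (hR : ∀ f : V →ₗ[S] V, ∃! r : R, ∀ v, f v = MulOpposite.op r • v) :
    IsIso ((bimodulePairs k J S R V).un' (ModuleCat.of Rᵐᵒᵖ R)) := by
  refine isIso_tensorHom_unit (S := R) (R := S) (V := Dual k J V) fun f => ?_
  have hsep : ∀ n n' : V, (∀ l : Dual k J V, l.toLin n = l.toLin n') → n = n' := by
    intro n n' h
    by_contra h0
    obtain ⟨l, hl⟩ := hJ.isInjectiveCogenerator.separate _ (sub_ne_zero.2 h0)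
    exact hl ((map_sub l n n').trans (sub_eq_zero.2 (h l)))
  obtain ⟨φ, rfl⟩ := exists_eq_dualMap hJ f
  obtain ⟨r, hr, hr'⟩ := hR φ
  refine ⟨r, fun l => Dual.ext fun v => congrArg l.toLin (hr v), fun r' h => hr' r' fun v => ?_⟩
  exact hsep _ _ fun l => congrArg (fun t : Dual k J V => t.toLin v) (h l)

variable [Module.Finite k S] [Module.Finite k R] [Module.Finite Rᵐᵒᵖ V] [Module.Finite k V]

/-- The context of a Wakamatsu-tilting bimodule. -/
@[reducible] def bimoduleContext (hJ : IsInjectiveEnvelopeOfTop k J)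
    (hS : ∀ f : V →ₗ[Rᵐᵒᵖ] V, ∃! s : S, ∀ v, f v = s • v)
    (hR : ∀ f : V →ₗ[S] V, ∃! r : R, ∀ v, f v = MulOpposite.op r • v)
    (ext : ∀ i, 0 < i → ExtVanishes (ModuleCat.of Rᵐᵒᵖ V) (ModuleCat.of Rᵐᵒᵖ V) i)
    (ext' : ∀ i, 0 < i → ExtVanishes (ModuleCat.of S V) (ModuleCat.of S V) i) :
    WakamatsuContext.{u, u + 1, u} k J (bimodulePairs k J S R V) where
  cog := hJ.isInjectiveCogenerator
  R := ModuleCat.of Rᵐᵒᵖ R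
  E := ModuleCat.of Rᵐᵒᵖ (Dual k J R)
  S := ModuleCat.of Sᵐᵒᵖ S
  F := ModuleCat.of Sᵐᵒᵖ (Dual k J S)
  trC := regularTrace k J R
  trD := regularTrace k J S
  modC := modLike hJ
  modD := modLike hJ
  H_linear := homFunctor_linear S R V k algebraMap_smul_bimodule
  L_linear := tensorFunctor_linear S R V k algebraMap_smul_bimodule
  H'_linear := homFunctor_linear R S (Dual k J V) k algebraMap_smul_dual
  L'_linear := tensorFunctor_linear R S (Dual k J V) k algebraMap_smul_dual
  fg_H := finite_homFunctor k S R V algebraMap_smul_bimodule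
  fg_L := finite_tensor S R V
  fg_H' :=
    have := finite_dual (S := S) (V := V) hJ
    finite_homFunctor k R S (Dual k J V) algebraMap_smul_dual
  fg_L' :=
    have := finite_dual (S := S) (V := V) hJ
    finite_tensor R S (Dual k J V)
  isoE := bimoduleIsoE k J S R V
  isoF := bimoduleIsoF hJ
  tr_eq := bimodule_trace_eq hJ
  isIso_un := isIso_tensorHom_unit hS
  isIso_un' := isIso_bimodule_unit' hJ hR
  ext i hi := ext_of_iso_left (tensorRegularIso S R V)
    (ext_of_iso_right (tensorRegularIso S R V) (ext i hi))
  ext' i hi := by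
    refine ext_of_iso_left (tensorRegularIso R S (Dual k J V))
      (ext_of_iso_right (tensorRegularIso R S (Dual k J V)) ?_)
    obtain ⟨i, rfl⟩ := Nat.exists_eq_add_of_le' hi
    have : Module.Finite S V := Module.Finite.of_restrictScalars_finite k S V
    exact extVanishes_dual hJ V i V ext'

end BimoduleContext

end WakamatsuTilting

end

set_option linter.unusedSectionVars false

noncomputable section

namespace WakamatsuTilting

open Limits ZeroObject Abelian

/-! ### Finite representation type -/

section FiniteType

section

universe v w

variable {C : Type w} [Category.{v} C] [Abelian C]

/-- A sum of two sums of copies is a sum of copies. -/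
def powerAdd (X : C) (a : ℕ) : ∀ b, power X b ⊞ power X a ≅ power X (b + a)
  | 0 => (isoZeroBiprod (isZero_zero C)).symm ≪≫ eqToIso (by rw [Nat.zero_add])
  | b + 1 => biprod.associator X (power X b) (power X a) ≪≫
    biprod.mapIso (Iso.refl X) (powerAdd X a b) ≪≫ eqToIso (by rw [Nat.add_right_comm]; rfl)

/-- A direct sum of retracts is a retract. -/
def retractBiprod {X X' Y Y' : C} (r : Retract X Y) (r' : Retract X' Y') :
    Retract (X ⊞ X') (Y ⊞ Y') where
  i := biprod.map r.i r'.i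
  r := biprod.map r.r r'.r
  retract := by ext <;> simp

/-- The direct sum of a family. -/
theorem exists_sum {P : ObjectProperty C} (h0 : P 0) (h : ∀ X Y, P X → P Y → P (X ⊞ Y)) :
    ∀ (n : ℕ) (L : Fin n → C), (∀ i, P (L i)) → ∃ M, P M ∧ ∀ i, Nonempty (Retract (L i) M)
  | 0, _, _ => ⟨0, h0, fun i => i.elim0⟩
  | n + 1, L, hL => by
    obtain ⟨M, hM, hr⟩ := exists_sum h0 h n (fun i => L i.succ) fun i => hL _
    refine ⟨L 0 ⊞ M, h _ _ (hL 0) hM, Fin.cases ⟨⟨biprod.inl, biprod.fst, biprod.inl_fst⟩⟩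
      fun i => ?_⟩
    obtain ⟨r⟩ := hr i
    exact ⟨r.trans ⟨biprod.inr, biprod.snd, biprod.inr_snd⟩⟩

end

variable {A : Type u} [Ring A] [IsNoetherianRing A] [IsArtinianRing A]

theorem length_biprod (X Y : ModuleCat.{u} A) :
    Module.length A (X ⊞ Y : ModuleCat.{u} A) = Module.length A X + Module.length A Y :=
  Module.length_eq_add_of_exact _ _
    ((ModuleCat.mono_iff_injective (biprod.inl : X ⟶ X ⊞ Y)).1 inferInstance)
    ((ModuleCat.epi_iff_surjective (biprod.snd : X ⊞ Y ⟶ Y)).1 inferInstance)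
    (Ses.biprod X Y).function_exact

theorem IsOfFiniteRepresentationType.hasGenerator {P : ObjectProperty (ModuleCat.{u} A)}
    (hP : IsOfFiniteRepresentationType P) (hfg : P ≤ ModuleCat.isFG A)
    (hret : ∀ X Y, Retract X Y → P Y → P X) (h0 : P 0) (hsum : ∀ X Y, P X → P Y → P (X ⊞ Y)) :
    HasGenerator P := by
  classical
  obtain ⟨n, L, hL⟩ := hP
  -- The list may contain modules outside the class; they are replaced by zero so that the sum stays
  -- inside.
  obtain ⟨M, hM, hr⟩ := exists_sum h0 hsum n (fun i => if P (L i) then L i else 0) fun i => by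
    split_ifs with h
    · exact h
    · exact h0
  refine ⟨M, hM, ?_⟩
  have key : ∀ (m : ℕ) (B : ModuleCat.{u} A), P B → Module.length A B = m →
      ∃ n, Nonempty (Retract B (power M n)) := by
    intro m
    induction m using Nat.strong_induction_on with
    | _ m ih =>
      intro B hB hm
      by_cases hind : Indecomposable B
      · obtain ⟨i, ⟨e⟩⟩ := hL B hB hind
        obtain ⟨r⟩ := hr i
        rw [if_pos (hret _ _ (Retract.ofIso e.symm) hB)] at r
        exact ⟨1, ⟨((Retract.ofIso e).trans r).trans ⟨biprod.inl, biprod.fst, biprod.inl_fst⟩⟩⟩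
      · by_cases hz : IsZero B
        · exact ⟨0, ⟨⟨0, 0, hz.eq_of_src _ _⟩⟩⟩
        · have h : ∃ (Y Z : ModuleCat.{u} A) (_ : B ≅ Y ⊞ Z), ¬ IsZero Y ∧ ¬ IsZero Z := by
            by_contra hc
            push Not at hc
            exact hind ⟨hz, fun Y Z e => or_iff_not_imp_left.2 (hc Y Z e)⟩
          obtain ⟨Y, Z, e, hY, hZ⟩ := h
          have hPY : P Y := hret _ _ ((⟨biprod.inl, biprod.fst, biprod.inl_fst⟩ :
            Retract Y (Y ⊞ Z)).trans (Retract.ofIso e.symm)) hB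
          have hPZ : P Z := hret _ _ ((⟨biprod.inr, biprod.snd, biprod.inr_snd⟩ :
            Retract Z (Y ⊞ Z)).trans (Retract.ofIso e.symm)) hB
          have : Module.Finite A Y := hfg _ hPY
          have : Module.Finite A Z := hfg _ hPZ
          have hlen : Module.length A Y + Module.length A Z = m := by
            rw [← length_biprod, ← hm]
            exact (e.toLinearEquiv.length_eq).symm
          have hY' : Module.length A Y ≠ 0 := fun h =>
            have := Module.length_eq_zero_iff.1 h
            hY (ModuleCat.isZero_of_subsingleton Y)
          have hZ' : Module.length A Z ≠ 0 := fun h =>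
            have := Module.length_eq_zero_iff.1 h
            hZ (ModuleCat.isZero_of_subsingleton Z)
          obtain ⟨y, hy⟩ := ENat.ne_top_iff_exists.1 (Module.length_ne_top (R := A) (M := Y))
          obtain ⟨z, hz⟩ := ENat.ne_top_iff_exists.1 (Module.length_ne_top (R := A) (M := Z))
          rw [← hy] at hY' hlen
          rw [← hz] at hZ' hlen
          norm_cast at hY' hZ' hlen
          obtain ⟨a, ⟨ra⟩⟩ := ih y (by omega) Y hPY hy.symm
          obtain ⟨b, ⟨rb⟩⟩ := ih z (by omega) Z hPZ hz.symm
          exact ⟨a + b, ⟨(Retract.ofIso e).trans ((retractBiprod ra rb).trans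
            (Retract.ofIso (powerAdd M b a)))⟩⟩
  intro B hB
  have : Module.Finite A B := hfg _ hB
  obtain ⟨m, hm⟩ := ENat.ne_top_iff_exists.1 (Module.length_ne_top (R := A) (M := B))
  exact key m B hB hm.symm

variable (T : Type u) [AddCommGroup T] [Module A T]

/-- The two descriptions of finite direct sums of copies of a module. -/
def powerFinIso : ∀ n, power (ModuleCat.of A T) n ≅ ModuleCat.of A (Fin n → T)
  | 0 => (isZero_zero _).iso (ModuleCat.isZero_of_subsingleton _)
  | n + 1 => biprod.mapIso (Iso.refl _) (powerFinIso n) ≪≫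
    ModuleCat.biprodIsoProd (ModuleCat.of A T) (ModuleCat.of A (Fin n → T)) ≪≫
    (Fin.consLinearEquiv A (fun _ : Fin (n + 1) => T)).toModuleIso

end FiniteType

end WakamatsuTilting

end

set_option linter.unusedSectionVars false

noncomputable section

namespace WakamatsuTilting

open Limits ZeroObject

/-! ### Repe-complexes over an algebra as repe-complexes for a pair of adjunctions -/

section Comparison

variable {k : Type u} [CommRing k] {J : Type u} [AddCommGroup J] [Module k J]
  {R : Type u} [Ring R] [Algebra k R] {D : Type (u + 1)} [Category.{u} D] [Abelian D]

variable (k J) in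
/-- Left multiplication on the dual of the regular module. -/
def dualLeftMul (r : R) : ModuleCat.of Rᵐᵒᵖ (Dual k J R) ⟶ ModuleCat.of Rᵐᵒᵖ (Dual k J R) :=
  ModuleCat.ofHom (DistribSMul.toLinearMap Rᵐᵒᵖ (Dual k J R) r)

variable (k J R) in
/-- The composite `H' H` is represented by the dual of the regular bimodule. -/
structure NakayamaData (Φ : AdjointPairs (ModuleCat.{u} Rᵐᵒᵖ) D) where
  isoE : Φ.H.obj (ModuleCat.of Rᵐᵒᵖ (Dual k J R)) ≅ Φ.L'.obj (ModuleCat.of Rᵐᵒᵖ R)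
  comm : ∀ r : R, Φ.H.map (dualLeftMul k J r) ≫ isoE.hom =
    isoE.hom ≫ Φ.L'.map (ofElement (X := ModuleCat.of Rᵐᵒᵖ R) r)
  isIso_co : IsIso (Φ.co (ModuleCat.of Rᵐᵒᵖ (Dual k J R)))
  fg_iff : ∀ X, Φ.fgC X ↔ Module.Finite Rᵐᵒᵖ X
  nak : HasNakayama Φ

namespace NakayamaData

variable {Φ : AdjointPairs (ModuleCat.{u} Rᵐᵒᵖ) D} (N : NakayamaData k J R Φ)

/-- The morphism `R ⟶ H' H X` given by a morphism `DR ⟶ X`. -/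
def toUnit {X : ModuleCat.{u} Rᵐᵒᵖ} (a : ModuleCat.of Rᵐᵒᵖ (Dual k J R) ⟶ X) :
    ModuleCat.of Rᵐᵒᵖ R ⟶ Φ.H'.obj (Φ.H.obj X) := Φ.fl' (N.isoE.inv ≫ Φ.H.map a)

theorem toUnit_comp {X Y : ModuleCat.{u} Rᵐᵒᵖ} (a : ModuleCat.of Rᵐᵒᵖ (Dual k J R) ⟶ X)
    (f : X ⟶ Y) : N.toUnit (a ≫ f) = N.toUnit a ≫ Φ.H'.map (Φ.H.map f) := by
  rw [toUnit, toUnit, ← Φ.fl'_comp, Functor.map_comp, Category.assoc]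

theorem toUnit_add {X : ModuleCat.{u} Rᵐᵒᵖ} (a b : ModuleCat.of Rᵐᵒᵖ (Dual k J R) ⟶ X) :
    N.toUnit (a + b) = N.toUnit a + N.toUnit b := by
  rw [toUnit, Functor.map_add, Preadditive.comp_add, Φ.fl'_add]
  rfl

theorem toUnit_leftMul {X : ModuleCat.{u} Rᵐᵒᵖ} (r : R)
    (a : ModuleCat.of Rᵐᵒᵖ (Dual k J R) ⟶ X) :
    N.toUnit (dualLeftMul k J r ≫ a) = ofElement (X := ModuleCat.of Rᵐᵒᵖ R) r ≫ N.toUnit a := by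
  have h : N.isoE.inv ≫ Φ.H.map (dualLeftMul k J r) =
      Φ.L'.map (ofElement (X := ModuleCat.of Rᵐᵒᵖ R) r) ≫ N.isoE.inv := by
    rw [Iso.inv_comp_eq, ← Category.assoc, ← N.comm, Category.assoc, Iso.hom_inv_id,
      Category.comp_id]
  rw [toUnit, toUnit, ← Φ.fl'_map, Functor.map_comp, ← Category.assoc, h, Category.assoc]

/-- The two adjunctions, together with `H DR ≅ L' R` and `L H DR ≅ DR`, identify morphisms `DR ⟶ X`
with morphisms `R ⟶ H' H X`. -/
theorem toUnit_bijective (X : ModuleCat.{u} Rᵐᵒᵖ) :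
    Function.Bijective (N.toUnit (X := X)) := by
  have := N.isIso_co
  refine Function.bijective_iff_has_inverse.2
    ⟨fun y => inv (Φ.co _) ≫ Φ.sh (N.isoE.hom ≫ Φ.sh' y), fun a => ?_, fun y => ?_⟩
  · change inv (Φ.co _) ≫ Φ.sh (N.isoE.hom ≫ Φ.sh' (Φ.fl' (N.isoE.inv ≫ Φ.H.map a))) = a
    rw [Φ.sh'_fl', Iso.hom_inv_id_assoc, Φ.sh_hmap, IsIso.inv_hom_id_assoc]
  · refine Φ.sh'_injective ?_
    change Φ.sh' (Φ.fl' (N.isoE.inv ≫ Φ.H.map (inv (Φ.co _) ≫ Φ.sh (N.isoE.hom ≫ Φ.sh' y)))) = _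
    have h : Φ.H.map (inv (Φ.co _) ≫ Φ.sh (N.isoE.hom ≫ Φ.sh' y)) = N.isoE.hom ≫ Φ.sh' y :=
      Φ.sh_injective (by rw [Φ.sh_hmap, IsIso.hom_inv_id_assoc])
    rw [Φ.sh'_fl', h, Iso.inv_hom_id_assoc]

/-- The comparison map `Hom_R(DR, X) ⟶ H' H X`. -/
def compare (X : ModuleCat.{u} Rᵐᵒᵖ) :
    (homFunctor R R (Dual k J R)).obj X ⟶ Φ.H'.obj (Φ.H.obj X) :=
  ModuleCat.ofHom (X := RHom R (Dual k J R) X)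
    { toFun := fun a => (N.toUnit (ModuleCat.ofHom a.toLin)).hom (1 : R)
      map_add' := fun a b =>
        congrArg (fun t => t.hom (1 : R)) (N.toUnit_add (ModuleCat.ofHom a.toLin) (ModuleCat.ofHom b.toLin))
      map_smul' := fun r a => by
        refine (congrArg (fun t => t.hom (1 : R))
          (N.toUnit_leftMul r.unop (ModuleCat.ofHom a.toLin))).trans ?_
        rw [RingHom.id_apply, ← map_smul]
        refine congrArg (N.toUnit (ModuleCat.ofHom a.toLin)).hom ?_
        change r.unop * 1 = 1 * r.unop
        rw [mul_one, one_mul] }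

instance isIso_compare (X : ModuleCat.{u} Rᵐᵒᵖ) : IsIso (N.compare X) := by
  rw [ConcreteCategory.isIso_iff_bijective]
  constructor
  · intro (a : RHom R (Dual k J R) X) (b : RHom R (Dual k J R) X) hab
    have h : N.toUnit (ModuleCat.ofHom a.toLin) = N.toUnit (ModuleCat.ofHom b.toLin) := by
      rw [← ofElement_hom_one (N.toUnit (ModuleCat.ofHom a.toLin)),
        ← ofElement_hom_one (N.toUnit (ModuleCat.ofHom b.toLin))]
      exact congrArg ofElement hab
    exact congrArg (fun t => t.hom) ((N.toUnit_bijective X).1 h)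
  · intro y
    obtain ⟨a, ha⟩ := (N.toUnit_bijective X).2 (ofElement y)
    refine ⟨(a.hom : RHom R (Dual k J R) X), ?_⟩
    exact (congrArg (fun t => t.hom (1 : R)) ha).trans (ofElement_one y)

theorem compare_naturality {X Y : ModuleCat.{u} Rᵐᵒᵖ} (f : X ⟶ Y) :
    (homFunctor R R (Dual k J R)).map f ≫ N.compare Y =
      N.compare X ≫ Φ.H'.map (Φ.H.map f) :=
  ModuleCat.hom_ext (LinearMap.ext fun (a : RHom R (Dual k J R) X) =>
    congrArg (fun t => t.hom (1 : R)) (N.toUnit_comp (ModuleCat.ofHom a.toLin) f))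

/-- A differential of a repe-complex as a morphism. -/
def ofδ {X Y : ModuleCat.{u} Rᵐᵒᵖ} (δ : X →ₗ[Rᵐᵒᵖ] RHom R (Dual k J R) Y) :
    X ⟶ (homFunctor R R (Dual k J R)).obj Y := ModuleCat.ofHom δ

theorem exists_δ {X Y : ModuleCat.{u} Rᵐᵒᵖ} (d : Φ.L'.obj X ⟶ Φ.H.obj Y) :
    ∃ δ : X →ₗ[Rᵐᵒᵖ] RHom R (Dual k J R) Y,
      Φ.sh' (ofδ δ ≫ N.compare Y) = d := by
  refine ⟨(Φ.fl' d ≫ inv (N.compare Y)).hom, ?_⟩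
  refine (congrArg Φ.sh' ((Category.assoc _ _ _).trans ?_)).trans (Φ.sh'_fl' d)
  exact (congrArg (Φ.fl' d ≫ ·) (IsIso.inv_hom_id _)).trans (Category.comp_id _)

/-- Transposing along both adjunctions and passing through the natural isomorphism `compare` turns
the condition into the vanishing of a composite with values in `Hom(DR, Hom(DR, Z))`. -/
theorem comp_eq_zero_iff {X Y Z : ModuleCat.{u} Rᵐᵒᵖ} (δ : X →ₗ[Rᵐᵒᵖ] RHom R (Dual k J R) Y)
    (δ' : Y →ₗ[Rᵐᵒᵖ] RHom R (Dual k J R) Z) :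
    Φ.sh (Φ.sh' (ofδ δ ≫ N.compare Y)) ≫
      Φ.fl' (Φ.sh' (ofδ δ' ≫ N.compare Z)) = 0 ↔
    ∀ x φ ψ, (δ' ((δ x).toLin φ)).toLin ψ = 0 := by
  let d := ofδ δ
  let d' := ofδ δ'
  have e1 : Φ.sh (Φ.sh' (d ≫ N.compare Y)) ≫ Φ.fl' (Φ.sh' (d' ≫ N.compare Z)) = 0 ↔
      Φ.sh (Φ.sh' (d ≫ N.compare Y)) ≫ d' = 0 := by
    rw [Φ.fl'_sh', ← Category.assoc]
    exact ⟨fun h => by rwa [← cancel_mono (N.compare Z), zero_comp], fun h => by rw [h, zero_comp]⟩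
  have e2 : Φ.sh (Φ.sh' (d ≫ N.compare Y)) ≫ d' = 0 ↔
      Φ.sh' (d ≫ N.compare Y) ≫ Φ.H.map d' = 0 :=
    ⟨fun h => Φ.sh_injective (by rw [Φ.sh_comp, h, Φ.sh_zero]),
      fun h => by rw [← Φ.sh_comp, h, Φ.sh_zero]⟩
  have e3 : Φ.sh' (d ≫ N.compare Y) ≫ Φ.H.map d' = 0 ↔
      d ≫ (homFunctor R R (Dual k J R)).map d' = 0 := by
    rw [← cancel_mono (N.compare _), zero_comp, Category.assoc, N.compare_naturality,
      ← Category.assoc]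
    exact ⟨fun h => Φ.sh'_injective (by rw [Φ.sh'_comp, h]; exact Φ.swap.sh_zero.symm),
      fun h => by rw [← Φ.sh'_comp, h]; exact Φ.swap.sh_zero⟩
  refine (e1.trans (e2.trans e3)).trans ⟨fun h x φ ψ => ?_, fun h => ?_⟩
  · exact congrArg (fun t : X ⟶ (homFunctor R R (Dual k J R)).obj
      ((homFunctor R R (Dual k J R)).obj Z) =>
      ((t.hom x : RHom R (Dual k J R) (RHom R (Dual k J R) Z)).toLin φ).toLin ψ) h
  · exact ModuleCat.hom_ext (LinearMap.ext fun x => RHom.ext fun φ => RHom.ext fun ψ => h x φ ψ)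

theorem comm_iff {X Y X' Y' : ModuleCat.{u} Rᵐᵒᵖ} (δ : X →ₗ[Rᵐᵒᵖ] RHom R (Dual k J R) Y)
    (δ' : X' →ₗ[Rᵐᵒᵖ] RHom R (Dual k J R) Y') (f : X ⟶ X') (g : Y ⟶ Y') :
    Φ.sh' (ofδ δ ≫ N.compare Y) ≫ Φ.H.map g =
      Φ.L'.map f ≫ Φ.sh' (ofδ δ' ≫ N.compare Y') ↔
    ∀ x φ, g.hom ((δ x).toLin φ) = (δ' (f.hom x)).toLin φ := by
  let d := ofδ δ
  let d' := ofδ δ'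
  have e : Φ.sh' (d ≫ N.compare Y) ≫ Φ.H.map g = Φ.L'.map f ≫ Φ.sh' (d' ≫ N.compare Y') ↔
      d ≫ (homFunctor R R (Dual k J R)).map g = f ≫ d' := by
    rw [← cancel_mono (N.compare _), Category.assoc, N.compare_naturality, ← Category.assoc,
      ← Φ.sh'_comp, ← Φ.sh'_map, Category.assoc]
    exact ⟨fun h => Φ.sh'_injective h, fun h => congrArg Φ.sh' h⟩
  refine e.trans ⟨fun h x φ => ?_, fun h => ?_⟩
  · exact congrArg (fun t : X ⟶ (homFunctor R R (Dual k J R)).obj Y' =>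
      (t.hom x : RHom R (Dual k J R) Y').toLin φ) h
  · exact ModuleCat.hom_ext (LinearMap.ext fun x => RHom.ext fun φ => h x φ)

theorem bdd_iff {X : ℤ → ModuleCat.{u} Rᵐᵒᵖ} : Bdd X ↔ {i | Nontrivial (X i)}.Finite := by
  have : {i | ¬ IsZero (X i)} = {i | Nontrivial (X i)} := by
    ext i
    change ¬ IsZero (X i) ↔ Nontrivial (X i)
    rw [ModuleCat.isZero_iff_subsingleton, not_subsingleton_iff_nontrivial]
  rw [Bdd, this]

/-- The comparison functor. -/
@[simps] def toRep : RepeComplex k J R ⥤ Rep Φ where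
  obj X :=
    { X := X.X
      fg := fun i => (N.fg_iff _).2 (X.finite i)
      bdd := bdd_iff.2 X.bounded
      d := fun i => Φ.sh' (ofδ (X.δ i) ≫
        N.compare (X.X i))
      d_comp := fun i => (N.comp_eq_zero_iff _ _).2 (X.δ_comp i) }
  map {X Y} f :=
    { f := fun i => ModuleCat.ofHom (f.f i)
      comm := fun i => (N.comm_iff _ _ _ _).2 (f.comm i) }
  map_id _ := rfl
  map_comp _ _ := rfl

instance : N.toRep.Faithful where
  map_injective {X Y} f g h := RepeComplex.Hom.ext (funext fun i =>
    congrArg (fun t : N.toRep.obj X ⟶ N.toRep.obj Y => (t.f i).hom) h)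

instance : N.toRep.Full where
  map_surjective {X Y} f := ⟨⟨fun i => (f.f i).hom, fun i => (N.comm_iff _ _ _ _).1 (f.comm i)⟩, rfl⟩

instance : N.toRep.EssSurj where
  mem_essImage Y := by
    choose δ hδ using fun i => N.exists_δ (Y.d i)
    let X : RepeComplex k J R :=
      { X := Y.X
        finite := fun i => (N.fg_iff _).1 (Y.fg i)
        bounded := bdd_iff.1 Y.bdd
        δ := δ
        δ_comp := fun i => (N.comp_eq_zero_iff _ _).1 (by rw [hδ, hδ, Y.d_comp]) }
    refine ⟨X, ⟨Rep.isoMk (fun i => Iso.refl _) fun i => ?_⟩⟩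
    refine (congrArg (· ≫ Φ.H.map (𝟙 _)) (hδ i)).trans ?_
    rw [Φ.H.map_id, Category.comp_id]
    refine Eq.trans ?_ (congrArg (· ≫ _) (Φ.L'.map_id _)).symm
    exact (Category.id_comp _).symm

instance : N.toRep.IsEquivalence where

end NakayamaData

end Comparison

end WakamatsuTilting

end

set_option linter.unusedSectionVars false

noncomputable section

namespace WakamatsuTilting

open Limits ZeroObject

/-! ### The repetitive category -/

section Comparison

variable {k : Type u} [CommRing k] {J : Type u} [AddCommGroup J] [Module k J]
  {R : Type u} [Ring R] [Algebra k R] {D : Type (u + 1)} [Category.{u} D] [Abelian D]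

theorem Rep.null_iff_of_iso {C : Type (u + 1)} [Category.{u} C] [Abelian C] {Φ : AdjointPairs C D}
    {X X' Y Y' : Rep Φ} (e : X' ≅ X) (e' : Y' ≅ Y) {f g : X ⟶ Y} {f' g' : X' ⟶ Y'}
    (hf : f' ≫ e'.hom = e.hom ≫ f) (hg : g' ≫ e'.hom = e.hom ≫ g) :
    Rep.Null X' Y' (fun i => f'.f i - g'.f i) ↔ Rep.Null X Y fun i => f.f i - g.f i := by
  constructor
  · intro h
    have := (h.comp e'.hom).precomp e.inv
    simpa only [Preadditive.sub_comp, Preadditive.comp_sub, ← Rep.comp_f, hf, hg,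
      Iso.inv_hom_id_assoc] using this
  · intro h
    have := (h.comp e'.inv).precomp e.hom
    simpa only [Preadditive.sub_comp, Preadditive.comp_sub, ← Rep.comp_f, ← reassoc_of% hf,
      ← reassoc_of% hg, Iso.hom_inv_id, Category.comp_id] using this

namespace NakayamaData

variable {Φ : AdjointPairs (ModuleCat.{u} Rᵐᵒᵖ) D} (N : NakayamaData k J R Φ)

theorem stableRel_iff {X Y : RepeComplex k J R} (g h : X ⟶ Y) : stableRel k J R g h ↔
    Rep.Null (N.toRep.obj X) (N.toRep.obj Y) fun i => (N.toRep.map g).f i - (N.toRep.map h).f i := by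
  rw [Rep.null_iff_projective N.nak]
  constructor
  · rintro ⟨P, hP, a, b, hab⟩
    exact ⟨N.toRep.obj P, (N.toRep.asEquivalence.map_projective_iff P).2 hP, N.toRep.map a,
      N.toRep.map b, fun i => ModuleCat.hom_ext (LinearMap.ext fun x => hab i x)⟩
  · rintro ⟨P, hP, a, b, hab⟩
    let e := N.toRep.objObjPreimageIso P
    refine ⟨N.toRep.objPreimage P,
      (N.toRep.asEquivalence.map_projective_iff _).1 (Projective.of_iso e.symm hP),
      N.toRep.preimage (a ≫ e.inv), N.toRep.preimage (e.hom ≫ b), fun i x => ?_⟩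
    have h1 : N.toRep.map (N.toRep.preimage (a ≫ e.inv) ≫ N.toRep.preimage (e.hom ≫ b)) = a ≫ b := by
      rw [Functor.map_comp, Functor.map_preimage, Functor.map_preimage, Category.assoc,
        Iso.inv_hom_id_assoc]
    have h2 : (N.toRep.map g).f i - (N.toRep.map h).f i =
        (N.toRep.map (N.toRep.preimage (a ≫ e.inv) ≫ N.toRep.preimage (e.hom ≫ b))).f i := by
      rw [h1, hab]
      rfl
    exact congrArg (fun t => t.hom x) h2

-- Needed so that equality in the quotient category is the stable relation itself, and not merely
-- the congruence it generates.
include N in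
theorem congruence : Congruence (stableRel k J R) where
  equivalence :=
    { refl := fun g => (N.stableRel_iff g g).2 (by
        simpa only [sub_self] using Rep.Null.zero N.nak)
      symm := fun {g h} hgh => (N.stableRel_iff h g).2 (by
        simpa only [neg_sub] using ((N.stableRel_iff g h).1 hgh).neg)
      trans := fun {f g h} hfg hgh => (N.stableRel_iff f h).2 (by
        simpa only [sub_add_sub_cancel] using
          ((N.stableRel_iff f g).1 hfg).add N.nak ((N.stableRel_iff g h).1 hgh)) }
  comp_left := fun {_ _ _} f {g h} hgh => (N.stableRel_iff _ _).2 (by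
    have := ((N.stableRel_iff g h).1 hgh).precomp (N.toRep.map f)
    simpa only [Preadditive.comp_sub, ← Rep.comp_f, ← Functor.map_comp] using this)
  comp_right := fun {_ _ _ f f'} g hf => (N.stableRel_iff _ _).2 (by
    have := ((N.stableRel_iff f f').1 hf).comp (N.toRep.map g)
    simpa only [Preadditive.sub_comp, ← Rep.comp_f, ← Functor.map_comp] using this)

/-- The functor from repe-complexes to the repetitive category. -/
def toStable : Rep Φ ⥤ RepetitiveCategory k J R := N.toRep.inv ⋙ Quotient.functor _

instance : N.toStable.Full := inferInstanceAs (N.toRep.inv ⋙ Quotient.functor _).Full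

instance : N.toStable.EssSurj := inferInstanceAs (N.toRep.inv ⋙ Quotient.functor _).EssSurj

theorem toStable_map_eq_iff (X Y : Rep Φ) (f g : X ⟶ Y) :
    N.toStable.map f = N.toStable.map g ↔ Rep.Null X Y fun i => f.f i - g.f i := by
  have := N.congruence
  refine (Quotient.functor_map_eq_iff (stableRel k J R) (N.toRep.inv.map f)
    (N.toRep.inv.map g)).trans ((N.stableRel_iff _ _).trans ?_)
  exact Rep.null_iff_of_iso (N.toRep.asEquivalence.counitIso.app X)
    (N.toRep.asEquivalence.counitIso.app Y) (N.toRep.asEquivalence.counitIso.hom.naturality f)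
    (N.toRep.asEquivalence.counitIso.hom.naturality g)

/-- The two functors from repe-complexes over `R` to the repetitive category. -/
def toRepStableIso : N.toRep ⋙ N.toStable ≅ Quotient.functor (stableRel k J R) :=
  Functor.isoWhiskerRight N.toRep.asEquivalence.unitIso.symm (Quotient.functor _)

end NakayamaData

end Comparison

/-! ### Stalk repe-complexes -/

section Stalk

variable (k : Type u) [CommRing k] (J : Type u) [AddCommGroup J] [Module k J]
  (R : Type u) [Ring R] [Algebra k R]

/-- The inclusion of the components of a stalk repe-complex. -/
def stalkInclusion (M : FGModuleCat.{u} Rᵐᵒᵖ) (i : ℤ) : ((stalk k J R).obj M).X i ⟶ M.obj :=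
  ModuleCat.ofHom (Submodule.subtype _)

instance isIso_stalkInclusion (M : FGModuleCat.{u} Rᵐᵒᵖ) : IsIso (stalkInclusion k J R M 0) := by
  rw [ConcreteCategory.isIso_iff_bijective]
  exact ⟨Subtype.val_injective, fun x => ⟨⟨x, Submodule.mem_top⟩, rfl⟩⟩

theorem isZero_stalk (M : FGModuleCat.{u} Rᵐᵒᵖ) {i : ℤ} (hi : i ≠ 0) :
    IsZero (((stalk k J R).obj M).X i) := by
  have : Subsingleton (((stalk k J R).obj M).X i) := by
    change Subsingleton (if i = 0 then ⊤ else ⊥ : Submodule Rᵐᵒᵖ M.obj)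
    rw [if_neg hi]
    infer_instance
  exact ModuleCat.isZero_of_subsingleton _

end Stalk

end WakamatsuTilting

end

set_option linter.unusedSectionVars false

noncomputable section

namespace WakamatsuTilting

open Limits ZeroObject

/-! ### The repetitive equivalence -/

section RepetitiveEquivalence

variable {k : Type u} [CommRing k] {J : Type u} [AddCommGroup J] [Module k J]
  {R S : Type u} [Ring R] [Algebra k R] [Ring S] [Algebra k S]

instance mono_stalkInclusion (M : FGModuleCat.{u} Rᵐᵒᵖ) (i : ℤ) : Mono (stalkInclusion k J R M i) :=
  (ModuleCat.mono_iff_injective _).2 Subtype.val_injective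

/-- A stalk is made of the submodules `⊤` and `⊥`, selected by the degree. In degree zero the
inclusion is invertible; in all other degrees both sides vanish. -/
theorem exists_stalk_iso (H : ModuleCat.{u} Rᵐᵒᵖ ⥤ ModuleCat.{u} Sᵐᵒᵖ) [H.Additive]
    (M : FGModuleCat.{u} Rᵐᵒᵖ) (M' : FGModuleCat.{u} Sᵐᵒᵖ) (e : H.obj M.obj ≅ M'.obj) (i : ℤ) :
    ∃ f : H.obj (((stalk k J R).obj M).X i) ≅ ((stalk k J S).obj M').X i,
      f.hom ≫ stalkInclusion k J S M' i = H.map (stalkInclusion k J R M i) ≫ e.hom := by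
  by_cases hi : i = 0
  · subst hi
    exact ⟨asIso (H.map (stalkInclusion k J R M 0)) ≪≫ e ≪≫
      (asIso (stalkInclusion k J S M' 0)).symm, by simp⟩
  · have h := H.map_isZero (isZero_stalk k J R M hi)
    exact ⟨h.iso (isZero_stalk k J S M' hi), h.eq_of_src _ _⟩

variable {Φ : AdjointPairs (ModuleCat.{u} Rᵐᵒᵖ) (ModuleCat.{u} Sᵐᵒᵖ)} (N : NakayamaData k J R Φ)
  (N' : NakayamaData k J S Φ.swap) {𝓑 𝓐 : ObjectProperty (ModuleCat.{u} Rᵐᵒᵖ)}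
  {𝓖 𝓚 : ObjectProperty (ModuleCat.{u} Sᵐᵒᵖ)} (hS : CounterSetup Φ 𝓑 𝓐 𝓖 𝓚)

include N N' hS

/-- The stalk of a member of `𝓐` has zero differentials, so `ofZeroFunctor` lifts it to links, and
the second component is the stalk of its image under `H` up to isomorphism. The stable equivalence
is compatible with both projections. -/
theorem exists_repetitive_equivalence (hiso : ∀ X Y, (X ≅ Y) → 𝓐 X → 𝓐 Y)
    (hA : 𝓐 ≤ ModuleCat.isFG Rᵐᵒᵖ) (hG : 𝓖 ≤ ModuleCat.isFG Sᵐᵒᵖ)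
    (F : 𝓐.FullSubcategory ⥤ 𝓖.FullSubcategory) (α : F ⋙ 𝓖.ι ≅ 𝓐.ι ⋙ Φ.H) :
    ∃ E : RepetitiveCategory k J R ≌ RepetitiveCategory k J S,
      Nonempty (ObjectProperty.ιOfLE hA ⋙ stalkStable k J R ⋙ E.functor ≅
        F ⋙ ObjectProperty.ιOfLE hG ⋙ stalkStable k J S) := by
  obtain ⟨E, ⟨ε⟩⟩ := Link.exists_stable_equivalence hS N.toStable N'.toStable
    N.toStable_map_eq_iff N'.toStable_map_eq_iff
  let A₀ : 𝓐.FullSubcategory ⥤ Rep Φ := ObjectProperty.ιOfLE hA ⋙ stalk k J R ⋙ N.toRep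
  let G₀ : 𝓐.FullSubcategory ⥤ Rep Φ.swap :=
    F ⋙ ObjectProperty.ιOfLE hG ⋙ stalk k J S ⋙ N'.toRep
  have hA₀ : ∀ a i, 𝓐 ((A₀.obj a).X i) := fun a i => by
    by_cases hi : i = 0
    · subst hi
      exact hiso _ _ (asIso (stalkInclusion k J R ((ObjectProperty.ιOfLE hA).obj a) 0)).symm
        a.property
    · exact hS.zero_A _ (isZero_stalk k J R ((ObjectProperty.ιOfLE hA).obj a) hi)
  have h0 : ∀ a i, (A₀.obj a).d i = 0 := fun a i =>
    (congrArg Φ.sh' zero_comp).trans Φ.swap.sh_zero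
  have h0' : ∀ a i, (G₀.obj a).d i = 0 := fun a i =>
    (congrArg Φ.swap.sh' zero_comp).trans Φ.sh_zero
  let L := Link.ofZeroFunctor hS A₀ hA₀ h0
  choose β hβ using fun (a : 𝓐.FullSubcategory) (i : ℤ) =>
    exists_stalk_iso (k := k) (J := J) Φ.H ((ObjectProperty.ιOfLE hA).obj a)
      ((ObjectProperty.ιOfLE hG).obj (F.obj a)) (α.symm.app a) i
  have nat : ∀ {a b : 𝓐.FullSubcategory} (f : a ⟶ b) (i : ℤ),
      Φ.H.map ((A₀.map f).f i) ≫ (β b i).hom = (β a i).hom ≫ (G₀.map f).f i := fun {a b} f i => by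
    refine (cancel_mono (stalkInclusion k J S ((ObjectProperty.ιOfLE hG).obj (F.obj b)) i)).1 ?_
    have e : Φ.H.map ((A₀.map f).f i) ≫
        Φ.H.map (stalkInclusion k J R ((ObjectProperty.ιOfLE hA).obj b) i) =
        Φ.H.map (stalkInclusion k J R ((ObjectProperty.ιOfLE hA).obj a) i) ≫ Φ.H.map f.hom :=
      (Φ.H.map_comp _ _).symm.trans (Φ.H.map_comp
        (stalkInclusion k J R ((ObjectProperty.ιOfLE hA).obj a) i) f.hom)
    have e' : Φ.H.map f.hom ≫ α.inv.app b = α.inv.app a ≫ (F.map f).hom := α.inv.naturality f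
    refine (Category.assoc _ _ _).trans ((congrArg (_ ≫ ·) (hβ b i)).trans ?_)
    refine Eq.trans ?_ ((congrArg (· ≫ (F.map f).hom) (hβ a i).symm).trans
      ((Category.assoc _ _ _).trans (Category.assoc _ _ _).symm))
    refine (Category.assoc _ _ _).symm.trans ((congrArg (· ≫ α.inv.app b) e).trans ?_)
    exact (Category.assoc _ _ _).trans
      ((congrArg (_ ≫ ·) e').trans (Category.assoc _ _ _).symm)
  let γ : L ⋙ Link.snd Φ 𝓑 𝓐 ≅ G₀ := NatIso.ofComponents
    (fun a => Rep.isoMk (β a) fun i => by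
      refine Eq.trans zero_comp ?_
      rw [h0']
      exact comp_zero.symm)
    fun {a b} f => Rep.hom_ext fun i => nat f i
  let e₁ : ObjectProperty.ιOfLE hA ⋙ stalkStable k J R ≅ A₀ ⋙ N.toStable :=
    Functor.isoWhiskerLeft (ObjectProperty.ιOfLE hA ⋙ stalk k J R) N.toRepStableIso.symm
  let e₂ : G₀ ⋙ N'.toStable ≅ F ⋙ ObjectProperty.ιOfLE hG ⋙ stalkStable k J S :=
    Functor.isoWhiskerLeft (F ⋙ ObjectProperty.ιOfLE hG ⋙ stalk k J S) N'.toRepStableIso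
  exact ⟨E, ⟨Functor.isoWhiskerRight e₁ E.functor ≪≫ Functor.isoWhiskerLeft L ε ≪≫
    Functor.isoWhiskerRight γ N'.toStable ≪≫ e₂⟩⟩

end RepetitiveEquivalence

end WakamatsuTilting

end

set_option linter.unusedSectionVars false

noncomputable section

namespace WakamatsuTilting

open Limits ZeroObject Abelian

/-! ### The Auslander and co-Auslander classes -/

section Classes

variable {A : Type u} [Ring A]

/-- The image of a linear map, as the source of an injective map with the same image. -/
def rangeIso {M N B : Type u} [AddCommGroup M] [Module A M] [AddCommGroup N] [Module A N]
    [AddCommGroup B] [Module A B] (h : M →ₗ[A] B) (g : N →ₗ[A] B) (hh : Function.Injective h)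
    (e : LinearMap.range h = LinearMap.range g) :
    ModuleCat.of A M ≅ ModuleCat.of A (LinearMap.range g) :=
  ((LinearEquiv.ofInjective h hh).trans (LinearEquiv.ofEq _ _ e)).toModuleIso

theorem Ses.injective {X Y Z : ModuleCat.{u} A} {f : X ⟶ Y} {g : Y ⟶ Z} (h : Ses f g) :
    Function.Injective f.hom := (ModuleCat.mono_iff_injective f).1 h.mono

theorem Ses.surjective {X Y Z : ModuleCat.{u} A} {f : X ⟶ Y} {g : Y ⟶ Z} (h : Ses f g) :
    Function.Surjective g.hom := (ModuleCat.epi_iff_surjective g).1 h.epi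

variable (T : Type u) [AddCommGroup T] [Module A T]

variable {T} in
theorem inAdd_iff {M : ModuleCat.{u} A} :
    InAdd T M ↔ ∃ n, Nonempty (Retract M (power (ModuleCat.of A T) n)) :=
  ⟨fun ⟨n, ⟨r⟩⟩ => ⟨n, ⟨r.trans (Retract.ofIso (powerFinIso T n).symm)⟩⟩,
    fun ⟨n, ⟨r⟩⟩ => ⟨n, ⟨r.trans (Retract.ofIso (powerFinIso T n))⟩⟩⟩

/-- The chosen sequences are spliced. The images in the spliced complex are isomorphic to the
successive kernels, which remain in the class, so the `Ext` conditions hold. -/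
theorem le_coAuslanderClass {P : ObjectProperty (ModuleCat.{u} A)} (hfg : P ≤ ModuleCat.isFG A)
    (hext : ∀ X, P X → ExtZero (ModuleCat.of A T) X)
    (hP : ∀ X, P X → ∃ (X₁ U : ModuleCat.{u} A) (i : X₁ ⟶ U) (p : U ⟶ X), Ses i p ∧ P X₁ ∧
      InAdd T U) : P ≤ coAuslanderClass T := by
  intro X hX
  choose K U i p hs hK hU using hP
  let M : ℕ → {X // P X} := fun n => Nat.rec ⟨X, hX⟩ (fun _ Y => ⟨K Y.1 Y.2, hK Y.1 Y.2⟩) n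
  have hn : ∀ n, Ses (X := (M (n + 1)).1) (i (M n).1 (M n).2) (p (M n).1 (M n).2) :=
    fun n => hs _ _
  refine ⟨hfg _ hX, fun n => U (M n).1 (M n).2, (p (M 0).1 (M 0).2).hom,
    fun n => (i (M n).1 (M n).2).hom.comp (p (M (n + 1)).1 (M (n + 1)).2).hom, fun n => hU _ _,
    (hn 0).surjective, ?_, fun n => ?_, fun n h => ?_, fun j n h => ?_⟩
  · intro x
    rw [(hn 0).function_exact x]
    exact ⟨fun ⟨y, hy⟩ => by
      obtain ⟨z, rfl⟩ := (hn 1).surjective y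
      exact ⟨z, hy⟩, fun ⟨z, hz⟩ => ⟨_, hz⟩⟩
  · intro x
    refine Iff.trans ?_ (((hn (n + 1)).function_exact x).trans ?_)
    · exact ⟨fun h => (hn n).injective (h.trans (map_zero _).symm),
        fun h => (congrArg (i (M n).1 (M n).2).hom h).trans (map_zero _)⟩
    · exact ⟨fun ⟨y, hy⟩ => by
        obtain ⟨z, rfl⟩ := (hn (n + 2)).surjective y
        exact ⟨z, hy⟩, fun ⟨z, hz⟩ => ⟨_, hz⟩⟩
  · refine (hext _ hX).of_iso_right (rangeIso LinearMap.id _ Function.injective_id ?_) n h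
    rw [LinearMap.range_id, LinearMap.range_eq_top.2 (hn 0).surjective]
  · refine (hext _ (M (j + 1)).2).of_iso_right
      (rangeIso (i (M j).1 (M j).2).hom _ (hn j).injective ?_) n h
    exact (LinearMap.range_comp_of_range_eq_top _
      (LinearMap.range_eq_top.2 (hn (j + 1)).surjective)).symm

theorem le_auslanderClass {P : ObjectProperty (ModuleCat.{u} A)} (hfg : P ≤ ModuleCat.isFG A)
    (hext : ∀ X, P X → ExtZero X (ModuleCat.of A T))
    (hP : ∀ X, P X → ∃ (U X₁ : ModuleCat.{u} A) (i : X ⟶ U) (p : U ⟶ X₁), Ses i p ∧ P X₁ ∧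
      InAdd T U) : P ≤ auslanderClass T := by
  intro X hX
  choose U K i p hs hK hU using hP
  let M : ℕ → {X // P X} := fun n => Nat.rec ⟨X, hX⟩ (fun _ Y => ⟨K Y.1 Y.2, hK Y.1 Y.2⟩) n
  have hn : ∀ n, Ses (Z := (M (n + 1)).1) (i (M n).1 (M n).2) (p (M n).1 (M n).2) :=
    fun n => hs _ _
  refine ⟨hfg _ hX, fun n => U (M n).1 (M n).2, (i (M 0).1 (M 0).2).hom,
    fun n => (i (M (n + 1)).1 (M (n + 1)).2).hom.comp (p (M n).1 (M n).2).hom, fun n => hU _ _,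
    (hn 0).injective, ?_, fun n => ?_, fun n h => ?_, fun j n h => ?_⟩
  · intro x
    refine Iff.trans ?_ ((hn 0).function_exact x)
    exact ⟨fun h => (hn 1).injective (h.trans (map_zero _).symm),
      fun h => (congrArg (i (M 1).1 (M 1).2).hom h).trans (map_zero _)⟩
  · intro x
    refine Iff.trans ?_ (((hn (n + 1)).function_exact x).trans ?_)
    · exact ⟨fun h => (hn (n + 2)).injective (h.trans (map_zero _).symm),
        fun h => (congrArg (i (M (n + 2)).1 (M (n + 2)).2).hom h).trans (map_zero _)⟩
    · exact ⟨fun ⟨y, hy⟩ => by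
        obtain ⟨z, rfl⟩ := (hn n).surjective y
        exact ⟨z, hy⟩, fun ⟨z, hz⟩ => ⟨_, hz⟩⟩
  · exact (hext _ hX).of_iso_left (rangeIso _ _ (hn 0).injective rfl) n h
  · refine (hext _ (M (j + 1)).2).of_iso_left
      (rangeIso (i (M (j + 1)).1 (M (j + 1)).2).hom _ (hn (j + 1)).injective ?_) n h
    exact (LinearMap.range_comp_of_range_eq_top _
      (LinearMap.range_eq_top.2 (hn j).surjective)).symm

variable {T} in
theorem coAuslanderClass.extZero {X : ModuleCat.{u} A} (hX : coAuslanderClass T X) :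
    ExtZero (ModuleCat.of A T) X := by
  obtain ⟨-, C, f, d, -, hf, -, -, h, -⟩ := hX
  refine ExtZero.of_iso_right (rangeIso LinearMap.id f Function.injective_id ?_).symm
    (fun n hn => h n hn)
  rw [LinearMap.range_id, LinearMap.range_eq_top.2 hf]

variable {T} in
theorem auslanderClass.extZero {X : ModuleCat.{u} A} (hX : auslanderClass T X) :
    ExtZero X (ModuleCat.of A T) := by
  obtain ⟨-, C, f, d, -, hf, -, -, h, -⟩ := hX
  exact ExtZero.of_iso_left (rangeIso f f hf rfl).symm (fun n hn => h n hn)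

variable {T} in
-- The image of `d 0` inherits the shifted resolution; its finite generation is where the noetherian
-- hypothesis enters.
theorem coAuslanderClass.exists_ses {X : ModuleCat.{u} A} (hX : coAuslanderClass T X)
    [IsNoetherianRing A] [Module.Finite A T] :
    ∃ (X₁ U : ModuleCat.{u} A) (i : X₁ ⟶ U) (p : U ⟶ X), Ses i p ∧ coAuslanderClass T X₁ ∧
      InAdd T U := by
  obtain ⟨-, C, f, d, hC, hf, h0, hd, h, h'⟩ := hX
  refine ⟨ModuleCat.of A (LinearMap.range (d 0)), C 0,
    ModuleCat.ofHom (LinearMap.range (d 0)).subtype, ModuleCat.ofHom f,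
    ses_of_function_exact (LinearMap.range (d 0)).injective_subtype hf fun x => ?_, ?_, hC 0⟩
  · rw [h0 x]
    exact ⟨fun h => ⟨⟨x, h⟩, rfl⟩, fun ⟨⟨_, h⟩, e⟩ => e ▸ h⟩
  · have : Module.Finite A (C 0) := by
      obtain ⟨n, ⟨r⟩⟩ := hC 0
      exact Module.Finite.of_injective r.i.hom ((ModuleCat.mono_iff_injective r.i).1 inferInstance)
    refine ⟨inferInstanceAs (Module.Finite A (LinearMap.range (d 0))), fun n => C (n + 1),
      (d 0).rangeRestrict, fun n => d (n + 1), fun n => hC _, LinearMap.surjective_rangeRestrict _,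
      fun x => ?_, fun n => hd (n + 1), fun n hn => ?_, fun i n hn => h' (i + 1) n hn⟩
    · rw [← hd 0 x]
      exact ⟨fun h => congrArg Subtype.val h, fun h => Subtype.ext h⟩
    · refine ExtZero.of_iso_right (rangeIso LinearMap.id _ Function.injective_id ?_)
        (fun n hn => h' 0 n hn) n hn
      rw [LinearMap.range_id, LinearMap.range_rangeRestrict]

variable {T} in
theorem auslanderClass.exists_ses {X : ModuleCat.{u} A} (hX : auslanderClass T X)
    [IsNoetherianRing A] [Module.Finite A T] :
    ∃ (U X₁ : ModuleCat.{u} A) (i : X ⟶ U) (p : U ⟶ X₁), Ses i p ∧ auslanderClass T X₁ ∧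
      InAdd T U := by
  obtain ⟨-, C, f, d, hC, hf, h0, hd, h, h'⟩ := hX
  refine ⟨C 0, ModuleCat.of A (LinearMap.range (d 0)), ModuleCat.ofHom f,
    ModuleCat.ofHom (d 0).rangeRestrict,
    ses_of_function_exact hf (LinearMap.surjective_rangeRestrict _) fun x => ?_, ?_, hC 0⟩
  · rw [← h0 x]
    exact ⟨fun h => congrArg Subtype.val h, fun h => Subtype.ext h⟩
  · have : Module.Finite A (C 0) := by
      obtain ⟨n, ⟨r⟩⟩ := hC 0
      exact Module.Finite.of_injective r.i.hom ((ModuleCat.mono_iff_injective r.i).1 inferInstance)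
    refine ⟨inferInstanceAs (Module.Finite A (LinearMap.range (d 0))), fun n => C (n + 1),
      (LinearMap.range (d 0)).subtype, fun n => d (n + 1), fun n => hC _,
      (LinearMap.range (d 0)).injective_subtype,
      fun x => ?_, fun n => hd (n + 1), fun n hn => ?_, fun i n hn => h' (i + 1) n hn⟩
    · rw [hd 0 x]
      exact ⟨fun h => ⟨⟨x, h⟩, rfl⟩, fun ⟨⟨_, h⟩, e⟩ => e ▸ h⟩
    · exact ExtZero.of_iso_left (rangeIso _ _ (LinearMap.range (d 0)).injective_subtype rfl)
        (fun n hn => h' 0 n hn) n hn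

end Classes

section Compare

variable {k : Type u} [CommRing k] {J : Type u} [AddCommGroup J] [Module k J]
  {A : Type u} [Ring A] [IsNoetherianRing A] [Linear k (ModuleCat.{u} A)]
  {D : Type (u + 1)} [Category.{u} D] [Abelian D] [Linear k D] [HasExt.{u} D]
  {T : Type u} [AddCommGroup T] [Module A T] [Module.Finite A T]

/-- Truncating a resolution feeds `bass_of_resolution`; iterating `bass.cover` gives the converse.
-/
theorem coAuslanderClass_eq_bass {Φ : AdjointPairs (ModuleCat.{u} A) D}
    (W : WakamatsuContext.{u, u + 1, u} k J Φ) (e : W.T ≅ ModuleCat.of A T)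
    (hfg : Φ.fgC = ModuleCat.isFG A) : coAuslanderClass T = W.bass := by
  refine le_antisymm ?_ ?_
  · refine WakamatsuContext.bass_of_resolution (fun X hX => hfg ▸ hX.1)
      (fun X hX => hX.extZero.of_iso_left e.symm) fun X hX => ?_
    obtain ⟨X₁, U, i, p, hs, hX₁, hU⟩ := hX.exists_ses
    obtain ⟨n, ⟨r⟩⟩ := inAdd_iff.1 hU
    exact ⟨n, X₁, U, i, p, hs, hX₁, ⟨r.trans (Retract.ofIso (powerIso e.symm n))⟩⟩
  · refine le_coAuslanderClass T (fun X hX => hfg ▸ hX.1) (fun X hX => hX.2.1.of_iso_left e)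
      fun X hX => ?_
    obtain ⟨n, X₁, i, p, hs, hX₁⟩ := hX.cover
    exact ⟨X₁, _, i, p, hs, hX₁, inAdd_iff.2 ⟨n, ⟨Retract.ofIso (powerIso e n)⟩⟩⟩

theorem auslanderClass_eq_cobass {Φ : AdjointPairs D (ModuleCat.{u} A)}
    (W : WakamatsuContext.{u, u + 1, u} k J Φ) (e : W.T' ≅ ModuleCat.of A T)
    (hfg : Φ.fgD = ModuleCat.isFG A) : auslanderClass T = W.cobass := by
  refine le_antisymm ?_ ?_
  · refine WakamatsuContext.cobass_of_coresolution (fun X hX => hfg ▸ hX.1)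
      (fun X hX => hX.extZero.of_iso_right e.symm) fun X hX => ?_
    obtain ⟨U, X₁, i, p, hs, hX₁, hU⟩ := hX.exists_ses
    obtain ⟨n, ⟨r⟩⟩ := inAdd_iff.1 hU
    exact ⟨n, U, X₁, i, p, hs, hX₁, ⟨r.trans (Retract.ofIso (powerIso e.symm n))⟩⟩
  · refine le_auslanderClass T (fun X hX => hfg ▸ hX.1) (fun X hX => hX.2.1.of_iso_right e)
      fun X hX => ?_
    obtain ⟨n, X₁, i, p, hs, hX₁⟩ := hX.embed
    exact ⟨_, X₁, i, p, hs, hX₁, inAdd_iff.2 ⟨n, ⟨Retract.ofIso (powerIso e n)⟩⟩⟩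

end Compare

end WakamatsuTilting

end

set_option linter.unusedSectionVars false

noncomputable section

namespace WakamatsuTilting

open Limits ZeroObject Abelian

/-! ### Cotorsion pairs of a Wakamatsu-tilting context -/

section CotorsionPairs

variable {k : Type u} [CommRing k] {J : Type u} [AddCommGroup J] [Module k J]
  {A : Type u} [Ring A] [Linear k (ModuleCat.{u} A)]
  {D : Type (u + 1)} [Category.{u} D] [Abelian D] [Linear k D] [HasExt.{u} D]

theorem ses_of_shortExact {E : ShortComplex (ModuleCat.{u} A)} (h : E.ShortExact) : Ses E.f E.g :=
  ⟨E.zero, h⟩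

theorem isCompleteHereditaryCotorsionPair_lperp_bass {Φ : AdjointPairs (ModuleCat.{u} A) D}
    (W : WakamatsuContext.{u, u + 1, u} k J Φ) (hfg : Φ.fgC = ModuleCat.isFG A)
    (h : HasGenerator W.lperp) : IsCompleteHereditaryCotorsionPair W.lperp W.bass where
  left_eq := funext fun X => propext (by rw [WakamatsuContext.lperp, hfg]; rfl)
  right_eq := funext fun X => propext (by rw [W.bass_iff, hfg]; rfl)
  hereditary :=
    { finite M hM := (congrFun hfg M).mp hM.1
      projective M hM hP := by
        have : Projective M := (IsProjective.iff_projective M).1 hP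
        exact W.lperp_of_projective M ((congrFun hfg M).mpr hM)
      extension E hE := W.lperp_extension (ses_of_shortExact hE)
      kernel E hE := W.lperp_ker (ses_of_shortExact hE)
      summand M N := fun ⟨r⟩ => W.lperp_of_retract r }
  complete_right X hX := by
    obtain ⟨A, B, i, p, ⟨hz, hs⟩, hA, hB⟩ :=
      WakamatsuContext.exists_embed_bass_lperp h ((congrFun hfg X).mpr hX)
    exact ⟨_, hs, ⟨Iso.refl _⟩, hA, hB⟩
  complete_left X hX := by
    obtain ⟨A, B, i, p, ⟨hz, hs⟩, hA, hB⟩ :=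
      WakamatsuContext.exists_bass_lperp h ((congrFun hfg X).mpr hX)
    exact ⟨_, hs, ⟨Iso.refl _⟩, hB, hA⟩

theorem isCompleteHereditaryCotorsionPair_cobass_rperp {Φ : AdjointPairs D (ModuleCat.{u} A)}
    (W : WakamatsuContext.{u, u + 1, u} k J Φ) (hfg : Φ.fgD = ModuleCat.isFG A)
    (h : HasGenerator W.rperp) : IsCompleteHereditaryCotorsionPair W.cobass W.rperp where
  left_eq := funext fun X => propext (by rw [W.cobass_iff, hfg]; rfl)
  right_eq := funext fun X => propext (by rw [WakamatsuContext.rperp, hfg]; rfl)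
  hereditary :=
    { finite M hM := (congrFun hfg M).mp hM.1
      projective M hM hP := by
        have : Projective M := (IsProjective.iff_projective M).1 hP
        exact WakamatsuContext.cobass_of_projective M ((congrFun hfg M).mpr hM)
      extension E hE := WakamatsuContext.cobass_extension (ses_of_shortExact hE)
      kernel E hE hY hZ := WakamatsuContext.cobass.ker hY hZ (ses_of_shortExact hE)
      summand M N := fun ⟨r⟩ => WakamatsuContext.cobass_of_retract r }
  complete_right X hX := by
    obtain ⟨A, B, i, p, ⟨hz, hs⟩, hA, hB⟩ :=
      WakamatsuContext.exists_embed_rperp_cobass h ((congrFun hfg X).mpr hX)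
    exact ⟨_, hs, ⟨Iso.refl _⟩, hA, hB⟩
  complete_left X hX := by
    obtain ⟨A, B, i, p, ⟨hz, hs⟩, hA, hB⟩ :=
      WakamatsuContext.exists_rperp_cobass h ((congrFun hfg X).mpr hX)
    exact ⟨_, hs, ⟨Iso.refl _⟩, hB, hA⟩

theorem hasGenerator_lperp [IsNoetherianRing A] [IsArtinianRing A]
    {Φ : AdjointPairs (ModuleCat.{u} A) D} (W : WakamatsuContext.{u, u + 1, u} k J Φ)
    (hfg : Φ.fgC = ModuleCat.isFG A) (h : IsOfFiniteRepresentationType W.lperp) :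
    HasGenerator W.lperp :=
  h.hasGenerator (fun X hX => (congrFun hfg X).mp hX.1) (fun _ _ r => W.lperp_of_retract r)
    (W.lperp_of_projective 0 (W.modC.fg_zero 0 (isZero_zero _)))
    fun X Y hX hY => W.lperp_extension (Ses.biprod X Y) hX hY

theorem hasGenerator_rperp [IsNoetherianRing A] [IsArtinianRing A]
    {Φ : AdjointPairs D (ModuleCat.{u} A)} (W : WakamatsuContext.{u, u + 1, u} k J Φ)
    (hfg : Φ.fgD = ModuleCat.isFG A) (h : IsOfFiniteRepresentationType W.rperp) :
    HasGenerator W.rperp :=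
  h.hasGenerator (fun X hX => (congrFun hfg X).mp hX.1) (fun _ _ r => W.rperp_of_retract r)
    (W.rperp_of_injective 0 (W.modD.fg_zero 0 (isZero_zero _)))
    fun X Y hX hY => W.rperp_extension (Ses.biprod X Y) hX hY

theorem IsOfFiniteRepresentationType.mono {P Q : ObjectProperty (ModuleCat.{u} A)} (h : P ≤ Q)
    (hQ : IsOfFiniteRepresentationType Q) : IsOfFiniteRepresentationType P := by
  obtain ⟨n, L, hL⟩ := hQ
  exact ⟨n, L, fun M hM => hL M (h M hM)⟩

end CotorsionPairs

namespace WakamatsuContext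

universe v w x

variable {C D : Type w} [Category.{v} C] [Category.{v} D] [Abelian C] [Abelian D]
  {k : Type v} [CommRing k] {J : Type v} [AddCommGroup J] [Module k J] [Linear k C] [Linear k D]
  [HasExt.{x} C] [HasExt.{x} D] {Φ : AdjointPairs C D} (W : WakamatsuContext.{v, w, x} k J Φ)

theorem exists_equivalence_bass : ∃ e : W.bass.FullSubcategory ≌ W.cobass.FullSubcategory,
    Nonempty (e.functor ⋙ W.cobass.ι ≅ W.bass.ι ⋙ Φ.H) ∧
      Nonempty (e.inverse ⋙ W.bass.ι ≅ W.cobass.ι ⋙ Φ.L) :=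
  exists_restricted_equivalence Φ.adj (fun _ h => h.H) (fun _ h => h.L)
    (fun X h => Φ.co_eq X ▸ h.2.2.1) (fun X h => Φ.un_eq X ▸ h.2.2.1)

theorem exists_equivalence_rperp : ∃ e : W.rperp.FullSubcategory ≌ W.lperp.FullSubcategory,
    Nonempty (e.functor ⋙ W.lperp.ι ≅ W.rperp.ι ⋙ Φ.H') ∧
      Nonempty (e.inverse ⋙ W.rperp.ι ≅ W.lperp.ι ⋙ Φ.L') :=
  exists_restricted_equivalence Φ.adj' (fun _ h => h.H') (fun _ h => h.L')
    (fun X h => Φ.swap.co_eq X ▸ h.isIso_co') (fun X h => Φ.swap.un_eq X ▸ h.isIso_un')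

end WakamatsuContext

/-! ### Repetitive equivalences from counter equivalences -/

section CounterPairs

variable {k : Type u} [CommRing k] [IsArtinianRing k] {J : Type u} [AddCommGroup J] [Module k J]
  {S R : Type u} [Ring S] [Ring R] [Algebra k S] [Algebra k R] {V : Type u} [AddCommGroup V]
  [Module k V] [Module S V] [Module Rᵐᵒᵖ V] [SMulCommClass S Rᵐᵒᵖ V] [IsScalarTower k S V]
  [IsScalarTower k Rᵐᵒᵖ V]

theorem rightPerp_of_iso {A : Type u} [Ring A] {𝓑 : ObjectProperty (ModuleCat.{u} A)}
    {X Y : ModuleCat.{u} A} (e : X ≅ Y) (h : rightPerp 𝓑 X) : rightPerp 𝓑 Y := by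
  have := h.1
  exact ⟨Module.Finite.equiv e.toLinearEquiv, fun N hN => ext_of_iso_right e.symm (h.2 N hN)⟩

section Restriction

universe v w

variable {C D : Type w} [Category.{v} C] [Category.{v} D] {H : C ⥤ D} {L : D ⥤ C}
  {P : ObjectProperty C} {Q : ObjectProperty D}

/-- The unit and counit of `e` are not assumed related to those of `adj`. Still `H` is fully
faithful and dense between the subcategories, and that suffices by `isIso_of_bijective_of_restrict`.
-/
theorem isIso_of_restricted_equivalence (adj : L ⊣ H)
    (hP : ∀ X Y, (X ≅ Y) → P X → P Y) (hQ : ∀ X Y, (X ≅ Y) → Q X → Q Y)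
    (e : P.FullSubcategory ≌ Q.FullSubcategory) (α : e.functor ⋙ Q.ι ≅ P.ι ⋙ H)
    (β : e.inverse ⋙ P.ι ≅ Q.ι ⋙ L) :
    (∀ X, P X → Q (H.obj X)) ∧ (∀ X, Q X → P (L.obj X)) ∧
      (∀ X, P X → IsIso (adj.counit.app X)) ∧ ∀ Y, Q Y → IsIso (adj.unit.app Y) := by
  have hH : ∀ X, P X → Q (H.obj X) := fun X hX =>
    hQ _ _ (α.app ⟨X, hX⟩) (e.functor.obj ⟨X, hX⟩).property
  have hL : ∀ X, Q X → P (L.obj X) := fun X hX =>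
    hP _ _ (β.app ⟨X, hX⟩) (e.inverse.obj ⟨X, hX⟩).property
  refine ⟨hH, hL, isIso_of_bijective_of_restrict adj hH hL (fun X Y hX hY => ?_) fun Y hY => ?_⟩
  · have : (P.ι ⋙ H).Full := Functor.Full.of_iso α
    have : (P.ι ⋙ H).Faithful := Functor.Faithful.of_iso α
    have h1 := (Functor.FullyFaithful.ofFullyFaithful (P.ι ⋙ H)).map_bijective ⟨X, hX⟩ ⟨Y, hY⟩
    have h2 := (P.fullyFaithfulι).map_bijective ⟨X, hX⟩ ⟨Y, hY⟩
    exact (Function.Bijective.of_comp_iff (fun f : X ⟶ Y => H.map f) h2).1 h1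
  · exact ⟨_, (e.inverse.obj ⟨Y, hY⟩).property,
      ⟨(α.app (e.inverse.obj ⟨Y, hY⟩)).symm ≪≫ Q.ι.mapIso (e.counitIso.app ⟨Y, hY⟩)⟩⟩

end Restriction

variable {𝓑 𝓐 : ObjectProperty (ModuleCat.{u} Rᵐᵒᵖ)} {𝓖 𝓚 : ObjectProperty (ModuleCat.{u} Sᵐᵒᵖ)}

theorem isCounterPair_of_counterEquivalence (hBA : IsCompleteHereditaryCotorsionPair 𝓑 𝓐)
    (hGK : IsCompleteHereditaryCotorsionPair 𝓖 𝓚)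
    (c : CounterEquivalence S R V (Dual k J V) 𝓑 𝓐 𝓖 𝓚) :
    IsCounterPair.{u, u + 1, u} (bimodulePairs k J S R V) 𝓑 𝓐 𝓖 𝓚 := by
  have hA : ∀ X Y, (X ≅ Y) → 𝓐 X → 𝓐 Y := fun _ _ e h => by
    rw [hBA.right_eq] at h ⊢
    exact rightPerp_of_iso e h
  have hB : ∀ X Y, (X ≅ Y) → 𝓑 X → 𝓑 Y := fun _ _ e =>
    hBA.hereditary.summand _ _ ⟨Retract.ofIso e.symm⟩
  have hG : ∀ X Y, (X ≅ Y) → 𝓖 X → 𝓖 Y := fun _ _ e =>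
    hGK.hereditary.summand _ _ ⟨Retract.ofIso e.symm⟩
  have hK : ∀ X Y, (X ≅ Y) → 𝓚 X → 𝓚 Y := fun _ _ e h => by
    rw [hGK.right_eq] at h ⊢
    exact rightPerp_of_iso e h
  obtain ⟨h1, h2, h3, h4⟩ := isIso_of_restricted_equivalence (bimodulePairs k J S R V).adj hA hG c.e
    c.e_functor c.e_inverse
  obtain ⟨h1', h2', h3', h4'⟩ := isIso_of_restricted_equivalence (bimodulePairs k J S R V).adj' hK
    hB c.e' c.e'_functor c.e'_inverse
  exact
    { mem_B X := iff_of_eq (congrFun hBA.left_eq X)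
      mem_A X := iff_of_eq (congrFun hBA.right_eq X)
      mem_G X := iff_of_eq (congrFun hGK.left_eq X)
      mem_K X := iff_of_eq (congrFun hGK.right_eq X)
      B_ker := fun ⟨_, hs⟩ => hBA.hereditary.kernel _ hs
      G_ker := fun ⟨_, hs⟩ => hGK.hereditary.kernel _ hs
      complete_A X hX := by
        obtain ⟨E, hE, ⟨e⟩, hA, hB⟩ := hBA.complete_right X hX
        exact ⟨_, _, _, _, (ses_of_shortExact hE).of_iso e (Iso.refl _) (Iso.refl _)
          (f' := e.inv ≫ E.f) (g' := E.g) (by simp) (by simp), hA, hB⟩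
      complete_G X hX := by
        obtain ⟨E, hE, ⟨e⟩, hG, hK⟩ := hGK.complete_left X hX
        exact ⟨_, _, _, _, (ses_of_shortExact hE).of_iso (Iso.refl _) (Iso.refl _) e
          (f' := E.f) (g' := E.g ≫ e.hom) (by simp) (by simp), hG, hK⟩
      H_mem := h1
      L_mem := h2
      H'_mem := h1'
      L'_mem := h2'
      isIso_co X h := (bimodulePairs k J S R V).co_eq X ▸ h3 X h
      isIso_un X h := (bimodulePairs k J S R V).un_eq X ▸ h4 X h
      isIso_co' X h := by
        rw [show (bimodulePairs k J S R V).co' X = _ from (bimodulePairs k J S R V).swap.co_eq X]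
        exact h3' X h
      isIso_un' X h := by
        rw [show (bimodulePairs k J S R V).un' X = _ from (bimodulePairs k J S R V).swap.un_eq X]
        exact h4' X h }

end CounterPairs

end WakamatsuTilting

end

set_option linter.unusedSectionVars false

noncomputable section

namespace WakamatsuTilting

open Limits ZeroObject Abelian

/-! ### Wakamatsu-tilting modules -/

section Bimodule

open scoped ModuleCat.Algebra

variable {k : Type u} [CommRing k] {J : Type u} [AddCommGroup J] [Module k J]
  {S R : Type u} [Ring S] [Ring R] [Algebra k S] [Algebra k R] {V : Type u} [AddCommGroup V]
  [Module k V] [Module S V] [Module Rᵐᵒᵖ V] [SMulCommClass S Rᵐᵒᵖ V] [IsScalarTower k S V]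
  [IsScalarTower k Rᵐᵒᵖ V]

theorem regularTrace_comm (r : R) (w : ModuleCat.of Rᵐᵒᵖ R ⟶ ModuleCat.of Rᵐᵒᵖ (Dual k J R)) :
    regularTrace k J R (ofElement (X := ModuleCat.of Rᵐᵒᵖ R) r ≫ w) =
      regularTrace k J R (w ≫ dualLeftMul k J r) := by
  change (w.hom (r * 1 : R) : Dual k J R).toLin 1 = (w.hom (1 : R) : Dual k J R).toLin (1 * r)
  have h := congrArg (fun f : Dual k J R => f.toLin 1) (w.hom.map_smul (MulOpposite.op r) (1 : R))
  rw [mul_one, one_mul]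
  have h' : (w.hom (1 * r : R) : Dual k J R).toLin 1 =
    (w.hom (1 : R) : Dual k J R).toLin (r * 1) := h
  rwa [mul_one, one_mul] at h'

theorem exists_counterEquivalence_of_lperp
    (W : WakamatsuContext.{u, u + 1, u} k J (bimodulePairs k J S R V))
    (h : HasGenerator W.lperp) :
    ∃ (𝓑 𝓐 : ObjectProperty (ModuleCat.{u} Rᵐᵒᵖ)) (𝓖 𝓚 : ObjectProperty (ModuleCat.{u} Sᵐᵒᵖ)),
      IsCompleteHereditaryCotorsionPair 𝓑 𝓐 ∧ IsCompleteHereditaryCotorsionPair 𝓖 𝓚 ∧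
      Nonempty (CounterEquivalence S R V (Dual k J V) 𝓑 𝓐 𝓖 𝓚) := by
  obtain ⟨e, ⟨α⟩, ⟨β⟩⟩ := W.exists_equivalence_bass
  obtain ⟨e', ⟨α'⟩, ⟨β'⟩⟩ := W.exists_equivalence_rperp
  exact ⟨_, _, _, _, isCompleteHereditaryCotorsionPair_lperp_bass W rfl h,
    isCompleteHereditaryCotorsionPair_cobass_rperp W rfl (W.rperp_hasGenerator h),
    ⟨⟨e, α, β, e', α', β'⟩⟩⟩

/-- In the swapped context the pair formed by `cobass` and `rperp` lives over `R`, so the two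
equivalences trade places. -/
theorem exists_counterEquivalence_of_rperp
    (W : WakamatsuContext.{u, u + 1, u} k J (bimodulePairs k J S R V).swap)
    (h : HasGenerator W.rperp) :
    ∃ (𝓑 𝓐 : ObjectProperty (ModuleCat.{u} Rᵐᵒᵖ)) (𝓖 𝓚 : ObjectProperty (ModuleCat.{u} Sᵐᵒᵖ)),
      IsCompleteHereditaryCotorsionPair 𝓑 𝓐 ∧ IsCompleteHereditaryCotorsionPair 𝓖 𝓚 ∧
      Nonempty (CounterEquivalence S R V (Dual k J V) 𝓑 𝓐 𝓖 𝓚) := by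
  obtain ⟨e, ⟨α⟩, ⟨β⟩⟩ := W.exists_equivalence_bass
  obtain ⟨e', ⟨α'⟩, ⟨β'⟩⟩ := W.exists_equivalence_rperp
  exact ⟨_, _, _, _, isCompleteHereditaryCotorsionPair_cobass_rperp W rfl h,
    isCompleteHereditaryCotorsionPair_lperp_bass W rfl (W.lperp_hasGenerator h),
    ⟨⟨e', α', β', e, α, β⟩⟩⟩

variable [IsArtinianRing k] [Module.Finite k S] [Module.Finite k R] [Module.Finite Rᵐᵒᵖ V]
  [Module.Finite k V] (hJ : IsInjectiveEnvelopeOfTop k J)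
  (hS : ∀ f : V →ₗ[Rᵐᵒᵖ] V, ∃! s : S, ∀ v, f v = s • v)
  (hR : ∀ f : V →ₗ[S] V, ∃! r : R, ∀ v, f v = MulOpposite.op r • v)
  (ext : ∀ i, 0 < i → ExtVanishes (ModuleCat.of Rᵐᵒᵖ V) (ModuleCat.of Rᵐᵒᵖ V) i)
  (ext' : ∀ i, 0 < i → ExtVanishes (ModuleCat.of S V) (ModuleCat.of S V) i)

include hJ hS hR ext ext'

theorem exists_counterEquivalence_of_finite
    (h : IsOfFiniteRepresentationType (leftPerp (coAuslanderClass (A := Rᵐᵒᵖ) V)) ∨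
      IsOfFiniteRepresentationType (rightPerp (auslanderClass (A := Rᵐᵒᵖ) V))) :
    ∃ (𝓑 𝓐 : ObjectProperty (ModuleCat.{u} Rᵐᵒᵖ)) (𝓖 𝓚 : ObjectProperty (ModuleCat.{u} Sᵐᵒᵖ)),
      IsCompleteHereditaryCotorsionPair 𝓑 𝓐 ∧ IsCompleteHereditaryCotorsionPair 𝓖 𝓚 ∧
      Nonempty (CounterEquivalence S R V (Dual k J V) 𝓑 𝓐 𝓖 𝓚) := by
  have := isNoetherianRing_op k R
  have := isArtinianRing_op k R
  let W := bimoduleContext hJ hS hR ext ext'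
  obtain h | h := h
  · rw [coAuslanderClass_eq_bass W (tensorRegularIso S R V) rfl] at h
    exact exists_counterEquivalence_of_lperp W (hasGenerator_lperp W rfl h)
  -- The swapped context has the given module as its `T'`, so the Auslander class is its `cobass`.
  · rw [auslanderClass_eq_cobass W.swap (tensorRegularIso S R V) rfl] at h
    exact exists_counterEquivalence_of_rperp W.swap (hasGenerator_rperp W.swap rfl h)

theorem exists_repetitive_equivalence_of_counterEquivalence
    {𝓑 𝓐 : ObjectProperty (ModuleCat.{u} Rᵐᵒᵖ)} {𝓖 𝓚 : ObjectProperty (ModuleCat.{u} Sᵐᵒᵖ)}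
    (hBA : IsCompleteHereditaryCotorsionPair 𝓑 𝓐) (hGK : IsCompleteHereditaryCotorsionPair 𝓖 𝓚)
    (c : CounterEquivalence S R V (Dual k J V) 𝓑 𝓐 𝓖 𝓚) :
    ∃ E : RepetitiveCategory k J R ≌ RepetitiveCategory k J S,
      Nonempty (ObjectProperty.ιOfLE hBA.right_le ⋙ stalkStable k J R ⋙ E.functor ≅
        c.e.functor ⋙ ObjectProperty.ιOfLE hGK.left_le ⋙ stalkStable k J S) := by
  let W := bimoduleContext hJ hS hR ext ext'
  let N : NakayamaData k J R (bimodulePairs k J S R V) :=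
    { isoE := W.isoE
      comm r := W.dual_end_comm (f := dualLeftMul k J r)
        (r := ofElement (X := ModuleCat.of Rᵐᵒᵖ R) r) (regularTrace_comm r)
      isIso_co := W.isIso_co_E
      fg_iff X := Iff.rfl
      nak := W.hasNakayama }
  let N' : NakayamaData k J S (bimodulePairs k J S R V).swap :=
    { isoE := W.swap.isoE
      comm s := W.swap.dual_end_comm (f := dualLeftMul k J s)
        (r := ofElement (X := ModuleCat.of Sᵐᵒᵖ S) s) (regularTrace_comm s)
      isIso_co := W.swap.isIso_co_E
      fg_iff X := Iff.rfl
      nak := W.swap.hasNakayama }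
  refine exists_repetitive_equivalence N N'
    ((isCounterPair_of_counterEquivalence hBA hGK c).counterSetup W) (fun X Y e h => ?_)
    hBA.right_le hGK.left_le c.e.functor c.e_functor
  rw [hBA.right_eq] at h ⊢
  exact rightPerp_of_iso e h

end Bimodule

section Endomorphism

variable {k : Type u} [CommRing k] [IsArtinianRing k] {R : Type u} [Ring R] [Algebra k R]
  {T : Type u} [AddCommGroup T] [Module k T] [Module Rᵐᵒᵖ T] [IsScalarTower k Rᵐᵒᵖ T]

theorem finite_end [Module.Finite k T] : Module.Finite k (Module.End Rᵐᵒᵖ T) :=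
  Module.Finite.of_injective (LinearMap.restrictScalarsₗ k Rᵐᵒᵖ T T k)
    (LinearMap.restrictScalars_injective k)

theorem existsUnique_smul_eq (f : T →ₗ[Rᵐᵒᵖ] T) :
    ∃! s : Module.End Rᵐᵒᵖ T, ∀ v, f v = s • v :=
  ⟨f, fun _ => rfl, fun _ h => LinearMap.ext fun v => (h v).symm⟩

theorem IsWakamatsuTilting.existsUnique_op_smul_eq (hT : IsWakamatsuTilting R T)
    (f : T →ₗ[Module.End Rᵐᵒᵖ T] T) : ∃! r : R, ∀ v, f v = MulOpposite.op r • v := by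
  obtain ⟨r, rfl⟩ := hT.balanced.2 f
  refine ⟨r.unop, fun _ => rfl, fun r' h => ?_⟩
  exact (congrArg MulOpposite.unop (hT.balanced.1 (LinearMap.ext h))).symm

end Endomorphism

end WakamatsuTilting

end

theorem mainTheorem5 {k : Type u} [CommRing k] [IsArtinianRing k]
    {J : Type u} [AddCommGroup J] [Module k J]
    (hJ : WakamatsuTilting.IsInjectiveEnvelopeOfTop k J)
    {R : Type u} [Ring R] [Algebra k R] [Module.Finite k R]
    {T : Type u} [AddCommGroup T] [Module k T] [Module Rᵐᵒᵖ T] [IsScalarTower k Rᵐᵒᵖ T]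
    (hT : WakamatsuTilting.IsWakamatsuTilting R T) :
    (WakamatsuTilting.IsOfFiniteType R T → WakamatsuTilting.IsGood R T k J) ∧
    (WakamatsuTilting.IsRepresentationFinite R →
      WakamatsuTilting.IsGood R T k J ∧
      WakamatsuTilting.InducesRepetitiveEquivalence R T k J) := by
  have := hT.finite
  have : Module.Finite k T := Module.Finite.trans Rᵐᵒᵖ T
  have : Module.Finite k (Module.End Rᵐᵒᵖ T) := WakamatsuTilting.finite_end
  have good : WakamatsuTilting.IsOfFiniteType R T → WakamatsuTilting.IsGood R T k J := fun h =>
    ⟨hT, WakamatsuTilting.exists_counterEquivalence_of_finite hJ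
      WakamatsuTilting.existsUnique_smul_eq hT.existsUnique_op_smul_eq hT.ext_right hT.ext_left h⟩
  -- When `mod R` has finitely many indecomposables so does every subcategory of it; either
  -- alternative of finite type would serve.
  refine ⟨good, fun h => ⟨good (Or.inl (h.mono fun X hX => hX.1)), ?_⟩⟩
  intro 𝓑 𝓐 𝓖 𝓚 hBA hGK c
  exact WakamatsuTilting.exists_repetitive_equivalence_of_counterEquivalence hJ
    WakamatsuTilting.existsUnique_smul_eq hT.existsUnique_op_smul_eq hT.ext_right hT.ext_left
    hBA hGK c
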